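/- Let $Z$ be a complex contact manifold of complex dimension $2n+1\ge 3$: a (Hausdorff, second countable) complex manifold with complex structure $\mathscr J$, an open cover $\{U_i\}$, holomorphic $1$-forms $\theta_i$ on $U_i$ with $\theta_i\wedge(d\theta_i)^n$ nowhere zero, and nowhere vanishing holomorphic functions $f_{ij}$ on $U_i\cap U_j$ with $\theta_i=f_{ij}\theta_j$. Let $E=\{f_{ij}\}$ be the contact line bundle and $L=E^{-1}$, with fibre coordinates $z_i$ over $U_i$ such that $z_i=f_{ij}^{-1}z_j$. Then $L$ admits Hermitian structures. Let $\langle\cdot,\cdot\rangle$ be any of them, write $\langle u,u\rangle=h_i|z_i|^2$ over $U_i$, and let $Q=\{u\in L : \langle u,u\rangle=1\}$ with projection $\pi_Q:Q\to Z$. Then $Q$ is a smooth submanifold of $L$ and a principal $\mathrm U(1)$-bundle over $Z$, and it carries an almost contact metric $3$-structure $(g_Q,\Phi_\alpha,\xi_\alpha,\eta_\alpha)$, $\alpha=1,2,3$, with the following properties. 1. $(\Phi_1,\xi_1,\eta_1)$ is a normal almost contact structure, namely Hatakeyama's structure built from the Ishihara–Konishi connection $\sqrt{-1}\,\eta_1$: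 over $U_i$ one has $\eta_1=\pi_Q^*\sigma_i+d\phi_i$, where $e^{\sqrt{-1}\phi_i}=z_i/|z_i|$ and $\sqrt{-1}\,\sigma_i=\tfrac12(\partial-\bar\partial)\log h_i$; $\xi_1$ generates the $\mathrm U(1)$-action; and $\Phi_1(X)$ is the horizontal lift of $\mathscr J\pi_{Q*}X$. Moreover $Z=Q/\mathscr F_{\xi_1}$ is, by means of $\pi_Q$, the leaf space of the foliation generated by $\xi_1$, and $\mathscr L_{\xi_1}g_Q=0$. The metric has the form $g_Q=\pi_Q^*g_Z+\eta_1\otimes\eta_1$ for a Hermitian metric $g_Z$ on $Z$. 2. $\eta_2$ and $\eta_3$ are the real and the imaginary part of the restriction to $Q$ of Kobayashi's form $\vartheta$, which is $z_i\,\pi^*\theta_i$ over $U_i$, where $\pi$ is the projection of $L$. Both are contact forms, and $\eta_2\wedge(d\eta_2)^{2n+1}=\eta_3\wedge(d\eta_3)^{2n+1}\neq 0$ at every point. 3. $(g_Q,\Phi_\alpha,\xi_\alpha,\eta_\alpha)$ is a contact metric structure for $\alpha=2,3$: $\eta_\alpha$ is a contact form with Reeb field $\xi_\alpha$, $\eta_\alpha=g_Q(\cdot,\xi_\alpha)$,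 $\Phi_\alpha^2=-\mathrm{Id}+\eta_\alpha\otimes\xi_\alpha$ and $d\eta_\alpha=g_Q(\Phi_\alpha\cdot,\cdot)$. -/

import Mathlib

open Set Bundle Function
open scoped Manifold ContDiff Topology

noncomputable section

namespace ContactTriple

section Manifold

variable {𝕜 : Type*} [NontriviallyNormedField 𝕜]
  {EM : Type*} [NormedAddCommGroup EM] [NormedSpace 𝕜 EM]
  {HM : Type*} [TopologicalSpace HM] (I : ModelWithCorners 𝕜 EM HM)
  {M : Type*} [TopologicalSpace M] [ChartedSpace HM M]

/-- The `1`-form `α` written in the chart at `x`: its pullback under the inverse of this chart. -/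
def chartForm (α : ∀ x : M, TangentSpace I x →L[𝕜] 𝕜) (x : M) (y : EM) : EM →L[𝕜] 𝕜 :=
  (α ((extChartAt I x).symm y)).comp
    (mfderivWithin 𝓘(𝕜, EM) I (extChartAt I x).symm (range I) y)

/-- The exterior derivative `dα` of a `1`-form at `x`, computed in the chart at `x`, with the
convention `dα(X, Y) = X(α(Y)) - Y(α(X)) - α([X, Y])`. -/
def extD (α : ∀ x : M, TangentSpace I x →L[𝕜] 𝕜) (x : M) (X Y : TangentSpace I x) : 𝕜 :=
  let D : EM →L[𝕜] EM →L[𝕜] 𝕜 := fderivWithin 𝕜 (chartForm I α x) (range I) (extChartAt I x x)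
  let X' : EM := mvfderiv I (extChartAt I x) x X
  let Y' : EM := mvfderiv I (extChartAt I x) x Y
  D X' Y' - D Y' X'

/-- The value of `α ∧ β^m` on `2m + 1` vectors, for a linear form `α` and an alternating
bilinear form `β`, where `(ω ∧ ω')(v₁, …, v_{p+q})` is `1 / (p! q!)` times the signed sum over all
permutations. -/
def wedgePow {V : Type*} (α : V → 𝕜) (β : V → V → 𝕜) (m : ℕ) (v : Fin (2 * m + 1) → V) : 𝕜 :=
  ((2 : 𝕜) ^ m)⁻¹ * ∑ s : Equiv.Perm (Fin (2 * m + 1)),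
    ((Equiv.Perm.sign s : ℤ) : 𝕜) * (α (v (s ⟨0, by omega⟩)) *
      ∏ k : Fin m, β (v (s ⟨2 * k + 1, by omega⟩)) (v (s ⟨2 * k + 2, by omega⟩)))

/-- `α ∧ (dα)^m` at the point `x`. -/
def contactVolume (α : ∀ x : M, TangentSpace I x →L[𝕜] 𝕜) (m : ℕ) (x : M)
    (v : Fin (2 * m + 1) → TangentSpace I x) : 𝕜 :=
  wedgePow (α x) (extD I α x) m v

end Manifold

section AlmostContact

variable {EM : Type*} [NormedAddCommGroup EM] [NormedSpace ℝ EM]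
  {HM : Type*} [TopologicalSpace HM] (I : ModelWithCorners ℝ EM HM)
  (M : Type*) [TopologicalSpace M] [ChartedSpace HM M] [IsManifold I ∞ M]

/-- Smooth vector fields. -/
def SmoothVectorField {M : Type*} [TopologicalSpace M] [ChartedSpace HM M] [IsManifold I ∞ M]
    (X : ∀ x : M, TangentSpace I x) : Prop :=
  ContMDiff I (I.prod 𝓘(ℝ, EM)) ∞ (fun x => TotalSpace.mk' EM x (X x))

/-- An almost contact structure `(Φ, ξ, η)` on `M`. -/
structure AlmostContactStructure where
  /-- the endomorphism `Φ` of the tangent bundle -/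
  Φ : ∀ x : M, TangentSpace I x →L[ℝ] TangentSpace I x
  /-- the vector field `ξ` -/
  ξ : ∀ x : M, TangentSpace I x
  /-- the `1`-form `η` -/
  η : ∀ x : M, TangentSpace I x →L[ℝ] ℝ
  smooth_Φ : ContMDiff I (I.prod 𝓘(ℝ, EM →L[ℝ] EM)) ∞
    (fun x => TotalSpace.mk' (EM →L[ℝ] EM) x (Φ x))
  smooth_ξ : SmoothVectorField I ξ
  smooth_η : ContMDiff I (I.prod 𝓘(ℝ, EM →L[ℝ] ℝ)) ∞
    (fun x => TotalSpace.mk' (EM →L[ℝ] ℝ) x (η x))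
  Φ_Φ : ∀ (x : M) (X : TangentSpace I x), Φ x (Φ x X) = -X + η x X • ξ x
  η_ξ : ∀ x : M, η x (ξ x) = 1

/-- Smooth Riemannian metrics on `M`. -/
abbrev Metric := ContMDiffRiemannianMetric I ∞ EM (fun x : M => TangentSpace I x)

variable {I M}

/-- The Frölicher–Nijenhuis bracket `[Φ, Φ](X, Y)` (twice the Nijenhuis tensor of `Φ`). -/
def bracketΦ (Φ : ∀ x : M, TangentSpace I x →L[ℝ] TangentSpace I x)
    (X Y : ∀ x : M, TangentSpace I x) (x : M) : TangentSpace I x :=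
  (2 : ℝ) • (VectorField.mlieBracket I (fun y => Φ y (X y)) (fun y => Φ y (Y y)) x
    + Φ x (Φ x (VectorField.mlieBracket I X Y x))
    - Φ x (VectorField.mlieBracket I (fun y => Φ y (X y)) Y x)
    - Φ x (VectorField.mlieBracket I X (fun y => Φ y (Y y)) x))

namespace AlmostContactStructure

/-- Normality: `[Φ, Φ] + 2 dη ⊗ ξ = 0`. -/
def IsNormal (S : AlmostContactStructure I M) : Prop :=
  ∀ X Y : ∀ x : M, TangentSpace I x, SmoothVectorField I X → SmoothVectorField I Y →
    ∀ x, bracketΦ S.Φ X Y x + (2 * extD I S.η x (X x) (Y x)) • S.ξ x = 0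

/-- The metric `g` is compatible with the almost contact structure. -/
def IsCompatible (S : AlmostContactStructure I M) (g : Metric I M) : Prop :=
  ∀ (x : M) (X Y : TangentSpace I x), g.inner x (S.ξ x) X = S.η x X ∧
    g.inner x (S.Φ x X) (S.Φ x Y) = g.inner x X Y - S.η x X * S.η x Y

/-- The relations in an almost contact `3`-structure for one ordered triple `(α, β, γ)` of
indices. -/
def CyclicRelations (Sα Sβ Sγ : AlmostContactStructure I M) : Prop :=
  ∀ x : M,
    (∀ X : TangentSpace I x,
      Sα.Φ x (Sβ.Φ x X) - Sβ.η x X • Sα.ξ x = Sγ.Φ x X ∧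
      -Sβ.Φ x (Sα.Φ x X) + Sα.η x X • Sβ.ξ x = Sγ.Φ x X ∧
      Sα.η x (Sβ.Φ x X) = Sγ.η x X ∧ -Sβ.η x (Sα.Φ x X) = Sγ.η x X) ∧
    Sα.Φ x (Sβ.ξ x) = Sγ.ξ x ∧ -Sβ.Φ x (Sα.ξ x) = Sγ.ξ x

/-- Three almost contact structures that form an almost contact `3`-structure. -/
def IsThreeStructure (S₁ S₂ S₃ : AlmostContactStructure I M) : Prop :=
  CyclicRelations S₁ S₂ S₃ ∧ CyclicRelations S₂ S₃ S₁ ∧ CyclicRelations S₃ S₁ S₂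

/-- An almost contact metric `3`-structure `(g, Φ_α, ξ_α, η_α)`. -/
def IsMetricThreeStructure (g : Metric I M) (S₁ S₂ S₃ : AlmostContactStructure I M) : Prop :=
  IsThreeStructure S₁ S₂ S₃ ∧ S₁.IsCompatible g ∧ S₂.IsCompatible g ∧ S₃.IsCompatible g

end AlmostContactStructure

/-- `η` is a contact form on the `(2m+1)`-dimensional manifold `M`: `η ∧ (dη)^m` vanishes
nowhere. -/
def IsContactForm (η : ∀ x : M, TangentSpace I x →L[ℝ] ℝ) (m : ℕ) : Prop :=
  ∀ x : M, contactVolume I η m x ≠ 0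

/-- `(g, Φ, ξ, η)` is a contact metric structure on the `(2m+1)`-dimensional manifold `M`: `η` is a
contact form with Reeb field `ξ`, and `η = g(·, ξ)`, `dη = g(Φ ·, ·)`. (The identity
`Φ² = -Id + η ⊗ ξ` is part of `S`.) -/
def AlmostContactStructure.IsContactMetric (S : AlmostContactStructure I M) (g : Metric I M)
    (m : ℕ) : Prop :=
  IsContactForm S.η m ∧
  ∀ (x : M) (X Y : TangentSpace I x),
    extD I S.η x (S.ξ x) X = 0 ∧ S.η x X = g.inner x X (S.ξ x) ∧
    extD I S.η x X Y = g.inner x (S.Φ x X) Y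

/-- The Lie derivative of the metric,
`(L_ξ g)(X, Y) = ξ(g(X, Y)) - g([ξ, X], Y) - g(X, [ξ, Y])`. -/
def lieDerivMetric (ξ : ∀ x : M, TangentSpace I x) (g : Metric I M)
    (X Y : ∀ x : M, TangentSpace I x) (x : M) : ℝ :=
  mvfderiv I (fun y => g.inner y (X y) (Y y)) x (ξ x)
    - g.inner x (VectorField.mlieBracket I ξ X x) (Y x)
    - g.inner x (X x) (VectorField.mlieBracket I ξ Y x)

/-- `L_ξ g = 0`. -/
def IsKilling (ξ : ∀ x : M, TangentSpace I x) (g : Metric I M) : Prop :=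
  ∀ X Y : ∀ x : M, TangentSpace I x, SmoothVectorField I X → SmoothVectorField I Y →
    ∀ x, lieDerivMetric ξ g X Y x = 0

/-- `p` and `q` lie on the same leaf of the foliation `F_ξ` by the integral curves of the nowhere
vanishing vector field `ξ`. -/
def SameLeaf (ξ : ∀ x : M, TangentSpace I x) (p q : M) : Prop :=
  ∃ (γ : ℝ → M) (a b s t : ℝ), IsMIntegralCurveOn γ ξ (Ioo a b) ∧
    s ∈ Ioo a b ∧ t ∈ Ioo a b ∧ γ s = p ∧ γ t = q

/-- `B` is, by means of `p : M → B`, the leaf space `M / F_ξ`: the map `p` is a smooth surjective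
submersion whose fibres are the leaves of `F_ξ`. -/
def IsLeafSpace {EB : Type*} [NormedAddCommGroup EB] [NormedSpace ℝ EB] {HB : Type*}
    [TopologicalSpace HB] (J : ModelWithCorners ℝ EB HB) {B : Type*} [TopologicalSpace B]
    [ChartedSpace HB B] (p : M → B) (ξ : ∀ x : M, TangentSpace I x) : Prop :=
  ContMDiff I J ∞ p ∧ Surjective p ∧ (∀ x, Surjective (mfderiv I J p x)) ∧
    ∀ x y, p x = p y ↔ SameLeaf ξ x y

/-- `p : P → B` is a smooth principal `U(1)`-bundle: the action is smooth, and over a neighbourhood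
of each point of `B` there is an equivariant smooth trivialisation. -/
def IsPrincipalCircleBundle {P EB HB B : Type*} [TopologicalSpace P] [ChartedSpace HM P]
    [MulAction Circle P] [NormedAddCommGroup EB] [NormedSpace ℝ EB] [TopologicalSpace HB]
    [TopologicalSpace B] [ChartedSpace HB B] (I : ModelWithCorners ℝ EM HM)
    (J : ModelWithCorners ℝ EB HB) (p : P → B) : Prop :=
  ContMDiff ((𝓡 1).prod I) I ∞ (fun x : Circle × P => x.1 • x.2) ∧
  ∀ b : B, ∃ e : Trivialization Circle p, b ∈ e.baseSet ∧
    ContMDiffOn I (J.prod (𝓡 1)) ∞ e e.source ∧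
    ContMDiffOn (J.prod (𝓡 1)) I ∞ e.toOpenPartialHomeomorph.symm e.target ∧
    ∀ (a : Circle) (x : P), p x ∈ e.baseSet → p (a • x) = p x ∧ (e (a • x)).2 = a * (e x).2

end AlmostContact

section RealStructure

variable {E : Type*} [NormedAddCommGroup E] [NormedSpace ℂ E]
  {Z : Type*} [TopologicalSpace Z] [ChartedSpace E Z]

/-- The underlying real manifold of a complex manifold. -/
instance isManifoldReal [IsManifold 𝓘(ℂ, E) ω Z] : IsManifold 𝓘(ℝ, E) ∞ Z :=
  isManifold_of_contDiffOn _ _ _ fun e e' he he' => by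
    have h := (contDiffGroupoid ω 𝓘(ℂ, E)).compatible he he'
    rw [contDiffGroupoid, mem_groupoid_of_pregroupoid] at h
    have h1 : ContDiffOn ℂ ω (𝓘(ℂ, E) ∘ e.symm ≫ₕ e' ∘ 𝓘(ℂ, E).symm)
      (𝓘(ℂ, E).symm ⁻¹' (e.symm ≫ₕ e').source ∩ range 𝓘(ℂ, E)) := h.1
    exact (h1.restrict_scalars ℝ).of_le le_top

theorem contMDiffOn_real {f : Z → ℂ} {s : Set Z} [IsManifold 𝓘(ℂ, E) ω Z]
    (hf : ContMDiffOn 𝓘(ℂ, E) 𝓘(ℂ, ℂ) ω f s) : ContMDiffOn 𝓘(ℝ, E) 𝓘(ℝ, ℂ) ∞ f s := by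
  rw [contMDiffOn_iff] at hf ⊢
  refine ⟨hf.1, fun x y => ?_⟩
  have h := hf.2 x y
  exact (h.restrict_scalars ℝ).of_le le_top

/-- The complex structure `𝒥` on the real tangent spaces of a complex manifold. -/
def complexStructure (z : Z) : TangentSpace 𝓘(ℝ, E) z →L[ℝ] TangentSpace 𝓘(ℝ, E) z :=
  ((Complex.I • ContinuousLinearMap.id ℂ E).restrictScalars ℝ : E →L[ℝ] E)

/-- A holomorphic cotangent vector evaluated on a real tangent vector, by means of the
identification of the real tangent space with the holomorphic one. -/
def evalReal {z : Z} (α : TangentSpace 𝓘(ℂ, E) z →L[ℂ] ℂ) (X : TangentSpace 𝓘(ℝ, E) z) : ℂ :=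
  α (show E from X)

/-- `∂f = (df - i df ∘ 𝒥) / 2`. -/
def del (f : Z → ℂ) (z : Z) (X : TangentSpace 𝓘(ℝ, E) z) : ℂ :=
  (mvfderiv 𝓘(ℝ, E) f z X - Complex.I * mvfderiv 𝓘(ℝ, E) f z (complexStructure z X)) / 2

/-- `∂̄f = (df + i df ∘ 𝒥) / 2`. -/
def delBar (f : Z → ℂ) (z : Z) (X : TangentSpace 𝓘(ℝ, E) z) : ℂ :=
  (mvfderiv 𝓘(ℝ, E) f z X + Complex.I * mvfderiv 𝓘(ℝ, E) f z (complexStructure z X)) / 2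

end RealStructure

/-- A complex contact structure on the complex manifold `Z` of complex dimension `2n + 1`. -/
structure ComplexContactStructure (n : ℕ) (E : Type*) [NormedAddCommGroup E] [NormedSpace ℂ E]
    (Z : Type*) [TopologicalSpace Z] [ChartedSpace E Z] [IsManifold 𝓘(ℂ, E) ω Z]
    (ι : Type*) where
  /-- the open cover `U_i` -/
  U : ι → Set Z
  isOpen_U : ∀ i, IsOpen (U i)
  cover : ∀ z, ∃ i, z ∈ U i
  /-- the local contact forms `θ_i` (only their values on `U_i` matter) -/
  θ : ι → ∀ z : Z, TangentSpace 𝓘(ℂ, E) z →L[ℂ] ℂ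
  holomorphic_θ : ∀ i, ContMDiffOn 𝓘(ℂ, E) (𝓘(ℂ, E).prod 𝓘(ℂ, E →L[ℂ] ℂ)) ω
    (fun z => TotalSpace.mk' (E →L[ℂ] ℂ) z (θ i z)) (U i)
  /-- `θ_i ∧ (dθ_i)^n` has no zero on `U_i` -/
  nondegenerate : ∀ i, ∀ z ∈ U i, contactVolume 𝓘(ℂ, E) (θ i) n z ≠ 0
  /-- the transition functions `f_ij` on `U_i ∩ U_j` -/
  f : ι → ι → Z → ℂ
  holomorphic_f : ∀ i j, ContMDiffOn 𝓘(ℂ, E) 𝓘(ℂ, ℂ) ω (f i j) (U i ∩ U j)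
  f_ne_zero : ∀ i j, ∀ z ∈ U i ∩ U j, f i j z ≠ 0
  θ_eq : ∀ i j, ∀ z ∈ U i ∩ U j, θ i z = f i j z • θ j z

namespace ComplexContactStructure

variable {n : ℕ} {E : Type*} [NormedAddCommGroup E] [NormedSpace ℂ E]
  {Z : Type*} [TopologicalSpace Z] [ChartedSpace E Z] [IsManifold 𝓘(ℂ, E) ω Z]
  {ι : Type*} (c : ComplexContactStructure n E Z ι)

theorem θ_ne_zero {i : ι} {z : Z} (hz : z ∈ c.U i) : c.θ i z ≠ 0 := by
  intro h0
  apply c.nondegenerate i z hz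
  funext v
  simp [contactVolume, wedgePow, h0]

theorem exists_θ_ne_zero {i : ι} {z : Z} (hz : z ∈ c.U i) : ∃ v, c.θ i z v ≠ 0 := by
  by_contra! h
  exact c.θ_ne_zero hz (ContinuousLinearMap.ext h)

theorem f_self {i : ι} {z : Z} (hz : z ∈ c.U i) : c.f i i z = 1 := by
  obtain ⟨v, hv⟩ := c.exists_θ_ne_zero hz
  have h : c.θ i z v = c.f i i z * c.θ i z v := DFunLike.congr_fun (c.θ_eq i i z ⟨hz, hz⟩) v
  exact (mul_eq_right₀ hv).1 h.symm

theorem f_comp {i j k : ι} {z : Z} (hi : z ∈ c.U i) (hj : z ∈ c.U j) (hk : z ∈ c.U k) :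
    c.f i j z * c.f j k z = c.f i k z := by
  obtain ⟨v, hv⟩ := c.exists_θ_ne_zero hk
  have h1 : c.θ i z v = c.f i j z * c.θ j z v := DFunLike.congr_fun (c.θ_eq i j z ⟨hi, hj⟩) v
  have h2 : c.θ j z v = c.f j k z * c.θ k z v := DFunLike.congr_fun (c.θ_eq j k z ⟨hj, hk⟩) v
  have h3 : c.θ i z v = c.f i k z * c.θ k z v := DFunLike.congr_fun (c.θ_eq i k z ⟨hi, hk⟩) v
  apply mul_right_cancel₀ hv
  rw [← h3, h1, h2, mul_assoc]

/-- The line bundle `L = E⁻¹` dual to the contact line bundle `E = {f_ij}`: the fibre coordinates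
of `L` are related by `z_j = f_ij z_i`, that is `z_i = g_ij z_j` with `g_ij = f_ij⁻¹`. -/
def L : VectorBundleCore ℂ Z ℂ ι where
  baseSet := c.U
  isOpen_baseSet := c.isOpen_U
  indexAt z := (c.cover z).choose
  mem_baseSet_at z := (c.cover z).choose_spec
  coordChange i j z := c.f i j z • ContinuousLinearMap.id ℂ ℂ
  coordChange_self i z hz v := by simp [c.f_self hz]
  continuousOn_coordChange i j := (c.holomorphic_f i j).continuousOn.smul continuousOn_const
  coordChange_comp i j k z hz v := by
    simp [← c.f_comp hz.1.1 hz.1.2 hz.2]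
    ring

instance : c.L.IsContMDiff 𝓘(ℂ, E) ω :=
  ⟨fun i j => (c.holomorphic_f i j).smul contMDiffOn_const⟩

/-- The fibre coordinate `z_i` on `L`. -/
def coord (i : ι) (u : c.L.TotalSpace) : ℂ := (c.L.localTriv i u).2

/-- The local frame of `L` over `U_i`, at which the fibre coordinate `z_i` is `1`. -/
def frame (i : ι) (z : Z) : c.L.Fiber z := c.L.coordChange i (c.L.indexAt z) z 1

/-- A (smooth) Hermitian structure on the line bundle `L`. -/
structure HermitianStructure where
  /-- the Hermitian inner product on the fibres of `L` -/
  inner : ∀ z : Z, c.L.Fiber z →ₗ⋆[ℂ] c.L.Fiber z →ₗ[ℂ] ℂ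
  conj_symm : ∀ z u v, starRingEnd ℂ (inner z u v) = inner z v u
  pos : ∀ z u, u ≠ 0 → 0 < (inner z u u).re
  smooth : ∀ i, ContMDiffOn 𝓘(ℝ, E) 𝓘(ℝ, ℝ) ∞
    (fun z => (inner z (c.frame i z) (c.frame i z)).re) (c.U i)

namespace HermitianStructure

variable {c} (h : c.HermitianStructure)

/-- The function `h_i` on `U_i`, for which `⟨u, u⟩ = h_i |z_i|²`. -/
def weight (i : ι) (z : Z) : ℝ := (h.inner z (c.frame i z) (c.frame i z)).re

/-- The unit circle bundle `Q(L) = {u ∈ L | ⟨u, u⟩ = 1}`, with the topology of a subspace of the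
total space of `L`. -/
def Q : Type _ := {u : c.L.TotalSpace // h.inner u.proj u.snd u.snd = 1}

instance : TopologicalSpace h.Q := inferInstanceAs (TopologicalSpace {_u : c.L.TotalSpace // _})

/-- The inclusion of `Q(L)` into the total space of `L`. -/
def incl (q : h.Q) : c.L.TotalSpace := q.1

/-- The projection `π_Q : Q(L) → Z`. -/
def proj (q : h.Q) : Z := q.1.proj

/-- The fibre coordinate `z_i` on `Q(L)`. -/
def coord (i : ι) (q : h.Q) : ℂ := c.coord i (h.incl q)

/-- `U(1)` acts on `Q(L)` by multiplication in the fibres of `L`. -/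
instance : MulAction Circle h.Q where
  smul a q := ⟨⟨q.1.proj, (a : ℂ) • q.1.snd⟩, by
    simp [q.2, Complex.mul_conj]⟩
  one_smul q := by
    apply Subtype.ext
    change TotalSpace.mk _ _ = _
    simp
  mul_smul a b q := by
    apply Subtype.ext
    exact congrArg (TotalSpace.mk q.1.proj) (mul_smul (a : ℂ) (b : ℂ) q.1.snd)

/-- The phase `e^{iφ_i} = z_i / |z_i|` of the fibre coordinate `z_i`. -/
def phase (i : ι) (q : h.Q) : Circle := Circle.exp (Complex.arg (h.coord i q))

theorem frame_eq (i : ι) (z : Z) : c.frame i z = c.f i (c.L.indexAt z) z :=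
  mul_one (c.f i (c.L.indexAt z) z)

theorem coord_eq (i : ι) (z : Z) (a : c.L.Fiber z) :
    c.coord i ⟨z, a⟩ = c.f (c.L.indexAt z) i z * (show ℂ from a) :=
  rfl

theorem frame_ne_zero {i : ι} {z : Z} (hz : z ∈ c.U i) : c.frame i z ≠ 0 := by
  rw [frame_eq]
  exact c.f_ne_zero _ _ z ⟨hz, c.L.mem_baseSet_at z⟩

theorem weight_pos {i : ι} {z : Z} (hz : z ∈ c.U i) : 0 < h.weight i z :=
  h.pos z _ (frame_ne_zero hz)

theorem inner_smul_frame (i : ι) (z : Z) (a : ℂ) :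
    h.inner z (a • c.frame i z) (a • c.frame i z) = (‖a‖ ^ 2 * h.weight i z : ℝ) := by
  have h1 : ((h.weight i z : ℝ) : ℂ) = h.inner z (c.frame i z) (c.frame i z) :=
    Complex.conj_eq_iff_re.1 (h.conj_symm z _ _)
  rw [Complex.ofReal_mul, h1]
  simp only [map_smulₛₗ, LinearMap.smul_apply, smul_eq_mul, RingHom.id_apply]
  rw [← mul_assoc, Complex.mul_conj, Complex.normSq_eq_norm_sq]

theorem snd_eq (i : ι) (u : c.L.TotalSpace) (hu : u.proj ∈ c.U i) :
    u.snd = c.coord i u • c.frame i u.proj := by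
  have h3 := c.f_comp (c.L.mem_baseSet_at u.proj) hu (c.L.mem_baseSet_at u.proj)
  rw [c.f_self (c.L.mem_baseSet_at u.proj)] at h3
  obtain ⟨z, a⟩ := u
  rw [coord_eq, frame_eq]
  change (show ℂ from a) = _ * _ * _
  rw [mul_right_comm, h3, one_mul]

theorem coord_change {i j : ι} (u : c.L.TotalSpace) (hi : u.proj ∈ c.U i) (hj : u.proj ∈ c.U j) :
    c.coord j u = c.f i j u.proj * c.coord i u := by
  obtain ⟨z, a⟩ := u
  rw [coord_eq, coord_eq, ← c.f_comp (c.L.mem_baseSet_at z) hi hj, mul_left_comm, mul_assoc]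

/-- On `Q(L)` one has `h_i |z_i|² = 1`. -/
theorem norm_coord_sq (i : ι) (q : h.Q) (hq : h.proj q ∈ c.U i) :
    ‖h.coord i q‖ ^ 2 * h.weight i (h.proj q) = 1 := by
  have h1 := q.2
  rw [snd_eq i q.1 hq, inner_smul_frame] at h1
  exact_mod_cast h1

theorem coord_ne_zero (i : ι) (q : h.Q) (hq : h.proj q ∈ c.U i) : h.coord i q ≠ 0 := by
  intro h0
  have := h.norm_coord_sq i q hq
  simp [h0] at this

theorem coord_eq_phase (i : ι) (q : h.Q) (hq : h.proj q ∈ c.U i) :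
    h.coord i q = (h.phase i q : ℂ) / (√(h.weight i (h.proj q)) : ℝ) := by
  have h1 := h.norm_coord_sq i q hq
  have h2 := h.weight_pos hq
  have h3 : ‖h.coord i q‖ * √(h.weight i (h.proj q)) = 1 := by
    rw [← Real.sqrt_sq (norm_nonneg (h.coord i q)), ← Real.sqrt_mul (sq_nonneg _), h1,
      Real.sqrt_one]
  have h4 : √(h.weight i (h.proj q)) ≠ 0 := (Real.sqrt_pos.2 h2).ne'
  have h5 : (‖h.coord i q‖ : ℂ) * (√(h.weight i (h.proj q)) : ℝ) = 1 := by exact_mod_cast h3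
  rw [eq_div_iff (by exact_mod_cast h4), phase, Circle.coe_exp]
  conv_lhs => rw [← Complex.norm_mul_exp_arg_mul_I (h.coord i q)]
  rw [mul_right_comm, h5, one_mul]

/-- The point of `Q(L)` over `z` with phase `w` in the `i`-th trivialisation. -/
def point (i : ι) (z : Z) (hz : z ∈ c.U i) (w : Circle) : h.Q :=
  ⟨⟨z, ((w : ℂ) / (√(h.weight i z) : ℝ)) • c.frame i z⟩, by
    rw [inner_smul_frame]
    have h2 := h.weight_pos hz
    have : ‖(w : ℂ) / (√(h.weight i z) : ℝ)‖ ^ 2 * h.weight i z = 1 := by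
      rw [norm_div, Circle.norm_coe, Complex.norm_real, Real.norm_of_nonneg (Real.sqrt_nonneg _),
        div_pow, Real.sq_sqrt h2.le, one_pow, one_div, inv_mul_cancel₀ h2.ne']
    exact_mod_cast this⟩

theorem coord_point (i : ι) (z : Z) (hz : z ∈ c.U i) (w : Circle) :
    h.coord i (h.point i z hz w) = (w : ℂ) / (√(h.weight i z) : ℝ) := by
  have h1 := snd_eq i (h.point i z hz w).1 hz
  exact (smul_left_injective ℂ (frame_ne_zero hz) h1).symm

theorem exp_arg_smul {r : ℝ} (hr : 0 < r) (w : Circle) :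
    Circle.exp (Complex.arg ((w : ℂ) / (r : ℂ))) = w := by
  have h1 : ((w : ℂ) / (r : ℂ)) = ((r⁻¹ : ℝ) : ℂ) * (w : ℂ) := by
    push_cast; rw [div_eq_inv_mul]
  rw [h1, Complex.arg_real_mul _ (inv_pos.2 hr), Circle.exp_arg]

theorem phase_point (i : ι) (z : Z) (hz : z ∈ c.U i) (w : Circle) :
    h.phase i (h.point i z hz w) = w := by
  rw [phase, coord_point, exp_arg_smul (Real.sqrt_pos.2 (h.weight_pos hz))]

theorem point_phase (i : ι) (q : h.Q) (hq : h.proj q ∈ c.U i) :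
    h.point i (h.proj q) hq (h.phase i q) = q := by
  apply Subtype.ext
  change TotalSpace.mk _ _ = q.1
  rw [← h.coord_eq_phase i q hq]
  exact congrArg (TotalSpace.mk q.1.proj) (snd_eq i q.1 hq).symm

theorem exp_arg_mul {a b : ℂ} (ha : a ≠ 0) (hb : b ≠ 0) :
    Circle.exp (Complex.arg (a * b)) = Circle.exp (Complex.arg a) * Circle.exp (Complex.arg b) := by
  apply Circle.ext
  rw [Circle.coe_mul, Circle.coe_exp, Circle.coe_exp, Circle.coe_exp]
  have e4 : (‖a * b‖ : ℂ) ≠ 0 := by exact_mod_cast norm_ne_zero_iff.2 (mul_ne_zero ha hb)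
  apply mul_left_cancel₀ e4
  rw [Complex.norm_mul_exp_arg_mul_I, norm_mul, Complex.ofReal_mul, mul_mul_mul_comm,
    Complex.norm_mul_exp_arg_mul_I, Complex.norm_mul_exp_arg_mul_I]

/-- `z ↦ z / |z|`, as a map to the circle, is smooth away from `0`. -/
theorem contMDiffAt_exp_arg {z : ℂ} (hz : z ≠ 0) :
    ContMDiffAt 𝓘(ℝ, ℂ) (𝓡 1) ∞ (fun w : ℂ => Circle.exp (Complex.arg w)) z := by
  have h1 : ContMDiffAt 𝓘(ℝ, ℂ) (𝓡 1) ∞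
      (fun w : ℂ => Circle.exp (Complex.arg z) * Circle.exp ((Complex.log (w / z)).im)) z := by
    have h2 : ContDiffAt ℝ ∞ (fun w : ℂ => (Complex.log (w / z)).im) z := by
      have h3 : ContDiffAt ℂ ∞ (fun w : ℂ => Complex.log (w / z)) z := by
        have h4 : ContDiffAt ℂ ∞ Complex.log (z / z) :=
          Complex.contDiffAt_log (by simp [div_self hz])
        exact ContDiffAt.comp (f := fun w : ℂ => w / z) z h4 (contDiffAt_id.div_const z)
      exact Complex.imCLM.contDiff.contDiffAt.comp z (h3.restrict_scalars ℝ)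
    exact contMDiffAt_const.mul (contMDiff_circleExp.contMDiffAt.comp z h2.contMDiffAt)
  refine h1.congr_of_eventuallyEq ?_
  filter_upwards [isOpen_ne.mem_nhds hz] with w hw
  rw [Complex.log_im, ← exp_arg_mul hz (div_ne_zero hw hz), mul_div_cancel₀ _ hz]

theorem continuous_incl : Continuous h.incl := continuous_subtype_val

theorem continuous_proj : Continuous h.proj :=
  (FiberBundle.continuous_proj ℂ c.L.Fiber).comp h.continuous_incl

theorem continuousOn_phase (i : ι) : ContinuousOn (h.phase i) (h.proj ⁻¹' c.U i) := by
  intro q hq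
  have h1 : ContinuousWithinAt (h.coord i) (h.proj ⁻¹' c.U i) q := by
    have h2 : ContinuousOn (c.L.localTriv i) (c.L.localTriv i).source :=
      (c.L.localTriv i).continuousOn_toFun
    exact (continuous_snd.comp_continuousOn
      (h2.comp h.continuous_incl.continuousOn (fun _ hx => hx))) q hq
  exact (contMDiffAt_exp_arg (h.coord_ne_zero i q hq)).continuousAt.comp_continuousWithinAt h1

open Classical in
/-- The inverse of the `i`-th trivialisation of `Q(L)` (with some irrelevant values outside
`U_i`). -/
def trivInv (i : ι) (p : Z × Circle) : h.Q :=
  if hp : p.1 ∈ c.U i then h.point i p.1 hp p.2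
    else h.point (c.L.indexAt p.1) p.1 (c.L.mem_baseSet_at p.1) p.2

theorem trivInv_eq (i : ι) (p : Z × Circle) (hp : p.1 ∈ c.U i) :
    h.trivInv i p = h.point i p.1 hp p.2 := dif_pos hp

/-- The local trivialisation `q ↦ (π_Q(q), e^{iφ_i(q)})` of `Q(L)` over `U_i`. -/
def triv (i : ι) : Trivialization Circle h.proj where
  toFun q := (h.proj q, h.phase i q)
  invFun := h.trivInv i
  source := h.proj ⁻¹' c.U i
  target := c.U i ×ˢ univ
  map_source' q hq := ⟨hq, mem_univ _⟩
  map_target' p hp := by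
    rw [trivInv_eq _ _ _ hp.1]
    exact hp.1
  left_inv' q hq := (h.trivInv_eq i (h.proj q, h.phase i q) hq).trans (h.point_phase i q hq)
  right_inv' p hp := by
    rw [trivInv_eq _ _ _ hp.1]
    exact Prod.ext rfl (h.phase_point i p.1 hp.1 p.2)
  open_source := (c.isOpen_U i).preimage h.continuous_proj
  open_target := (c.isOpen_U i).prod isOpen_univ
  continuousOn_toFun := h.continuous_proj.continuousOn.prodMk (h.continuousOn_phase i)
  continuousOn_invFun := by
    refine (Topology.IsInducing.subtypeVal).continuousOn_iff.2 ?_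
    have h1 : ContinuousOn (fun p : Z × Circle => (c.L.localTriv i).toOpenPartialHomeomorph.symm
        (p.1, (p.2 : ℂ) / (√(h.weight i p.1) : ℝ))) (c.U i ×ˢ univ) := by
      refine (c.L.localTriv i).toOpenPartialHomeomorph.symm.continuousOn.comp ?_ ?_
      · refine continuousOn_fst.prodMk ?_
        refine ContinuousOn.div ?_ ?_ ?_
        · exact (continuous_subtype_val.comp continuous_snd).continuousOn
        · refine Complex.continuous_ofReal.comp_continuousOn
            (Real.continuous_sqrt.comp_continuousOn ?_)
          exact (h.smooth i).continuousOn.comp continuousOn_fst (fun p hp => hp.1)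
        · intro p hp
          exact_mod_cast (Real.sqrt_pos.2 (h.weight_pos hp.1)).ne'
      · intro p hp
        exact (c.L.mem_localTriv_target i _).2 hp.1
    refine h1.congr fun p hp => ?_
    refine (congrArg Subtype.val (h.trivInv_eq i p hp.1)).trans ?_
    refine congrArg (TotalSpace.mk p.1) ?_
    rw [frame_eq]
    exact mul_comm ((p.2 : ℂ) / (√(h.weight i p.1) : ℝ)) (c.f i (c.L.indexAt p.1) p.1)
  baseSet := c.U i
  open_baseSet := c.isOpen_U i
  source_eq := rfl
  target_eq := rfl
  proj_toFun _ _ := rfl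

/-- `Q(L)` is locally modelled on `Z × U(1)`. -/
instance chartedSpaceProd : ChartedSpace (Z × Circle) h.Q where
  atlas := range fun i => (h.triv i).toOpenPartialHomeomorph
  chartAt q := (h.triv (c.L.indexAt (h.proj q))).toOpenPartialHomeomorph
  mem_chart_source q := c.L.mem_baseSet_at (h.proj q)
  chart_mem_atlas _ := mem_range_self _

/-- The charts of `Q(L)`: local trivialisations followed by charts of `Z × U(1)`. -/
instance chartedSpace : ChartedSpace (ModelProd E (EuclideanSpace ℝ (Fin 1))) h.Q :=
  ChartedSpace.comp _ (Z × Circle) _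

variable (E Z) in
/-- The groupoid of local diffeomorphisms of `Z × U(1)`. -/
def localDiffeos : StructureGroupoid (Z × Circle) :=
  Pregroupoid.groupoid
    { property := fun φ s =>
        ContMDiffOn (𝓘(ℝ, E).prod (𝓡 1)) (𝓘(ℝ, E).prod (𝓡 1)) ∞ φ s
      comp := fun hf hg _ _ _ => hg.comp (hf.mono inter_subset_left) inter_subset_right
      id_mem := contMDiffOn_id
      locality := fun _ H => contMDiffOn_of_locally_contMDiffOn H
      congr := fun _ H hf => hf.congr H }

theorem transition_apply (i j : ι) {p : Z × Circle} (hi : p.1 ∈ c.U i) (hj : p.1 ∈ c.U j) :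
    (h.proj (h.trivInv i p), h.phase j (h.trivInv i p)) =
      (p.1, Circle.exp (Complex.arg (c.f i j p.1)) * p.2) := by
  rw [trivInv_eq _ _ _ hi]
  refine Prod.ext rfl ?_
  have h1 : h.coord j (h.point i p.1 hi p.2) = c.f i j p.1 * h.coord i (h.point i p.1 hi p.2) :=
    coord_change (h.incl (h.point i p.1 hi p.2)) hi hj
  change Circle.exp (Complex.arg (h.coord j _)) = _
  rw [h1, exp_arg_mul (c.f_ne_zero i j _ ⟨hi, hj⟩) (h.coord_ne_zero i (h.point i p.1 hi p.2) hi)]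
  exact congrArg (Circle.exp (Complex.arg (c.f i j p.1)) * ·) (h.phase_point i p.1 hi p.2)

theorem transition_smooth (i j : ι) :
    ContMDiffOn (𝓘(ℝ, E).prod (𝓡 1)) (𝓘(ℝ, E).prod (𝓡 1)) ∞
      ((h.triv i).toOpenPartialHomeomorph.symm ≫ₕ (h.triv j).toOpenPartialHomeomorph)
      ((h.triv i).toOpenPartialHomeomorph.symm ≫ₕ
        (h.triv j).toOpenPartialHomeomorph).source := by
  have hs : ∀ p ∈ ((h.triv i).toOpenPartialHomeomorph.symm ≫ₕ
      (h.triv j).toOpenPartialHomeomorph).source, p.1 ∈ c.U i ∧ p.1 ∈ c.U j := by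
    rintro p ⟨hp, hp'⟩
    have h1 : p.1 ∈ c.U i := hp.1
    refine ⟨h1, ?_⟩
    have h2 : h.proj (h.trivInv i p) ∈ c.U j := hp'
    rwa [trivInv_eq _ _ _ h1] at h2
  have h1 : ContMDiffOn (𝓘(ℝ, E).prod (𝓡 1)) (𝓘(ℝ, E).prod (𝓡 1)) ∞
      (fun p : Z × Circle => (p.1, Circle.exp (Complex.arg (c.f i j p.1)) * p.2))
      ((c.U i ∩ c.U j) ×ˢ univ) := by
    refine contMDiffOn_fst.prodMk (ContMDiffOn.mul ?_ contMDiffOn_snd)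
    intro p hp
    have h2 : ContMDiffWithinAt 𝓘(ℝ, E) 𝓘(ℝ, ℂ) ∞ (c.f i j) (c.U i ∩ c.U j) p.1 :=
      contMDiffOn_real (c.holomorphic_f i j) p.1 hp.1
    have h3 : MapsTo Prod.fst ((c.U i ∩ c.U j) ×ˢ (univ : Set Circle)) (c.U i ∩ c.U j) :=
      fun _ hq => hq.1
    have h4 : ContMDiffWithinAt (𝓘(ℝ, E).prod (𝓡 1)) 𝓘(ℝ, ℂ) ∞ (fun q : Z × Circle => c.f i j q.1)
        ((c.U i ∩ c.U j) ×ˢ univ) p :=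
      ContMDiffWithinAt.comp (g := c.f i j) (f := Prod.fst) p h2 contMDiffWithinAt_fst h3
    exact ContMDiffAt.comp_contMDiffWithinAt (g := fun w : ℂ => Circle.exp (Complex.arg w))
      (f := fun q : Z × Circle => c.f i j q.1) p
      (contMDiffAt_exp_arg (c.f_ne_zero i j p.1 hp.1)) h4
  refine (h1.mono fun p hp => ⟨hs p hp, mem_univ _⟩).congr fun p hp => ?_
  exact h.transition_apply i j (hs p hp).1 (hs p hp).2

instance : HasGroupoid h.Q (localDiffeos E Z) where
  compatible := by
    rintro _ _ ⟨i, rfl⟩ ⟨j, rfl⟩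
    refine mem_groupoid_of_pregroupoid.2 ⟨h.transition_smooth i j, ?_⟩
    exact h.transition_smooth j i

instance isManifold : IsManifold (𝓘(ℝ, E).prod (𝓡 1)) ∞ h.Q := by
  refine { StructureGroupoid.HasGroupoid.comp (localDiffeos E Z) ?_ with }
  intro e he
  rw [isLocalStructomorphOn_contDiffGroupoid_iff]
  exact mem_groupoid_of_pregroupoid.1 he

/-- `Q(L)` is a smoothly embedded submanifold of the total space of `L`. (Its topology is the
subspace topology by definition.) -/
def IsSubmanifoldOfL : Prop :=
  ContMDiff (𝓘(ℝ, E).prod (𝓡 1)) (𝓘(ℝ, E).prod 𝓘(ℝ, ℂ)) ∞ h.incl ∧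
  ∀ q, Injective (mfderiv (𝓘(ℝ, E).prod (𝓡 1)) (𝓘(ℝ, E).prod 𝓘(ℝ, ℂ)) h.incl q)

/-- Almost contact structures on `Q(L)`. -/
abbrev AlmostContact := AlmostContactStructure (𝓘(ℝ, E).prod (𝓡 1)) h.Q

/-- The differential of `π_Q`. -/
def dproj (q : h.Q) : TangentSpace (𝓘(ℝ, E).prod (𝓡 1)) q →L[ℝ] TangentSpace 𝓘(ℝ, E) (h.proj q) :=
  mfderiv (𝓘(ℝ, E).prod (𝓡 1)) 𝓘(ℝ, E) h.proj q

/-- Kobayashi's form `ϑ = z_i π^*θ_i`, restricted to `Q(L)|_{U_i}`. -/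
def kobayashiForm (i : ι) (q : h.Q) (X : TangentSpace (𝓘(ℝ, E).prod (𝓡 1)) q) : ℂ :=
  h.coord i q * evalReal (c.θ i (h.proj q)) (h.dproj q X)

/-- `√-1 σ_i = (∂ - ∂̄) log(h_i) / 2` on `U_i`. -/
def iσ (i : ι) (z : Z) (X : TangentSpace 𝓘(ℝ, E) z) : ℂ :=
  (del (fun z => (Real.log (h.weight i z) : ℂ)) z X -
    delBar (fun z => (Real.log (h.weight i z) : ℂ)) z X) / 2

/-- `√-1 dφ_i`, the logarithmic differential of the phase `e^{iφ_i}`, on `Q(L)|_{U_i}`. -/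
def idφ (i : ι) (q : h.Q) (X : TangentSpace (𝓘(ℝ, E).prod (𝓡 1)) q) : ℂ :=
  mvfderiv (𝓘(ℝ, E).prod (𝓡 1)) (fun p : h.Q => (h.phase i p : ℂ)) q X / (h.phase i q : ℂ)

variable {h}

/-- `√-1 η` is the Ishihara–Konishi connection: `η = π_Q^*σ_i + dφ_i` on `Q(L)|_{U_i}`. -/
def IsIKConnection (η : ∀ q : h.Q, TangentSpace (𝓘(ℝ, E).prod (𝓡 1)) q →L[ℝ] ℝ) : Prop :=
  ∀ (i : ι) (q : h.Q), h.proj q ∈ c.U i → ∀ X : TangentSpace (𝓘(ℝ, E).prod (𝓡 1)) q,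
    Complex.I * (η q X : ℂ) = h.iσ i (h.proj q) (h.dproj q X) + h.idφ i q X

/-- `(Φ, ξ, η)` is Hatakeyama's almost contact structure built from the Ishihara–Konishi
connection: `√-1 η` is this connection, `ξ` generates the action of `U(1)`, and `Φ(X)` is the
horizontal lift of `𝒥(π_{Q*} X)`. -/
def IsHatakeyama (S : h.AlmostContact) : Prop :=
  IsIKConnection S.η ∧
  (∀ q : h.Q, IsMIntegralCurve (I := 𝓘(ℝ, E).prod (𝓡 1)) (fun t : ℝ => Circle.exp t • q) S.ξ) ∧
  ∀ (q : h.Q) (X : TangentSpace (𝓘(ℝ, E).prod (𝓡 1)) q), S.η q (S.Φ q X) = 0 ∧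
    h.dproj q (S.Φ q X) = complexStructure (h.proj q) (h.dproj q X)

/-- `η` is the real part of Kobayashi's form on `Q(L)`. -/
def IsReKobayashi (η : ∀ q : h.Q, TangentSpace (𝓘(ℝ, E).prod (𝓡 1)) q →L[ℝ] ℝ) : Prop :=
  ∀ (i : ι) (q : h.Q), h.proj q ∈ c.U i → ∀ X : TangentSpace (𝓘(ℝ, E).prod (𝓡 1)) q,
    η q X = (h.kobayashiForm i q X).re

/-- `η` is the imaginary part of Kobayashi's form on `Q(L)`. -/
def IsImKobayashi (η : ∀ q : h.Q, TangentSpace (𝓘(ℝ, E).prod (𝓡 1)) q →L[ℝ] ℝ) : Prop :=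
  ∀ (i : ι) (q : h.Q), h.proj q ∈ c.U i → ∀ X : TangentSpace (𝓘(ℝ, E).prod (𝓡 1)) q,
    η q X = (h.kobayashiForm i q X).im

/-- `g_Q = π_Q^* g_Z + η ⊗ η` for a Hermitian metric `g_Z` on `Z`. -/
def IsSubmersionMetric (gQ : Metric (𝓘(ℝ, E).prod (𝓡 1)) h.Q)
    (η : ∀ q : h.Q, TangentSpace (𝓘(ℝ, E).prod (𝓡 1)) q →L[ℝ] ℝ) : Prop :=
  ∃ gZ : Metric 𝓘(ℝ, E) Z,
    (∀ (z : Z) (X Y : TangentSpace 𝓘(ℝ, E) z),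
      gZ.inner z (complexStructure z X) (complexStructure z Y) = gZ.inner z X Y) ∧
    ∀ (q : h.Q) (X Y : TangentSpace (𝓘(ℝ, E).prod (𝓡 1)) q),
      gQ.inner q X Y = gZ.inner (h.proj q) (h.dproj q X) (h.dproj q Y) + η q X * η q Y

end HermitianStructure
end ComplexContactStructure

end ContactTriple

end

/-!
# The almost contact metric 3-structure on the circle bundle of a complex contact manifold

A Hermitian structure on `L` is obtained from a partition of unity `ρ_k` subordinate to the cover
`U_k`, as `h_i = ∑ ρ_k |f_ik|²`. Fix any Hermitian structure.

**Linear algebra on the base.** The differentials `dθ_i` do not transform like `θ_i`, but the forms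
`ψ_i = dθ_i - ∂ log h_i ∧ θ_i` do: `ψ_i = f_ij ψ_j`, because `∂ log h_i - ∂ log h_j = d log f_ij`
(`ψLoc_change`). On `ker θ_i` they agree with `dθ_i`, so they are nondegenerate there, and there is
a unique complex Reeb vector `v_i` with `θ_i(v_i) = 1` and `ψ_i(v_i, ·) = 0`. Let `r_i = h_i^{-1/2}`
be the length of the fibre coordinate on `Q`. Starting from any Hermitian metric of `Z`, rescaled so
that `ker θ_i` is orthogonal to `v_i` and `|v_i| = r_i`, the form `r_i Re ψ_i` is represented by a
skew antilinear operator `A`, whose polar decomposition `A = P K` has a positive factor `P`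
commuting with `A` and with the complex structure. Replacing the metric by `g_Z = g(P ·, ·)` gives
`g_Z(K x, y) = r_i Re ψ_i(x, y)` with `K² = -1` on `ker θ_i` (`IsDatum.isAdapted`). The construction
is natural: `g_Z` does not depend on `i`, while `K` is multiplied by the phase of `f_ij` under a
change of trivialisation (`IsDatum.transport`). It is smooth because the positive square root
depends smoothly on the operator and on the metric (`exists_contDiffAt_posSqrt`).

**The circle bundle.** The form `dz_i / z_i + ∂ log h_i` does not depend on `i`; it is imaginary on
`Q` since `h_i |z_i|² = 1` there, and it equals `√-1 η₁`. The pair `(dπ_Q, η₁)` identifies `T_q Q`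
with `T_z Z × ℝ`. As `z_i = r_i u_i` with `u_i` the phase, the phase that multiplies `K` cancels
against that of `u_i`, and `K` together with `θ_i` and `v_i` defines endomorphisms `Φ₂`, `Φ₃` of
`T Q` (`modelΦ`, for the phases `u_i` and `-√-1 u_i`), while `Φ₁` is the horizontal lift of the
complex structure. The relations of an almost contact metric `3`-structure become identities on
`E × ℝ` (`IsAdapted.cyclic_one`, `cyclic_two`, `cyclic_three`, `modelG_modelΦ`). The structure
equation `dϑ = √-1 η₁ ∧ ϑ + z_i ψ_i` (`extD_kob`) says precisely that the real and the imaginary part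
of `ϑ` have the differentials `g_Q(Φ₂ ·, ·)` and `g_Q(Φ₃ ·, ·)` (`extD_kob_eq`); being nondegenerate
on the kernels of the two contact forms, these yield volume forms. The volume forms are equal since
multiplication by `√-√-1` on `ker θ_i`, and by `-√-1` on the Reeb vector, has determinant one and
carries one pair of forms to the other (`wedgePow_rot`).

Normality of `Φ₁` and the Killing property of `ξ₁` hold because `dη₁ = √-1 ∂∂̄ log h_i` is a
horizontal form of type `(1, 1)`, and `g_Q = π_Q^* g_Z + η₁ ⊗ η₁`.
-/


noncomputable section

namespace ContactTriple

/-! ### The top-degree form `α ∧ β^m` -/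

section Wedge

variable {𝕜 : Type*} [NontriviallyNormedField 𝕜] {V : Type*} [AddCommGroup V] [Module 𝕜 V]

theorem fin_two_mul_add_one_cases {m : ℕ} (j : Fin (2 * m + 1)) :
    j = ⟨0, by omega⟩ ∨ (∃ k : Fin m, j = ⟨2 * k + 1, by omega⟩) ∨
      ∃ k : Fin m, j = ⟨2 * k + 2, by omega⟩ := by
  obtain ⟨j, hj⟩ := j
  rcases Nat.eq_zero_or_pos j with h | h
  · exact Or.inl (Fin.ext h)
  rcases Nat.even_or_odd' j with ⟨k, hk | hk⟩
  · exact Or.inr (Or.inr ⟨⟨k - 1, by omega⟩, Fin.ext (by simp only; omega)⟩)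
  · exact Or.inr (Or.inl ⟨⟨k, by omega⟩, Fin.ext (by simp only; omega)⟩)

/-- The summand of `α ∧ β^m` that belongs to the trivial permutation depends linearly on each
argument. -/
theorem exists_linear_wedge_summand (α : V →ₗ[𝕜] 𝕜) (β : V →ₗ[𝕜] V →ₗ[𝕜] 𝕜) (m : ℕ)
    (v : Fin (2 * m + 1) → V) (j : Fin (2 * m + 1)) :
    ∃ l : V →ₗ[𝕜] 𝕜, ∀ x, α (update v j x ⟨0, by omega⟩) *
      ∏ k : Fin m, β (update v j x ⟨2 * k + 1, by omega⟩) (update v j x ⟨2 * k + 2, by omega⟩)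
        = l x := by
  rcases fin_two_mul_add_one_cases j with rfl | ⟨k, rfl⟩ | ⟨k, rfl⟩
  · refine ⟨(∏ k : Fin m, β (v ⟨2 * k + 1, by omega⟩) (v ⟨2 * k + 2, by omega⟩)) • α, fun x => ?_⟩
    simp [mul_comm]
  · refine ⟨(α (v ⟨0, by omega⟩) * ∏ k' ∈ Finset.univ.erase k,
      β (v ⟨2 * k' + 1, by omega⟩) (v ⟨2 * k' + 2, by omega⟩)) •
        β.flip (v ⟨2 * k + 2, by omega⟩), fun x => ?_⟩
    rw [← Finset.mul_prod_erase _ _ (Finset.mem_univ k)]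
    have h : ∀ k' ∈ Finset.univ.erase k,
        β (update v ⟨2 * k + 1, by omega⟩ x ⟨2 * k' + 1, by omega⟩)
          (update v ⟨2 * k + 1, by omega⟩ x ⟨2 * k' + 2, by omega⟩) =
        β (v ⟨2 * k' + 1, by omega⟩) (v ⟨2 * k' + 2, by omega⟩) := by
      intro k' hk'
      have h1 : (k' : ℕ) ≠ k := fun h => (Finset.ne_of_mem_erase hk') (Fin.ext h)
      rw [update_of_ne, update_of_ne]
      · simp only [ne_eq, Fin.mk.injEq]; omega
      · simp only [ne_eq, Fin.mk.injEq]; omega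
    rw [Finset.prod_congr rfl h, update_of_ne (by simp), update_self, update_of_ne (by simp)]
    simp only [LinearMap.smul_apply, LinearMap.flip_apply, smul_eq_mul]
    ring
  · refine ⟨(α (v ⟨0, by omega⟩) * ∏ k' ∈ Finset.univ.erase k,
      β (v ⟨2 * k' + 1, by omega⟩) (v ⟨2 * k' + 2, by omega⟩)) •
        β (v ⟨2 * k + 1, by omega⟩), fun x => ?_⟩
    rw [← Finset.mul_prod_erase _ _ (Finset.mem_univ k)]
    have h : ∀ k' ∈ Finset.univ.erase k,
        β (update v ⟨2 * k + 2, by omega⟩ x ⟨2 * k' + 1, by omega⟩)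
          (update v ⟨2 * k + 2, by omega⟩ x ⟨2 * k' + 2, by omega⟩) =
        β (v ⟨2 * k' + 1, by omega⟩) (v ⟨2 * k' + 2, by omega⟩) := by
      intro k' hk'
      have h1 : (k' : ℕ) ≠ k := fun h => (Finset.ne_of_mem_erase hk') (Fin.ext h)
      rw [update_of_ne, update_of_ne]
      · simp only [ne_eq, Fin.mk.injEq]; omega
      · simp only [ne_eq, Fin.mk.injEq]; omega
    rw [Finset.prod_congr rfl h, update_of_ne (by simp), update_self, update_of_ne (by simp)]
    simp only [LinearMap.smul_apply, smul_eq_mul]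
    ring

/-- `α ⊗ β ⊗ ⋯ ⊗ β` as a multilinear map. -/
def tensorPow (α : V →ₗ[𝕜] 𝕜) (β : V →ₗ[𝕜] V →ₗ[𝕜] 𝕜) (m : ℕ) :
    MultilinearMap 𝕜 (fun _ : Fin (2 * m + 1) => V) 𝕜 where
  toFun v := α (v ⟨0, by omega⟩) * ∏ k : Fin m, β (v ⟨2 * k + 1, by omega⟩) (v ⟨2 * k + 2, by omega⟩)
  map_update_add' {d} v j x y := by
    obtain rfl : d = instDecidableEqFin _ := Subsingleton.elim _ _
    obtain ⟨l, hl⟩ := exists_linear_wedge_summand α β m v j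
    simp only [hl, map_add]
  map_update_smul' {d} v j a x := by
    obtain rfl : d = instDecidableEqFin _ := Subsingleton.elim _ _
    obtain ⟨l, hl⟩ := exists_linear_wedge_summand α β m v j
    simp only [hl, map_smul]

/-- `α ∧ β^m` as an alternating map. -/
def wedgeAlt (α : V →ₗ[𝕜] 𝕜) (β : V →ₗ[𝕜] V →ₗ[𝕜] 𝕜) (m : ℕ) :
    V [⋀^Fin (2 * m + 1)]→ₗ[𝕜] 𝕜 :=
  ((2 : 𝕜) ^ m)⁻¹ • MultilinearMap.alternatization (tensorPow α β m)

theorem wedgeAlt_apply (α : V →ₗ[𝕜] 𝕜) (β : V →ₗ[𝕜] V →ₗ[𝕜] 𝕜) (m : ℕ)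
    (v : Fin (2 * m + 1) → V) :
    wedgeAlt α β m v = wedgePow (fun x => α x) (fun x y => β x y) m v := by
  simp only [wedgeAlt, wedgePow, AlternatingMap.smul_apply, smul_eq_mul,
    MultilinearMap.alternatization_apply, MultilinearMap.domDomCongr_apply]
  congr 1
  refine Finset.sum_congr rfl fun s _ => ?_
  rw [Units.smul_def, zsmul_eq_mul]
  rfl

/-- In top degree, `α ∧ β^m` changes by the determinant under a linear map. -/
theorem wedgePow_comp_det (α : V →ₗ[𝕜] 𝕜) (β : V →ₗ[𝕜] V →ₗ[𝕜] 𝕜) (m : ℕ)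
    (hV : Module.finrank 𝕜 V = 2 * m + 1) (R : V →ₗ[𝕜] V) (v : Fin (2 * m + 1) → V) :
    wedgePow (fun x => α (R x)) (fun x y => β (R x) (R y)) m v =
      LinearMap.det R * wedgePow (fun x => α x) (fun x y => β x y) m v := by
  have hfin : FiniteDimensional 𝕜 V := Module.finite_of_finrank_pos (by omega)
  let e := Module.finBasisOfFinrankEq 𝕜 V hV
  have h := (wedgeAlt α β m).eq_smul_basis_det e
  have h1 : wedgePow (fun x => α (R x)) (fun x y => β (R x) (R y)) m v =
      wedgeAlt α β m (R ∘ v) := by rw [wedgeAlt_apply]; rfl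
  rw [h1, ← wedgeAlt_apply, h]
  simp only [AlternatingMap.smul_apply, smul_eq_mul, Module.Basis.det_comp]
  ring

/-- The other element of the pair `{2k+1, 2k+2}`. -/
theorem exists_partner {m : ℕ} {p : Fin (2 * m + 1)} (hp : p ≠ ⟨0, by omega⟩) :
    ∃ k : Fin m, ∃ p' : Fin (2 * m + 1), p' ≠ ⟨0, by omega⟩ ∧ p' ≠ p ∧
      ((p = ⟨2 * k + 1, by omega⟩ ∧ p' = ⟨2 * k + 2, by omega⟩) ∨
        (p = ⟨2 * k + 2, by omega⟩ ∧ p' = ⟨2 * k + 1, by omega⟩)) := by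
  rcases fin_two_mul_add_one_cases p with rfl | ⟨k, rfl⟩ | ⟨k, rfl⟩
  · exact absurd rfl hp
  · exact ⟨k, ⟨2 * k + 2, by omega⟩, by simp, by simp, Or.inl ⟨rfl, rfl⟩⟩
  · exact ⟨k, ⟨2 * k + 1, by omega⟩, by simp, by simp, Or.inr ⟨rfl, rfl⟩⟩

/-- If `α w = 0` and `β(w, ·)` is a multiple of `α`, then `w` is in the kernel of `α ∧ β^m`:
exchanging the argument of `α` with the one paired with `w` cancels the summands in pairs. -/
theorem wedgePow_eq_zero {V : Type*} (α : V → 𝕜) (β : V → V → 𝕜) (hβ : ∀ x y, β x y = -β y x)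
    (m : ℕ) (v : Fin (2 * m + 1) → V) (j : Fin (2 * m + 1)) (h0 : α (v j) = 0) (κ : 𝕜)
    (hκ : ∀ y, β (v j) y = κ * α y) : wedgePow α β m v = 0 := by
  classical
  choose! K P hP0 hPne hPK using fun (p : Fin (2 * m + 1)) (hp : p ≠ ⟨0, by omega⟩) =>
    exists_partner hp
  refine mul_eq_zero_of_right _ ?_
  let z : Fin (2 * m + 1) := ⟨0, by omega⟩
  let t : Equiv.Perm (Fin (2 * m + 1)) → Equiv.Perm (Fin (2 * m + 1)) := fun s =>
    if s.symm j = z then s else s * Equiv.swap z (P (s.symm j))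
  have ht : ∀ s, s.symm j ≠ z → (t s) (s.symm j) = j := by
    intro s hs
    simp only [t, if_neg hs, Equiv.Perm.mul_apply]
    rw [Equiv.swap_apply_of_ne_of_ne hs (hPne _ hs).symm, Equiv.apply_symm_apply]
  have ht' : ∀ s, s.symm j ≠ z → (t s).symm j = s.symm j := by
    intro s hs
    rw [Equiv.symm_apply_eq, ht s hs]
  refine Finset.sum_involution (fun s _ => t s) ?_ ?_ (fun _ _ => Finset.mem_univ _) ?_
  · intro s _
    by_cases hs : s.symm j = z
    · have h1 : s z = j := by rw [← hs, Equiv.apply_symm_apply]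
      have h2 : t s = s := if_pos hs
      rw [h2, show s ⟨0, by omega⟩ = j from h1, h0]
      simp
    have hts : t s = s * Equiv.swap z (P (s.symm j)) := if_neg hs
    have hsign : (Equiv.Perm.sign (t s) : ℤ) = -(Equiv.Perm.sign s : ℤ) := by
      rw [hts, Equiv.Perm.sign_mul, Equiv.Perm.sign_swap (hP0 _ hs).symm]
      simp
    have hz : t s z = s (P (s.symm j)) := by
      rw [hts, Equiv.Perm.mul_apply, Equiv.swap_apply_left]
    have hp' : t s (P (s.symm j)) = s z := by
      rw [hts, Equiv.Perm.mul_apply, Equiv.swap_apply_right]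
    have hot : ∀ p, p ≠ z → p ≠ P (s.symm j) → t s p = s p := by
      intro p h1 h2
      rw [hts, Equiv.Perm.mul_apply, Equiv.swap_apply_of_ne_of_ne h1 h2]
    obtain ⟨p, hpd⟩ : ∃ p, s.symm j = p := ⟨_, rfl⟩
    have hsp : s p = j := by rw [← hpd, Equiv.apply_symm_apply]
    have htsp : t s p = j := hpd ▸ ht s hs
    rw [hpd] at hz hp' hot
    have hk := hPK p (hpd ▸ hs)
    generalize K p (hpd ▸ hs) = k at hk
    rw [hsign]
    have key : α (v (s z)) * ∏ k : Fin m, β (v (s ⟨2 * k + 1, by omega⟩))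
          (v (s ⟨2 * k + 2, by omega⟩)) =
        α (v (t s z)) * ∏ k : Fin m, β (v (t s ⟨2 * k + 1, by omega⟩))
          (v (t s ⟨2 * k + 2, by omega⟩)) := by
      rw [← Finset.mul_prod_erase _ _ (Finset.mem_univ k),
        ← Finset.mul_prod_erase (a := k) _ (fun k : Fin m => β (v (t s ⟨2 * k + 1, by omega⟩))
          (v (t s ⟨2 * k + 2, by omega⟩))) (Finset.mem_univ k)]
      have hrest : ∏ x ∈ Finset.univ.erase k, β (v (t s ⟨2 * x + 1, by omega⟩))
            (v (t s ⟨2 * x + 2, by omega⟩)) =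
          ∏ x ∈ Finset.univ.erase k, β (v (s ⟨2 * x + 1, by omega⟩))
            (v (s ⟨2 * x + 2, by omega⟩)) := by
        refine Finset.prod_congr rfl fun x hx => ?_
        have h1 : (x : ℕ) ≠ k := fun h => (Finset.ne_of_mem_erase hx) (Fin.ext h)
        rw [hot, hot]
        · simp [z]
        · rcases hk with ⟨-, h⟩ | ⟨-, h⟩ <;> rw [h] <;> simp only [ne_eq, Fin.mk.injEq] <;> omega
        · simp [z]
        · rcases hk with ⟨-, h⟩ | ⟨-, h⟩ <;> rw [h] <;> simp only [ne_eq, Fin.mk.injEq] <;> omega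
      rw [hrest, ← mul_assoc, ← mul_assoc]
      congr 1
      rcases hk with ⟨h1, h2⟩ | ⟨h1, h2⟩
      · rw [← h1, ← h2, hsp, htsp, hz, hp', hκ, hκ]; ring
      · rw [← h1, ← h2, hsp, htsp, hz, hp', hβ _ (v j), hβ _ (v j), hκ, hκ]; ring
    push_cast
    change _ * (α (v (s z)) * _) + _ * (α (v (t s z)) * _) = 0
    rw [key]; ring
  · intro s _ hne hts
    by_cases hs : s.symm j = z
    · apply hne
      have h1 : s z = j := by rw [← hs, Equiv.apply_symm_apply]
      rw [show s ⟨0, by omega⟩ = j from h1, h0]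
      simp
    · have h1 : s * Equiv.swap z (P (s.symm j)) = s := by
        simpa only [t, if_neg hs] using hts
      have h2 := (Equiv.Perm.ext_iff.1 h1) z
      rw [Equiv.Perm.mul_apply, Equiv.swap_apply_left] at h2
      exact hP0 _ hs (s.injective h2)
  · intro s _
    by_cases hs : s.symm j = z
    · have h2 : t s = s := if_pos hs
      rw [h2, h2]
    · have h1 := ht' s hs
      have h2 : t (t s) = t s * Equiv.swap z (P ((t s).symm j)) := if_neg (h1 ▸ hs)
      rw [h2, h1]
      have h3 : t s = s * Equiv.swap z (P (s.symm j)) := if_neg hs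
      rw [h3, mul_assoc, Equiv.swap_mul_self, mul_one]

/-- If the top-degree form `α ∧ β^m` is not zero, then `β` is nondegenerate on the kernel
of `α`. -/
theorem nondegenerate_of_wedgePow_ne_zero (α : V →ₗ[𝕜] 𝕜) (β : V →ₗ[𝕜] V →ₗ[𝕜] 𝕜)
    (hβ : ∀ x y, β x y = -β y x) (m : ℕ) (hV : Module.finrank 𝕜 V = 2 * m + 1)
    (hne : wedgePow (fun x => α x) (fun x y => β x y) m ≠ 0) (w : V) (hw : α w = 0)
    (hwβ : ∀ y, α y = 0 → β w y = 0) : w = 0 := by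
  by_contra hw0
  obtain ⟨v, hv⟩ := Function.ne_iff.1 hne
  rw [Pi.zero_apply, ← wedgeAlt_apply] at hv
  have hli : LinearIndependent 𝕜 v := by
    by_contra h
    exact hv ((wedgeAlt α β m).map_linearDependent v h)
  let b := basisOfLinearIndependentOfCardEqFinrank hli (by simp [hV])
  have hb : ⇑b = v := coe_basisOfLinearIndependentOfCardEqFinrank hli _
  obtain ⟨u, hu⟩ : ∃ u, α u ≠ 0 := by
    by_contra! h
    apply hv
    rw [wedgeAlt_apply, wedgePow]
    simp [h]
  have hκ : ∀ y, β w y = β w u / α u * α y := by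
    intro y
    have h1 : β w (y - (α y / α u) • u) = 0 := hwβ _ (by simp [div_mul_cancel₀ _ hu])
    rw [map_sub, map_smul, smul_eq_mul, sub_eq_zero] at h1
    rw [h1]; ring
  obtain ⟨j, hj⟩ : ∃ j, b.repr w j ≠ 0 := by
    by_contra! h
    exact hw0 (b.repr.map_eq_zero_iff.1 (Finsupp.ext h))
  have h1 : wedgeAlt α β m (update v j w) = 0 := by
    rw [wedgeAlt_apply]
    exact wedgePow_eq_zero _ _ hβ m _ j (by simpa using hw) (β w u / α u) (by simpa using hκ)
  have h2 : w = ∑ i, b.repr w i • v i := by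
    conv_lhs => rw [← b.sum_repr w]
    rw [hb]
  rw [h2, AlternatingMap.map_update_sum, Finset.sum_eq_single j] at h1
  · rw [AlternatingMap.map_update_smul, update_eq_self, smul_eq_mul] at h1
    exact (mul_ne_zero hj hv) h1
  · intro i _ hij
    rw [AlternatingMap.map_update_smul, AlternatingMap.map_update_self _ _ hij.symm, smul_zero]
  · simp

end Wedge

section Symplectic

/-- The positions `0`, `2k+1`, `2k+2` of `Fin (2m+1)` as `none`, `(k, 0)`, `(k, 1)`. -/
def pairEquiv (m : ℕ) : Option (Fin m × Fin 2) ≃ Fin (2 * m + 1) :=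
  Equiv.ofBijective (fun o => o.elim ⟨0, by omega⟩ fun p => ⟨2 * p.1 + 1 + p.2, by omega⟩) <| by
    rw [Fintype.bijective_iff_surjective_and_card]
    refine ⟨fun j => ?_, by simp [mul_comm]⟩
    rcases fin_two_mul_add_one_cases j with rfl | ⟨k, rfl⟩ | ⟨k, rfl⟩
    · exact ⟨none, rfl⟩
    · exact ⟨some (k, 0), rfl⟩
    · exact ⟨some (k, 1), rfl⟩

/-- The standard symplectic form on pairs. -/
def stdPairing {m : ℕ} : Option (Fin m × Fin 2) → Option (Fin m × Fin 2) → ℤ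
  | some (k, a), some (l, b) => if k = l then (b : ℤ) - (a : ℤ) else 0
  | _, _ => 0

theorem sign_perm_fin_two (τ : Equiv.Perm (Fin 2)) :
    ((τ 1 : Fin 2) : ℤ) - ((τ 0 : Fin 2) : ℤ) = (Equiv.Perm.sign τ : ℤ) := by
  revert τ; decide

/-- Every nonzero summand of `α ∧ β^m` on a symplectic family is `1`. -/
theorem sign_mul_prod_stdPairing_eq_one {m : ℕ} (s : Equiv.Perm (Option (Fin m × Fin 2)))
    (hs0 : s none = none)
    (hs : ∀ k, stdPairing (s (some (k, 0))) (s (some (k, 1))) ≠ 0) :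
    (Equiv.Perm.sign s : ℤ) * ∏ k, stdPairing (s (some (k, 0))) (s (some (k, 1))) = 1 := by
  classical
  -- On a nonzero summand the permutation maps pairs to pairs.
  have h1 : ∀ k : Fin m, ∃ l : Fin m, ∃ τ : Equiv.Perm (Fin 2),
      ∀ a, s (some (k, a)) = some (l, τ a) := by
    intro k
    have h := hs k
    rcases h0 : s (some (k, 0)) with _ | ⟨l, a⟩
    · exact absurd (s.injective (h0.trans hs0.symm)) (by simp)
    rcases h0' : s (some (k, 1)) with _ | ⟨l', b⟩
    · exact absurd (s.injective (h0'.trans hs0.symm)) (by simp)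
    have hl : l = l' := by
      by_contra hl
      simp [h0, h0', stdPairing, hl] at h
    subst hl
    have hab : a ≠ b := by
      rintro rfl
      simp [h0, h0', stdPairing] at h
    refine ⟨l, Equiv.swap 0 a, fun c => ?_⟩
    fin_cases c
    · simpa using h0
    · refine h0'.trans ?_
      congr 2
      exact (show ∀ a b : Fin 2, a ≠ b → b = Equiv.swap 0 a 1 by decide) a b hab
  choose σ τ hστ using h1
  have hσ : Injective σ := by
    intro k l hkl
    have h2 : s (some (k, (τ k).symm 0)) = s (some (l, (τ l).symm 0)) := by
      rw [hστ, hστ, hkl]; simp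
    simpa using congrArg (Option.map Prod.fst) (s.injective h2)
  let σ' : Equiv.Perm (Fin m) := Equiv.ofBijective σ (Finite.injective_iff_bijective.1 hσ)
  have hfact : s = Equiv.optionCongr ((Equiv.prodCongrLeft fun _ : Fin 2 => σ') *
      (Equiv.prodCongrRight τ)) := by
    ext1 o
    rcases o with _ | ⟨k, a⟩
    · simpa using hs0
    · rw [hστ]
      rfl
  have hsign : (Equiv.Perm.sign s : ℤ) = ∏ k, (Equiv.Perm.sign (τ k) : ℤ) := by
    rw [hfact, Equiv.optionCongr_sign, Equiv.Perm.sign_mul, Equiv.Perm.sign_prodCongrLeft,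
      Equiv.Perm.sign_prodCongrRight]
    simp
  have hpair : ∀ k, stdPairing (s (some (k, 0))) (s (some (k, 1))) =
      (Equiv.Perm.sign (τ k) : ℤ) := by
    intro k
    rw [hστ, hστ, ← sign_perm_fin_two]
    simp [stdPairing]
  rw [hsign, Finset.prod_congr rfl fun k _ => hpair k, ← Finset.prod_mul_distrib]
  exact Finset.prod_eq_one fun k _ => by
    rcases Int.units_eq_one_or (Equiv.Perm.sign (τ k)) with h | h <;> simp [h]

variable {V : Type*}

/-- `α ∧ β^m` does not vanish on a symplectic family for `β` completed by a vector dual to `α`. -/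
theorem wedgePow_ne_zero (α : V → ℝ) (β : V → V → ℝ) (m : ℕ)
    (b : Option (Fin m × Fin 2) → V) (hα0 : α (b none) = 1) (hα : ∀ p, α (b (some p)) = 0)
    (hβ : ∀ o o', β (b o) (b o') = stdPairing o o') : wedgePow α β m ≠ 0 := by
  classical
  intro h
  have h1 := congrFun h (b ∘ (pairEquiv m).symm)
  rw [Pi.zero_apply, wedgePow, mul_eq_zero] at h1
  have hodd : ∀ (k : Fin m) (h : 2 * (k : ℕ) + 1 < 2 * m + 1),
      (⟨2 * k + 1, h⟩ : Fin (2 * m + 1)) = pairEquiv m (some (k, 0)) := fun _ _ => rfl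
  have heven : ∀ (k : Fin m) (h : 2 * (k : ℕ) + 2 < 2 * m + 1),
      (⟨2 * k + 2, h⟩ : Fin (2 * m + 1)) = pairEquiv m (some (k, 1)) := fun _ _ => rfl
  have hzero : (⟨0, by omega⟩ : Fin (2 * m + 1)) = pairEquiv m none := rfl
  have h2 := h1.resolve_left (by positivity)
  rw [← (Equiv.permCongr (pairEquiv m)).sum_comp] at h2
  simp only [hodd, heven, hzero, comp_apply, Equiv.permCongr_apply, Equiv.symm_apply_apply,
    Equiv.Perm.sign_permCongr, hβ] at h2
  refine (ne_of_gt ?_) h2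
  have hterm : ∀ s : Equiv.Perm (Option (Fin m × Fin 2)),
      ((Equiv.Perm.sign s : ℤ) : ℝ) * (α (b (s none)) *
        ∏ k, (stdPairing (s (some (k, 0))) (s (some (k, 1))) : ℝ)) = 0 ∨
      ((Equiv.Perm.sign s : ℤ) : ℝ) * (α (b (s none)) *
        ∏ k, (stdPairing (s (some (k, 0))) (s (some (k, 1))) : ℝ)) = 1 := by
    intro s
    rcases hs0 : s none with _ | p
    · by_cases hs : ∀ k, stdPairing (s (some (k, 0))) (s (some (k, 1))) ≠ 0
      · right
        rw [hα0, one_mul]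
        exact_mod_cast sign_mul_prod_stdPairing_eq_one s hs0 hs
      · left
        push Not at hs
        obtain ⟨k, hk⟩ := hs
        rw [Finset.prod_eq_zero (Finset.mem_univ k) (by rw [hk]; simp)]
        simp
    · left
      rw [hα]; simp
  refine Finset.sum_pos' (fun s _ => ?_) ⟨1, Finset.mem_univ _, ?_⟩
  · rcases hterm s with h | h
    · rw [h]
    · rw [h]; exact zero_le_one
  · simp [hα0, stdPairing]

/-- A nondegenerate alternating form on the kernel of a linear form has a symplectic family
of full length. -/
theorem exists_symplectic_family [AddCommGroup V] [Module ℝ V] [FiniteDimensional ℝ V]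
    (α : V →ₗ[ℝ] ℝ) (β : V →ₗ[ℝ] V →ₗ[ℝ] ℝ) (ξ : V) (hβ : ∀ x y, β x y = -β y x)
    (hξ : α ξ = 1) (hβξ : ∀ y, β ξ y = 0)
    (hnd : ∀ x, α x = 0 → (∀ y, α y = 0 → β x y = 0) → x = 0)
    (m : ℕ) (hm : 2 * m + 1 ≤ Module.finrank ℝ V) :
    ∃ b : Option (Fin m × Fin 2) → V, α (b none) = 1 ∧ (∀ p, α (b (some p)) = 0) ∧
      (∀ o o', β (b o) (b o') = stdPairing o o') ∧ b none = ξ := by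
  have hself : ∀ x, β x x = 0 := fun x => by linarith [hβ x x]
  induction m with
  | zero =>
    refine ⟨fun _ => ξ, hξ, fun p => p.1.elim0, ?_, rfl⟩
    rintro (_ | ⟨k, _⟩) (_ | ⟨l, _⟩)
    · simp [hself, stdPairing]
    · exact l.elim0
    · exact k.elim0
    · exact l.elim0
  | succ m ih =>
    obtain ⟨b, hb0, hbα, hbβ, hbξ⟩ := ih (by omega)
    let e : Fin m → V := fun k => b (some (k, 0))
    let f : Fin m → V := fun k => b (some (k, 1))
    have hee : ∀ k l, β (e k) (e l) = 0 := fun k l => by simp [e, hbβ, stdPairing]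
    have hff : ∀ k l, β (f k) (f l) = 0 := fun k l => by simp [f, hbβ, stdPairing]
    have hef : ∀ k l, β (e k) (f l) = if k = l then 1 else 0 := fun k l => by
      simp [e, f, hbβ, stdPairing]
    have hfe : ∀ k l, β (f k) (e l) = if k = l then -1 else 0 := fun k l => by
      rw [hβ, hef]; simp only [eq_comm (a := l)]; split_ifs <;> simp
    have hαe : ∀ k, α (e k) = 0 := fun k => hbα _
    have hαf : ∀ k, α (f k) = 0 := fun k => hbα _
    -- The projection to the complement of the span of the family.
    let p : V → V := fun x => x - α x • ξ - ∑ k, β x (f k) • e k + ∑ k, β x (e k) • f k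
    have hpα : ∀ x, α (p x) = 0 := fun x => by simp [p, hξ, hαe, hαf]
    have hpe : ∀ x l, β (p x) (e l) = 0 := fun x l => by
      simp [p, hβξ, hee, hfe, LinearMap.sum_apply]
    have hpf : ∀ x l, β (p x) (f l) = 0 := fun x l => by
      simp [p, hβξ, hff, hef, LinearMap.sum_apply]
    have hep : ∀ x l, β (e l) (p x) = 0 := fun x l => by rw [hβ, hpe, neg_zero]
    have hfp : ∀ x l, β (f l) (p x) = 0 := fun x l => by rw [hβ, hpf, neg_zero]
    -- The family has fewer vectors than the dimension, so `p` is not zero; a vector `p x` and a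
    -- vector paired nontrivially with it are the next pair.
    obtain ⟨x, hx⟩ : ∃ x, p x ≠ 0 := by
      by_contra! h
      have hspan : Submodule.span ℝ (range b) = ⊤ := by
        refine eq_top_iff.2 fun x _ => ?_
        have h1 : x = α x • ξ + ∑ k, β x (f k) • e k - ∑ k, β x (e k) • f k := by
          have := h x
          simp only [p] at this
          rw [← sub_eq_zero, ← this]
          abel
        have hmem : ∀ o, b o ∈ Submodule.span ℝ (range b) := fun o =>
          Submodule.subset_span (mem_range_self o)
        rw [h1]
        refine Submodule.sub_mem _ (Submodule.add_mem _ ?_ ?_) ?_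
        · exact Submodule.smul_mem _ _ (hbξ ▸ hmem none)
        · exact Submodule.sum_mem _ fun k _ => Submodule.smul_mem _ _ (hmem _)
        · exact Submodule.sum_mem _ fun k _ => Submodule.smul_mem _ _ (hmem _)
      have h2 := finrank_range_le_card (R := ℝ) b
      rw [Set.finrank, hspan, finrank_top] at h2
      simp at h2
      omega
    obtain ⟨y, hy, hxy⟩ : ∃ y, α y = 0 ∧ β (p x) y ≠ 0 := by
      by_contra! h
      exact hx (hnd _ (hpα x) h)
    have hxpy : β (p x) (p y) = β (p x) y := by
      simp only [p, map_add, map_sub, map_sum, map_smul]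
      have h1 : ∀ k, β (x - α x • ξ - ∑ k, β x (f k) • e k + ∑ k, β x (e k) • f k) (e k) = 0 :=
        hpe x
      have h2 : ∀ k, β (x - α x • ξ - ∑ k, β x (f k) • e k + ∑ k, β x (e k) • f k) (f k) = 0 :=
        hpf x
      simp only [map_add, map_sub, map_sum, map_smul] at h1 h2
      simp [h1, h2, hy]
    have hne : β (p x) (p y) ≠ 0 := hxpy ▸ hxy
    let e' := p x
    let f' := (β (p x) (p y))⁻¹ • p y
    have hef' : β e' f' = 1 := by simp [e', f', hne]
    have hfe' : β f' e' = -1 := by rw [hβ, hef']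
    refine ⟨fun o => o.elim ξ fun q => Fin.snoc (α := fun _ => V)
        (fun k => b (some (k, q.2))) (if q.2 = 0 then e' else f') q.1, hξ, ?_, ?_, rfl⟩
    · rintro ⟨k, a⟩
      induction k using Fin.lastCases with
      | last => fin_cases a <;> simp [e', f', hpα]
      | cast k => simp [hbα]
    · have hβξ' : ∀ y, β y ξ = 0 := fun y => by rw [hβ, hβξ, neg_zero]
      rintro (_ | ⟨k, a⟩) (_ | ⟨l, c⟩)
      · simp [hβξ, stdPairing]
      · simp [hβξ, stdPairing]
      · simp [hβξ', stdPairing]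
      · induction k using Fin.lastCases with
        | last =>
          induction l using Fin.lastCases with
          | last =>
            fin_cases a <;> fin_cases c <;> simp [stdPairing, hself, hef', hfe']
          | cast l =>
            have h0 : Fin.last m ≠ l.castSucc := (Fin.castSucc_lt_last l).ne'
            fin_cases a <;> fin_cases c <;> simp [stdPairing, h0, e', f']
            all_goals first | exact Or.inr (hpe _ _) | exact Or.inr (hpf _ _) | exact hpe _ _ | exact hpf _ _
        | cast k =>
          induction l using Fin.lastCases with
          | last =>
            have h0 : k.castSucc ≠ Fin.last m := (Fin.castSucc_lt_last k).ne
            fin_cases a <;> fin_cases c <;> simp [stdPairing, h0, e', f']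
            all_goals first | exact Or.inr (hep _ _) | exact Or.inr (hfp _ _) | exact hep _ _ | exact hfp _ _
          | cast l =>
            simp [hbβ, stdPairing, Fin.castSucc_inj]

/-- A linear form and an alternating form that is nondegenerate on its kernel, with a common Reeb
vector, give a volume form. -/
theorem wedgePow_ne_zero_of_nondegenerate [AddCommGroup V] [Module ℝ V]
    (α : V →ₗ[ℝ] ℝ) (β : V →ₗ[ℝ] V →ₗ[ℝ] ℝ) (ξ : V) (hβ : ∀ x y, β x y = -β y x)
    (hξ : α ξ = 1) (hβξ : ∀ y, β ξ y = 0)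
    (hnd : ∀ x, α x = 0 → (∀ y, α y = 0 → β x y = 0) → x = 0)
    (m : ℕ) (hm : Module.finrank ℝ V = 2 * m + 1) :
    wedgePow (fun x => α x) (fun x y => β x y) m ≠ 0 := by
  have hfin : FiniteDimensional ℝ V := Module.finite_of_finrank_pos (by omega)
  obtain ⟨b, h0, h1, h2, -⟩ := exists_symplectic_family α β ξ hβ hξ hβξ hnd m hm.ge
  exact wedgePow_ne_zero _ _ m b h0 h1 h2

end Symplectic

/-! ### Positive square roots with respect to a varying inner product -/

section SquareRoot

variable {E : Type*} [NormedAddCommGroup E] [NormedSpace ℝ E]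

/-- `g` is an inner product on `E`. -/
structure IsInner (g : E →L[ℝ] E →L[ℝ] ℝ) : Prop where
  symm : ∀ x y, g x y = g y x
  pos : ∀ x, x ≠ 0 → 0 < g x x

/-- `P` is symmetric and positive with respect to the inner product `g`. -/
structure IsPosOp (g : E →L[ℝ] E →L[ℝ] ℝ) (P : E →L[ℝ] E) : Prop where
  symm : ∀ x y, g (P x) y = g x (P y)
  pos : ∀ x, x ≠ 0 → 0 < g (P x) x

theorem IsInner.ext {g : E →L[ℝ] E →L[ℝ] ℝ} (hg : IsInner g) {x y : E}
    (h : ∀ z, g x z = g y z) : x = y := by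
  by_contra hne
  have h1 := hg.pos (x - y) (sub_ne_zero.2 hne)
  have h2 : g (x - y) (x - y) = 0 := by
    rw [map_sub g x y, sub_apply, h, sub_self]
  exact h1.ne' h2

theorem IsInner.self_nonneg {g : E →L[ℝ] E →L[ℝ] ℝ} (hg : IsInner g) (x : E) : 0 ≤ g x x := by
  rcases eq_or_ne x 0 with rfl | hx
  · simp
  · exact (hg.pos x hx).le

theorem IsInner.eq_zero {g : E →L[ℝ] E →L[ℝ] ℝ} (hg : IsInner g) {x : E} (h : g x x = 0) :
    x = 0 := by
  by_contra hx
  exact (hg.pos x hx).ne' h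

theorem IsPosOp.injective {g : E →L[ℝ] E →L[ℝ] ℝ} {P : E →L[ℝ] E}
    (hP : IsPosOp g P) : Injective P := by
  refine (injective_iff_map_eq_zero P).2 fun x hx => ?_
  by_contra hne
  have := hP.pos x hne
  simp [hx] at this

variable [FiniteDimensional ℝ E]

/-- An orthonormal basis of eigenvectors of a symmetric operator. -/
theorem IsInner.exists_eigenbasis {g : E →L[ℝ] E →L[ℝ] ℝ} (hg : IsInner g) (S : E →L[ℝ] E)
    (hS : ∀ x y, g (S x) y = g x (S y)) :
    ∃ (b : Module.Basis (Fin (Module.finrank ℝ E)) ℝ E) (μ : Fin (Module.finrank ℝ E) → ℝ),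
      (∀ i j, g (b i) (b j) = if i = j then 1 else 0) ∧ ∀ i, S (b i) = μ i • b i := by
  -- The eigenbasis comes from the spectral theorem on a copy of `E` with the inner product `g`.
  suffices H : ∀ (V : Type _) [AddCommGroup V] [Module ℝ V] [FiniteDimensional ℝ V]
      (G : V →ₗ[ℝ] V →ₗ[ℝ] ℝ), (∀ x y, G x y = G y x) → (∀ x, x ≠ 0 → 0 < G x x) →
      ∀ S : V →ₗ[ℝ] V, (∀ x y, G (S x) y = G x (S y)) →
      ∃ (b : Module.Basis (Fin (Module.finrank ℝ V)) ℝ V) (μ : Fin (Module.finrank ℝ V) → ℝ),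
      (∀ i j, G (b i) (b j) = if i = j then 1 else 0) ∧ ∀ i, S (b i) = μ i • b i from
    H E (LinearMap.mk₂ ℝ (fun x y => g x y) (by simp) (by simp) (by simp) (by simp))
      hg.symm hg.pos S hS
  intro V _ _ _ G hsymm hpos S hS
  let core : InnerProductSpace.Core ℝ V :=
    { inner := fun x y => G x y
      conj_inner_symm := fun x y => hsymm y x
      re_inner_nonneg := fun x => by
        rcases eq_or_ne x 0 with rfl | hx
        · simp
        · exact (hpos x hx).le
      add_left := fun x y z => by simp
      smul_left := fun x y r => by simp
      definite := fun x hx => by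
        by_contra hne
        exact (hpos x hne).ne' hx }
  let _ : NormedAddCommGroup V := core.toNormedAddCommGroup
  let _ : InnerProductSpace ℝ V := InnerProductSpace.ofCore core.toCore
  have hSs : S.IsSymmetric := fun x y => hS x y
  let b := hSs.eigenvectorBasis rfl
  refine ⟨b.toBasis, hSs.eigenvalues rfl, fun i j => ?_, fun i => ?_⟩
  · rw [OrthonormalBasis.coe_toBasis]
    exact orthonormal_iff_ite.1 b.orthonormal i j
  · rw [OrthonormalBasis.coe_toBasis]
    exact hSs.apply_eigenvectorBasis rfl i

/-- Uniqueness in Sylvester's equation `P X + X S = 0` for positive `P` and `S`. Everything needed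
about positive square roots follows from it: uniqueness, smoothness, and that they commute with
whatever commutes with the square. -/
theorem sylvester_unique {g : E →L[ℝ] E →L[ℝ] ℝ} (hg : IsInner g) {P S X : E →L[ℝ] E}
    (hP : IsPosOp g P) (hS : IsPosOp g S) (h : ∀ x, P (X x) = -X (S x)) : X = 0 := by
  obtain ⟨b, μ, hb, hμ⟩ := hg.exists_eigenbasis S hS.symm
  have hX : ∀ i, X (b i) = 0 := by
    intro i
    by_contra hne
    have h1 : 0 < μ i := by
      have := hS.pos (b i) (b.ne_zero i)
      rw [hμ] at this
      simpa [hb] using this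
    have h2 := hP.pos _ hne
    rw [h, hμ] at h2
    simp only [map_smul, map_neg, neg_apply, smul_apply,
      smul_eq_mul] at h2
    nlinarith [hg.pos _ hne]
  have h1 : (X : E →ₗ[ℝ] E) = 0 := b.ext fun i => by simpa using hX i
  ext x
  exact LinearMap.congr_fun h1 x

theorem IsPosOp.eq_of_sq_eq {g : E →L[ℝ] E →L[ℝ] ℝ} (hg : IsInner g) {P S : E →L[ℝ] E}
    (hP : IsPosOp g P) (hS : IsPosOp g S) (h : P.comp P = S.comp S) : P = S := by
  rw [← sub_eq_zero]
  refine sylvester_unique hg hP hS fun x => ?_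
  have h1 : P (P x) = S (S x) := DFunLike.congr_fun h x
  simp [h1]

theorem exists_posSqrt {g : E →L[ℝ] E →L[ℝ] ℝ} (hg : IsInner g) {B : E →L[ℝ] E}
    (hB : IsPosOp g B) : ∃ P, IsPosOp g P ∧ P.comp P = B := by
  obtain ⟨b, μ, hb, hμ⟩ := hg.exists_eigenbasis B hB.symm
  have hμpos : ∀ i, 0 < μ i := fun i => by
    have := hB.pos (b i) (b.ne_zero i)
    rw [hμ] at this
    simpa [hb] using this
  let P₀ : E →ₗ[ℝ] E := b.constr ℝ fun i => √(μ i) • b i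
  let P : E →L[ℝ] E := LinearMap.toContinuousLinearMap P₀
  have hPb : ∀ i, P (b i) = √(μ i) • b i := fun i => b.constr_basis ℝ _ i
  have hgb : ∀ x i, g x (b i) = b.repr x i := by
    intro x i
    have h : g x (b i) = g (∑ j, b.repr x j • b j) (b i) := by rw [b.sum_repr]
    rw [h]
    simp only [map_sum, map_smul, sum_apply, smul_apply, hb]
    simp
  have hPx : ∀ x, P x = ∑ i, b.repr x i • √(μ i) • b i := by
    intro x
    have h : P x = P (∑ j, b.repr x j • b j) := by rw [b.sum_repr]
    rw [h]
    simp only [map_sum, map_smul, hPb]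
  have hPg : ∀ x y, g (P x) y = ∑ i, √(μ i) * (b.repr x i * b.repr y i) := by
    intro x y
    rw [hPx]
    simp only [map_sum, map_smul, sum_apply, smul_apply,
      smul_eq_mul]
    exact Finset.sum_congr rfl fun i _ => by rw [hg.symm, hgb]; ring
  refine ⟨P, ⟨fun x y => ?_, fun x hx => ?_⟩, ?_⟩
  · rw [hg.symm x, hPg, hPg]
    exact Finset.sum_congr rfl fun i _ => by ring
  · rw [hPg]
    obtain ⟨i, hi⟩ : ∃ i, b.repr x i ≠ 0 := by
      by_contra! h
      exact hx (b.repr.map_eq_zero_iff.1 (Finsupp.ext h))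
    refine Finset.sum_pos' (fun i _ => ?_) ⟨i, Finset.mem_univ i, ?_⟩
    · exact mul_nonneg (Real.sqrt_nonneg _) (mul_self_nonneg _)
    · exact mul_pos (Real.sqrt_pos.2 (hμpos i)) (mul_self_pos.2 hi)
  · have h1 : ((P.comp P : E →L[ℝ] E) : E →ₗ[ℝ] E) = B := b.ext fun i => by
      change P (P (b i)) = B (b i)
      rw [hPb, map_smul, hPb, hμ, smul_smul, Real.mul_self_sqrt (hμpos i).le]
    ext x
    exact LinearMap.congr_fun h1 x

open Classical in
/-- The positive square root of a positive operator with respect to an inner product `g`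
(and `0` if there is none). -/
def posSqrt (g : E →L[ℝ] E →L[ℝ] ℝ) (B : E →L[ℝ] E) : E →L[ℝ] E :=
  if h : ∃ P, IsPosOp g P ∧ P.comp P = B then h.choose else 0

theorem posSqrt_spec {g : E →L[ℝ] E →L[ℝ] ℝ} (hg : IsInner g) {B : E →L[ℝ] E}
    (hB : IsPosOp g B) :
    IsPosOp g (posSqrt g B) ∧ (posSqrt g B).comp (posSqrt g B) = B := by
  have h := exists_posSqrt hg hB
  rw [posSqrt, dif_pos h]
  exact h.choose_spec

theorem exists_coercive {g : E →L[ℝ] E →L[ℝ] ℝ} (h0 : ∀ y, y ≠ 0 → 0 < g y y) :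
    ∃ c > 0, ∀ y : E, c * ‖y‖ ^ 2 ≤ g y y := by
  have hcont : Continuous fun y : E => g y y := by fun_prop
  have hK : IsCompact (Metric.sphere (0 : E) 1) := isCompact_sphere 0 1
  rcases (Metric.sphere (0 : E) 1).eq_empty_or_nonempty with hS | hS
  · refine ⟨1, one_pos, fun y => ?_⟩
    have hy : y = 0 := by
      by_contra hy
      have : (‖y‖⁻¹ • y) ∈ Metric.sphere (0 : E) 1 := by
        simp [norm_smul, inv_mul_cancel₀ (norm_ne_zero_iff.2 hy)]
      rw [hS] at this
      exact this
    simp [hy]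
  · obtain ⟨e, he, hmin⟩ := hK.exists_isMinOn hS hcont.continuousOn
    refine ⟨g e e, h0 e (by rintro rfl; simp at he), fun y => ?_⟩
    rcases eq_or_ne y 0 with rfl | hy
    · simp
    have hn : ‖y‖ ≠ 0 := norm_ne_zero_iff.2 hy
    have h1 := hmin (show (‖y‖⁻¹ • y) ∈ Metric.sphere (0 : E) 1 by
      simp [norm_smul, inv_mul_cancel₀ hn])
    simp only [mem_ofPred_eq, map_smul, smul_apply, smul_eq_mul] at h1
    calc g e e * ‖y‖ ^ 2 ≤ (‖y‖⁻¹ * (‖y‖⁻¹ * g y y)) * ‖y‖ ^ 2 := by gcongr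
      _ = g y y := by field_simp

/-- Positive definiteness is an open condition. -/
theorem eventually_pos_def {M : Type*} [TopologicalSpace M] {G : M → E →L[ℝ] E →L[ℝ] ℝ} {x₀ : M}
    (hG : ContinuousAt G x₀) (h0 : ∀ y, y ≠ 0 → 0 < G x₀ y y) :
    ∀ᶠ x in 𝓝 x₀, ∀ y, y ≠ 0 → 0 < G x y y := by
  obtain ⟨c, hc, hcG⟩ := exists_coercive h0
  have hlim : Filter.Tendsto (fun x => ‖G x - G x₀‖) (𝓝 x₀) (𝓝 0) :=
    (tendsto_iff_norm_sub_tendsto_zero (E := E →L[ℝ] E →L[ℝ] ℝ)).1 hG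
  filter_upwards [hlim.eventually (gt_mem_nhds hc)] with x hx y hy
  have hn : 0 < ‖y‖ ^ 2 := pow_pos (norm_pos_iff.2 hy) 2
  have h1 : |(G x - G x₀) y y| ≤ ‖G x - G x₀‖ * ‖y‖ * ‖y‖ := (G x - G x₀).le_opNorm₂ y y
  have h2 : ‖G x - G x₀‖ * ‖y‖ * ‖y‖ < c * ‖y‖ ^ 2 := by
    rw [mul_assoc, ← sq]; gcongr
  have h3 : G x y y = G x₀ y y + (G x - G x₀) y y := by simp
  have := neg_le_of_abs_le h1
  linarith [hcG y]

theorem IsInner.isInvertible {g : E →L[ℝ] E →L[ℝ] ℝ} (hg : IsInner g) : g.IsInvertible := by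
  have hinj : Injective (g : E →ₗ[ℝ] E →L[ℝ] ℝ) := by
    intro x y hxy
    exact hg.ext fun z => DFunLike.congr_fun hxy z
  have hdim : Module.finrank ℝ E = Module.finrank ℝ (E →L[ℝ] ℝ) := by
    rw [← (LinearMap.toContinuousLinearMap (𝕜 := ℝ) (E := E) (F' := ℝ)).finrank_eq]
    exact (Subspace.dual_finrank_eq (K := ℝ) (V := E)).symm
  exact ⟨(LinearEquiv.ofInjectiveOfFinrankEq (g : E →ₗ[ℝ] E →L[ℝ] ℝ) hinj hdim).toContinuousLinearEquiv,
    by ext; rfl⟩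

omit [FiniteDimensional ℝ E] in
theorem apply_inverse_apply {F : Type*} [NormedAddCommGroup F] [NormedSpace ℝ F] {L : E →L[ℝ] F}
    (hL : L.IsInvertible) (y : F) : L (L.inverse y) = y := by
  obtain ⟨e, rfl⟩ := hL
  simp

omit [FiniteDimensional ℝ E] in
theorem inverse_apply_apply {F : Type*} [NormedAddCommGroup F] [NormedSpace ℝ F] {L : E →L[ℝ] F}
    (hL : L.IsInvertible) (x : E) : L.inverse (L x) = x := by
  obtain ⟨e, rfl⟩ := hL
  simp

theorem contDiffAt_inverse {F : Type*} [NormedAddCommGroup F] [NormedSpace ℝ F] {L : E →L[ℝ] F}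
    (hL : L.IsInvertible) {n : WithTop ℕ∞} :
    ContDiffAt ℝ n (ContinuousLinearMap.inverse : (E →L[ℝ] F) → F →L[ℝ] E) L := by
  have : CompleteSpace E := FiniteDimensional.complete ℝ E
  obtain ⟨e, rfl⟩ := hL
  exact contDiffAt_map_inverse e

/-- The positive square root is locally a smooth function of the operator, independent of the
inner product: it is the local inverse of the squaring map. Symmetry of this local inverse
follows from its uniqueness, applied to the adjoint. -/
theorem exists_contDiffAt_posSqrt {M : Type*} [TopologicalSpace M] {g : M → E →L[ℝ] E →L[ℝ] ℝ}
    {B : M → E →L[ℝ] E} {x₀ : M} (hgc : ContinuousAt g x₀) (hBc : ContinuousAt B x₀)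
    (hg : ∀ᶠ x in 𝓝 x₀, IsInner (g x)) (hB : ∀ᶠ x in 𝓝 x₀, IsPosOp (g x) (B x)) :
    ∃ S : (E →L[ℝ] E) → (E →L[ℝ] E), ContDiffAt ℝ ∞ S (B x₀) ∧
      ∀ᶠ x in 𝓝 x₀, posSqrt (g x) (B x) = S (B x) := by
  have hg0 := hg.self_of_nhds
  have hB0 := hB.self_of_nhds
  obtain ⟨hP0, hPP0⟩ := posSqrt_spec hg0 hB0
  set P₀ := posSqrt (g x₀) (B x₀) with hP₀def
  let sq : (E →L[ℝ] E) → (E →L[ℝ] E) := fun P => P.comp P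
  have hsq : ContDiff ℝ ∞ sq := contDiff_id.clm_comp contDiff_id
  -- The derivative `H ↦ P₀ H + H P₀` of the squaring map is injective by Sylvester's equation.
  let D₀ : (E →L[ℝ] E) →ₗ[ℝ] (E →L[ℝ] E) :=
    { toFun := fun H => P₀.comp H + H.comp P₀
      map_add' := fun H H' => by ext; simp; abel
      map_smul' := fun a H => by ext; simp }
  have hD₀ : Injective D₀ := by
    refine (injective_iff_map_eq_zero D₀).2 fun H hH => ?_
    refine sylvester_unique hg0 hP0 hP0 fun x => ?_
    have : P₀ (H x) + H (P₀ x) = 0 := DFunLike.congr_fun hH x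
    exact eq_neg_of_add_eq_zero_left this
  let D : (E →L[ℝ] E) ≃L[ℝ] (E →L[ℝ] E) :=
    (LinearEquiv.ofInjectiveEndo D₀ hD₀).toContinuousLinearEquiv
  have hD : HasFDerivAt sq (D : (E →L[ℝ] E) →L[ℝ] (E →L[ℝ] E)) P₀ := by
    have h1 := (hasFDerivAt_id (𝕜 := ℝ) P₀).clm_comp (hasFDerivAt_id (𝕜 := ℝ) P₀)
    refine h1.congr_fderiv ?_
    ext H x
    simp only [add_apply, ContinuousLinearMap.comp_apply]
    rfl
  have : CompleteSpace (E →L[ℝ] E) := FiniteDimensional.complete ℝ _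
  let S := hsq.contDiffAt.localInverse hD (by simp)
  have hS : ContDiffAt ℝ ∞ S (sq P₀) := hsq.contDiffAt.to_localInverse hD (by simp)
  have hstrict : HasStrictFDerivAt sq (D : (E →L[ℝ] E) →L[ℝ] (E →L[ℝ] E)) P₀ :=
    hsq.contDiffAt.hasStrictFDerivAt' hD (by simp)
  have hsqP₀ : sq P₀ = B x₀ := hPP0
  rw [hsqP₀] at hS
  have hSB0 : S (B x₀) = P₀ := by
    rw [← hsqP₀]; exact hsq.contDiffAt.localInverse_apply_image hD (by simp)
  have hleft : ∀ᶠ P in 𝓝 P₀, S (sq P) = P := hstrict.eventually_left_inverse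
  have hright : ∀ᶠ B' in 𝓝 (B x₀), sq (S B') = B' := by
    rw [← hsqP₀]; exact hstrict.eventually_right_inverse
  have hSBc : ContinuousAt (fun x => S (B x)) x₀ := ContinuousAt.comp hS.continuousAt hBc
  -- The adjoint with respect to `g x`.
  let adj : M → (E →L[ℝ] E) → (E →L[ℝ] E) := fun x H =>
    (g x).inverse.comp (((ContinuousLinearMap.compL ℝ E E ℝ).flip H).comp (g x))
  have hadj : ∀ x, IsInner (g x) → ∀ H y z, g x (adj x H y) z = g x y (H z) := by
    intro x hx H y z
    change g x ((g x).inverse _) z = _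
    rw [apply_inverse_apply hx.isInvertible]
    rfl
  have hadjc : ContinuousAt (fun x => adj x (S (B x))) x₀ := by
    have h1 : ContinuousAt (fun x => (g x).inverse) x₀ :=
      ContinuousAt.comp (contDiffAt_inverse (n := 0) hg0.isInvertible).continuousAt hgc
    exact h1.clm_comp ((((ContinuousLinearMap.compL ℝ E E ℝ).flip.continuous.continuousAt).comp
      hSBc).clm_comp hgc)
  have hadj0 : adj x₀ (S (B x₀)) = P₀ := by
    ext y
    refine hg0.ext fun z => ?_
    rw [hadj x₀ hg0, hSB0, hP0.symm]
  refine ⟨S, hS, ?_⟩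
  have hposc : ContinuousAt (fun x => (g x).comp (S (B x))) x₀ := hgc.clm_comp hSBc
  have hpos := eventually_pos_def hposc (by
    intro y hy
    have := hP0.pos y hy
    rwa [← hSB0] at this)
  have hleft' : ∀ᶠ x in 𝓝 x₀, S (sq (adj x (S (B x)))) = adj x (S (B x)) := by
    have h1 : Filter.Tendsto (fun x => adj x (S (B x))) (𝓝 x₀) (𝓝 P₀) := hadj0 ▸ hadjc
    exact h1.eventually hleft
  filter_upwards [hg, hB, hBc.eventually hright, hleft', hpos] with x hgx hBx hr hl hp
  -- The adjoint of `S (B x)` is a square root of `B x` near `P₀` as well, so it equals `S (B x)`.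
  have h1 : sq (adj x (S (B x))) = B x := by
    ext y
    refine hgx.ext fun z => ?_
    change g x (adj x _ (adj x _ y)) z = _
    rw [hadj x hgx, hadj x hgx, hBx.symm]
    exact congrArg (g x y) (DFunLike.congr_fun hr z)
  rw [h1] at hl
  obtain ⟨h2, h3⟩ := posSqrt_spec hgx hBx
  refine h2.eq_of_sq_eq hgx ⟨fun y z => ?_, hp⟩ (h3.trans hr.symm)
  conv_lhs => rw [hl]
  exact hadj x hgx _ y z

end SquareRoot

/-! ### The quaternionic reduction of a complex contact vector space -/

section Datum

variable {E : Type*} [NormedAddCommGroup E] [NormedSpace ℂ E]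

/-- The real part of a complex bilinear form. -/
def reBilin (ψ : E →L[ℝ] E →L[ℝ] ℂ) : E →L[ℝ] E →L[ℝ] ℝ :=
  (ContinuousLinearMap.compL ℝ E ℂ ℝ Complex.reCLM).comp ψ

/-- The tensor product `a ⊗ b` of two complex linear forms. -/
def outer (a b : E →L[ℝ] ℂ) : E →L[ℝ] E →L[ℝ] ℂ :=
  ((ContinuousLinearMap.compL ℝ E ℂ ℂ).flip b).comp ((ContinuousLinearMap.mul ℝ ℂ).comp a)

/-- The pullback of a bilinear form under an endomorphism. -/
def pullBilin (g : E →L[ℝ] E →L[ℝ] ℝ) (p : E →L[ℝ] E) : E →L[ℝ] E →L[ℝ] ℝ :=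
  ((ContinuousLinearMap.compL ℝ E E ℝ).flip p).comp (g.comp p)

/-- The endomorphism `x ↦ θ(x) v`. -/
def vertPart (θ : E →L[ℝ] ℂ) (v : E) : E →L[ℝ] E :=
  ((ContinuousLinearMap.lsmul ℝ ℂ).flip v).comp θ

@[simp] theorem reBilin_apply (ψ : E →L[ℝ] E →L[ℝ] ℂ) (x y : E) :
    reBilin ψ x y = (ψ x y).re := rfl

@[simp] theorem outer_apply (a b : E →L[ℝ] ℂ) (x y : E) : outer a b x y = a x * b y := rfl

@[simp] theorem pullBilin_apply (g : E →L[ℝ] E →L[ℝ] ℝ) (p : E →L[ℝ] E) (x y : E) :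
    pullBilin g p x y = g (p x) (p y) := rfl

@[simp] theorem vertPart_apply (θ : E →L[ℝ] ℂ) (v x : E) : vertPart θ v x = θ x • v := rfl

/-- The linear algebra underlying a complex contact structure at a point: a Hermitian inner
product `g₀`, a contact form `θ`, a complex alternating form `ψ` which is nondegenerate on
`ker θ`, and the length `r` of the fibre coordinate. -/
structure IsDatum (g₀ : E →L[ℝ] E →L[ℝ] ℝ) (θ : E →L[ℝ] ℂ) (ψ : E →L[ℝ] E →L[ℝ] ℂ) (r : ℝ) :
    Prop where
  inner : IsInner g₀
  inner_I : ∀ x y, g₀ (Complex.I • x) (Complex.I • y) = g₀ x y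
  θ_I : ∀ x, θ (Complex.I • x) = Complex.I * θ x
  alt : ∀ x y, ψ x y = -ψ y x
  ψ_I : ∀ x y, ψ (Complex.I • x) y = Complex.I * ψ x y
  nondegenerate : ∀ x, θ x = 0 → (∀ y, θ y = 0 → ψ x y = 0) → x = 0
  exists_ne : ∃ x, θ x ≠ 0
  r_pos : 0 < r

/-- The form `Re(ψ + θ ⊗ θ)`. It is nondegenerate, and `Re θ` is its contraction with the complex
Reeb vector, which is thereby a smooth function of `θ` and `ψ`. -/
def reebForm (θ : E →L[ℝ] ℂ) (ψ : E →L[ℝ] E →L[ℝ] ℂ) : E →L[ℝ] E →L[ℝ] ℝ :=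
  reBilin (ψ + outer θ θ)

/-- The complex Reeb vector `v`, for which `θ(v) = 1` and `ψ(v, ·) = 0`. -/
def reeb (θ : E →L[ℝ] ℂ) (ψ : E →L[ℝ] E →L[ℝ] ℂ) : E :=
  (reebForm θ ψ).inverse (Complex.reCLM.comp θ)

/-- The Hermitian inner product `r² Re(θ̄ θ) + g₀(p ·, p ·)`, where `p` is the projection
to `ker θ` along the Reeb vector `v`. -/
def adaptedInner (g₀ : E →L[ℝ] E →L[ℝ] ℝ) (θ : E →L[ℝ] ℂ) (v : E) (r : ℝ) :
    E →L[ℝ] E →L[ℝ] ℝ :=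
  (r ^ 2) • reBilin (outer ((Complex.conjCLE : ℂ →L[ℝ] ℂ).comp θ) θ) +
    pullBilin g₀ (ContinuousLinearMap.id ℝ E - vertPart θ v)

/-- The antilinear operator `A` with `g(A x, y) = r Re ψ(x, y)`. -/
def skewOp (g : E →L[ℝ] E →L[ℝ] ℝ) (ψ : E →L[ℝ] E →L[ℝ] ℂ) (r : ℝ) : E →L[ℝ] E :=
  g.inverse.comp (r • reBilin ψ)

/-- The positive operator `-A² + θ(·) v`. The second summand makes it invertible, since `A v = 0`. -/
def sqOp (A : E →L[ℝ] E) (θ : E →L[ℝ] ℂ) (v : E) : E →L[ℝ] E := vertPart θ v - A.comp A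

namespace IsDatum

variable [FiniteDimensional ℂ E] {g₀ : E →L[ℝ] E →L[ℝ] ℝ} {θ : E →L[ℝ] ℂ}
  {ψ : E →L[ℝ] E →L[ℝ] ℂ} {r : ℝ} (D : IsDatum g₀ θ ψ r)

include D

omit [FiniteDimensional ℂ E] in
theorem θ_smul (a : ℂ) (x : E) : θ (a • x) = a * θ x := by
  have h : a • x = a.re • x + a.im • (Complex.I • x) := by
    conv_lhs => rw [← Complex.re_add_im a, add_smul, mul_smul]
    rfl
  rw [h, map_add, map_smul, map_smul, D.θ_I]
  conv_rhs => rw [← Complex.re_add_im a]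
  simp only [Complex.real_smul]; ring

omit [FiniteDimensional ℂ E] in
theorem ψ_smul_left (a : ℂ) (x y : E) : ψ (a • x) y = a * ψ x y := by
  have h : a • x = a.re • x + a.im • (Complex.I • x) := by
    conv_lhs => rw [← Complex.re_add_im a, add_smul, mul_smul]
    rfl
  rw [h, map_add, map_smul, map_smul, add_apply, smul_apply, smul_apply, D.ψ_I]
  conv_rhs => rw [← Complex.re_add_im a]
  simp only [Complex.real_smul]; ring

omit [FiniteDimensional ℂ E] in
theorem ψ_smul_right (a : ℂ) (x y : E) : ψ x (a • y) = a * ψ x y := by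
  rw [D.alt, D.ψ_smul_left, D.alt y]; ring

omit [FiniteDimensional ℂ E] in
theorem ψ_self (x : E) : ψ x x = 0 := by
  have := D.alt x x
  exact self_eq_neg.1 this

theorem reebForm_isInvertible : (reebForm θ ψ).IsInvertible := by
  have hinj : Injective (reebForm θ ψ : E →ₗ[ℝ] E →L[ℝ] ℝ) := by
    refine (injective_iff_map_eq_zero _).2 fun x hx => ?_
    have h1 : ∀ y, (ψ x y + θ x * θ y).re = 0 := fun y => DFunLike.congr_fun hx y
    have h2 : ∀ y, ψ x y + θ x * θ y = 0 := by
      intro y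
      have h3 := h1 (Complex.I • y)
      rw [D.ψ_smul_right, D.θ_I] at h3
      apply Complex.ext (h1 y)
      rw [show Complex.I * ψ x y + θ x * (Complex.I * θ y) = Complex.I * (ψ x y + θ x * θ y) by
        ring, Complex.I_mul_re] at h3
      exact neg_eq_zero.1 h3
    have h4 : θ x = 0 := by
      have := h2 x
      rw [D.ψ_self, zero_add] at this
      exact mul_self_eq_zero.1 this
    exact D.nondegenerate x h4 fun y _ => by simpa [h4] using h2 y
  have hdim : Module.finrank ℝ E = Module.finrank ℝ (E →L[ℝ] ℝ) := by
    rw [← (LinearMap.toContinuousLinearMap (𝕜 := ℝ) (E := E) (F' := ℝ)).finrank_eq]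
    exact (Subspace.dual_finrank_eq (K := ℝ) (V := E)).symm
  exact ⟨(LinearEquiv.ofInjectiveOfFinrankEq (reebForm θ ψ : E →ₗ[ℝ] E →L[ℝ] ℝ) hinj
    hdim).toContinuousLinearEquiv, by ext; rfl⟩

theorem reeb_spec : θ (reeb θ ψ) = 1 ∧ ∀ y, ψ (reeb θ ψ) y = 0 := by
  set v := reeb θ ψ with hv
  have h0 : reebForm θ ψ v = Complex.reCLM.comp θ :=
    apply_inverse_apply D.reebForm_isInvertible _
  have h1 : ∀ y, (ψ v y + θ v * θ y).re = (θ y).re := fun y => DFunLike.congr_fun h0 y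
  have h2 : ∀ y, ψ v y + θ v * θ y = θ y := by
    intro y
    have h3 := h1 (Complex.I • y)
    rw [D.ψ_smul_right, D.θ_I] at h3
    apply Complex.ext (h1 y)
    rw [show Complex.I * ψ v y + θ v * (Complex.I * θ y) = Complex.I * (ψ v y + θ v * θ y) by
      ring, Complex.I_mul_re, Complex.I_mul_re] at h3
    exact neg_injective h3
  have h3 : θ v = 1 := by
    have h4 := h2 v
    rw [D.ψ_self, zero_add] at h4
    rcases eq_or_ne (θ v) 0 with h5 | h5
    · have h6 : v = 0 := D.nondegenerate v h5 fun y hy => by simpa [hy] using h2 y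
      obtain ⟨x, hx⟩ := D.exists_ne
      have h7 := h2 x
      rw [h6] at h7
      simp at h7
      exact absurd h7.symm hx
    · exact mul_right_cancel₀ h5 (by rw [h4, one_mul])
  refine ⟨h3, fun y => ?_⟩
  have := h2 y
  rw [h3, one_mul] at this
  simpa using this

omit [FiniteDimensional ℂ E] in
theorem reeb_unique {v w : E} (hv : θ v = 1) (hv' : ∀ y, ψ v y = 0) (hw : θ w = 1)
    (hw' : ∀ y, ψ w y = 0) : v = w := by
  rw [← sub_eq_zero]
  exact D.nondegenerate _ (by simp [hv, hw]) fun y _ => by simp [hv', hw']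

omit [FiniteDimensional ℂ E] D in
theorem adaptedInner_apply (v x y : E) : adaptedInner g₀ θ v r x y =
    r ^ 2 * ((starRingEnd ℂ (θ x)) * θ y).re + g₀ (x - θ x • v) (y - θ y • v) := rfl

section

set_option linter.unusedSectionVars false

variable {v : E} (hv : θ v = 1) (hv' : ∀ y, ψ v y = 0)

include hv

omit [FiniteDimensional ℂ E] in
theorem isInner_adapted : IsInner (adaptedInner g₀ θ v r) where
  symm x y := by
    rw [adaptedInner_apply, adaptedInner_apply, D.inner.symm]
    congr 2
    simp only [Complex.mul_re, Complex.conj_re, Complex.conj_im]; ring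
  pos x hx := by
    have hr : 0 < r ^ 2 := pow_pos D.r_pos 2
    rw [adaptedInner_apply]
    have h1 : ((starRingEnd ℂ (θ x)) * θ x).re = Complex.normSq (θ x) := by
      rw [mul_comm, Complex.mul_conj, Complex.ofReal_re]
    rw [h1]
    by_cases h : θ x = 0
    · have := D.inner.pos x hx
      simpa [h] using this
    · exact add_pos_of_pos_of_nonneg (mul_pos hr (Complex.normSq_pos.2 h)) (D.inner.self_nonneg _)

omit [FiniteDimensional ℂ E] hv in
theorem adapted_I (x y : E) : adaptedInner g₀ θ v r (Complex.I • x) (Complex.I • y) =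
    adaptedInner g₀ θ v r x y := by
  rw [adaptedInner_apply, adaptedInner_apply, D.θ_I, D.θ_I, mul_smul, mul_smul, ← smul_sub,
    ← smul_sub, D.inner_I]
  congr 2
  simp only [map_mul, Complex.conj_I]
  rw [show -Complex.I * (starRingEnd ℂ) (θ x) * (Complex.I * θ y) =
    -(Complex.I * Complex.I) * ((starRingEnd ℂ) (θ x) * θ y) by ring, Complex.I_mul_I]
  ring_nf

omit [FiniteDimensional ℂ E] in
theorem adapted_smul_reeb (x : E) (a : ℂ) : adaptedInner g₀ θ v r (a • v) x =
    r ^ 2 * (starRingEnd ℂ a * θ x).re := by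
  rw [adaptedInner_apply, D.θ_smul, hv, mul_one, sub_self]
  simp

theorem skewOp_apply (x y : E) :
    adaptedInner g₀ θ v r (skewOp (adaptedInner g₀ θ v r) ψ r x) y = r * (ψ x y).re :=
  DFunLike.congr_fun (apply_inverse_apply (D.isInner_adapted hv).isInvertible
    ((r • reBilin ψ) x)) y

theorem skewOp_I (x : E) : skewOp (adaptedInner g₀ θ v r) ψ r (Complex.I • x) =
    -(Complex.I • skewOp (adaptedInner g₀ θ v r) ψ r x) := by
  refine (D.isInner_adapted hv).ext fun y => ?_
  have h : y = -(Complex.I • Complex.I • y) := by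
    rw [smul_smul, Complex.I_mul_I, neg_one_smul, neg_neg]
  rw [D.skewOp_apply hv, D.ψ_smul_left]
  conv_rhs => rw [h]
  have hneg : ∀ a b : E, adaptedInner g₀ θ v r (-a) (-b) = adaptedInner g₀ θ v r a b := by
    intro a b
    rw [(adaptedInner g₀ θ v r).map_neg, neg_apply,
      (adaptedInner g₀ θ v r a).map_neg, neg_neg]
  rw [hneg, D.adapted_I, D.skewOp_apply hv, D.ψ_smul_right]

theorem skewOp_skew (x y : E) :
    adaptedInner g₀ θ v r (skewOp (adaptedInner g₀ θ v r) ψ r x) y =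
      -adaptedInner g₀ θ v r x (skewOp (adaptedInner g₀ θ v r) ψ r y) := by
  rw [(D.isInner_adapted hv).symm x, D.skewOp_apply hv, D.skewOp_apply hv, D.alt]
  simp

include hv'

theorem skewOp_reeb (a : ℂ) : skewOp (adaptedInner g₀ θ v r) ψ r (a • v) = 0 := by
  refine (D.isInner_adapted hv).ext fun y => ?_
  rw [D.skewOp_apply hv, D.ψ_smul_left, hv']
  simp

theorem θ_skewOp (x : E) : θ (skewOp (adaptedInner g₀ θ v r) ψ r x) = 0 := by
  have hr : r ^ 2 ≠ 0 := (pow_pos D.r_pos 2).ne'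
  have h : ∀ a : ℂ, (starRingEnd ℂ a * θ (skewOp (adaptedInner g₀ θ v r) ψ r x)).re = 0 := by
    intro a
    have h1 := D.adapted_smul_reeb hv (skewOp (adaptedInner g₀ θ v r) ψ r x) a
    rw [(D.isInner_adapted hv).symm, D.skewOp_skew hv, D.skewOp_reeb hv hv', map_zero,
      neg_zero] at h1
    exact (mul_eq_zero.1 h1.symm).resolve_left hr
  apply Complex.ext
  · simpa using h 1
  · simpa using h Complex.I

theorem sqOp_apply (x y : E) : adaptedInner g₀ θ v r
      (sqOp (skewOp (adaptedInner g₀ θ v r) ψ r) θ v x) y =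
    r ^ 2 * (starRingEnd ℂ (θ x) * θ y).re +
      adaptedInner g₀ θ v r (skewOp (adaptedInner g₀ θ v r) ψ r x)
        (skewOp (adaptedInner g₀ θ v r) ψ r y) := by
  rw [sqOp, sub_apply, vertPart_apply, map_sub, sub_apply, D.adapted_smul_reeb hv]
  rw [ContinuousLinearMap.comp_apply, D.skewOp_skew hv]
  ring

theorem isPosOp_sqOp : IsPosOp (adaptedInner g₀ θ v r)
    (sqOp (skewOp (adaptedInner g₀ θ v r) ψ r) θ v) where
  symm x y := by
    have hs := (D.isInner_adapted hv).symm
    rw [hs x, D.sqOp_apply hv hv', D.sqOp_apply hv hv', hs (skewOp _ _ _ x)]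
    congr 2
    simp only [Complex.mul_re, Complex.conj_re, Complex.conj_im]; ring
  pos x hx := by
    have hr : 0 < r ^ 2 := pow_pos D.r_pos 2
    have hg := D.isInner_adapted hv
    rw [D.sqOp_apply hv hv', mul_comm (starRingEnd ℂ (θ x)), Complex.mul_conj, Complex.ofReal_re]
    by_cases h : θ x = 0
    · refine add_pos_of_nonneg_of_pos (mul_nonneg hr.le (Complex.normSq_nonneg _)) (hg.pos _ ?_)
      intro hA
      refine hx (D.nondegenerate x h fun y _ => ?_)
      have h1 : ∀ y, (ψ x y).re = 0 := by
        intro y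
        have := D.skewOp_apply hv x y
        rw [hA, map_zero, zero_apply] at this
        exact (mul_eq_zero.1 this.symm).resolve_left D.r_pos.ne'
      apply Complex.ext (h1 y)
      have h2 := h1 (Complex.I • y)
      rw [D.ψ_smul_right, Complex.I_mul_re] at h2
      simpa using h2
    · exact add_pos_of_pos_of_nonneg (mul_pos hr (Complex.normSq_pos.2 h)) (hg.self_nonneg _)

theorem sqOp_I (x : E) : sqOp (skewOp (adaptedInner g₀ θ v r) ψ r) θ v (Complex.I • x) =
    Complex.I • sqOp (skewOp (adaptedInner g₀ θ v r) ψ r) θ v x := by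
  simp only [sqOp, sub_apply, vertPart_apply, ContinuousLinearMap.comp_apply]
  rw [D.skewOp_I hv, map_neg, D.skewOp_I hv, D.θ_I, mul_smul, neg_neg, smul_sub]

end

/-- The positive operator `P` with `P² = -A² + θ(·) v` commutes with the complex structure and
with `A`, and it fixes the Reeb vector. -/
theorem posSqrt_props {v : E} (hv : θ v = 1) (hv' : ∀ y, ψ v y = 0) {P A : E →L[ℝ] E}
    (hAdef : A = skewOp (adaptedInner g₀ θ v r) ψ r)
    (hP : IsPosOp (adaptedInner g₀ θ v r) P) (hPP : P.comp P = sqOp A θ v) :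
    (∀ x, P (Complex.I • x) = Complex.I • P x) ∧ (∀ x, P (A x) = A (P x)) ∧
      ∀ a : ℂ, P (a • v) = a • v := by
  have hg := D.isInner_adapted hv
  have hPP' : ∀ x, P (P x) = sqOp A θ v x := fun x => DFunLike.congr_fun hPP x
  have hθA : ∀ x, θ (A x) = 0 := fun x => hAdef ▸ D.θ_skewOp hv hv' x
  have hAv : ∀ a : ℂ, A (a • v) = 0 := fun a => hAdef ▸ D.skewOp_reeb hv hv' a
  have hI : ∀ x, P (Complex.I • x) = Complex.I • P x := by
    let J : E →L[ℝ] E := (Complex.I • ContinuousLinearMap.id ℂ E).restrictScalars ℝ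
    have h : P.comp J - J.comp P = 0 := by
      refine sylvester_unique hg hP hP fun x => ?_
      change P (P (Complex.I • x) - Complex.I • P x) =
        -(P (Complex.I • P x) - Complex.I • P (P x))
      rw [map_sub, hPP', hPP', hAdef, D.sqOp_I hv hv']
      abel
    intro x
    exact sub_eq_zero.1 (DFunLike.congr_fun h x)
  have hA : ∀ x, P (A x) = A (P x) := by
    have h : P.comp A - A.comp P = 0 := by
      refine sylvester_unique hg hP hP fun x => ?_
      change P (P (A x) - A (P x)) = -(P (A (P x)) - A (P (P x)))
      rw [map_sub, hPP', hPP']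
      simp only [sqOp, sub_apply, vertPart_apply, ContinuousLinearMap.comp_apply, map_sub, hθA,
        zero_smul, hAv]
      abel
    intro x
    exact sub_eq_zero.1 (DFunLike.congr_fun h x)
  refine ⟨hI, hA, ?_⟩
  -- `P² v = v`, so `P v - v` would be an eigenvector of the positive operator `P` for `-1`.
  have hPv : P v = v := by
    have h1 : P (P v) = v := by
      rw [hPP', sqOp, sub_apply, vertPart_apply, hv, one_smul, ContinuousLinearMap.comp_apply]
      have := hAv 1
      rw [one_smul] at this
      rw [this, map_zero, sub_zero]
    by_contra hne
    have h2 := hP.pos _ (sub_ne_zero.2 hne)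
    have h3 : P (P v - v) = -(P v - v) := by rw [map_sub, h1]; abel
    rw [h3, map_neg, neg_apply] at h2
    have h4 := hg.self_nonneg (P v - v)
    linarith
  intro a
  have h : a • v = a.re • v + a.im • (Complex.I • v) := by
    conv_lhs => rw [← Complex.re_add_im a, add_smul, mul_smul]
    rfl
  rw [h, map_add, map_smul, map_smul, hI, hPv]

end IsDatum

/-- The adapted metric `g(P ·, ·)`, where `g` is `adaptedInner`, and `P` is the positive square root
of `-A² + θ(·) v` for the operator `A` of `skewOp`. Passing from `g` to `g(P ·, ·)` replaces `A` by
the factor `K` of its polar decomposition `A = P K`. -/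
def hkMetric (g₀ : E →L[ℝ] E →L[ℝ] ℝ) (θ : E →L[ℝ] ℂ) (ψ : E →L[ℝ] E →L[ℝ] ℂ) (r : ℝ) :
    E →L[ℝ] E →L[ℝ] ℝ :=
  let g := adaptedInner g₀ θ (reeb θ ψ) r
  g.comp (posSqrt g (sqOp (skewOp g ψ r) θ (reeb θ ψ)))

/-- The antilinear operator `K = P⁻¹ A`, with `K² = -1` on `ker θ` and `K v = 0`. -/
def hkOp (g₀ : E →L[ℝ] E →L[ℝ] ℝ) (θ : E →L[ℝ] ℂ) (ψ : E →L[ℝ] E →L[ℝ] ℂ) (r : ℝ) : E →L[ℝ] E :=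
  let g := adaptedInner g₀ θ (reeb θ ψ) r
  (posSqrt g (sqOp (skewOp g ψ r) θ (reeb θ ψ))).inverse.comp (skewOp g ψ r)

/-- The algebraic properties of a metric `g`, an operator `K` and a vector `v` adapted to a
contact form `θ` and a complex two-form `ψ`. -/
structure IsAdapted (θ : E →L[ℝ] ℂ) (ψ : E →L[ℝ] E →L[ℝ] ℂ) (r : ℝ) (g : E →L[ℝ] E →L[ℝ] ℝ)
    (K : E →L[ℝ] E) (v : E) : Prop where
  inner : IsInner g
  inner_I : ∀ x y, g (Complex.I • x) (Complex.I • y) = g x y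
  θ_reeb : θ v = 1
  ψ_reeb : ∀ y, ψ v y = 0
  inner_reeb : ∀ (a : ℂ) x, g (a • v) x = r ^ 2 * (starRingEnd ℂ a * θ x).re
  inner_K : ∀ x y, g (K x) y = r * (ψ x y).re
  K_K : ∀ x, K (K x) = -x + θ x • v
  K_I : ∀ x, K (Complex.I • x) = -(Complex.I • K x)
  K_reeb : ∀ a : ℂ, K (a • v) = 0
  θ_K : ∀ x, θ (K x) = 0

theorem IsPosOp.isInvertible [FiniteDimensional ℂ E] {g : E →L[ℝ] E →L[ℝ] ℝ} {P : E →L[ℝ] E}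
    (hP : IsPosOp g P) : P.IsInvertible :=
  ⟨(LinearEquiv.ofInjectiveEndo (P : E →ₗ[ℝ] E) hP.injective).toContinuousLinearEquiv,
    by ext; rfl⟩

theorem IsDatum.isAdapted [FiniteDimensional ℂ E] {g₀ : E →L[ℝ] E →L[ℝ] ℝ} {θ : E →L[ℝ] ℂ}
    {ψ : E →L[ℝ] E →L[ℝ] ℂ} {r : ℝ} (D : IsDatum g₀ θ ψ r) :
    IsAdapted θ ψ r (hkMetric g₀ θ ψ r) (hkOp g₀ θ ψ r) (reeb θ ψ) := by
  obtain ⟨hv, hv'⟩ := D.reeb_spec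
  set v := reeb θ ψ with hvdef
  set g := adaptedInner g₀ θ v r with hgdef
  set A := skewOp g ψ r with hAdef
  obtain ⟨hP, hPP⟩ := posSqrt_spec (D.isInner_adapted hv) (D.isPosOp_sqOp hv hv')
  rw [← hgdef, ← hAdef] at hP hPP
  set P := posSqrt g (sqOp A θ v) with hPdef
  have hG : hkMetric g₀ θ ψ r = g.comp P := rfl
  have hK : hkOp g₀ θ ψ r = P.inverse.comp A := rfl
  have hg := D.isInner_adapted hv (r := r)
  rw [← hgdef] at hg
  have hPinv := hP.isInvertible
  -- `P` commutes with `i` and with `A`; hence `K² = P⁻² A² = -1 + θ(·) v`.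
  obtain ⟨hPI, hPA, hPv⟩ := D.posSqrt_props hv hv' hAdef hP hPP
  have hθA : ∀ x, θ (A x) = 0 := D.θ_skewOp hv hv'
  have hAv : ∀ a : ℂ, A (a • v) = 0 := D.skewOp_reeb hv hv'
  have hPK : ∀ x, P (hkOp g₀ θ ψ r x) = A x := fun x => by
    rw [hK]; exact apply_inverse_apply hPinv _
  have hPinj := hP.injective
  have hAK : ∀ x, P (A (hkOp g₀ θ ψ r x)) = A (A x) := fun x => by rw [hPA, hPK]
  have hPP' : ∀ x, P (P x) = sqOp A θ v x := fun x => DFunLike.congr_fun hPP x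
  have hreeb : ∀ (a : ℂ) x, g.comp P (a • v) x = r ^ 2 * (starRingEnd ℂ a * θ x).re := by
    intro a x
    rw [ContinuousLinearMap.comp_apply, hPv]
    exact D.adapted_smul_reeb hv x a
  have hKv : ∀ a : ℂ, hkOp g₀ θ ψ r (a • v) = 0 := fun a =>
    hPinj (by rw [hPK, hAv, map_zero])
  refine ⟨⟨fun x y => ?_, hP.pos⟩, fun x y => ?_, hv, hv', hG ▸ hreeb, fun x y => ?_, fun x => ?_,
    fun x => ?_, hKv, fun x => ?_⟩
  · rw [hG, ContinuousLinearMap.comp_apply, ContinuousLinearMap.comp_apply, hP.symm, hg.symm]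
  · rw [hG, ContinuousLinearMap.comp_apply, ContinuousLinearMap.comp_apply, hPI]
    exact D.adapted_I _ _
  · rw [hG, ContinuousLinearMap.comp_apply, hPK]
    exact D.skewOp_apply hv x y
  · apply hPinj
    apply hPinj
    rw [hPK, hAK, map_add, map_add, hPv, hPv, map_neg, map_neg, hPP', sqOp, sub_apply,
      vertPart_apply, ContinuousLinearMap.comp_apply]
    abel
  · apply hPinj
    rw [hPK, map_neg, hPI, hPK]
    exact D.skewOp_I hv x
  · have hr : r ^ 2 ≠ 0 := (pow_pos D.r_pos 2).ne'
    have h : ∀ a : ℂ, (starRingEnd ℂ a * θ (hkOp g₀ θ ψ r x)).re = 0 := by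
      intro a
      have h1 := hreeb a (hkOp g₀ θ ψ r x)
      have h2 : g.comp P (a • v) (hkOp g₀ θ ψ r x) = 0 := by
        rw [ContinuousLinearMap.comp_apply, hP.symm, hPK, hg.symm, D.skewOp_skew hv]
        change -g x (A (a • v)) = 0
        rw [hAv, map_zero, neg_zero]
      rw [h2] at h1
      exact (mul_eq_zero.1 h1.symm).resolve_left hr
    apply Complex.ext
    · simpa using h 1
    · simpa using h Complex.I

/-- The adapted structure is natural under complex linear isomorphisms `T`, and under the
rescaling of the contact form by a complex number `f`. Only the phase `f / |f|` acts on `K`: this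
matches the change of the phase of the fibre coordinate on the circle bundle, so that the tensors
there are globally defined. -/
theorem IsDatum.transport [FiniteDimensional ℂ E] {g₀ g₀' : E →L[ℝ] E →L[ℝ] ℝ}
    {θ θ' : E →L[ℝ] ℂ} {ψ ψ' : E →L[ℝ] E →L[ℝ] ℂ} {r r' : ℝ} (D : IsDatum g₀ θ ψ r)
    (D' : IsDatum g₀' θ' ψ' r') (T : E ≃L[ℝ] E) (hT : ∀ x, T (Complex.I • x) = Complex.I • T x)
    {f : ℂ} (hf : f ≠ 0) (hg : ∀ x y, g₀' (T x) (T y) = g₀ x y) (hθ : ∀ x, θ' (T x) = f * θ x)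
    (hψ : ∀ x y, ψ' (T x) (T y) = f * ψ x y) (hr : r' * ‖f‖ = r) :
    T (reeb θ ψ) = f • reeb θ' ψ' ∧
      (∀ x y, hkMetric g₀' θ' ψ' r' (T x) (T y) = hkMetric g₀ θ ψ r x y) ∧
      ∀ x, hkOp g₀' θ' ψ' r' (T x) = T (hkOp g₀ θ ψ r ((f / ‖f‖) • x)) := by
  obtain ⟨hv, hv'⟩ := D.reeb_spec
  obtain ⟨hw, hw'⟩ := D'.reeb_spec
  have hTc : ∀ (a : ℂ) x, T (a • x) = a • T x := by
    intro a x
    have h : ∀ y : E, a • y = a.re • y + a.im • (Complex.I • y) := fun y => by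
      conv_lhs => rw [← Complex.re_add_im a, add_smul, mul_smul]
      rfl
    rw [h x, map_add, map_smul, map_smul, hT, ← h]
  have hreeb : reeb θ ψ = f • T.symm (reeb θ' ψ') := by
    have hsymm : T.symm (f • reeb θ' ψ') = f • T.symm (reeb θ' ψ') := by
      apply T.injective; rw [hTc]; simp
    refine D.reeb_unique hv hv' ?_ fun y => ?_
    · have h1 := hθ (T.symm (reeb θ' ψ'))
      rw [T.apply_symm_apply, hw] at h1
      rw [D.θ_smul]; exact h1.symm
    · have h1 := hψ (T.symm (reeb θ' ψ')) y
      rw [T.apply_symm_apply, hw'] at h1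
      rw [D.ψ_smul_left]; exact h1.symm
  have hTv : T (reeb θ ψ) = f • reeb θ' ψ' := by rw [hreeb, hTc, T.apply_symm_apply]
  refine ⟨hTv, ?_⟩
  set v := reeb θ ψ with hvdef
  set w := reeb θ' ψ' with hwdef
  have hg1 : ∀ x y, adaptedInner g₀' θ' w r' (T x) (T y) = adaptedInner g₀ θ v r x y := by
    intro x y
    have h1 : ∀ x, T x - θ' (T x) • w = T (x - θ x • v) := fun x => by
      rw [map_sub, hTc, hTv, hθ, smul_smul, mul_comm]
    rw [IsDatum.adaptedInner_apply, IsDatum.adaptedInner_apply, h1, h1, hg, hθ, hθ, ← hr]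
    congr 1
    rw [show (starRingEnd ℂ) (f * θ x) * (f * θ y) = (f * starRingEnd ℂ f) *
      (starRingEnd ℂ (θ x) * θ y) by rw [map_mul]; ring, Complex.mul_conj,
      Complex.re_ofReal_mul, Complex.normSq_eq_norm_sq]
    ring
  have hnf : (‖f‖ : ℂ) ≠ 0 := by exact_mod_cast norm_ne_zero_iff.2 hf
  set g := adaptedInner g₀ θ v r with hgdef
  set g' := adaptedInner g₀' θ' w r' with hgdef'
  have hgi : IsInner g := D.isInner_adapted hv
  have hgi' : IsInner g' := D'.isInner_adapted hw
  set A := skewOp g ψ r with hAdef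
  set A' := skewOp g' ψ' r' with hAdef'
  have hA : ∀ x, A' (T x) = T (A ((f / ‖f‖) • x)) := by
    intro x
    refine hgi'.ext fun y => ?_
    obtain ⟨y, rfl⟩ := T.surjective y
    rw [hg1, hAdef, hAdef', D'.skewOp_apply hw, D.skewOp_apply hv, hψ, D.ψ_smul_left, ← hr,
      show f / ‖f‖ * ψ x y = ((‖f‖⁻¹ : ℝ) : ℂ) * (f * ψ x y) by push_cast; field_simp,
      Complex.re_ofReal_mul]
    field_simp
  have hunit : (starRingEnd ℂ (f / ‖f‖)) * (f / ‖f‖) = 1 := by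
    rw [map_div₀, Complex.conj_ofReal, div_mul_div_comm, mul_comm, Complex.mul_conj,
      Complex.normSq_eq_norm_sq]
    push_cast
    field_simp
  have hAanti : ∀ (a : ℂ) x, A (a • x) = starRingEnd ℂ a • A x := by
    intro a x
    have h : ∀ (b : ℂ) (y : E), b • y = b.re • y + b.im • (Complex.I • y) := fun b y => by
      conv_lhs => rw [← Complex.re_add_im b, add_smul, mul_smul]
      rfl
    have hAI : A (Complex.I • x) = -(Complex.I • A x) := D.skewOp_I hv x
    rw [h a, h (starRingEnd ℂ a), map_add, map_smul, map_smul, hAI]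
    simp
  have hB : ∀ x, sqOp A' θ' w (T x) = T (sqOp A θ v x) := by
    intro x
    simp only [sqOp, sub_apply, vertPart_apply, ContinuousLinearMap.comp_apply]
    rw [hA, hA, map_sub, hTc, hTv, hθ, hAanti, hAanti, smul_smul, hAanti,
      Complex.conj_conj, smul_smul, hunit, one_smul, mul_comm]
  obtain ⟨hP, hPP⟩ := posSqrt_spec hgi (D.isPosOp_sqOp hv hv')
  obtain ⟨hP', hPP'⟩ := posSqrt_spec hgi' (D'.isPosOp_sqOp hw hw')
  rw [← hgdef, ← hAdef] at hP hPP
  rw [← hgdef', ← hAdef'] at hP' hPP'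
  set P := posSqrt g (sqOp A θ v) with hPdef
  set P' := posSqrt g' (sqOp A' θ' w) with hPdef'
  have hPT : ∀ x, P' (T x) = T (P x) := by
    let Q : E →L[ℝ] E := (T : E →L[ℝ] E).comp (P.comp (T.symm : E →L[ℝ] E))
    have hQT : ∀ x, Q (T x) = T (P x) := fun x => by simp [Q]
    have hQ : IsPosOp g' Q := by
      refine ⟨fun x y => ?_, fun x hx => ?_⟩
      · obtain ⟨x, rfl⟩ := T.surjective x
        obtain ⟨y, rfl⟩ := T.surjective y
        rw [hQT, hQT, hg1, hg1, hP.symm]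
      · obtain ⟨x, rfl⟩ := T.surjective x
        rw [hQT, hg1]
        exact hP.pos x (by rintro rfl; simp at hx)
    have hQQ : Q.comp Q = sqOp A' θ' w := by
      ext x
      obtain ⟨x, rfl⟩ := T.surjective x
      rw [ContinuousLinearMap.comp_apply, hQT, hQT, hB]
      exact congrArg T (DFunLike.congr_fun hPP x)
    intro x
    rw [hP'.eq_of_sq_eq hgi' hQ (hPP'.trans hQQ.symm), hQT]
  refine ⟨fun x y => ?_, fun x => ?_⟩
  · change g' (P' (T x)) (T y) = g (P x) y
    rw [hPT, hg1]
  · apply hP'.injective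
    change P' (P'.inverse (A' (T x))) = P' (T (P.inverse (A ((f / ‖f‖) • x))))
    rw [apply_inverse_apply hP'.isInvertible, hPT, apply_inverse_apply hP.isInvertible, hA]

end Datum

/-! ### Calculus of forms and vector fields on a manifold -/

section Calculus

variable {𝕜 : Type*} [NontriviallyNormedField 𝕜]
  {EM : Type*} [NormedAddCommGroup EM] [NormedSpace 𝕜 EM]
  {HM : Type*} [TopologicalSpace HM] (I : ModelWithCorners 𝕜 EM HM)
  {M : Type*} [TopologicalSpace M] [ChartedSpace HM M] [IsManifold I ∞ M]
  {V : Type*} [NormedAddCommGroup V] [NormedSpace 𝕜 V]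
  {W : Type*} [NormedAddCommGroup W] [NormedSpace 𝕜 W]

/-- The differential at `x` of the chart at `x₀`. -/
def dchart (x₀ x : M) : TangentSpace I x →L[𝕜] EM := mvfderiv I (extChartAt I x₀) x

/-- The inverse of the differential at `x` of the chart at `x₀`. -/
def dchartSymm (x₀ x : M) : EM →L[𝕜] TangentSpace I x :=
  (trivializationAt EM (TangentSpace I) x₀).symmL 𝕜 x

variable {I}

omit [IsManifold I ∞ M] in
theorem eventually_mem_chart_source (x₀ : M) : ∀ᶠ x in 𝓝 x₀, x ∈ (chartAt HM x₀).source :=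
  (chartAt HM x₀).open_source.mem_nhds (mem_chart_source HM x₀)

theorem dchart_eq {x₀ x : M} (hx : x ∈ (chartAt HM x₀).source) :
    dchart I x₀ x = (trivializationAt EM (TangentSpace I) x₀).continuousLinearMapAt 𝕜 x :=
  (TangentBundle.continuousLinearMapAt_trivializationAt hx).symm

theorem dchart_dchartSymm {x₀ x : M} (hx : x ∈ (chartAt HM x₀).source) (w : EM) :
    dchart I x₀ x (dchartSymm I x₀ x w) = w := by
  rw [dchart_eq hx]
  exact (trivializationAt EM (TangentSpace I) x₀).continuousLinearMapAt_symmL hx w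

theorem dchartSymm_dchart {x₀ x : M} (hx : x ∈ (chartAt HM x₀).source) (X : TangentSpace I x) :
    dchartSymm I x₀ x (dchart I x₀ x X) = X := by
  rw [dchart_eq hx]
  exact (trivializationAt EM (TangentSpace I) x₀).symmL_continuousLinearMapAt hx X

theorem dchart_self (x : M) (X : TangentSpace I x) : dchart I x x X = X := by
  rw [dchart]
  exact DFunLike.congr_fun (mfderiv_extChartAt_self (I := I) (x := x)) X

omit [IsManifold I ∞ M] in
theorem mvfderiv_comp_fderiv {f : V → W} {b : M → V} {x : M} (hf : DifferentiableAt 𝕜 f (b x))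
    (hb : MDifferentiableAt I 𝓘(𝕜, V) b x) (X : TangentSpace I x) :
    mvfderiv I (f ∘ b) x X = fderiv 𝕜 f (b x) (mvfderiv I b x X) := by
  have h := mfderiv_comp_apply x hf.mdifferentiableAt hb X
  rw [mfderiv_eq_fderiv] at h
  exact h

omit [IsManifold I ∞ M] in
theorem mvfderiv_congr {f g : M → V} {x : M} (h : f =ᶠ[𝓝 x] g) {X : TangentSpace I x} :
    mvfderiv I f x X = mvfderiv I g x X :=
  congrArg (fun L : EM →L[𝕜] V => L X) h.mfderiv_eq

theorem contMDiffAt_vectorField {n : ℕ∞} {X : ∀ x : M, TangentSpace I x} {x₀ : M} :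
    ContMDiffAt I (I.prod 𝓘(𝕜, EM)) n (fun x => TotalSpace.mk' EM x (X x)) x₀ ↔
      ContMDiffAt I 𝓘(𝕜, EM) n (fun x => dchart I x₀ x (X x)) x₀ := by
  rw [contMDiffAt_section]
  refine Filter.EventuallyEq.contMDiffAt_iff ?_
  filter_upwards [eventually_mem_chart_source (HM := HM) x₀] with x hx
  rw [dchart_eq hx]
  exact ((trivializationAt EM (TangentSpace I) x₀).continuousLinearMapAt_apply_of_mem 𝕜 hx _).symm

/-- A field of linear maps `T_x M → V` is smooth iff it is, near each point `x₀`, a smooth family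
of linear maps applied to the differential of the chart at `x₀`. -/
theorem contMDiffAt_form {n : ℕ∞} {C : ∀ x : M, TangentSpace I x →L[𝕜] V} {x₀ : M} :
    ContMDiffAt I (I.prod 𝓘(𝕜, EM →L[𝕜] V)) n (fun x => TotalSpace.mk' (EM →L[𝕜] V) x (C x)) x₀ ↔
      ∃ C' : M → EM →L[𝕜] V, ContMDiffAt I 𝓘(𝕜, EM →L[𝕜] V) n C' x₀ ∧
        ∀ᶠ x in 𝓝 x₀, ∀ X, C x X = C' x (dchart I x₀ x X) := by
  have key : ∀ x ∈ (chartAt HM x₀).source,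
      ContinuousLinearMap.inCoordinates EM (TangentSpace I) V (Trivial M V) x₀ x x₀ x (C x) =
        (C x).comp (dchartSymm I x₀ x) := by
    intro x hx
    rw [ContinuousLinearMap.inCoordinates]
    ext w
    simp [dchartSymm]
  rw [contMDiffAt_hom_bundle]
  constructor
  · rintro ⟨-, h⟩
    refine ⟨_, h, ?_⟩
    filter_upwards [eventually_mem_chart_source (HM := HM) x₀] with x hx X
    rw [key x hx, ContinuousLinearMap.comp_apply, dchartSymm_dchart hx]
  · rintro ⟨C', hC', h⟩
    refine ⟨contMDiffAt_id, hC'.congr_of_eventuallyEq ?_⟩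
    filter_upwards [eventually_mem_chart_source (HM := HM) x₀, h] with x hx h
    refine (key x hx).trans ?_
    ext w
    rw [ContinuousLinearMap.comp_apply, h, dchart_dchartSymm hx]

theorem contMDiffAt_endomorphism {n : ℕ∞} {Φ : ∀ x : M, TangentSpace I x →L[𝕜] TangentSpace I x}
    {x₀ : M} {Φ' : M → EM →L[𝕜] EM} (hΦ' : ContMDiffAt I 𝓘(𝕜, EM →L[𝕜] EM) n Φ' x₀)
    (h : ∀ᶠ x in 𝓝 x₀, ∀ X, dchart I x₀ x (Φ x X) = Φ' x (dchart I x₀ x X)) :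
    ContMDiffAt I (I.prod 𝓘(𝕜, EM →L[𝕜] EM)) n (fun x => TotalSpace.mk' (EM →L[𝕜] EM) x (Φ x))
      x₀ := by
  rw [contMDiffAt_hom_bundle]
  refine ⟨contMDiffAt_id, hΦ'.congr_of_eventuallyEq ?_⟩
  filter_upwards [eventually_mem_chart_source (HM := HM) x₀, h] with x hx h
  ext w
  change (trivializationAt EM (TangentSpace I) x₀).continuousLinearMapAt 𝕜 x
    (Φ x (dchartSymm I x₀ x w)) = _
  rw [← dchart_eq hx, h, dchart_dchartSymm hx]

theorem contMDiffAt_bilinear {n : ℕ∞}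
    {g : ∀ x : M, TangentSpace I x →L[𝕜] TangentSpace I x →L[𝕜] 𝕜}
    {x₀ : M} {g' : M → EM →L[𝕜] EM →L[𝕜] 𝕜}
    (hg' : ContMDiffAt I 𝓘(𝕜, EM →L[𝕜] EM →L[𝕜] 𝕜) n g' x₀)
    (h : ∀ᶠ x in 𝓝 x₀, ∀ X Y, g x X Y = g' x (dchart I x₀ x X) (dchart I x₀ x Y)) :
    ContMDiffAt I (I.prod 𝓘(𝕜, EM →L[𝕜] EM →L[𝕜] 𝕜)) n
      (fun x => TotalSpace.mk' (EM →L[𝕜] EM →L[𝕜] 𝕜) x (g x)) x₀ := by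
  rw [contMDiffAt_hom_bundle]
  refine ⟨contMDiffAt_id, hg'.congr_of_eventuallyEq ?_⟩
  filter_upwards [eventually_mem_chart_source (HM := HM) x₀, h] with x hx h
  ext w w'
  have hx' : x ∈ (trivializationAt EM (TangentSpace I) x₀).baseSet := hx
  rw [inCoordinates_apply_eq₂ (E₃ := Trivial M 𝕜) hx' hx' (mem_univ _)]
  have h1 := h (dchartSymm I x₀ x w) (dchartSymm I x₀ x w')
  rw [dchart_dchartSymm hx, dchart_dchartSymm hx] at h1
  rw [← h1]
  have e : ∀ w : EM, (trivializationAt EM (TangentSpace I) x₀).symm x w = dchartSymm I x₀ x w :=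
    fun w => ((trivializationAt EM (TangentSpace I) x₀).symmL_apply hx' w).symm
  rw [e, e]
  simp

theorem exists_bilinear {n : ℕ∞}
    {g : ∀ x : M, TangentSpace I x →L[𝕜] TangentSpace I x →L[𝕜] 𝕜} {x₀ : M}
    (hg : ContMDiffAt I (I.prod 𝓘(𝕜, EM →L[𝕜] EM →L[𝕜] 𝕜)) n
      (fun x => TotalSpace.mk' (EM →L[𝕜] EM →L[𝕜] 𝕜) x (g x)) x₀) :
    ∃ g' : M → EM →L[𝕜] EM →L[𝕜] 𝕜, ContMDiffAt I 𝓘(𝕜, EM →L[𝕜] EM →L[𝕜] 𝕜) n g' x₀ ∧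
      ∀ᶠ x in 𝓝 x₀, ∀ X Y, g x X Y = g' x (dchart I x₀ x X) (dchart I x₀ x Y) := by
  rw [contMDiffAt_hom_bundle] at hg
  refine ⟨_, hg.2, ?_⟩
  filter_upwards [eventually_mem_chart_source (HM := HM) x₀] with x hx X Y
  have hx' : x ∈ (trivializationAt EM (TangentSpace I) x₀).baseSet := hx
  rw [inCoordinates_apply_eq₂ (E₃ := Trivial M 𝕜) hx' hx' (mem_univ _)]
  have e : ∀ w : EM, (trivializationAt EM (TangentSpace I) x₀).symm x w = dchartSymm I x₀ x w :=
    fun w => ((trivializationAt EM (TangentSpace I) x₀).symmL_apply hx' w).symm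
  rw [e, e, dchartSymm_dchart hx, dchartSymm_dchart hx]
  simp

variable [I.Boundaryless]

theorem contDiffAt_comp_extChartAt_symm {n : ℕ∞} {b : M → V} {x₀ x : M}
    (hx : x ∈ (chartAt HM x₀).source) (hb : ContMDiffAt I 𝓘(𝕜, V) n b x) :
    ContDiffAt 𝕜 n (b ∘ (extChartAt I x₀).symm) (extChartAt I x₀ x) := by
  have hx' : x ∈ (extChartAt I x₀).source := by rwa [extChartAt_source]
  have h1 : ContMDiffAt 𝓘(𝕜, EM) I n (extChartAt I x₀).symm (extChartAt I x₀ x) :=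
    ((contMDiffOn_extChartAt_symm x₀).contMDiffAt
      (extChartAt_target_mem_nhds' ((extChartAt I x₀).map_source hx')))
  refine ContMDiffAt.contDiffAt (ContMDiffAt.comp_of_eq hb h1 ?_)
  exact (extChartAt I x₀).left_inv hx'

/-- The differential of a function, expressed in the chart at `x₀`. -/
theorem mvfderiv_eq_fderiv_comp {b : M → V} {x₀ x : M} (hx : x ∈ (chartAt HM x₀).source)
    (hb : ContMDiffAt I 𝓘(𝕜, V) 1 b x) (X : TangentSpace I x) :
    mvfderiv I b x X =
      fderiv 𝕜 (b ∘ (extChartAt I x₀).symm) (extChartAt I x₀ x) (dchart I x₀ x X) := by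
  have hx' : x ∈ (extChartAt I x₀).source := by rwa [extChartAt_source]
  have h1 : b =ᶠ[𝓝 x] (b ∘ (extChartAt I x₀).symm) ∘ extChartAt I x₀ := by
    filter_upwards [(isOpen_extChartAt_source x₀).mem_nhds hx'] with y hy
    simp only [comp_apply, (extChartAt I x₀).left_inv hy]
  have h2 : DifferentiableAt 𝕜 (b ∘ (extChartAt I x₀).symm) (extChartAt I x₀ x) :=
    (contDiffAt_comp_extChartAt_symm (n := 1) hx hb).differentiableAt one_ne_zero
  rw [mvfderiv_congr h1, mvfderiv_comp_fderiv h2 (mdifferentiableAt_extChartAt hx)]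
  rfl

/-- The exterior derivative of a form `A ∘ db`. -/
theorem extD_comp_mvfderiv [IsRCLikeNormedField 𝕜] {α : ∀ x : M, TangentSpace I x →L[𝕜] 𝕜}
    {b : M → V} {A : M → V →L[𝕜] 𝕜} {x₀ : M} (hb : ContMDiffAt I 𝓘(𝕜, V) ∞ b x₀)
    (hA : ContMDiffAt I 𝓘(𝕜, V →L[𝕜] 𝕜) ∞ A x₀)
    (h : ∀ᶠ x in 𝓝 x₀, ∀ X, α x X = A x (mvfderiv I b x X)) (X Y : TangentSpace I x₀) :
    extD I α x₀ X Y = mvfderiv I A x₀ X (mvfderiv I b x₀ Y) -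
      mvfderiv I A x₀ Y (mvfderiv I b x₀ X) := by
  set φ := extChartAt I x₀ with hφ
  have hx0 := mem_chart_source HM x₀
  set A' : EM → V →L[𝕜] 𝕜 := A ∘ φ.symm
  set b' : EM → V := b ∘ φ.symm
  have hb' : ContDiffAt 𝕜 ∞ b' (φ x₀) := contDiffAt_comp_extChartAt_symm (n := ⊤) hx0 hb
  have hA' : ContDiffAt 𝕜 ∞ A' (φ x₀) := contDiffAt_comp_extChartAt_symm (n := ⊤) hx0 hA
  have hb1 : ∀ᶠ x in 𝓝 x₀, ContMDiffAt I 𝓘(𝕜, V) 1 b x :=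
    (contMDiffAt_iff_contMDiffAt_nhds (by simp)).1 (hb.of_le ENat.LEInfty.out)
  have hev : chartForm I α x₀ =ᶠ[𝓝 (φ x₀)] fun y => (A' y).comp (fderiv 𝕜 b' y) := by
    have h1 : Filter.Tendsto φ.symm (𝓝 (φ x₀)) (𝓝 x₀) := by
      have := continuousAt_extChartAt_symm (I := I) x₀
      rwa [ContinuousAt, extChartAt_to_inv] at this
    filter_upwards [h1.eventually (h.and (hb1.and (eventually_mem_chart_source (HM := HM) x₀))),
      extChartAt_target_mem_nhds (I := I) x₀] with y hy hyt
    obtain ⟨hy1, hy2, hy3⟩ := hy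
    ext w
    change α (φ.symm y) (mfderivWithin 𝓘(𝕜, EM) I φ.symm (range I) y w) = _
    rw [hy1, mvfderiv_eq_fderiv_comp hy3 hy2, ← hφ, φ.right_inv hyt, ContinuousLinearMap.comp_apply]
    have h2 := DFunLike.congr_fun
      (mfderiv_extChartAt_comp_mfderivWithin_extChartAt_symm (I := I) (x := x₀) hyt) w
    exact congrArg (fun w => A' y (fderiv 𝕜 b' y w)) h2
  have hdA : DifferentiableAt 𝕜 A' (φ x₀) := hA'.differentiableAt (by simp)
  have hdb : DifferentiableAt 𝕜 (fderiv 𝕜 b') (φ x₀) :=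
    (hb'.fderiv_right (m := 1) (by rw [one_add_one_eq_two]; exact ENat.LEInfty.out)).differentiableAt one_ne_zero
  have hD : fderivWithin 𝕜 (chartForm I α x₀) (range I) (φ x₀) =
      fderiv 𝕜 (fun y => (A' y).comp (fderiv 𝕜 b' y)) (φ x₀) := by
    rw [I.range_eq_univ, fderivWithin_univ]
    exact hev.fderiv_eq
  have hs : IsSymmSndFDerivAt 𝕜 b' (φ x₀) := hb'.isSymmSndFDerivAt (by
    rw [minSmoothness_of_isRCLikeNormedField]; exact ENat.LEInfty.out)
  have hA1 : ∀ Z : TangentSpace I x₀, mvfderiv I A x₀ Z = fderiv 𝕜 A' (φ x₀) (dchart I x₀ x₀ Z) :=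
    mvfderiv_eq_fderiv_comp hx0 (hA.of_le ENat.LEInfty.out)
  have hB1 : ∀ Z : TangentSpace I x₀, mvfderiv I b x₀ Z = fderiv 𝕜 b' (φ x₀) (dchart I x₀ x₀ Z) :=
    mvfderiv_eq_fderiv_comp hx0 (hb.of_le ENat.LEInfty.out)
  rw [hA1, hA1, hB1, hB1]
  change fderivWithin 𝕜 (chartForm I α x₀) (range I) (φ x₀) (dchart I x₀ x₀ X) (dchart I x₀ x₀ Y) -
    fderivWithin 𝕜 (chartForm I α x₀) (range I) (φ x₀) (dchart I x₀ x₀ Y) (dchart I x₀ x₀ X) = _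
  rw [hD, fderiv_clm_comp hdA hdb]
  have hs' := hs (dchart I x₀ x₀ X) (dchart I x₀ x₀ Y)
  simp only [add_apply, ContinuousLinearMap.comp_apply, ContinuousLinearMap.compL_apply,
    ContinuousLinearMap.flip_apply]
  rw [hs']
  abel

/-- The defining property `[X, Y] b = X(Y b) - Y(X b)` of the Lie bracket. -/
theorem mvfderiv_mlieBracket [CompleteSpace EM] [IsRCLikeNormedField 𝕜]
    {X Y : ∀ x : M, TangentSpace I x} {b : M → V} {x₀ : M} (hb : ContMDiffAt I 𝓘(𝕜, V) ∞ b x₀)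
    (hX : ContMDiffAt I (I.prod 𝓘(𝕜, EM)) ∞ (fun x => TotalSpace.mk' EM x (X x)) x₀)
    (hY : ContMDiffAt I (I.prod 𝓘(𝕜, EM)) ∞ (fun x => TotalSpace.mk' EM x (Y x)) x₀) :
    mvfderiv I b x₀ (VectorField.mlieBracket I X Y x₀) =
      mvfderiv I (fun x => mvfderiv I b x (Y x)) x₀ (X x₀) -
        mvfderiv I (fun x => mvfderiv I b x (X x)) x₀ (Y x₀) := by
  set φ := extChartAt I x₀ with hφ
  have hx0 := mem_chart_source HM x₀
  set b' : EM → V := b ∘ φ.symm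
  have hb' : ContDiffAt 𝕜 ∞ b' (φ x₀) := contDiffAt_comp_extChartAt_symm (n := ⊤) hx0 hb
  have hb1 : ∀ᶠ x in 𝓝 x₀, ContMDiffAt I 𝓘(𝕜, V) 1 b x :=
    (contMDiffAt_iff_contMDiffAt_nhds (by simp)).1 (hb.of_le ENat.LEInfty.out)
  have hdb : DifferentiableAt 𝕜 (fderiv 𝕜 b') (φ x₀) :=
    (hb'.fderiv_right (m := 1) (by rw [one_add_one_eq_two]; exact ENat.LEInfty.out)).differentiableAt one_ne_zero
  have hB1 : ∀ Z : TangentSpace I x₀, mvfderiv I b x₀ Z = fderiv 𝕜 b' (φ x₀) (dchart I x₀ x₀ Z) :=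
    mvfderiv_eq_fderiv_comp hx0 (hb.of_le ENat.LEInfty.out)
  have hs : IsSymmSndFDerivAt 𝕜 b' (φ x₀) := hb'.isSymmSndFDerivAt (by
    rw [minSmoothness_of_isRCLikeNormedField]; exact ENat.LEInfty.out)
  have h1 : Filter.Tendsto φ.symm (𝓝 (φ x₀)) (𝓝 x₀) := by
    have := continuousAt_extChartAt_symm (I := I) x₀
    rwa [ContinuousAt, extChartAt_to_inv] at this
  -- the vector fields in the chart
  have hrep : ∀ Z : ∀ x : M, TangentSpace I x,
      ∃ Z' : EM → EM, Z' = VectorField.mpullbackWithin 𝓘(𝕜, EM) I φ.symm Z (range I) ∧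
        ∀ᶠ y in 𝓝 (φ x₀), Z' y = dchart I x₀ (φ.symm y) (Z (φ.symm y)) := by
    intro Z
    refine ⟨_, rfl, ?_⟩
    filter_upwards [extChartAt_target_mem_nhds (I := I) x₀] with y hy
    rw [VectorField.mpullbackWithin_apply]
    have hinv := isInvertible_mfderivWithin_extChartAt_symm (I := I) (x := x₀) hy
    have h2 := mfderiv_extChartAt_comp_mfderivWithin_extChartAt_symm (I := I) (x := x₀) hy
    have h3 := DFunLike.congr_fun h2
      ((mfderivWithin 𝓘(𝕜, EM) I φ.symm (range I) y).inverse (Z (φ.symm y)))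
    rw [ContinuousLinearMap.comp_apply, hinv.self_apply_inverse] at h3
    exact h3.symm
  obtain ⟨X', hX'd, hX'⟩ := hrep X
  obtain ⟨Y', hY'd, hY'⟩ := hrep Y
  have hdiff : ∀ (Z : ∀ x : M, TangentSpace I x) (Z' : EM → EM),
      ContMDiffAt I (I.prod 𝓘(𝕜, EM)) ∞ (fun x => TotalSpace.mk' EM x (Z x)) x₀ →
      (∀ᶠ y in 𝓝 (φ x₀), Z' y = dchart I x₀ (φ.symm y) (Z (φ.symm y))) →
      DifferentiableAt 𝕜 Z' (φ x₀) := by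
    intro Z Z' hZ hZ'
    have h2 := contDiffAt_comp_extChartAt_symm (n := ⊤) hx0 ((contMDiffAt_vectorField (n := ⊤)).1 hZ)
    exact (h2.differentiableAt (by simp)).congr_of_eventuallyEq hZ'
  have hdX := hdiff X X' hX hX'
  have hdY := hdiff Y Y' hY hY'
  have happ : ∀ (Z : ∀ x : M, TangentSpace I x) (Z' : EM → EM),
      ContMDiffAt I (I.prod 𝓘(𝕜, EM)) ∞ (fun x => TotalSpace.mk' EM x (Z x)) x₀ →
      (∀ᶠ y in 𝓝 (φ x₀), Z' y = dchart I x₀ (φ.symm y) (Z (φ.symm y))) →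
      ∀ T : TangentSpace I x₀, mvfderiv I (fun x => mvfderiv I b x (Z x)) x₀ T =
        fderiv 𝕜 (fderiv 𝕜 b') (φ x₀) (dchart I x₀ x₀ T) (Z' (φ x₀)) +
          fderiv 𝕜 b' (φ x₀) (fderiv 𝕜 Z' (φ x₀) (dchart I x₀ x₀ T)) := by
    intro Z Z' hZ hZ' T
    have hdZ := hdiff Z Z' hZ hZ'
    have e1 : (fun x => mvfderiv I b x (Z x)) =ᶠ[𝓝 x₀] (fun y => fderiv 𝕜 b' y (Z' y)) ∘ φ := by
      have hc : Filter.Tendsto φ (𝓝 x₀) (𝓝 (φ x₀)) := continuousAt_extChartAt x₀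
      filter_upwards [hb1, eventually_mem_chart_source (HM := HM) x₀, hc.eventually hZ'] with x h2 h3 h4
      have h5 : φ.symm (φ x) = x := φ.left_inv (by rwa [hφ, extChartAt_source])
      rw [h5] at h4
      simp only [comp_apply]
      rw [h4, mvfderiv_eq_fderiv_comp h3 h2]
    have h6 : DifferentiableAt 𝕜 (fun y => fderiv 𝕜 b' y (Z' y)) (φ x₀) := hdb.clm_apply hdZ
    rw [mvfderiv_congr e1, mvfderiv_comp_fderiv h6 (mdifferentiableAt_extChartAt hx0),
      fderiv_clm_apply hdb hdZ]
    simp only [add_apply, ContinuousLinearMap.comp_apply, ContinuousLinearMap.flip_apply]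
    rw [add_comm]
    rfl
  have hval : ∀ (Z : ∀ x : M, TangentSpace I x) (Z' : EM → EM),
      (∀ᶠ y in 𝓝 (φ x₀), Z' y = dchart I x₀ (φ.symm y) (Z (φ.symm y))) →
      dchart I x₀ x₀ (Z x₀) = Z' (φ x₀) := by
    intro Z Z' hZ'
    have h2 := hZ'.self_of_nhds
    rw [h2]
    have : φ.symm (φ x₀) = x₀ := extChartAt_to_inv x₀
    rw [this]
  rw [hB1, happ X X' hX hX', happ Y Y' hY hY', hval X X' hX', hval Y Y' hY', hs (X' (φ x₀))]
  have hbr : dchart I x₀ x₀ (VectorField.mlieBracket I X Y x₀) =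
      fderiv 𝕜 Y' (φ x₀) (X' (φ x₀)) - fderiv 𝕜 X' (φ x₀) (Y' (φ x₀)) := by
    rw [← VectorField.mlieBracketWithin_univ, VectorField.mlieBracketWithin_apply, ← hφ,
      ← hX'd, ← hY'd, preimage_univ, univ_inter, I.range_eq_univ,
      VectorField.lieBracketWithin_univ]
    have hinv := isInvertible_mfderiv_extChartAt (I := I) (x := x₀) (mem_extChartAt_source x₀)
    exact hinv.self_apply_inverse _
  rw [hbr, map_sub]
  abel

end Calculus

/-! ### Tensor fields in a coframe -/

section Coframe

variable {𝕜 : Type*} [NontriviallyNormedField 𝕜]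
  {EM : Type*} [NormedAddCommGroup EM] [NormedSpace 𝕜 EM]
  {HM : Type*} [TopologicalSpace HM] {I : ModelWithCorners 𝕜 EM HM}
  {M : Type*} [TopologicalSpace M] [ChartedSpace HM M] [IsManifold I ∞ M]
  {V : Type*} [NormedAddCommGroup V] [NormedSpace 𝕜 V]
  {W : Type*} [NormedAddCommGroup W] [NormedSpace 𝕜 W]

variable (I) in
/-- A field of linear maps `T_x M → V` which is smooth at `x₀`: near `x₀` it is a smooth family of
linear maps applied to the differential of the chart at `x₀`. -/
def SmoothFormAt (C : ∀ x : M, TangentSpace I x →L[𝕜] V) (x₀ : M) : Prop :=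
  ∃ C' : M → EM →L[𝕜] V, ContMDiffAt I 𝓘(𝕜, EM →L[𝕜] V) ∞ C' x₀ ∧
    ∀ᶠ x in 𝓝 x₀, ∀ X, C x X = C' x (dchart I x₀ x X)

theorem smoothFormAt_iff {C : ∀ x : M, TangentSpace I x →L[𝕜] V} {x₀ : M} :
    SmoothFormAt I C x₀ ↔ ContMDiffAt I (I.prod 𝓘(𝕜, EM →L[𝕜] V)) ∞
      (fun x => TotalSpace.mk' (EM →L[𝕜] V) x (C x)) x₀ :=
  (contMDiffAt_form (n := ⊤)).symm

omit [IsManifold I ∞ M] in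
theorem SmoothFormAt.congr {C C₁ : ∀ x : M, TangentSpace I x →L[𝕜] V} {x₀ : M}
    (h : SmoothFormAt I C x₀) (h₁ : ∀ᶠ x in 𝓝 x₀, ∀ X, C₁ x X = C x X) : SmoothFormAt I C₁ x₀ := by
  obtain ⟨C', hC', h2⟩ := h
  refine ⟨C', hC', ?_⟩
  filter_upwards [h₁, h2] with x h3 h4 X
  rw [h3, h4]

omit [IsManifold I ∞ M] in
theorem SmoothFormAt.clm_comp {C : ∀ x : M, TangentSpace I x →L[𝕜] V} {x₀ : M}
    (h : SmoothFormAt I C x₀) {L : M → V →L[𝕜] W} (hL : ContMDiffAt I 𝓘(𝕜, V →L[𝕜] W) ∞ L x₀) :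
    SmoothFormAt I (fun x => (L x).comp (C x)) x₀ := by
  obtain ⟨C', hC', h2⟩ := h
  refine ⟨fun x => (L x).comp (C' x), hL.clm_comp hC', ?_⟩
  filter_upwards [h2] with x h4 X
  rw [ContinuousLinearMap.comp_apply, ContinuousLinearMap.comp_apply, h4]

omit [IsManifold I ∞ M] in
theorem SmoothFormAt.prodMk {C : ∀ x : M, TangentSpace I x →L[𝕜] V}
    {C₁ : ∀ x : M, TangentSpace I x →L[𝕜] W} {x₀ : M}
    (h : SmoothFormAt I C x₀) (h₁ : SmoothFormAt I C₁ x₀) :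
    SmoothFormAt I (fun x => (C x).prod (C₁ x)) x₀ := by
  obtain ⟨C', hC', h2⟩ := h
  obtain ⟨D', hD', h3⟩ := h₁
  refine ⟨fun x => (ContinuousLinearMap.inl 𝕜 V W).comp (C' x) +
    (ContinuousLinearMap.inr 𝕜 V W).comp (D' x),
    (contMDiffAt_const.clm_comp hC').add (contMDiffAt_const.clm_comp hD'), ?_⟩
  filter_upwards [h2, h3] with x h4 h5 X
  simp [h4, h5]

theorem smoothFormAt_mvfderiv [I.Boundaryless] {b : M → V} {x₀ : M}
    (hb : ContMDiffAt I 𝓘(𝕜, V) ∞ b x₀) : SmoothFormAt I (fun x => mvfderiv I b x) x₀ := by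
  have hb1 : ∀ᶠ x in 𝓝 x₀, ContMDiffAt I 𝓘(𝕜, V) 1 b x :=
    (contMDiffAt_iff_contMDiffAt_nhds (by simp)).1 (hb.of_le ENat.LEInfty.out)
  have hb' : ContDiffAt 𝕜 ∞ (b ∘ (extChartAt I x₀).symm) (extChartAt I x₀ x₀) :=
    contDiffAt_comp_extChartAt_symm (n := ⊤) (mem_chart_source HM x₀) hb
  refine ⟨fun x => fderiv 𝕜 (b ∘ (extChartAt I x₀).symm) (extChartAt I x₀ x), ?_, ?_⟩
  · exact ContDiffAt.comp_contMDiffAt (g := fderiv 𝕜 (b ∘ (extChartAt I x₀).symm))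
      (f := extChartAt I x₀) (hb'.fderiv_right (m := ∞) (by simp)) contMDiffAt_extChartAt
  · filter_upwards [hb1, eventually_mem_chart_source (HM := HM) x₀] with x h1 h2 X
    exact mvfderiv_eq_fderiv_comp h2 h1 X

theorem mvfderiv_clm_apply [I.Boundaryless] {A : M → V →L[𝕜] W} {f : M → V} {x₀ : M}
    (hA : ContMDiffAt I 𝓘(𝕜, V →L[𝕜] W) ∞ A x₀) (hf : ContMDiffAt I 𝓘(𝕜, V) ∞ f x₀)
    (X : TangentSpace I x₀) :
    mvfderiv I (fun x => A x (f x)) x₀ X =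
      mvfderiv I A x₀ X (f x₀) + A x₀ (mvfderiv I f x₀ X) := by
  have hx0 := mem_chart_source HM x₀
  have hA' := contDiffAt_comp_extChartAt_symm (n := ⊤) hx0 hA
  have hf' := contDiffAt_comp_extChartAt_symm (n := ⊤) hx0 hf
  have h0 : (extChartAt I x₀).symm (extChartAt I x₀ x₀) = x₀ := extChartAt_to_inv x₀
  rw [mvfderiv_eq_fderiv_comp hx0 (hA.of_le ENat.LEInfty.out),
    mvfderiv_eq_fderiv_comp hx0 (hf.of_le ENat.LEInfty.out),
    mvfderiv_eq_fderiv_comp hx0 ((hA.clm_apply hf).of_le ENat.LEInfty.out)]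
  have h1 := fderiv_clm_apply (hA'.differentiableAt (by simp)) (hf'.differentiableAt (by simp))
  have h2 : ((fun x => A x (f x)) ∘ (extChartAt I x₀).symm) =
    fun y => (A ∘ (extChartAt I x₀).symm) y ((f ∘ (extChartAt I x₀).symm) y) := rfl
  rw [h2, h1]
  simp only [add_apply, ContinuousLinearMap.comp_apply, ContinuousLinearMap.flip_apply,
    Function.comp_apply, h0]
  rw [add_comm]

theorem SmoothFormAt.contMDiffAt_apply [I.Boundaryless] {C : ∀ x : M, TangentSpace I x →L[𝕜] V}
    {x₀ : M} (h : SmoothFormAt I C x₀) {X : ∀ x : M, TangentSpace I x}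
    (hX : ContMDiffAt I (I.prod 𝓘(𝕜, EM)) ∞ (fun x => TotalSpace.mk' EM x (X x)) x₀) :
    ContMDiffAt I 𝓘(𝕜, V) ∞ (fun x => C x (X x)) x₀ := by
  obtain ⟨C', hC', h⟩ := h
  refine (hC'.clm_apply ((contMDiffAt_vectorField (n := ⊤)).1 hX)).congr_of_eventuallyEq ?_
  filter_upwards [h] with x hx
  exact hx _

/-- The formula `dη(X, Y) = X(η(Y)) - Y(η(X)) - η([X, Y])`. -/
theorem extD_eq_bracket [I.Boundaryless] [CompleteSpace EM] [IsRCLikeNormedField 𝕜]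
    {η : ∀ x : M, TangentSpace I x →L[𝕜] 𝕜} {x₀ : M} (hη : SmoothFormAt I η x₀)
    {X Y : ∀ x : M, TangentSpace I x}
    (hX : ContMDiffAt I (I.prod 𝓘(𝕜, EM)) ∞ (fun x => TotalSpace.mk' EM x (X x)) x₀)
    (hY : ContMDiffAt I (I.prod 𝓘(𝕜, EM)) ∞ (fun x => TotalSpace.mk' EM x (Y x)) x₀) :
    extD I η x₀ (X x₀) (Y x₀) = mvfderiv I (fun x => η x (Y x)) x₀ (X x₀) -
      mvfderiv I (fun x => η x (X x)) x₀ (Y x₀) - η x₀ (VectorField.mlieBracket I X Y x₀) := by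
  obtain ⟨A, hA, h⟩ := hη
  have hb : ContMDiffAt I 𝓘(𝕜, EM) ∞ (extChartAt I x₀) x₀ := contMDiffAt_extChartAt
  have hval : ∀ {Z : ∀ x : M, TangentSpace I x},
      ContMDiffAt I (I.prod 𝓘(𝕜, EM)) ∞ (fun x => TotalSpace.mk' EM x (Z x)) x₀ →
      ∀ T : TangentSpace I x₀, mvfderiv I (fun x => η x (Z x)) x₀ T =
        mvfderiv I A x₀ T (dchart I x₀ x₀ (Z x₀)) +
          A x₀ (mvfderiv I (fun x => dchart I x₀ x (Z x)) x₀ T) := by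
    intro Z hZ T
    rw [← mvfderiv_clm_apply hA ((contMDiffAt_vectorField (n := ⊤)).1 hZ)]
    refine mvfderiv_congr ?_
    filter_upwards [h] with x hx using hx _
  rw [extD_comp_mvfderiv hb hA h, hval hX, hval hY, h.self_of_nhds]
  have h3 := mvfderiv_mlieBracket hb hX hY
  change dchart I x₀ x₀ (VectorField.mlieBracket I X Y x₀) =
    mvfderiv I (fun x => dchart I x₀ x (Y x)) x₀ (X x₀) -
      mvfderiv I (fun x => dchart I x₀ x (X x)) x₀ (Y x₀) at h3
  rw [h3, map_sub]
  change mvfderiv I A x₀ (X x₀) (dchart I x₀ x₀ (Y x₀)) -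
    mvfderiv I A x₀ (Y x₀) (dchart I x₀ x₀ (X x₀)) = _
  abel

end Coframe

section RealCoframe

variable {EM : Type*} [NormedAddCommGroup EM] [NormedSpace ℝ EM] [FiniteDimensional ℝ EM]
  {HM : Type*} [TopologicalSpace HM] {I : ModelWithCorners ℝ EM HM}
  {M : Type*} [TopologicalSpace M] [ChartedSpace HM M] [IsManifold I ∞ M]
  {V : Type*} [NormedAddCommGroup V] [NormedSpace ℝ V]
  {W : Type*} [NormedAddCommGroup W] [NormedSpace ℝ W]

/-- A coframe near `x₀`, in local coordinates, is a smooth family of invertible linear maps. -/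
theorem SmoothFormAt.exists_inverse {C : ∀ x : M, TangentSpace I x →L[ℝ] W} {x₀ : M}
    (h : SmoothFormAt I C x₀) (hC : (C x₀).IsInvertible) :
    ∃ (C' : M → EM →L[ℝ] W) (D' : M → W →L[ℝ] EM), ContMDiffAt I 𝓘(ℝ, EM →L[ℝ] W) ∞ C' x₀ ∧
      ContMDiffAt I 𝓘(ℝ, W →L[ℝ] EM) ∞ D' x₀ ∧
      (∀ᶠ x in 𝓝 x₀, ∀ X, C x X = C' x (dchart I x₀ x X)) ∧
      ∀ᶠ x in 𝓝 x₀, ∀ X, dchart I x₀ x X = D' x (C x X) := by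
  obtain ⟨C', hC', h⟩ := h
  have h0 : C' x₀ = C x₀ := by
    ext X
    exact ((h.self_of_nhds X).trans (congrArg (C' x₀) (dchart_self x₀ X))).symm
  have hinv : (C' x₀).IsInvertible := by rw [h0]; exact hC
  refine ⟨C', fun x => (C' x).inverse, hC', ?_, h, ?_⟩
  · exact ContDiffAt.comp_contMDiffAt (g := ContinuousLinearMap.inverse) (f := C')
      (contDiffAt_inverse hinv) hC'
  · have hCc : ContinuousAt C' x₀ := hC'.continuousAt
    have hev : ∀ᶠ x in 𝓝 x₀, (C' x).IsInvertible := by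
      obtain ⟨e, he⟩ := hinv
      have : CompleteSpace EM := FiniteDimensional.complete ℝ EM
      refine hCc.eventually ?_
      rw [← he]
      exact e.nhds
    filter_upwards [h, hev] with x h1 h2 X
    rw [h1, inverse_apply_apply h2]

theorem SmoothFormAt.contMDiffAt_vectorField {C : ∀ x : M, TangentSpace I x →L[ℝ] W} {x₀ : M}
    (h : SmoothFormAt I C x₀) (hC : (C x₀).IsInvertible) {X : ∀ x : M, TangentSpace I x}
    {S : M → W} (hS : ContMDiffAt I 𝓘(ℝ, W) ∞ S x₀) (hX : ∀ᶠ x in 𝓝 x₀, C x (X x) = S x) :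
    ContMDiffAt I (I.prod 𝓘(ℝ, EM)) ∞ (fun x => TotalSpace.mk' EM x (X x)) x₀ := by
  obtain ⟨C', D', hC', hD', h1, h2⟩ := h.exists_inverse hC
  refine (ContactTriple.contMDiffAt_vectorField (n := ⊤)).2
    ((hD'.clm_apply hS).congr_of_eventuallyEq ?_)
  filter_upwards [h2, hX] with x h3 h4
  rw [h3, h4]

theorem SmoothFormAt.contMDiffAt_endomorphism {C : ∀ x : M, TangentSpace I x →L[ℝ] W} {x₀ : M}
    (h : SmoothFormAt I C x₀) (hC : (C x₀).IsInvertible)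
    {Φ : ∀ x : M, TangentSpace I x →L[ℝ] TangentSpace I x}
    {S : M → W →L[ℝ] W} (hS : ContMDiffAt I 𝓘(ℝ, W →L[ℝ] W) ∞ S x₀)
    (hΦ : ∀ᶠ x in 𝓝 x₀, ∀ X, C x (Φ x X) = S x (C x X)) :
    ContMDiffAt I (I.prod 𝓘(ℝ, EM →L[ℝ] EM)) ∞ (fun x => TotalSpace.mk' (EM →L[ℝ] EM) x (Φ x))
      x₀ := by
  obtain ⟨C', D', hC', hD', h1, h2⟩ := h.exists_inverse hC
  refine ContactTriple.contMDiffAt_endomorphism (n := ⊤) (hD'.clm_comp (hS.clm_comp hC')) ?_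
  filter_upwards [h1, h2, hΦ] with x h3 h4 h5 X
  rw [h4, h5, h3]
  rfl

omit [FiniteDimensional ℝ EM] in
theorem SmoothFormAt.contMDiffAt_bilinear {C : ∀ x : M, TangentSpace I x →L[ℝ] W} {x₀ : M}
    (h : SmoothFormAt I C x₀) {g : ∀ x : M, TangentSpace I x →L[ℝ] TangentSpace I x →L[ℝ] ℝ}
    {S : M → W →L[ℝ] W →L[ℝ] ℝ} (hS : ContMDiffAt I 𝓘(ℝ, W →L[ℝ] W →L[ℝ] ℝ) ∞ S x₀)
    (hg : ∀ᶠ x in 𝓝 x₀, ∀ X Y, g x X Y = S x (C x X) (C x Y)) :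
    ContMDiffAt I (I.prod 𝓘(ℝ, EM →L[ℝ] EM →L[ℝ] ℝ)) ∞
      (fun x => TotalSpace.mk' (EM →L[ℝ] EM →L[ℝ] ℝ) x (g x)) x₀ := by
  obtain ⟨C', hC', h1⟩ := h
  refine ContactTriple.contMDiffAt_bilinear (n := ⊤) ((hC'.clm_precomp (F₃ := ℝ)).clm_comp (hS.clm_comp hC')) ?_
  filter_upwards [h1, hg] with x h3 h4 X Y
  rw [h4, h3, h3]
  rfl

variable [I.Boundaryless]

/-- A criterion for normality: `Φ` is the lift of a complex structure `J`, with `b` a local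
holomorphic coordinate, and `dη` is of type `(1, 1)`. -/
theorem AlmostContactStructure.isNormal_of (S : AlmostContactStructure I M) (J : V →L[ℝ] V)
    (hJ : ∀ v, J (J v) = -v) (hηΦ : ∀ x X, S.η x (S.Φ x X) = 0)
    (hdη : ∀ x X Y, extD I S.η x (S.Φ x X) (S.Φ x Y) = extD I S.η x X Y)
    (hb : ∀ x₀ : M, ∃ b : M → V, ContMDiffAt I 𝓘(ℝ, V) ∞ b x₀ ∧
      (∀ᶠ x in 𝓝 x₀, ∀ X, mvfderiv I b x (S.Φ x X) = J (mvfderiv I b x X)) ∧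
      mvfderiv I b x₀ (S.ξ x₀) = 0 ∧
      ∀ X : TangentSpace I x₀, mvfderiv I b x₀ X = 0 → S.η x₀ X = 0 → X = 0) :
    S.IsNormal := by
  intro X Y hX hY x₀
  have : CompleteSpace EM := FiniteDimensional.complete ℝ EM
  obtain ⟨b, hb, hΦb, hξb, hinj⟩ := hb x₀
  have hη : SmoothFormAt I S.η x₀ := smoothFormAt_iff.2 (S.smooth_η x₀)
  have hΦ : ∀ {Z : ∀ x : M, TangentSpace I x}, SmoothVectorField I Z →
      SmoothVectorField I fun x => S.Φ x (Z x) := fun {Z} hZ x =>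
    ContMDiffAt.clm_bundle_apply (S.smooth_Φ x) (hZ x)
  have hdb := smoothFormAt_mvfderiv hb
  have hJb : ∀ {Z : ∀ x : M, TangentSpace I x}, SmoothVectorField I Z →
      ∀ T : TangentSpace I x₀, mvfderiv I (fun x => mvfderiv I b x (S.Φ x (Z x))) x₀ T =
        J (mvfderiv I (fun x => mvfderiv I b x (Z x)) x₀ T) := by
    intro Z hZ T
    have h1 := mvfderiv_clm_apply (A := fun _ : M => J) contMDiffAt_const
      (hdb.contMDiffAt_apply (hZ x₀)) T
    have h2 : mvfderiv I (fun _ : M => J) x₀ T = 0 := by rw [mvfderiv_const]; rfl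
    rw [h2, zero_apply, zero_add] at h1
    rw [← h1]
    refine mvfderiv_congr ?_
    filter_upwards [hΦb] with x hx using hx _
  have hη0 : ∀ {Z : ∀ x : M, TangentSpace I x} (T : TangentSpace I x₀),
      mvfderiv I (fun x => S.η x (S.Φ x (Z x))) x₀ T = 0 := by
    intro Z T
    simp only [hηΦ, mvfderiv_const]
    rfl
  have hΦb0 := hΦb.self_of_nhds
  -- The tensor vanishes because its image under `db` is the Nijenhuis tensor of the constant `J`, and
  -- its image under `η` is the difference of `dη(X, Y)` and `dη(Φ X, Φ Y)`.
  apply hinj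
  · rw [bracketΦ, map_add, map_smul, map_smul, hξb, smul_zero, add_zero, map_sub, map_sub, map_add,
      hΦb0, hΦb0, hΦb0, hΦb0, mvfderiv_mlieBracket hb (hΦ hX x₀) (hΦ hY x₀),
      mvfderiv_mlieBracket hb (hX x₀) (hY x₀), mvfderiv_mlieBracket hb (hΦ hX x₀) (hY x₀),
      mvfderiv_mlieBracket hb (hX x₀) (hΦ hY x₀), hJ, hJb hX, hJb hY, hJb hX, hJb hY, map_sub,
      map_sub, hJ, hJ]
    rw [smul_eq_zero]
    right
    abel
  · have h1 := extD_eq_bracket hη (hΦ hX x₀) (hΦ hY x₀)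
    rw [hη0, hη0, hdη] at h1
    rw [bracketΦ, map_add, map_smul, map_smul, map_sub, map_sub, map_add, hηΦ, hηΦ, hηΦ, S.η_ξ, h1]
    simp only [smul_eq_mul]
    ring

/-- A criterion for `ξ` to be a Killing field: locally the metric is the sum of the square of `η`
and of a metric on the space of leaves. -/
theorem isKilling_of (S : AlmostContactStructure I M) (g : Metric I M)
    (hdη : ∀ x X, extD I S.η x (S.ξ x) X = 0)
    (hb : ∀ x₀ : M, ∃ (b : M → V) (G : M → V →L[ℝ] V →L[ℝ] ℝ), ContMDiffAt I 𝓘(ℝ, V) ∞ b x₀ ∧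
      ContMDiffAt I 𝓘(ℝ, V →L[ℝ] V →L[ℝ] ℝ) ∞ G x₀ ∧
      (∀ᶠ x in 𝓝 x₀, mvfderiv I b x (S.ξ x) = 0) ∧ mvfderiv I G x₀ (S.ξ x₀) = 0 ∧
      ∀ᶠ x in 𝓝 x₀, ∀ X Y, g.inner x X Y =
        G x (mvfderiv I b x X) (mvfderiv I b x Y) + S.η x X * S.η x Y) :
    IsKilling S.ξ g := by
  intro X Y hX hY x₀
  have : CompleteSpace EM := FiniteDimensional.complete ℝ EM
  obtain ⟨b, G, hb, hG, hξb, hξG, hg⟩ := hb x₀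
  have hη : SmoothFormAt I S.η x₀ := smoothFormAt_iff.2 (S.smooth_η x₀)
  have hdb := smoothFormAt_mvfderiv hb
  have hbξ : ∀ {Z : ∀ x : M, TangentSpace I x}, SmoothVectorField I Z →
      mvfderiv I b x₀ (VectorField.mlieBracket I S.ξ Z x₀) =
        mvfderiv I (fun x => mvfderiv I b x (Z x)) x₀ (S.ξ x₀) := by
    intro Z hZ
    rw [mvfderiv_mlieBracket hb (S.smooth_ξ x₀) (hZ x₀), mvfderiv_congr (g := fun _ => (0 : V))
      (f := fun x => mvfderiv I b x (S.ξ x)) hξb, mvfderiv_const, zero_apply, sub_zero]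
  have hηξ : ∀ {Z : ∀ x : M, TangentSpace I x}, SmoothVectorField I Z →
      S.η x₀ (VectorField.mlieBracket I S.ξ Z x₀) =
        mvfderiv I (fun x => S.η x (Z x)) x₀ (S.ξ x₀) := by
    intro Z hZ
    have h1 := extD_eq_bracket hη (S.smooth_ξ x₀) (hZ x₀)
    simp only [S.η_ξ, mvfderiv_const, hdη, zero_apply] at h1
    linarith
  have hXb := hdb.contMDiffAt_apply (hX x₀)
  have hYb := hdb.contMDiffAt_apply (hY x₀)
  have hXη := hη.contMDiffAt_apply (hX x₀)
  have hYη := hη.contMDiffAt_apply (hY x₀)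
  have hcongr : (fun y => g.inner y (X y) (Y y)) =ᶠ[𝓝 x₀] fun y =>
      G y (mvfderiv I b y (X y)) (mvfderiv I b y (Y y)) + S.η y (X y) * S.η y (Y y) := by
    filter_upwards [hg] with x hx using hx _ _
  have hGX := hG.clm_apply hXb
  have hg0 := hg.self_of_nhds
  have h2 := mvfderiv_fun_add (I := I) ((hGX.clm_apply hYb).mdifferentiableAt (by simp))
    ((hXη.mul hYη).mdifferentiableAt (by simp))
  have h3 := mvfderiv_fun_mul (I := I) (hXη.mdifferentiableAt (by simp))
    (hYη.mdifferentiableAt (by simp))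
  have h4 := mvfderiv_clm_apply hGX hYb (S.ξ x₀)
  have h5 := mvfderiv_clm_apply hG hXb (S.ξ x₀)
  rw [hξG, zero_apply, zero_add] at h5
  rw [lieDerivMetric, mvfderiv_congr hcongr, hg0, hg0, hbξ hX, hbξ hY, hηξ hX, hηξ hY]
  have h6 := DFunLike.congr_fun h2 (S.ξ x₀)
  have h7 := DFunLike.congr_fun h3 (S.ξ x₀)
  rw [add_apply, h4, h5] at h6
  rw [add_apply, smul_apply, smul_apply, smul_eq_mul, smul_eq_mul] at h7
  refine (congrArg (fun t => t - _ - _) (h6.trans (congrArg _ h7))).trans ?_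
  ring

end RealCoframe

/-! ### Holomorphic forms in a chart -/

section LocalForm

variable {𝕜 : Type*} [NontriviallyNormedField 𝕜]
  {EM : Type*} [NormedAddCommGroup EM] [NormedSpace 𝕜 EM]
  {HM : Type*} [TopologicalSpace HM] {I : ModelWithCorners 𝕜 EM HM} [I.Boundaryless]
  {M : Type*} [TopologicalSpace M] [ChartedSpace HM M] [IsManifold I ∞ M]

omit [I.Boundaryless] in
theorem chartForm_extChartAt {α : ∀ x : M, TangentSpace I x →L[𝕜] 𝕜} {x₀ x : M}
    (hx : x ∈ (chartAt HM x₀).source) :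
    chartForm I α x₀ (extChartAt I x₀ x) = (α x).comp (dchartSymm I x₀ x) := by
  have hx' : x ∈ (extChartAt I x₀).source := by rwa [extChartAt_source]
  have h1 : dchartSymm I x₀ x =
      mfderivWithin 𝓘(𝕜, EM) I (extChartAt I x₀).symm (range I) (extChartAt I x₀ x) :=
    TangentBundle.symmL_trivializationAt hx
  rw [h1, chartForm, (extChartAt I x₀).left_inv hx']

omit [I.Boundaryless] in
/-- A form evaluated by means of its expression in a chart. -/
theorem form_eq_chartForm {α : ∀ x : M, TangentSpace I x →L[𝕜] 𝕜} {x₀ x : M}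
    (hx : x ∈ (chartAt HM x₀).source) (X : TangentSpace I x) :
    α x X = chartForm I α x₀ (extChartAt I x₀ x) (dchart I x₀ x X) := by
  rw [chartForm_extChartAt hx, ContinuousLinearMap.comp_apply, dchartSymm_dchart hx]

theorem contDiffAt_chartForm {α : ∀ x : M, TangentSpace I x →L[𝕜] 𝕜} {x₀ x : M}
    (hx : x ∈ (chartAt HM x₀).source) (hα : ContMDiffAt I (I.prod 𝓘(𝕜, EM →L[𝕜] 𝕜)) ∞
      (fun x => TotalSpace.mk' (EM →L[𝕜] 𝕜) x (α x)) x) :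
    ContDiffAt 𝕜 ∞ (chartForm I α x₀) (extChartAt I x₀ x) := by
  have hx' : x ∈ (extChartAt I x₀).source := by rwa [extChartAt_source]
  let e := trivializationAt (EM →L[𝕜] 𝕜)
    (fun x : M => TangentSpace I x →L[𝕜] Trivial M 𝕜 x) x₀
  have hxe : x ∈ e.baseSet := ⟨hx, mem_univ _⟩
  have h1 : ContMDiffAt I 𝓘(𝕜, EM →L[𝕜] 𝕜) ∞ (fun y => (e ⟨y, α y⟩).2) x :=
    (e.contMDiffAt_section_iff hxe).1 hα
  have h2 : ContMDiffAt I 𝓘(𝕜, EM →L[𝕜] 𝕜) ∞ (fun y => (α y).comp (dchartSymm I x₀ y)) x := by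
    refine h1.congr_of_eventuallyEq ?_
    filter_upwards [(chartAt HM x₀).open_source.mem_nhds hx] with y hy
    ext w
    change _ = (ContinuousLinearMap.inCoordinates EM (TangentSpace I) 𝕜 (Trivial M 𝕜) x₀ y x₀ y
      (α y)) w
    rw [ContinuousLinearMap.inCoordinates]
    simp [dchartSymm]
  refine (contDiffAt_comp_extChartAt_symm (n := ⊤) hx h2).congr_of_eventuallyEq ?_
  filter_upwards [extChartAt_target_mem_nhds' ((extChartAt I x₀).map_source hx')] with y hy
  have h3 : (extChartAt I x₀).symm y ∈ (chartAt HM x₀).source := by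
    rw [← extChartAt_source I]
    exact (extChartAt I x₀).map_target hy
  have h4 := chartForm_extChartAt (α := α) h3
  rw [(extChartAt I x₀).right_inv hy] at h4
  exact h4

end LocalForm

section ComplexManifold

variable {E : Type*} [NormedAddCommGroup E] [NormedSpace ℂ E]
  {Z : Type*} [TopologicalSpace Z] [ChartedSpace E Z]
  {V : Type*} [NormedAddCommGroup V] [NormedSpace ℂ V]

/-- The real differential of a holomorphic map. -/
theorem mvfderiv_real_eq {f : Z → V} {z : Z} (hf : MDifferentiableAt 𝓘(ℂ, E) 𝓘(ℂ, V) f z) (X : E) :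
    mvfderiv 𝓘(ℝ, E) f z X = mvfderiv 𝓘(ℂ, E) f z X := by
  have h1 := hf.hasMFDerivAt
  have h2 : HasMFDerivAt 𝓘(ℝ, E) 𝓘(ℝ, V) f z
      ((show E →L[ℂ] V from mfderiv 𝓘(ℂ, E) 𝓘(ℂ, V) f z).restrictScalars ℝ) :=
    ⟨h1.1, HasFDerivWithinAt.restrictScalars ℝ h1.2⟩
  exact congrArg (fun L : E →L[ℝ] V => L X) h2.mfderiv

variable [IsManifold 𝓘(ℂ, E) ω Z]

theorem dchart_real_eq {z₀ z : Z} (hz : z ∈ (chartAt E z₀).source) (X : E) :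
    dchart 𝓘(ℝ, E) z₀ z X = dchart 𝓘(ℂ, E) z₀ z X :=
  mvfderiv_real_eq (mdifferentiableAt_extChartAt hz) X

theorem dchart_smul {z₀ z : Z} (hz : z ∈ (chartAt E z₀).source) (a : ℂ) (X : E) :
    dchart 𝓘(ℝ, E) z₀ z (a • X : E) = a • dchart 𝓘(ℝ, E) z₀ z X := by
  rw [dchart_real_eq hz, dchart_real_eq hz]
  exact map_smul (show E →L[ℂ] E from dchart 𝓘(ℂ, E) z₀ z) a X

/-- The `(1, 0)`-part `∂F` of the differential of a real function `F`. -/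
def delForm (F : E → ℝ) (y : E) : E →L[ℝ] ℂ :=
  (1 / 2 : ℂ) • (Complex.ofRealCLM.comp (fderiv ℝ F y) -
    Complex.I • Complex.ofRealCLM.comp ((fderiv ℝ F y).comp
      ((Complex.I • ContinuousLinearMap.id ℂ E).restrictScalars ℝ)))

theorem delForm_apply (F : E → ℝ) (y x : E) : delForm F y x =
    (1 / 2) * ((fderiv ℝ F y x : ℂ) - Complex.I * (fderiv ℝ F y (Complex.I • x) : ℝ)) := rfl

theorem delForm_I (F : E → ℝ) (y x : E) :
    delForm F y (Complex.I • x) = Complex.I * delForm F y x := by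
  rw [delForm_apply, delForm_apply, smul_smul, Complex.I_mul_I, neg_one_smul, map_neg]
  push_cast
  linear_combination (1 / 2 * (fderiv ℝ F y (Complex.I • x) : ℂ)) * Complex.I_mul_I

/-- `∂ log |f|² = df / f` for a holomorphic function `f`. -/
theorem delForm_log_norm_sq {F : E → ℂ} {y : E} (hF : DifferentiableAt ℂ F y) (h0 : F y ≠ 0)
    (x : E) : delForm (fun y => Real.log (‖F y‖ ^ 2)) y x = fderiv ℂ F y x / F y := by
  have hFr : HasFDerivAt F ((fderiv ℂ F y).restrictScalars ℝ) y :=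
    hF.hasFDerivAt.restrictScalars ℝ
  have h1 : HasFDerivAt (fun y => Real.log (‖F y‖ ^ 2))
      ((‖F y‖ ^ 2)⁻¹ • (2 • (innerSL ℝ (F y)).comp ((fderiv ℂ F y).restrictScalars ℝ))) y :=
    hFr.norm_sq.log (pow_ne_zero 2 (norm_ne_zero_iff.2 h0))
  have h2 : ∀ x, fderiv ℝ (fun y => Real.log (‖F y‖ ^ 2)) y x =
      2 * (fderiv ℂ F y x / F y).re := by
    intro x
    rw [h1.fderiv]
    change (‖F y‖ ^ 2)⁻¹ * (2 • inner ℝ (F y) (fderiv ℂ F y x)) = _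
    rw [Complex.inner, Complex.div_re, ← Complex.normSq_eq_norm_sq, Complex.mul_re,
      Complex.conj_re, Complex.conj_im, nsmul_eq_mul]
    push_cast
    ring
  rw [delForm_apply, h2, h2, map_smul, smul_eq_mul, mul_div_assoc, Complex.I_mul_re]
  apply Complex.ext <;> simp

end ComplexManifold

namespace ComplexContactStructure

variable {n : ℕ} {E : Type*} [NormedAddCommGroup E] [NormedSpace ℂ E]
  {Z : Type*} [TopologicalSpace Z] [ChartedSpace E Z] [IsManifold 𝓘(ℂ, E) ω Z]
  {ι : Type*} (c : ComplexContactStructure n E Z ι)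

/-- The form `θ_i` in the chart at `z₀`. -/
def θLoc (i : ι) (z₀ : Z) (y : E) : E →L[ℝ] ℂ :=
  (chartForm 𝓘(ℂ, E) (c.θ i) z₀ y).restrictScalars ℝ

/-- The exterior derivative of `θ_i` in the chart at `z₀`. -/
def dθLoc (i : ι) (z₀ : Z) (y : E) : E →L[ℝ] E →L[ℝ] ℂ :=
  fderiv ℝ (c.θLoc i z₀) y - (fderiv ℝ (c.θLoc i z₀) y).flip

theorem contDiffAt_chartForm_θ {i : ι} {z₀ z : Z} (hi : z ∈ c.U i)
    (hz : z ∈ (chartAt E z₀).source) :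
    ContDiffAt ℂ ∞ (chartForm 𝓘(ℂ, E) (c.θ i) z₀) (extChartAt 𝓘(ℂ, E) z₀ z) :=
  contDiffAt_chartForm hz (((c.holomorphic_θ i).contMDiffAt ((c.isOpen_U i).mem_nhds hi)).of_le
    le_top)

theorem contDiffAt_θLoc {i : ι} {z₀ z : Z} (hi : z ∈ c.U i) (hz : z ∈ (chartAt E z₀).source) :
    ContDiffAt ℝ ∞ (c.θLoc i z₀) (extChartAt 𝓘(ℝ, E) z₀ z) :=
  (ContinuousLinearMap.restrictScalarsL ℂ E ℂ ℝ ℝ).contDiff.contDiffAt.comp _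
    ((c.contDiffAt_chartForm_θ hi hz).restrict_scalars ℝ)

theorem fderiv_θLoc {i : ι} {z₀ z : Z} (hi : z ∈ c.U i) (hz : z ∈ (chartAt E z₀).source) (x y : E) :
    fderiv ℝ (c.θLoc i z₀) (extChartAt 𝓘(ℝ, E) z₀ z) x y =
      fderiv ℂ (chartForm 𝓘(ℂ, E) (c.θ i) z₀) (extChartAt 𝓘(ℂ, E) z₀ z) x y := by
  have h1 := (((c.contDiffAt_chartForm_θ hi hz).differentiableAt
    (by simp)).hasFDerivAt.restrictScalars ℝ)
  have h2 := (ContinuousLinearMap.restrictScalarsL ℂ E ℂ ℝ ℝ).hasFDerivAt.comp _ h1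
  exact congrArg (fun L : E →L[ℝ] E →L[ℝ] ℂ => L x y) h2.fderiv

theorem θLoc_dchart {i : ι} {z₀ z : Z} (hz : z ∈ (chartAt E z₀).source) (X : E) :
    c.θLoc i z₀ (extChartAt 𝓘(ℝ, E) z₀ z) (dchart 𝓘(ℝ, E) z₀ z X) = c.θ i z X := by
  rw [dchart_real_eq hz]
  exact (form_eq_chartForm (I := 𝓘(ℂ, E)) (α := c.θ i) hz X).symm

theorem θLoc_smul (i : ι) (z₀ : Z) (y : E) (a : ℂ) (x : E) :
    c.θLoc i z₀ y (a • x) = a * c.θLoc i z₀ y x :=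
  map_smul (chartForm 𝓘(ℂ, E) (c.θ i) z₀ y) a x

/-- The expression of `dθ_i` in an arbitrary chart. -/
theorem dθLoc_dchart {i : ι} {z₀ z : Z} (hi : z ∈ c.U i) (hz : z ∈ (chartAt E z₀).source) (X Y : E) :
    c.dθLoc i z₀ (extChartAt 𝓘(ℝ, E) z₀ z) (dchart 𝓘(ℝ, E) z₀ z X) (dchart 𝓘(ℝ, E) z₀ z Y) =
      extD 𝓘(ℂ, E) (c.θ i) z X Y := by
  have hb : ContMDiffAt 𝓘(ℂ, E) 𝓘(ℂ, E) ∞ (extChartAt 𝓘(ℂ, E) z₀) z := contMDiffAt_extChartAt' hz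
  have hφ := c.contDiffAt_chartForm_θ hi hz
  have hA : ContMDiffAt 𝓘(ℂ, E) 𝓘(ℂ, E →L[ℂ] ℂ) ∞
      (fun x => chartForm 𝓘(ℂ, E) (c.θ i) z₀ (extChartAt 𝓘(ℂ, E) z₀ x)) z :=
    ContDiffAt.comp_contMDiffAt (f := extChartAt 𝓘(ℂ, E) z₀) hφ hb
  have hev : ∀ᶠ x in 𝓝 z, ∀ X, c.θ i x X = chartForm 𝓘(ℂ, E) (c.θ i) z₀
      (extChartAt 𝓘(ℂ, E) z₀ x) (mvfderiv 𝓘(ℂ, E) (extChartAt 𝓘(ℂ, E) z₀) x X) := by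
    filter_upwards [(chartAt E z₀).open_source.mem_nhds hz] with x hx X
    exact form_eq_chartForm hx X
  have hdA : ∀ T : E, mvfderiv 𝓘(ℂ, E) (fun x => chartForm 𝓘(ℂ, E) (c.θ i) z₀
      (extChartAt 𝓘(ℂ, E) z₀ x)) z T = fderiv ℂ (chartForm 𝓘(ℂ, E) (c.θ i) z₀)
        (extChartAt 𝓘(ℂ, E) z₀ z) (dchart 𝓘(ℂ, E) z₀ z T) := fun T =>
    mvfderiv_comp_fderiv (hφ.differentiableAt (by simp)) (mdifferentiableAt_extChartAt hz) T
  rw [extD_comp_mvfderiv hb hA hev X Y, hdA, hdA, dθLoc, sub_apply, sub_apply,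
    ContinuousLinearMap.flip_apply, c.fderiv_θLoc hi hz, c.fderiv_θLoc hi hz,
    dchart_real_eq hz, dchart_real_eq hz]
  rfl

theorem dθLoc_I {i : ι} {z₀ z : Z} (hi : z ∈ c.U i) (hz : z ∈ (chartAt E z₀).source) (x y : E) :
    c.dθLoc i z₀ (extChartAt 𝓘(ℝ, E) z₀ z) (Complex.I • x) y =
      Complex.I * c.dθLoc i z₀ (extChartAt 𝓘(ℝ, E) z₀ z) x y := by
  rw [dθLoc, sub_apply, sub_apply, ContinuousLinearMap.flip_apply, sub_apply, sub_apply,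
    ContinuousLinearMap.flip_apply]
  rw [c.fderiv_θLoc hi hz, c.fderiv_θLoc hi hz, c.fderiv_θLoc hi hz, c.fderiv_θLoc hi hz,
    map_smul, map_smul, smul_apply, smul_eq_mul, smul_eq_mul, mul_sub]

theorem eq_zero_of_dθLoc [FiniteDimensional ℂ E] (hE : Module.finrank ℂ E = 2 * n + 1)
    {i : ι} {z₀ z : Z} (hi : z ∈ c.U i) (hz : z ∈ (chartAt E z₀).source) (x : E)
    (hx : c.θLoc i z₀ (extChartAt 𝓘(ℝ, E) z₀ z) x = 0)
    (hx' : ∀ y, c.θLoc i z₀ (extChartAt 𝓘(ℝ, E) z₀ z) y = 0 →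
      c.dθLoc i z₀ (extChartAt 𝓘(ℝ, E) z₀ z) x y = 0) : x = 0 := by
  have hsurj : ∀ x : E, ∃ X : E, dchart 𝓘(ℝ, E) z₀ z X = x := fun x =>
    ⟨dchartSymm 𝓘(ℝ, E) z₀ z x, dchart_dchartSymm hz x⟩
  obtain ⟨X, rfl⟩ := hsurj x
  rw [c.θLoc_dchart hz] at hx
  let D : E →L[ℂ] E →L[ℂ] ℂ := fderivWithin ℂ (chartForm 𝓘(ℂ, E) (c.θ i) z) (range 𝓘(ℂ, E))
    (extChartAt 𝓘(ℂ, E) z z)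
  let T : E →L[ℂ] E := mvfderiv 𝓘(ℂ, E) (extChartAt 𝓘(ℂ, E) z) z
  let β : E →ₗ[ℂ] E →ₗ[ℂ] ℂ := LinearMap.mk₂ ℂ (fun X Y => D (T X) (T Y) - D (T Y) (T X))
    (by intros; simp only [map_add, add_apply]; ring)
    (by intros; simp only [map_smul, smul_apply, smul_eq_mul]; ring)
    (by intros; simp only [map_add, add_apply]; ring)
    (by intros; simp only [map_smul, smul_apply, smul_eq_mul]; ring)
  have hβ : ∀ X Y : E, β X Y = extD 𝓘(ℂ, E) (c.θ i) z X Y := fun X Y => rfl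
  have hX : X = 0 := by
    refine nondegenerate_of_wedgePow_ne_zero (show E →L[ℂ] ℂ from c.θ i z).toLinearMap β
      (fun X Y => ?_) n hE (c.nondegenerate i z hi) X hx fun Y hY => ?_
    · rw [LinearMap.mk₂_apply, LinearMap.mk₂_apply, neg_sub]
    · rw [hβ, ← c.dθLoc_dchart hi hz]
      exact hx' _ ((c.θLoc_dchart hz Y).trans hY)
  rw [hX]
  exact map_zero _

end ComplexContactStructure

/-! ### Smooth families of adapted structures -/

theorem contDiff_flip {E F : Type*} [NormedAddCommGroup E] [NormedSpace ℝ E]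
    [NormedAddCommGroup F] [NormedSpace ℝ F] :
    ContDiff ℝ ∞ (fun L : E →L[ℝ] E →L[ℝ] F => L.flip) := by
  refine IsBoundedLinearMap.contDiff (f := fun L : E →L[ℝ] E →L[ℝ] F => L.flip)
    ⟨⟨fun _ _ => rfl, fun _ _ => rfl⟩, 1, one_pos, fun L => ?_⟩
  rw [one_mul, ContinuousLinearMap.opNorm_flip]

theorem contDiffAt_flip {E E' F : Type*} [NormedAddCommGroup E] [NormedSpace ℝ E]
    [NormedAddCommGroup E'] [NormedSpace ℝ E'] [NormedAddCommGroup F] [NormedSpace ℝ F]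
    {f : E' → E →L[ℝ] E →L[ℝ] F} {y : E'} (hf : ContDiffAt ℝ ∞ f y) :
    ContDiffAt ℝ ∞ (fun x => (f x).flip) y :=
  ContDiffAt.comp (g := fun L : E →L[ℝ] E →L[ℝ] F => L.flip) (f := f) y
    contDiff_flip.contDiffAt hf

section SmoothFamily

variable {E : Type*} [NormedAddCommGroup E] [NormedSpace ℂ E]
  {EM : Type*} [NormedAddCommGroup EM] [NormedSpace ℝ EM]
  {HM : Type*} [TopologicalSpace HM] {I : ModelWithCorners ℝ EM HM}
  {M : Type*} [TopologicalSpace M] [ChartedSpace HM M] {x₀ : M}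
  {g₀ : M → E →L[ℝ] E →L[ℝ] ℝ} {θ a b : M → E →L[ℝ] ℂ} {ψ : M → E →L[ℝ] E →L[ℝ] ℂ} {r : M → ℝ}
  {p : M → E →L[ℝ] E} {v : M → E}

theorem contMDiffAt_reBilin (hψ : ContMDiffAt I 𝓘(ℝ, E →L[ℝ] E →L[ℝ] ℂ) ∞ ψ x₀) :
    ContMDiffAt I 𝓘(ℝ, E →L[ℝ] E →L[ℝ] ℝ) ∞ (fun x => reBilin (ψ x)) x₀ :=
  contMDiffAt_const.clm_comp hψ

theorem contMDiffAt_outer (ha : ContMDiffAt I 𝓘(ℝ, E →L[ℝ] ℂ) ∞ a x₀)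
    (hb : ContMDiffAt I 𝓘(ℝ, E →L[ℝ] ℂ) ∞ b x₀) :
    ContMDiffAt I 𝓘(ℝ, E →L[ℝ] E →L[ℝ] ℂ) ∞ (fun x => outer (a x) (b x)) x₀ :=
  (hb.clm_precomp (F₃ := ℂ)).clm_comp
    ((contMDiffAt_const (c := ContinuousLinearMap.mul ℝ ℂ)).clm_comp ha)

theorem contMDiffAt_pullBilin (hg : ContMDiffAt I 𝓘(ℝ, E →L[ℝ] E →L[ℝ] ℝ) ∞ g₀ x₀)
    (hp : ContMDiffAt I 𝓘(ℝ, E →L[ℝ] E) ∞ p x₀) :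
    ContMDiffAt I 𝓘(ℝ, E →L[ℝ] E →L[ℝ] ℝ) ∞ (fun x => pullBilin (g₀ x) (p x)) x₀ :=
  (hp.clm_precomp (F₃ := ℝ)).clm_comp (hg.clm_comp hp)

theorem contMDiffAt_vertPart (hθ : ContMDiffAt I 𝓘(ℝ, E →L[ℝ] ℂ) ∞ θ x₀)
    (hv : ContMDiffAt I 𝓘(ℝ, E) ∞ v x₀) :
    ContMDiffAt I 𝓘(ℝ, E →L[ℝ] E) ∞ (fun x => vertPart (θ x) (v x)) x₀ :=
  ((contMDiffAt_const (c := (ContinuousLinearMap.lsmul ℝ ℂ).flip)).clm_apply hv).clm_comp hθ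

theorem contMDiffAt_adaptedInner (hg : ContMDiffAt I 𝓘(ℝ, E →L[ℝ] E →L[ℝ] ℝ) ∞ g₀ x₀)
    (hθ : ContMDiffAt I 𝓘(ℝ, E →L[ℝ] ℂ) ∞ θ x₀) (hv : ContMDiffAt I 𝓘(ℝ, E) ∞ v x₀)
    (hr : ContMDiffAt I 𝓘(ℝ, ℝ) ∞ r x₀) :
    ContMDiffAt I 𝓘(ℝ, E →L[ℝ] E →L[ℝ] ℝ) ∞
      (fun x => adaptedInner (g₀ x) (θ x) (v x) (r x)) x₀ :=
  ((hr.pow 2).smul (contMDiffAt_reBilin (contMDiffAt_outer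
    ((contMDiffAt_const (c := (Complex.conjCLE : ℂ →L[ℝ] ℂ))).clm_comp hθ) hθ))).add
    (contMDiffAt_pullBilin hg (contMDiffAt_const.sub (contMDiffAt_vertPart hθ hv)))

variable [FiniteDimensional ℂ E]

theorem contMDiffAt_reeb (hθ : ContMDiffAt I 𝓘(ℝ, E →L[ℝ] ℂ) ∞ θ x₀)
    (hψ : ContMDiffAt I 𝓘(ℝ, E →L[ℝ] E →L[ℝ] ℂ) ∞ ψ x₀)
    (D : IsDatum (g₀ x₀) (θ x₀) (ψ x₀) (r x₀)) :
    ContMDiffAt I 𝓘(ℝ, E) ∞ (fun x => reeb (θ x) (ψ x)) x₀ := by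
  have h1 : ContMDiffAt I 𝓘(ℝ, E →L[ℝ] E →L[ℝ] ℝ) ∞ (fun x => reebForm (θ x) (ψ x)) x₀ :=
    contMDiffAt_reBilin (hψ.add (contMDiffAt_outer hθ hθ))
  have h2 : ContMDiffAt I 𝓘(ℝ, (E →L[ℝ] ℝ) →L[ℝ] E) ∞
      (fun x => (reebForm (θ x) (ψ x)).inverse) x₀ :=
    ContDiffAt.comp_contMDiffAt (g := ContinuousLinearMap.inverse)
      (f := fun x => reebForm (θ x) (ψ x)) (contDiffAt_inverse D.reebForm_isInvertible) h1
  exact h2.clm_apply ((contMDiffAt_const (c := Complex.reCLM)).clm_comp hθ)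

theorem contMDiffAt_skewOp (hg : ContMDiffAt I 𝓘(ℝ, E →L[ℝ] E →L[ℝ] ℝ) ∞ g₀ x₀)
    (hψ : ContMDiffAt I 𝓘(ℝ, E →L[ℝ] E →L[ℝ] ℂ) ∞ ψ x₀) (hr : ContMDiffAt I 𝓘(ℝ, ℝ) ∞ r x₀)
    (h : IsInner (g₀ x₀)) :
    ContMDiffAt I 𝓘(ℝ, E →L[ℝ] E) ∞ (fun x => skewOp (g₀ x) (ψ x) (r x)) x₀ := by
  have h2 : ContMDiffAt I 𝓘(ℝ, (E →L[ℝ] ℝ) →L[ℝ] E) ∞ (fun x => (g₀ x).inverse) x₀ :=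
    ContDiffAt.comp_contMDiffAt (g := ContinuousLinearMap.inverse) (f := g₀)
      (contDiffAt_inverse h.isInvertible) hg
  exact h2.clm_comp (hr.smul (contMDiffAt_reBilin hψ))

/-- The adapted metric and operator depend smoothly on the data. -/
theorem contMDiffAt_hk (hg : ContMDiffAt I 𝓘(ℝ, E →L[ℝ] E →L[ℝ] ℝ) ∞ g₀ x₀)
    (hθ : ContMDiffAt I 𝓘(ℝ, E →L[ℝ] ℂ) ∞ θ x₀)
    (hψ : ContMDiffAt I 𝓘(ℝ, E →L[ℝ] E →L[ℝ] ℂ) ∞ ψ x₀) (hr : ContMDiffAt I 𝓘(ℝ, ℝ) ∞ r x₀)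
    (D : ∀ᶠ x in 𝓝 x₀, IsDatum (g₀ x) (θ x) (ψ x) (r x)) :
    ContMDiffAt I 𝓘(ℝ, E →L[ℝ] E →L[ℝ] ℝ) ∞
      (fun x => hkMetric (g₀ x) (θ x) (ψ x) (r x)) x₀ ∧
    ContMDiffAt I 𝓘(ℝ, E →L[ℝ] E) ∞ (fun x => hkOp (g₀ x) (θ x) (ψ x) (r x)) x₀ := by
  have D₀ := D.self_of_nhds
  have hv := contMDiffAt_reeb hθ hψ D₀
  have hG := contMDiffAt_adaptedInner hg hθ hv hr
  have hA := contMDiffAt_skewOp hG hψ hr (D₀.isInner_adapted D₀.reeb_spec.1)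
  have hB : ContMDiffAt I 𝓘(ℝ, E →L[ℝ] E) ∞ (fun x =>
      sqOp (skewOp (adaptedInner (g₀ x) (θ x) (reeb (θ x) (ψ x)) (r x)) (ψ x) (r x)) (θ x)
        (reeb (θ x) (ψ x))) x₀ :=
    (contMDiffAt_vertPart hθ hv).sub (hA.clm_comp hA)
  obtain ⟨S, hS, hSe⟩ := exists_contDiffAt_posSqrt hG.continuousAt hB.continuousAt
    (D.mono fun x D => D.isInner_adapted D.reeb_spec.1)
    (D.mono fun x D => D.isPosOp_sqOp D.reeb_spec.1 D.reeb_spec.2)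
  have hP : ContMDiffAt I 𝓘(ℝ, E →L[ℝ] E) ∞ (fun x =>
      posSqrt (adaptedInner (g₀ x) (θ x) (reeb (θ x) (ψ x)) (r x))
        (sqOp (skewOp (adaptedInner (g₀ x) (θ x) (reeb (θ x) (ψ x)) (r x)) (ψ x) (r x)) (θ x)
          (reeb (θ x) (ψ x)))) x₀ :=
    (ContDiffAt.comp_contMDiffAt (g := S) (f := fun x =>
      sqOp (skewOp (adaptedInner (g₀ x) (θ x) (reeb (θ x) (ψ x)) (r x)) (ψ x) (r x)) (θ x)
        (reeb (θ x) (ψ x))) hS hB).congr_of_eventuallyEq hSe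
  have hPinv := (posSqrt_spec (D₀.isInner_adapted D₀.reeb_spec.1)
    (D₀.isPosOp_sqOp D₀.reeb_spec.1 D₀.reeb_spec.2)).1.isInvertible
  refine ⟨hG.clm_comp hP, ContMDiffAt.clm_comp ?_ hA⟩
  exact ContDiffAt.comp_contMDiffAt (g := ContinuousLinearMap.inverse)
    (f := fun x => posSqrt (adaptedInner (g₀ x) (θ x) (reeb (θ x) (ψ x)) (r x))
        (sqOp (skewOp (adaptedInner (g₀ x) (θ x) (reeb (θ x) (ψ x)) (r x)) (ψ x) (r x)) (θ x)
          (reeb (θ x) (ψ x)))) (contDiffAt_inverse hPinv) hP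

end SmoothFamily

/-! ### The curvature-corrected differential of the contact form -/

theorem contDiffAt_delForm {E : Type*} [NormedAddCommGroup E] [NormedSpace ℂ E] {F : E → ℝ}
    {y : E} (hF : ContDiffAt ℝ ∞ F y) :
    ContDiffAt ℝ ∞ (delForm F) y := by
  have h1 : ContDiffAt ℝ ∞ (fderiv ℝ F) y := hF.fderiv_right (by simp)
  exact ((contDiffAt_const.clm_comp h1).sub
    ((contDiffAt_const.clm_comp (h1.clm_comp contDiffAt_const)).const_smul _)).const_smul _

namespace ComplexContactStructure.HermitianStructure

variable {n : ℕ} {E : Type*} [NormedAddCommGroup E] [NormedSpace ℂ E]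
  {Z : Type*} [TopologicalSpace Z] [ChartedSpace E Z] [IsManifold 𝓘(ℂ, E) ω Z]
  {ι : Type*} {c : ComplexContactStructure n E Z ι} (h : c.HermitianStructure)

/-- The function `log h_i` in the chart at `z₀`. -/
def logWeight (i : ι) (z₀ : Z) (y : E) : ℝ :=
  Real.log (h.weight i ((extChartAt 𝓘(ℝ, E) z₀).symm y))

/-- The form `ψ_i = dθ_i - ∂ log h_i ∧ θ_i` in the chart at `z₀`. -/
def ψLoc (i : ι) (z₀ : Z) (y : E) : E →L[ℝ] E →L[ℝ] ℂ :=
  c.dθLoc i z₀ y - (outer (delForm (h.logWeight i z₀) y) (c.θLoc i z₀ y) -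
    outer (c.θLoc i z₀ y) (delForm (h.logWeight i z₀) y))

/-- The length of the fibre coordinate `z_i` on `Q(L)`. -/
def radius (i : ι) (z : Z) : ℝ := (√(h.weight i z))⁻¹

theorem radius_pos {i : ι} {z : Z} (hi : z ∈ c.U i) : 0 < h.radius i z :=
  inv_pos.2 (Real.sqrt_pos.2 (h.weight_pos hi))

theorem contMDiffAt_weight {i : ι} {z : Z} (hi : z ∈ c.U i) :
    ContMDiffAt 𝓘(ℝ, E) 𝓘(ℝ, ℝ) ∞ (h.weight i) z :=
  (h.smooth i).contMDiffAt ((c.isOpen_U i).mem_nhds hi)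

theorem contMDiffAt_log_weight {i : ι} {z : Z} (hi : z ∈ c.U i) :
    ContMDiffAt 𝓘(ℝ, E) 𝓘(ℝ, ℝ) ∞ (fun z => Real.log (h.weight i z)) z :=
  ContDiffAt.comp_contMDiffAt (g := Real.log) (f := h.weight i)
    (Real.contDiffAt_log.2 (h.weight_pos hi).ne') (h.contMDiffAt_weight hi)

theorem contMDiffAt_radius {i : ι} {z : Z} (hi : z ∈ c.U i) :
    ContMDiffAt 𝓘(ℝ, E) 𝓘(ℝ, ℝ) ∞ (h.radius i) z := by
  have h1 : ContDiffAt ℝ ∞ (fun t : ℝ => (√t)⁻¹) (h.weight i z) :=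
    (Real.contDiffAt_sqrt (h.weight_pos hi).ne').inv (Real.sqrt_pos.2 (h.weight_pos hi)).ne'
  exact ContDiffAt.comp_contMDiffAt (f := h.weight i) h1 (h.contMDiffAt_weight hi)

theorem contDiffAt_logWeight {i : ι} {z₀ z : Z} (hi : z ∈ c.U i)
    (hz : z ∈ (chartAt E z₀).source) :
    ContDiffAt ℝ ∞ (h.logWeight i z₀) (extChartAt 𝓘(ℝ, E) z₀ z) :=
  contDiffAt_comp_extChartAt_symm (n := ⊤) hz (h.contMDiffAt_log_weight hi)

theorem contDiffAt_ψLoc {i : ι} {z₀ z : Z} (hi : z ∈ c.U i) (hz : z ∈ (chartAt E z₀).source) :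
    ContDiffAt ℝ ∞ (h.ψLoc i z₀) (extChartAt 𝓘(ℝ, E) z₀ z) := by
  have h1 := c.contDiffAt_θLoc hi hz
  have h2 : ContDiffAt ℝ ∞ (fderiv ℝ (c.θLoc i z₀)) (extChartAt 𝓘(ℝ, E) z₀ z) :=
    h1.fderiv_right (by simp)
  have h3 := contDiffAt_delForm (h.contDiffAt_logWeight hi hz)
  have h4 : ContDiffAt ℝ ∞ (fun y => (fderiv ℝ (c.θLoc i z₀) y).flip)
      (extChartAt 𝓘(ℝ, E) z₀ z) :=
    contDiffAt_flip h2
  exact (h2.sub h4).sub ((contMDiffAt_outer h3.contMDiffAt h1.contMDiffAt).contDiffAt.sub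
    (contMDiffAt_outer h1.contMDiffAt h3.contMDiffAt).contDiffAt)

/-- `ψ_i` is complex bilinear and nondegenerate on `ker θ_i`. -/
theorem isDatum [FiniteDimensional ℂ E] (hE : Module.finrank ℂ E = 2 * n + 1)
    {i : ι} {z₀ z : Z} (hi : z ∈ c.U i) (hz : z ∈ (chartAt E z₀).source)
    {g : E →L[ℝ] E →L[ℝ] ℝ} (hg : IsInner g)
    (hgI : ∀ x y, g (Complex.I • x) (Complex.I • y) = g x y) :
    IsDatum g (c.θLoc i z₀ (extChartAt 𝓘(ℝ, E) z₀ z)) (h.ψLoc i z₀ (extChartAt 𝓘(ℝ, E) z₀ z))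
      (h.radius i z) where
  inner := hg
  inner_I := hgI
  θ_I x := c.θLoc_smul i z₀ _ Complex.I x
  alt x y := by
    simp only [ψLoc, ComplexContactStructure.dθLoc, sub_apply, outer_apply,
      ContinuousLinearMap.flip_apply]
    ring
  ψ_I x y := by
    simp only [ψLoc, sub_apply, outer_apply, c.dθLoc_I hi hz, delForm_I, c.θLoc_smul]
    ring
  nondegenerate x hx hx' := by
    refine c.eq_zero_of_dθLoc hE hi hz x hx fun y hy => ?_
    have := hx' y hy
    simp only [ψLoc, sub_apply, outer_apply, hx, hy, mul_zero, zero_mul, sub_zero] at this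
    exact this
  exists_ne := by
    obtain ⟨v, hv⟩ := c.exists_θ_ne_zero hi
    exact ⟨dchart 𝓘(ℝ, E) z₀ z (show E from v), fun h0 => hv ((c.θLoc_dchart hz _).symm.trans h0)⟩
  r_pos := h.radius_pos hi

/-- The law `h_i = h_j |f_ij|²`. -/
theorem weight_eq {i j : ι} {z : Z} (hi : z ∈ c.U i) (hj : z ∈ c.U j) :
    h.weight i z = h.weight j z * ‖c.f i j z‖ ^ 2 := by
  have h1 : c.frame i z = c.f i j z • c.frame j z := by
    rw [frame_eq, frame_eq]
    exact (c.f_comp hi hj (c.L.mem_baseSet_at z)).symm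
  have h2 := h.inner_smul_frame j z (c.f i j z)
  rw [← h1] at h2
  have h3 := congrArg Complex.re h2
  rw [Complex.ofReal_re] at h3
  rw [weight, h3, mul_comm]

theorem radius_mul {i j : ι} {z : Z} (hi : z ∈ c.U i) (hj : z ∈ c.U j) :
    h.radius i z * ‖c.f i j z‖ = h.radius j z := by
  have hf : ‖c.f i j z‖ ≠ 0 := norm_ne_zero_iff.2 (c.f_ne_zero i j z ⟨hi, hj⟩)
  have hw : √(h.weight j z) ≠ 0 := (Real.sqrt_pos.2 (h.weight_pos hj)).ne'
  rw [radius, radius, h.weight_eq hi hj, Real.sqrt_mul (h.weight_pos hj).le,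
    Real.sqrt_sq (norm_nonneg _)]
  field_simp

/-- The transition function `f_ij` in the chart at `z₀`. -/
theorem differentiableAt_f {i j : ι} {z₀ z : Z} (hi : z ∈ c.U i) (hj : z ∈ c.U j)
    (hz : z ∈ (chartAt E z₀).source) :
    DifferentiableAt ℂ (c.f i j ∘ (extChartAt 𝓘(ℝ, E) z₀).symm) (extChartAt 𝓘(ℝ, E) z₀ z) := by
  have h1 : ContMDiffAt 𝓘(ℂ, E) 𝓘(ℂ, ℂ) ∞ (c.f i j) z :=
    ((c.holomorphic_f i j).contMDiffAt
      (((c.isOpen_U i).inter (c.isOpen_U j)).mem_nhds ⟨hi, hj⟩)).of_le le_top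
  exact (contDiffAt_comp_extChartAt_symm (I := 𝓘(ℂ, E)) (n := ⊤) hz h1).differentiableAt (by simp)

theorem eventually_mem_U {i : ι} {z₀ z : Z} (hi : z ∈ c.U i) (hz : z ∈ (chartAt E z₀).source) :
    ∀ᶠ y in 𝓝 (extChartAt 𝓘(ℝ, E) z₀ z), (extChartAt 𝓘(ℝ, E) z₀).symm y ∈ c.U i ∧
      (extChartAt 𝓘(ℝ, E) z₀).symm y ∈ (chartAt E z₀).source ∧
      extChartAt 𝓘(ℝ, E) z₀ ((extChartAt 𝓘(ℝ, E) z₀).symm y) = y := by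
  have hz' : z ∈ (extChartAt 𝓘(ℝ, E) z₀).source := by rwa [extChartAt_source]
  have hc : Filter.Tendsto (extChartAt 𝓘(ℝ, E) z₀).symm (𝓝 (extChartAt 𝓘(ℝ, E) z₀ z)) (𝓝 z) := by
    have := continuousAt_extChartAt_symm' (I := 𝓘(ℝ, E)) hz'
    rwa [ContinuousAt, (extChartAt 𝓘(ℝ, E) z₀).left_inv hz'] at this
  filter_upwards [hc.eventually ((c.isOpen_U i).mem_nhds hi),
    hc.eventually ((chartAt E z₀).open_source.mem_nhds hz),
    extChartAt_target_mem_nhds' ((extChartAt 𝓘(ℝ, E) z₀).map_source hz')] with y h1 h2 h3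
  exact ⟨h1, h2, (extChartAt 𝓘(ℝ, E) z₀).right_inv h3⟩

theorem θLoc_change {i j : ι} {z₀ z : Z} (hi : z ∈ c.U i) (hj : z ∈ c.U j)
    (hz : z ∈ (chartAt E z₀).source) (x : E) :
    c.θLoc i z₀ (extChartAt 𝓘(ℝ, E) z₀ z) x =
      c.f i j z * c.θLoc j z₀ (extChartAt 𝓘(ℝ, E) z₀ z) x := by
  obtain ⟨X, rfl⟩ : ∃ X : E, dchart 𝓘(ℝ, E) z₀ z X = x :=
    ⟨dchartSymm 𝓘(ℝ, E) z₀ z x, dchart_dchartSymm hz x⟩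
  rw [c.θLoc_dchart hz, c.θLoc_dchart hz, c.θ_eq i j z ⟨hi, hj⟩]
  rfl

/-- The law `∂ log h_i = ∂ log h_j + d log f_ij`. -/
theorem delForm_change {i j : ι} {z₀ z : Z} (hi : z ∈ c.U i) (hj : z ∈ c.U j)
    (hz : z ∈ (chartAt E z₀).source) (x : E) :
    delForm (h.logWeight i z₀) (extChartAt 𝓘(ℝ, E) z₀ z) x =
      delForm (h.logWeight j z₀) (extChartAt 𝓘(ℝ, E) z₀ z) x +
        fderiv ℂ (c.f i j ∘ (extChartAt 𝓘(ℝ, E) z₀).symm) (extChartAt 𝓘(ℝ, E) z₀ z) x /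
          c.f i j z := by
  set φ := extChartAt 𝓘(ℝ, E) z₀ with hφ
  set F : E → ℂ := c.f i j ∘ φ.symm with hFdef
  have hz' : z ∈ φ.source := by rwa [hφ, extChartAt_source]
  have hFz : F (φ z) = c.f i j z := congrArg (c.f i j) (φ.left_inv hz')
  have hF := differentiableAt_f hi hj hz
  rw [← hφ, ← hFdef] at hF
  have hF0 : F (φ z) ≠ 0 := by rw [hFz]; exact c.f_ne_zero i j z ⟨hi, hj⟩
  have hL : h.logWeight i z₀ =ᶠ[𝓝 (φ z)] fun y => h.logWeight j z₀ y + Real.log (‖F y‖ ^ 2) := by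
    filter_upwards [eventually_mem_U hi hz, eventually_mem_U hj hz] with y h1 h2
    rw [logWeight, h.weight_eq h1.1 h2.1, Real.log_mul (h.weight_pos h2.1).ne'
      (pow_ne_zero 2 (norm_ne_zero_iff.2 (c.f_ne_zero i j _ ⟨h1.1, h2.1⟩)))]
    rfl
  have hlogF : DifferentiableAt ℝ (fun y => Real.log (‖F y‖ ^ 2)) (φ z) :=
    ((hF.restrictScalars ℝ).norm_sq ℝ).log (pow_ne_zero 2 (norm_ne_zero_iff.2 hF0))
  have hLj : DifferentiableAt ℝ (h.logWeight j z₀) (φ z) :=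
    (h.contDiffAt_logWeight hj hz).differentiableAt (by simp)
  rw [← hFz, ← delForm_log_norm_sq hF hF0, delForm_apply, delForm_apply, delForm_apply,
    hL.fderiv_eq, fderiv_fun_add hLj hlogF, add_apply, add_apply]
  push_cast
  ring

/-- The law `ψ_i = f_ij ψ_j`: the correction by `∂ log h_i` makes the differential of the contact
form a tensor with values in the contact line bundle. -/
theorem ψLoc_change {i j : ι} {z₀ z : Z} (hi : z ∈ c.U i) (hj : z ∈ c.U j)
    (hz : z ∈ (chartAt E z₀).source) (x y : E) :
    h.ψLoc i z₀ (extChartAt 𝓘(ℝ, E) z₀ z) x y =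
      c.f i j z * h.ψLoc j z₀ (extChartAt 𝓘(ℝ, E) z₀ z) x y := by
  have hdel := h.delForm_change hi hj hz
  have hθz := θLoc_change hi hj hz
  set φ := extChartAt 𝓘(ℝ, E) z₀ with hφ
  set F : E → ℂ := c.f i j ∘ φ.symm with hFdef
  have hz' : z ∈ φ.source := by rwa [hφ, extChartAt_source]
  have hFz : F (φ z) = c.f i j z := congrArg (c.f i j) (φ.left_inv hz')
  have hF := differentiableAt_f hi hj hz
  rw [← hφ, ← hFdef] at hF
  have hF0 : c.f i j z ≠ 0 := c.f_ne_zero i j z ⟨hi, hj⟩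
  have hθ : c.θLoc i z₀ =ᶠ[𝓝 (φ z)] fun y => F y • c.θLoc j z₀ y := by
    filter_upwards [eventually_mem_U hi hz, eventually_mem_U hj hz] with y h1 h2
    ext x
    have h3 := θLoc_change h1.1 h2.1 h1.2.1 x
    rw [h1.2.2] at h3
    exact h3
  have hFr' : ∀ x, fderiv ℝ F (φ z) x = fderiv ℂ F (φ z) x := fun x =>
    congrArg (fun L : E →L[ℝ] ℂ => L x) (hF.fderiv_restrictScalars ℝ)
  have hθj : DifferentiableAt ℝ (c.θLoc j z₀) (φ z) :=
    (c.contDiffAt_θLoc hj hz).differentiableAt (by simp)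
  have hdθ : ∀ x y, fderiv ℝ (c.θLoc i z₀) (φ z) x y =
      c.f i j z * fderiv ℝ (c.θLoc j z₀) (φ z) x y +
        fderiv ℂ F (φ z) x * c.θLoc j z₀ (φ z) y := by
    intro x y
    rw [hθ.fderiv_eq, fderiv_fun_smul (hF.restrictScalars ℝ) hθj, ← hFr', ← hFz]
    rfl
  simp only [ψLoc, ComplexContactStructure.dθLoc, sub_apply, outer_apply,
    ContinuousLinearMap.flip_apply, hdθ, hdel, hθz]
  field_simp
  ring

/-- The differential of `log h_i` in an arbitrary chart. -/
theorem fderiv_logWeight {i : ι} {z₀ z : Z} (hi : z ∈ c.U i) (hz : z ∈ (chartAt E z₀).source)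
    (X : TangentSpace 𝓘(ℝ, E) z) :
    fderiv ℝ (h.logWeight i z₀) (extChartAt 𝓘(ℝ, E) z₀ z) (dchart 𝓘(ℝ, E) z₀ z X) =
      mvfderiv 𝓘(ℝ, E) (fun z => Real.log (h.weight i z)) z X :=
  (mvfderiv_eq_fderiv_comp hz ((h.contMDiffAt_log_weight hi).of_le ENat.LEInfty.out) X).symm

theorem delForm_logWeight {i : ι} {z₀ z : Z} (hi : z ∈ c.U i) (hz : z ∈ (chartAt E z₀).source)
    (X : E) :
    delForm (h.logWeight i z₀) (extChartAt 𝓘(ℝ, E) z₀ z) (dchart 𝓘(ℝ, E) z₀ z X) =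
      delForm (h.logWeight i z) (extChartAt 𝓘(ℝ, E) z z) (dchart 𝓘(ℝ, E) z z X) := by
  have hzz := mem_chart_source E z
  have e1 : ∀ X : E, fderiv ℝ (h.logWeight i z₀) (extChartAt 𝓘(ℝ, E) z₀ z)
      (dchart 𝓘(ℝ, E) z₀ z X) = fderiv ℝ (h.logWeight i z) (extChartAt 𝓘(ℝ, E) z z)
      (dchart 𝓘(ℝ, E) z z X) := fun X =>
    (h.fderiv_logWeight hi hz X).trans (h.fderiv_logWeight hi hzz X).symm
  rw [delForm_apply, delForm_apply, ← dchart_smul hz, ← dchart_smul hzz, e1, e1]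

theorem ψLoc_dchart {i : ι} {z₀ z : Z} (hi : z ∈ c.U i) (hz : z ∈ (chartAt E z₀).source)
    (X Y : E) :
    h.ψLoc i z₀ (extChartAt 𝓘(ℝ, E) z₀ z) (dchart 𝓘(ℝ, E) z₀ z X) (dchart 𝓘(ℝ, E) z₀ z Y) =
      h.ψLoc i z (extChartAt 𝓘(ℝ, E) z z) X Y := by
  have hzz := mem_chart_source E z
  have hs : ∀ X : E, dchart 𝓘(ℝ, E) z z X = X := fun X => dchart_self z X
  conv_rhs => rw [← hs X, ← hs Y]
  simp only [ψLoc, sub_apply, outer_apply]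
  rw [c.dθLoc_dchart hi hz, c.dθLoc_dchart hi hzz, h.delForm_logWeight hi hz,
    h.delForm_logWeight hi hz, c.θLoc_dchart hz, c.θLoc_dchart hz, c.θLoc_dchart hzz,
    c.θLoc_dchart hzz]

end ComplexContactStructure.HermitianStructure

/-! ### The circle bundle -/

theorem mvfderiv_prodMk_space {𝕜 : Type*} [NontriviallyNormedField 𝕜]
    {EM : Type*} [NormedAddCommGroup EM] [NormedSpace 𝕜 EM]
    {HM : Type*} [TopologicalSpace HM] {I : ModelWithCorners 𝕜 EM HM}
    {M : Type*} [TopologicalSpace M] [ChartedSpace HM M]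
    {V : Type*} [NormedAddCommGroup V] [NormedSpace 𝕜 V]
    {W : Type*} [NormedAddCommGroup W] [NormedSpace 𝕜 W] {f : M → V} {g : M → W} {x : M}
    (hf : MDifferentiableAt I 𝓘(𝕜, V) f x) (hg : MDifferentiableAt I 𝓘(𝕜, W) g x)
    (X : TangentSpace I x) :
    mvfderiv I (fun x => (f x, g x)) x X = (mvfderiv I f x X, mvfderiv I g x X) := by
  have hb := hf.prodMk_space hg
  have h1 := mvfderiv_comp_fderiv (f := (ContinuousLinearMap.fst 𝕜 V W))
    (ContinuousLinearMap.differentiableAt _) hb X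
  have h2 := mvfderiv_comp_fderiv (f := (ContinuousLinearMap.snd 𝕜 V W))
    (ContinuousLinearMap.differentiableAt _) hb X
  rw [ContinuousLinearMap.fderiv] at h1 h2
  exact Prod.ext h1.symm h2.symm

namespace ComplexContactStructure.HermitianStructure

variable {n : ℕ} {E : Type*} [NormedAddCommGroup E] [NormedSpace ℂ E]
  {Z : Type*} [TopologicalSpace Z] [ChartedSpace E Z] [IsManifold 𝓘(ℂ, E) ω Z]
  {ι : Type*} {c : ComplexContactStructure n E Z ι} (h : c.HermitianStructure)

theorem contMDiffAt_triv (i : ι) {q : h.Q} (hi : h.proj q ∈ c.U i) :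
    ContMDiffAt (𝓘(ℝ, E).prod (𝓡 1)) (𝓘(ℝ, E).prod (𝓡 1)) ∞
      (fun q => (h.proj q, h.phase i q)) q := by
  -- the charts of `Q(L)` are built from the trivialisations over the sets `U_j` of `indexAt`
  set j := c.L.indexAt (h.proj q)
  have hj : h.proj q ∈ c.U j := c.L.mem_baseSet_at _
  have hself : ContMDiffAt (𝓘(ℝ, E).prod (𝓡 1)) (𝓘(ℝ, E).prod (𝓡 1)) ∞
      (fun q => (h.proj q, h.phase j q)) q := by
    set e := chartAt (ModelProd E (EuclideanSpace ℝ (Fin 1))) (h.proj q, h.phase j q) with he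
    have h1 : ContMDiffAt (𝓘(ℝ, E).prod (𝓡 1)) (𝓘(ℝ, E).prod (𝓡 1)) ∞
        (chartAt (ModelProd E (EuclideanSpace ℝ (Fin 1))) q) q :=
      contMDiffOn_chart.contMDiffAt (chart_source_mem_nhds _ q)
    have h2 : ContMDiffAt (𝓘(ℝ, E).prod (𝓡 1)) (𝓘(ℝ, E).prod (𝓡 1)) ∞ e.symm
        (chartAt (ModelProd E (EuclideanSpace ℝ (Fin 1))) q q) :=
      contMDiffOn_chart_symm.contMDiffAt (chart_target_mem_nhds _ (h.proj q, h.phase j q))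
    refine (h2.comp q h1).congr_of_eventuallyEq ?_
    filter_upwards [chart_source_mem_nhds (ModelProd E (EuclideanSpace ℝ (Fin 1))) q] with p hp
    exact (e.left_inv hp.2).symm
  have h3 := (h.transition_smooth j i).contMDiffAt (x := (h.proj q, h.phase j q))
    (((h.triv j).toOpenPartialHomeomorph.symm ≫ₕ
      (h.triv i).toOpenPartialHomeomorph).open_source.mem_nhds
      ⟨(h.triv j).map_source hj, by
        change h.proj (h.trivInv j (h.proj q, h.phase j q)) ∈ c.U i
        rw [h.trivInv_eq _ _ hj]
        exact hi⟩)
  refine (h3.comp q hself).congr_of_eventuallyEq ?_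
  filter_upwards [((c.isOpen_U j).preimage h.continuous_proj).mem_nhds hj] with p hp
  exact congrArg (h.triv i) ((h.triv j).left_inv hp).symm

theorem contMDiffAt_trivInv (i : ι) {p : Z × Circle} (hi : p.1 ∈ c.U i) :
    ContMDiffAt (𝓘(ℝ, E).prod (𝓡 1)) (𝓘(ℝ, E).prod (𝓡 1)) ∞ (h.trivInv i) p := by
  set q := h.trivInv i p with hq
  have hqz : h.proj q = p.1 := by rw [hq, trivInv_eq _ _ _ hi]; rfl
  set j := c.L.indexAt (h.proj q)
  have hj : p.1 ∈ c.U j := hqz ▸ c.L.mem_baseSet_at (h.proj q)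
  have hjq : h.proj q ∈ c.U j := c.L.mem_baseSet_at (h.proj q)
  set p' := (h.proj q, h.phase j q)
  have hself : ContMDiffAt (𝓘(ℝ, E).prod (𝓡 1)) (𝓘(ℝ, E).prod (𝓡 1)) ∞ (h.trivInv j) p' := by
    set e := chartAt (ModelProd E (EuclideanSpace ℝ (Fin 1))) p' with he
    set e' := chartAt (ModelProd E (EuclideanSpace ℝ (Fin 1))) q with he'
    have h1 : ContMDiffAt (𝓘(ℝ, E).prod (𝓡 1)) (𝓘(ℝ, E).prod (𝓡 1)) ∞ e p' :=
      contMDiffOn_chart.contMDiffAt (chart_source_mem_nhds _ p')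
    have h2 : ContMDiffAt (𝓘(ℝ, E).prod (𝓡 1)) (𝓘(ℝ, E).prod (𝓡 1)) ∞ e'.symm (e p') :=
      contMDiffOn_chart_symm.contMDiffAt (chart_target_mem_nhds _ q)
    refine (h2.comp p' h1).congr_of_eventuallyEq ?_
    filter_upwards [chart_source_mem_nhds (ModelProd E (EuclideanSpace ℝ (Fin 1))) p'] with p hp
    exact congrArg (h.trivInv j) (e.left_inv hp).symm
  have h3 := (h.transition_smooth i j).contMDiffAt (x := p)
    (((h.triv i).toOpenPartialHomeomorph.symm ≫ₕ
      (h.triv j).toOpenPartialHomeomorph).open_source.mem_nhds ⟨⟨hi, mem_univ _⟩, hjq⟩)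
  refine (hself.comp p h3).congr_of_eventuallyEq ?_
  filter_upwards [(((c.isOpen_U i).inter (c.isOpen_U j)).preimage continuous_fst).mem_nhds
    (show p ∈ Prod.fst ⁻¹' (c.U i ∩ c.U j) from ⟨hi, hj⟩)] with p hp
  refine ((h.triv j).left_inv (x := h.trivInv i p) ?_).symm
  change h.proj (h.trivInv i p) ∈ c.U j
  rw [h.trivInv_eq _ _ hp.1]
  exact hp.2

theorem contMDiff_proj : ContMDiff (𝓘(ℝ, E).prod (𝓡 1)) 𝓘(ℝ, E) ∞ h.proj := fun q =>
  contMDiffAt_fst.comp q (h.contMDiffAt_triv _ (c.L.mem_baseSet_at (h.proj q)))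

theorem contMDiffAt_phase {i : ι} {q : h.Q} (hi : h.proj q ∈ c.U i) :
    ContMDiffAt (𝓘(ℝ, E).prod (𝓡 1)) (𝓡 1) ∞ (h.phase i) q :=
  contMDiffAt_snd.comp q (h.contMDiffAt_triv _ hi)

theorem contMDiffAt_coe_phase {i : ι} {q : h.Q} (hi : h.proj q ∈ c.U i) :
    ContMDiffAt (𝓘(ℝ, E).prod (𝓡 1)) 𝓘(ℝ, ℂ) ∞ (fun q => (h.phase i q : ℂ)) q :=
  let _ := finrank_real_complex_fact'
  ContMDiffAt.comp (g := fun w : Circle => (w : ℂ)) q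
    (contMDiff_coe_sphere (n := 1) (E := ℂ) (h.phase i q)) (h.contMDiffAt_phase hi)

theorem coord_eq_radius {i : ι} {q : h.Q} (hi : h.proj q ∈ c.U i) :
    h.coord i q = h.radius i (h.proj q) * h.phase i q := by
  rw [h.coord_eq_phase i q hi, radius, div_eq_inv_mul]
  push_cast
  rfl

theorem eventually_proj_mem {i : ι} {q : h.Q} (hi : h.proj q ∈ c.U i) :
    ∀ᶠ p in 𝓝 q, h.proj p ∈ c.U i :=
  ((c.isOpen_U i).preimage h.continuous_proj).mem_nhds hi

theorem eventually_proj_mem_chart {z₀ : Z} {q : h.Q} (hz : h.proj q ∈ (chartAt E z₀).source) :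
    ∀ᶠ p in 𝓝 q, h.proj p ∈ (chartAt E z₀).source :=
  ((chartAt E z₀).open_source.preimage h.continuous_proj).mem_nhds hz

theorem contMDiffAt_coord {i : ι} {q : h.Q} (hi : h.proj q ∈ c.U i) :
    ContMDiffAt (𝓘(ℝ, E).prod (𝓡 1)) 𝓘(ℝ, ℂ) ∞ (h.coord i) q := by
  have h1 : ContMDiffAt (𝓘(ℝ, E).prod (𝓡 1)) 𝓘(ℝ, ℝ) ∞ (fun q => h.radius i (h.proj q)) q :=
    ContMDiffAt.comp (g := h.radius i) (f := h.proj) q (h.contMDiffAt_radius hi)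
      (h.contMDiff_proj q)
  refine (h1.smul (h.contMDiffAt_coe_phase hi)).congr_of_eventuallyEq ?_
  filter_upwards [h.eventually_proj_mem hi] with p hp
  exact (h.coord_eq_radius hp).trans (Complex.real_smul).symm

/-! ### The circle action -/

theorem coord_smul (i : ι) (a : Circle) (q : h.Q) : h.coord i (a • q) = a * h.coord i q :=
  mul_left_comm (c.f (c.L.indexAt (h.proj q)) i (h.proj q)) (a : ℂ) (show ℂ from q.1.snd)

theorem phase_smul {i : ι} (a : Circle) {q : h.Q} (hi : h.proj q ∈ c.U i) :
    h.phase i (a • q) = a * h.phase i q := by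
  rw [phase, coord_smul, exp_arg_mul (Circle.coe_ne_zero a) (h.coord_ne_zero i q hi),
    Circle.exp_arg, phase]

theorem isPrincipalCircleBundle :
    IsPrincipalCircleBundle (𝓘(ℝ, E).prod (𝓡 1)) 𝓘(ℝ, E) h.proj := by
  constructor
  · rintro ⟨a, q⟩
    set i := c.L.indexAt (h.proj q)
    have hi : h.proj q ∈ c.U i := c.L.mem_baseSet_at _
    have h1 : ContMDiffAt ((𝓡 1).prod (𝓘(ℝ, E).prod (𝓡 1))) (𝓘(ℝ, E).prod (𝓡 1)) ∞
        (fun x : Circle × h.Q => (h.proj x.2, x.1 * h.phase i x.2)) (a, q) :=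
      ((h.contMDiff_proj q).comp (a, q) contMDiffAt_snd).prodMk
        (contMDiffAt_fst.mul ((h.contMDiffAt_phase hi).comp (a, q) contMDiffAt_snd))
    have h2 : ContMDiffAt (𝓘(ℝ, E).prod (𝓡 1)) (𝓘(ℝ, E).prod (𝓡 1)) ∞ (h.trivInv i)
        (h.proj q, a * h.phase i q) := h.contMDiffAt_trivInv i hi
    refine (h2.comp (a, q) h1).congr_of_eventuallyEq ?_
    filter_upwards [continuous_snd.continuousAt.eventually (h.eventually_proj_mem hi)] with x hx
    refine (((h.triv i).left_inv (x := x.1 • x.2) hx).symm).trans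
      (congrArg (h.trivInv i) (Prod.ext rfl (h.phase_smul x.1 hx)))
  · intro z
    obtain ⟨i, hi⟩ := c.cover z
    exact ⟨h.triv i, hi, fun q hq => (h.contMDiffAt_triv i hq).contMDiffWithinAt,
      fun p hp => (h.contMDiffAt_trivInv i hp.1).contMDiffWithinAt,
      fun a q hq => ⟨rfl, h.phase_smul a hq⟩⟩

/-! ### Local coordinates on the circle bundle -/

/-- The coordinates of the base point in the chart at `z₀`. -/
def base (z₀ : Z) (q : h.Q) : E := extChartAt 𝓘(ℝ, E) z₀ (h.proj q)

/-- The differential of `base`. -/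
def dbase (z₀ : Z) (q : h.Q) : TangentSpace (𝓘(ℝ, E).prod (𝓡 1)) q →L[ℝ] E :=
  mvfderiv (𝓘(ℝ, E).prod (𝓡 1)) (h.base z₀) q

/-- The differential of the fibre coordinate `z_i`. -/
def dcoord (i : ι) (q : h.Q) : TangentSpace (𝓘(ℝ, E).prod (𝓡 1)) q →L[ℝ] ℂ :=
  mvfderiv (𝓘(ℝ, E).prod (𝓡 1)) (h.coord i) q

theorem contMDiffAt_base {z₀ : Z} {q : h.Q} (hz : h.proj q ∈ (chartAt E z₀).source) :
    ContMDiffAt (𝓘(ℝ, E).prod (𝓡 1)) 𝓘(ℝ, E) ∞ (h.base z₀) q :=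
  (contMDiffAt_extChartAt' hz).comp q (h.contMDiff_proj q)

theorem dbase_eq {z₀ : Z} {q : h.Q} (hz : h.proj q ∈ (chartAt E z₀).source)
    (X : TangentSpace (𝓘(ℝ, E).prod (𝓡 1)) q) :
    h.dbase z₀ q X = dchart 𝓘(ℝ, E) z₀ (h.proj q) (h.dproj q X) :=
  mfderiv_comp_apply q (mdifferentiableAt_extChartAt hz)
    ((h.contMDiff_proj q).mdifferentiableAt (by simp)) X

theorem dbase_self (q : h.Q) (X : TangentSpace (𝓘(ℝ, E).prod (𝓡 1)) q) :
    h.dbase (h.proj q) q X = h.dproj q X :=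
  (h.dbase_eq (mem_chart_source E _) X).trans (dchart_self (h.proj q) (h.dproj q X))

/-- A tangent vector of `Q(L)` is determined by its image in `Z` and by the derivative of the fibre
coordinate. -/
theorem eq_zero_of_dbase_of_dcoord {i : ι} {z₀ : Z} {q : h.Q} (hi : h.proj q ∈ c.U i)
    (hz : h.proj q ∈ (chartAt E z₀).source) {X : TangentSpace (𝓘(ℝ, E).prod (𝓡 1)) q}
    (hX : h.dbase z₀ q X = 0) (hX' : h.dcoord i q X = 0) : X = 0 := by
  -- a smooth left inverse of the coordinates
  set G : E × ℂ → h.Q := fun p =>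
    h.trivInv i ((extChartAt 𝓘(ℝ, E) z₀).symm p.1, Circle.exp (Complex.arg p.2))
  set b : h.Q → E × ℂ := fun q => (h.base z₀ q, h.coord i q)
  have hz' : h.proj q ∈ (extChartAt 𝓘(ℝ, E) z₀).source := by rwa [extChartAt_source]
  have hinv : (extChartAt 𝓘(ℝ, E) z₀).symm (h.base z₀ q) = h.proj q :=
    (extChartAt 𝓘(ℝ, E) z₀).left_inv hz'
  have hb1 := (h.contMDiffAt_base hz).mdifferentiableAt (n := ∞) (by simp)
  have hb2 := (h.contMDiffAt_coord hi).mdifferentiableAt (n := ∞) (by simp)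
  have hb : MDifferentiableAt (𝓘(ℝ, E).prod (𝓡 1)) 𝓘(ℝ, E × ℂ) b q := hb1.prodMk_space hb2
  have hG1 : ContMDiffAt 𝓘(ℝ, E × ℂ) (𝓘(ℝ, E).prod (𝓡 1)) ∞ (fun p : E × ℂ =>
      ((extChartAt 𝓘(ℝ, E) z₀).symm p.1, Circle.exp (Complex.arg p.2))) (b q) := by
    refine ContMDiffAt.prodMk ?_ ?_
    · exact ContMDiffAt.comp (g := (extChartAt 𝓘(ℝ, E) z₀).symm) (f := Prod.fst) (b q)
        ((contMDiffOn_extChartAt_symm z₀).contMDiffAt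
          (extChartAt_target_mem_nhds' ((extChartAt 𝓘(ℝ, E) z₀).map_source hz')))
        contDiff_fst.contMDiff.contMDiffAt
    · exact ContMDiffAt.comp (g := fun w : ℂ => Circle.exp (Complex.arg w)) (f := Prod.snd) (b q)
        (contMDiffAt_exp_arg (h.coord_ne_zero i q hi)) contDiff_snd.contMDiff.contMDiffAt
  have hG : MDifferentiableAt 𝓘(ℝ, E × ℂ) (𝓘(ℝ, E).prod (𝓡 1)) G (b q) := by
    refine (ContMDiffAt.comp (g := h.trivInv i) (b q) (h.contMDiffAt_trivInv i ?_)
      hG1).mdifferentiableAt (n := ∞) (by simp)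
    change (extChartAt 𝓘(ℝ, E) z₀).symm (h.base z₀ q) ∈ c.U i
    rwa [hinv]
  have hid : G ∘ b =ᶠ[𝓝 q] id := by
    filter_upwards [h.eventually_proj_mem hi, h.eventually_proj_mem_chart hz] with p hp hp'
    have hp'' : h.proj p ∈ (extChartAt 𝓘(ℝ, E) z₀).source := by rwa [extChartAt_source]
    have h1 : (extChartAt 𝓘(ℝ, E) z₀).symm (h.base z₀ p) = h.proj p :=
      (extChartAt 𝓘(ℝ, E) z₀).left_inv hp''
    change h.trivInv i ((extChartAt 𝓘(ℝ, E) z₀).symm (h.base z₀ p), h.phase i p) = p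
    rw [h1]
    exact (h.triv i).left_inv hp
  have h2 := mfderiv_comp_apply q hG hb X
  rw [hid.mfderiv_eq, mfderiv_id] at h2
  have h3 : mfderiv (𝓘(ℝ, E).prod (𝓡 1)) 𝓘(ℝ, E × ℂ) b q X = 0 := by
    exact (mvfderiv_prodMk_space hb1 hb2 X).trans (Prod.ext hX hX')
  refine h2.trans ?_
  rw [h3]
  exact map_zero _

end ComplexContactStructure.HermitianStructure

/-! ### The connection form -/

theorem mvfderiv_mul_complex {EM : Type*} [NormedAddCommGroup EM] [NormedSpace ℝ EM]
    {HM : Type*} [TopologicalSpace HM] {I : ModelWithCorners ℝ EM HM}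
    {M : Type*} [TopologicalSpace M] [ChartedSpace HM M] {f g : M → ℂ} {x : M}
    (hf : MDifferentiableAt I 𝓘(ℝ, ℂ) f x) (hg : MDifferentiableAt I 𝓘(ℝ, ℂ) g x)
    (X : TangentSpace I x) :
    mvfderiv I (fun x => f x * g x) x X = f x * mvfderiv I g x X + g x * mvfderiv I f x X := by
  have h1 : HasFDerivAt (fun p : ℂ × ℂ => p.1 * p.2) _ (f x, g x) :=
    (hasFDerivAt_fst (𝕜 := ℝ)).mul (hasFDerivAt_snd (𝕜 := ℝ))
  have h2 := mvfderiv_comp_fderiv (f := fun p : ℂ × ℂ => p.1 * p.2) h1.differentiableAt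
    (b := fun x => (f x, g x)) (hf.prodMk_space hg) X
  rw [h1.fderiv, mvfderiv_prodMk_space hf hg] at h2
  exact h2

theorem fderiv_eq_re_delForm {E : Type*} [NormedAddCommGroup E] [NormedSpace ℂ E] (F : E → ℝ)
    (y x : E) : fderiv ℝ F y x = 2 * (delForm F y x).re := by
  rw [delForm_apply]
  simp

theorem im_delForm {E : Type*} [NormedAddCommGroup E] [NormedSpace ℂ E] (F : E → ℝ)
    (y x : E) : (delForm F y x).im = -(1 / 2) * fderiv ℝ F y (Complex.I • x) := by
  rw [delForm_apply]
  simp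

/-- `d log |w|² = 2 Re (dw / w)`. -/
theorem mvfderiv_log_norm_sq {EM : Type*} [NormedAddCommGroup EM] [NormedSpace ℝ EM]
    {HM : Type*} [TopologicalSpace HM] {I : ModelWithCorners ℝ EM HM}
    {M : Type*} [TopologicalSpace M] [ChartedSpace HM M] {f : M → ℂ} {x : M}
    (hf : MDifferentiableAt I 𝓘(ℝ, ℂ) f x) (h0 : f x ≠ 0) (X : TangentSpace I x) :
    mvfderiv I (fun x => Real.log (‖f x‖ ^ 2)) x X = 2 * (mvfderiv I f x X / f x).re := by
  have h1 : DifferentiableAt ℝ (fun w : ℂ => Real.log (‖w‖ ^ 2)) (f x) :=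
    (differentiableAt_id.norm_sq ℝ).log (pow_ne_zero 2 (norm_ne_zero_iff.2 h0))
  refine (mvfderiv_comp_fderiv (f := fun w : ℂ => Real.log (‖w‖ ^ 2)) h1 hf X).trans ?_
  rw [fderiv_eq_re_delForm]
  have h2 := delForm_log_norm_sq (F := fun w : ℂ => w) (y := f x) differentiableAt_id h0
    (mvfderiv I f x X)
  rw [fderiv_fun_id] at h2
  rw [h2]
  rfl

namespace ComplexContactStructure.HermitianStructure

variable {n : ℕ} {E : Type*} [NormedAddCommGroup E] [NormedSpace ℂ E]
  {Z : Type*} [TopologicalSpace Z] [ChartedSpace E Z] [IsManifold 𝓘(ℂ, E) ω Z]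
  {ι : Type*} {c : ComplexContactStructure n E Z ι} (h : c.HermitianStructure)

/-- The form `dz_i / z_i + ∂ log h_i`, which does not depend on `i` and is the connection form of
the Hermitian holomorphic line bundle. -/
def connForm (i : ι) (z₀ : Z) (q : h.Q) : TangentSpace (𝓘(ℝ, E).prod (𝓡 1)) q →L[ℝ] ℂ :=
  (ContinuousLinearMap.mul ℝ ℂ (h.coord i q)⁻¹).comp (h.dcoord i q) +
    (delForm (h.logWeight i z₀) (h.base z₀ q)).comp (h.dbase z₀ q)

theorem connForm_apply (i : ι) (z₀ : Z) (q : h.Q) (X : TangentSpace (𝓘(ℝ, E).prod (𝓡 1)) q) :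
    h.connForm i z₀ q X =
      h.dcoord i q X / h.coord i q + delForm (h.logWeight i z₀) (h.base z₀ q) (h.dbase z₀ q X) := by
  rw [div_eq_inv_mul]
  rfl

theorem mdifferentiableAt_coord {i : ι} {q : h.Q} (hi : h.proj q ∈ c.U i) :
    MDifferentiableAt (𝓘(ℝ, E).prod (𝓡 1)) 𝓘(ℝ, ℂ) (h.coord i) q :=
  (h.contMDiffAt_coord hi).mdifferentiableAt (by simp)

theorem mdifferentiableAt_base {z₀ : Z} {q : h.Q} (hz : h.proj q ∈ (chartAt E z₀).source) :
    MDifferentiableAt (𝓘(ℝ, E).prod (𝓡 1)) 𝓘(ℝ, E) (h.base z₀) q :=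
  (h.contMDiffAt_base hz).mdifferentiableAt (by simp)

theorem base_symm {z₀ : Z} {q : h.Q} (hz : h.proj q ∈ (chartAt E z₀).source) :
    (extChartAt 𝓘(ℝ, E) z₀).symm (h.base z₀ q) = h.proj q :=
  (extChartAt 𝓘(ℝ, E) z₀).left_inv (by rwa [extChartAt_source])

/-- The connection form is imaginary, because `h_i |z_i|² = 1`. -/
theorem connForm_re {i : ι} {z₀ : Z} {q : h.Q} (hi : h.proj q ∈ c.U i)
    (hz : h.proj q ∈ (chartAt E z₀).source) (X : TangentSpace (𝓘(ℝ, E).prod (𝓡 1)) q) :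
    (h.connForm i z₀ q X).re = 0 := by
  have hev : (fun p => Real.log (‖h.coord i p‖ ^ 2)) =ᶠ[𝓝 q]
      (-h.logWeight i z₀) ∘ h.base z₀ := by
    filter_upwards [h.eventually_proj_mem hi, h.eventually_proj_mem_chart hz] with p hp hp'
    have h1 := congrArg Real.log (h.norm_coord_sq i p hp)
    rw [Real.log_mul (pow_ne_zero 2 (norm_ne_zero_iff.2 (h.coord_ne_zero i p hp)))
      (h.weight_pos hp).ne', Real.log_one] at h1
    rw [comp_apply, Pi.neg_apply, logWeight, h.base_symm hp']
    linarith
  have hL : DifferentiableAt ℝ (h.logWeight i z₀) (h.base z₀ q) :=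
    (h.contDiffAt_logWeight hi hz).differentiableAt (by simp)
  have h1 := mvfderiv_congr hev (X := X)
  rw [mvfderiv_log_norm_sq (h.mdifferentiableAt_coord hi) (h.coord_ne_zero i q hi),
    mvfderiv_comp_fderiv hL.neg (h.mdifferentiableAt_base hz), fderiv_neg, neg_apply,
    fderiv_eq_re_delForm] at h1
  rw [connForm_apply, Complex.add_re]
  have h2 : (h.dcoord i q X / h.coord i q).re =
    -(delForm (h.logWeight i z₀) (h.base z₀ q) (h.dbase z₀ q X)).re := by
    unfold dcoord dbase
    linarith
  rw [h2]
  ring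

theorem connForm_index {i j : ι} {z₀ : Z} {q : h.Q} (hi : h.proj q ∈ c.U i)
    (hj : h.proj q ∈ c.U j) (hz : h.proj q ∈ (chartAt E z₀).source)
    (X : TangentSpace (𝓘(ℝ, E).prod (𝓡 1)) q) : h.connForm i z₀ q X = h.connForm j z₀ q X := by
  set F : E → ℂ := c.f i j ∘ (extChartAt 𝓘(ℝ, E) z₀).symm with hFdef
  have hFq : F (h.base z₀ q) = c.f i j (h.proj q) := congrArg (c.f i j) (h.base_symm hz)
  have hF : DifferentiableAt ℂ F (h.base z₀ q) := differentiableAt_f hi hj hz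
  have hFb : MDifferentiableAt (𝓘(ℝ, E).prod (𝓡 1)) 𝓘(ℝ, ℂ) (F ∘ h.base z₀) q :=
    (hF.restrictScalars ℝ).mdifferentiableAt.comp q (h.mdifferentiableAt_base hz)
  have hev : h.coord j =ᶠ[𝓝 q] fun p => (F ∘ h.base z₀) p * h.coord i p := by
    filter_upwards [h.eventually_proj_mem hi, h.eventually_proj_mem hj,
      h.eventually_proj_mem_chart hz] with p h1 h2 h3
    rw [comp_apply, hFdef, comp_apply, h.base_symm h3]
    exact coord_change (h.incl p) h1 h2
  have h1 := mvfderiv_congr hev (X := X)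
  rw [mvfderiv_mul_complex hFb (h.mdifferentiableAt_coord hi),
    mvfderiv_comp_fderiv (hF.restrictScalars ℝ) (h.mdifferentiableAt_base hz), comp_apply, hFq,
    hF.fderiv_restrictScalars ℝ] at h1
  have hc : h.coord j q = c.f i j (h.proj q) * h.coord i q := coord_change (h.incl q) hi hj
  have hi0 := h.coord_ne_zero i q hi
  have hf0 := c.f_ne_zero i j _ ⟨hi, hj⟩
  rw [connForm_apply, connForm_apply, hc, dcoord, dcoord, h1]
  have h2 := h.delForm_change hi hj hz (h.dbase z₀ q X)
  change delForm (h.logWeight i z₀) (h.base z₀ q) (h.dbase z₀ q X) =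
    delForm (h.logWeight j z₀) (h.base z₀ q) (h.dbase z₀ q X) +
      fderiv ℂ F (h.base z₀ q) (h.dbase z₀ q X) / c.f i j (h.proj q) at h2
  rw [h2]
  change _ = (c.f i j (h.proj q) * h.dcoord i q X + h.coord i q *
    fderiv ℂ F (h.base z₀ q) (h.dbase z₀ q X)) / _ + _
  change h.dcoord i q X / _ + _ = _
  field_simp
  ring

theorem connForm_chart {i : ι} {z₀ : Z} {q : h.Q} (hi : h.proj q ∈ c.U i)
    (hz : h.proj q ∈ (chartAt E z₀).source) (X : TangentSpace (𝓘(ℝ, E).prod (𝓡 1)) q) :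
    h.connForm i z₀ q X = h.connForm i (h.proj q) q X := by
  have hzz := mem_chart_source E (h.proj q)
  rw [connForm_apply, connForm_apply, h.dbase_eq hz, h.dbase_eq hzz]
  exact congrArg (_ + ·) (h.delForm_logWeight hi hz _)

/-- The form `η₁`, for which `√-1 η₁` is the Ishihara–Konishi connection. -/
def η₁ (q : h.Q) : TangentSpace (𝓘(ℝ, E).prod (𝓡 1)) q →L[ℝ] ℝ :=
  Complex.imCLM.comp (h.connForm (c.L.indexAt (h.proj q)) (h.proj q) q)

theorem I_mul_η₁ {i : ι} {z₀ : Z} {q : h.Q} (hi : h.proj q ∈ c.U i)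
    (hz : h.proj q ∈ (chartAt E z₀).source) (X : TangentSpace (𝓘(ℝ, E).prod (𝓡 1)) q) :
    Complex.I * (h.η₁ q X : ℂ) = h.connForm i z₀ q X := by
  rw [h.connForm_chart hi hz, h.connForm_index hi (c.L.mem_baseSet_at _) (mem_chart_source E _)]
  apply Complex.ext
  · rw [h.connForm_re (c.L.mem_baseSet_at _) (mem_chart_source E _)]
    simp
  · simp [η₁]

theorem dcoord_eq {i : ι} {z₀ : Z} {q : h.Q} (hi : h.proj q ∈ c.U i)
    (hz : h.proj q ∈ (chartAt E z₀).source) (X : TangentSpace (𝓘(ℝ, E).prod (𝓡 1)) q) :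
    h.dcoord i q X = h.coord i q * (Complex.I * (h.η₁ q X : ℂ) -
      delForm (h.logWeight i z₀) (h.base z₀ q) (h.dbase z₀ q X)) := by
  have hi0 := h.coord_ne_zero i q hi
  rw [h.I_mul_η₁ hi hz, connForm_apply]
  field_simp
  ring

theorem isIKConnection : IsIKConnection h.η₁ := by
  intro i q hi X
  have hz := mem_chart_source E (h.proj q)
  have hp0 := Circle.coe_ne_zero (h.phase i q)
  have hr0 := h.radius_pos hi
  have hr : MDifferentiableAt (𝓘(ℝ, E).prod (𝓡 1)) 𝓘(ℝ, ℂ)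
      (fun p : h.Q => (h.radius i (h.proj p) : ℂ)) q := by
    have h1 : ContMDiffAt (𝓘(ℝ, E).prod (𝓡 1)) 𝓘(ℝ, ℝ) ∞ (fun q => h.radius i (h.proj q)) q :=
      ContMDiffAt.comp (g := h.radius i) (f := h.proj) q (h.contMDiffAt_radius hi)
        (h.contMDiff_proj q)
    exact (ContDiffAt.comp_contMDiffAt (g := Complex.ofRealCLM)
      (f := fun p : h.Q => h.radius i (h.proj p)) Complex.ofRealCLM.contDiff.contDiffAt
      h1).mdifferentiableAt (n := ∞) (by simp)
  have hrr : ∃ t : ℝ, mvfderiv (𝓘(ℝ, E).prod (𝓡 1))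
      (fun p : h.Q => (h.radius i (h.proj p) : ℂ)) q X = t := by
    have h1 : MDifferentiableAt (𝓘(ℝ, E).prod (𝓡 1)) 𝓘(ℝ, ℝ) (fun q => h.radius i (h.proj q)) q :=
      (ContMDiffAt.comp (g := h.radius i) (f := h.proj) q (h.contMDiffAt_radius hi)
        (h.contMDiff_proj q)).mdifferentiableAt (n := ∞) (by simp)
    have h2 := mvfderiv_comp_fderiv (f := Complex.ofRealCLM)
      (Complex.ofRealCLM.differentiableAt) h1 X
    rw [ContinuousLinearMap.fderiv] at h2
    exact ⟨_, h2⟩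
  obtain ⟨t, ht⟩ := hrr
  have hp : MDifferentiableAt (𝓘(ℝ, E).prod (𝓡 1)) 𝓘(ℝ, ℂ) (fun p : h.Q => (h.phase i p : ℂ)) q :=
    (h.contMDiffAt_coe_phase hi).mdifferentiableAt (by simp)
  have hev : h.coord i =ᶠ[𝓝 q] fun p => (h.radius i (h.proj p) : ℂ) * h.phase i p := by
    filter_upwards [h.eventually_proj_mem hi] with p hp using h.coord_eq_radius hp
  have h1 := mvfderiv_congr hev (X := X)
  rw [mvfderiv_mul_complex hr hp, ht] at h1
  have h2 : h.dcoord i q X / h.coord i q = h.idφ i q X + ((t / h.radius i (h.proj q) : ℝ) : ℂ) := by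
    have hr1 : (h.radius i (h.proj q) : ℂ) ≠ 0 := by exact_mod_cast hr0.ne'
    rw [dcoord, h1, h.coord_eq_radius hi, idφ]
    push_cast
    field_simp
  -- the phase has norm one
  have h3 : (h.idφ i q X).re = 0 := by
    have h4 := mvfderiv_log_norm_sq hp hp0 X
    have h5 : (fun p : h.Q => Real.log (‖(h.phase i p : ℂ)‖ ^ 2)) = fun _ => 0 := by
      funext p
      rw [Circle.norm_coe, one_pow, Real.log_one]
    rw [h5, mvfderiv_const, zero_apply] at h4
    rw [idφ]
    linarith
  have h6 : h.iσ i (h.proj q) (h.dproj q X) = Complex.I *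
      ((delForm (h.logWeight i (h.proj q)) (h.base (h.proj q) q) (h.dbase (h.proj q) q X)).im : ℂ) := by
    have h7 : ∀ Y : TangentSpace 𝓘(ℝ, E) (h.proj q), mvfderiv 𝓘(ℝ, E)
        (fun z => (Real.log (h.weight i z) : ℂ)) (h.proj q) Y =
          (mvfderiv 𝓘(ℝ, E) (fun z => Real.log (h.weight i z)) (h.proj q) Y : ℝ) := fun Y => by
      have h8 := mvfderiv_comp_fderiv (f := Complex.ofRealCLM) Complex.ofRealCLM.differentiableAt
        ((h.contMDiffAt_log_weight hi).mdifferentiableAt (by simp)) Y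
      rw [ContinuousLinearMap.fderiv] at h8
      exact h8
    have h9 := h.fderiv_logWeight hi hz (complexStructure (h.proj q) (h.dproj q X))
    have h10 : dchart 𝓘(ℝ, E) (h.proj q) (h.proj q) (complexStructure (h.proj q) (h.dproj q X)) =
        Complex.I • h.dbase (h.proj q) q X := by
      rw [h.dbase_eq hz]
      exact dchart_smul hz Complex.I _
    rw [iσ, del, delBar, h7, h7, im_delForm, ← h9, h10]
    push_cast
    change _ = Complex.I * (-(1 / 2) * (fderiv ℝ (h.logWeight i (h.proj q))
      (extChartAt 𝓘(ℝ, E) (h.proj q) (h.proj q)) _ : ℂ))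
    ring
  rw [h.I_mul_η₁ hi hz, h6]
  apply Complex.ext
  · rw [h.connForm_re hi hz, Complex.add_re, h3]
    simp
  · rw [connForm_apply, h2]
    simp
    ring

end ComplexContactStructure.HermitianStructure

/-! ### The coframe of the circle bundle and the exterior derivatives -/

/-- The exterior derivative of the pullback, under a map `b` to a vector space, of a form given by
its coefficients `A`. -/
theorem extD_pullback {EM : Type*} [NormedAddCommGroup EM] [NormedSpace ℝ EM]
    {HM : Type*} [TopologicalSpace HM] {I : ModelWithCorners ℝ EM HM} [I.Boundaryless]
    {M : Type*} [TopologicalSpace M] [ChartedSpace HM M] [IsManifold I ∞ M]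
    {V : Type*} [NormedAddCommGroup V] [NormedSpace ℝ V]
    {α : ∀ x : M, TangentSpace I x →L[ℝ] ℝ} {b : M → V} {A : V → V →L[ℝ] ℝ} {x₀ : M}
    (hb : ContMDiffAt I 𝓘(ℝ, V) ∞ b x₀) (hA : ContDiffAt ℝ ∞ A (b x₀))
    (h : ∀ᶠ x in 𝓝 x₀, ∀ X, α x X = A (b x) (mvfderiv I b x X)) (X Y : TangentSpace I x₀) :
    extD I α x₀ X Y = fderiv ℝ A (b x₀) (mvfderiv I b x₀ X) (mvfderiv I b x₀ Y) -
      fderiv ℝ A (b x₀) (mvfderiv I b x₀ Y) (mvfderiv I b x₀ X) := by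
  have h1 : ∀ T : TangentSpace I x₀, mvfderiv I (A ∘ b) x₀ T =
      fderiv ℝ A (b x₀) (mvfderiv I b x₀ T) := fun T =>
    mvfderiv_comp_fderiv (hA.differentiableAt (by simp)) (hb.mdifferentiableAt (by simp)) T
  rw [extD_comp_mvfderiv hb (hA.comp_contMDiffAt hb) h, ← h1, ← h1]

section Coefficients

variable {E : Type*} [NormedAddCommGroup E] [NormedSpace ℂ E]

/-- The form `Im (dw / w + ∂L)` on `ℂ × E`. -/
def connCoeff (L : E → ℝ) (p : ℂ × E) : ℂ × E →L[ℝ] ℝ :=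
  Complex.imCLM.comp ((ContinuousLinearMap.mul ℝ ℂ p.1⁻¹).comp (ContinuousLinearMap.fst ℝ ℂ E)) +
    Complex.imCLM.comp ((delForm L p.2).comp (ContinuousLinearMap.snd ℝ ℂ E))

theorem contDiffAt_connCoeff {L : E → ℝ} {p : ℂ × E} (hp : p.1 ≠ 0) (hL : ContDiffAt ℝ ∞ L p.2) :
    ContDiffAt ℝ ∞ (connCoeff L) p := by
  have h1 : ContDiffAt ℝ ∞ (fun p : ℂ × E => p.1⁻¹) p := contDiffAt_fst.inv hp
  have h2 : ContDiffAt ℝ ∞ (fun p : ℂ × E => delForm L p.2) p :=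
    (contDiffAt_delForm hL).comp p contDiffAt_snd
  exact (contDiffAt_const.clm_comp (((contDiffAt_const (c := ContinuousLinearMap.mul ℝ ℂ)).clm_apply
    h1).clm_comp contDiffAt_const)).add
    (contDiffAt_const.clm_comp (h2.clm_comp contDiffAt_const))

theorem fderiv_clm_const_apply {V W : Type*} [NormedAddCommGroup V] [NormedSpace ℝ V]
    [NormedAddCommGroup W] [NormedSpace ℝ W] {A : V → W →L[ℝ] ℝ} {p : V}
    (hA : DifferentiableAt ℝ A p) (a : V) (v : W) :
    fderiv ℝ A p a v = fderiv ℝ (fun p => A p v) p a := by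
  rw [fderiv_clm_apply hA (differentiableAt_const v)]
  simp

theorem fderiv_im_delForm {L : E → ℝ} {y : E} (hL : ContDiffAt ℝ ∞ L y) (x v : E) :
    fderiv ℝ (fun y => (delForm L y v).im) y x =
      -(1 / 2) * fderiv ℝ (fderiv ℝ L) y x (Complex.I • v) := by
  have h1 : DifferentiableAt ℝ (fderiv ℝ L) y :=
    (hL.fderiv_right (m := ∞) (by simp)).differentiableAt (by simp)
  have h2 : (fun y => (delForm L y v).im) = fun y => -(1 / 2) * fderiv ℝ L y (Complex.I • v) :=
    funext fun y => im_delForm L y v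
  rw [h2, fderiv_const_mul (h1.clm_apply (differentiableAt_const _)), smul_apply, smul_eq_mul,
    fderiv_clm_const_apply h1]

/-- The exterior derivative of `Im (dw / w + ∂L)` is the `(1, 1)`-form `√-1 ∂∂̄L`: the
part `dw / w` is closed. -/
theorem fderiv_connCoeff {L : E → ℝ} {p : ℂ × E} (hp : p.1 ≠ 0) (hL : ContDiffAt ℝ ∞ L p.2)
    (a v : ℂ × E) :
    fderiv ℝ (connCoeff L) p a v - fderiv ℝ (connCoeff L) p v a =
      -(1 / 2) * (fderiv ℝ (fderiv ℝ L) p.2 a.2 (Complex.I • v.2) -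
        fderiv ℝ (fderiv ℝ L) p.2 v.2 (Complex.I • a.2)) := by
  have hd : DifferentiableAt ℝ (connCoeff L) p :=
    (contDiffAt_connCoeff hp hL).differentiableAt (by simp)
  have key : ∀ a v : ℂ × E, fderiv ℝ (connCoeff L) p a v =
      (-(p.1 ^ 2)⁻¹ * a.1 * v.1).im -
        1 / 2 * fderiv ℝ (fderiv ℝ L) p.2 a.2 (Complex.I • v.2) := by
    intro a v
    rw [fderiv_clm_const_apply hd]
    have h1 : HasFDerivAt (fun p : ℂ × E => (p.1⁻¹ * v.1).im) (Complex.imCLM.comp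
        (((ContinuousLinearMap.mul ℝ ℂ).flip v.1).comp
          (((ContinuousLinearMap.toSpanSingleton ℂ (-(p.1 ^ 2)⁻¹)).restrictScalars ℝ).comp
            (ContinuousLinearMap.fst ℝ ℂ E)))) p :=
      Complex.imCLM.hasFDerivAt.comp p
        ((((ContinuousLinearMap.mul ℝ ℂ).flip v.1).hasFDerivAt).comp p
          (((hasDerivAt_inv hp).hasFDerivAt.restrictScalars ℝ).comp p hasFDerivAt_fst))
    have hL1 : DifferentiableAt ℝ (fun y => (delForm L y v.2).im) p.2 :=
      DifferentiableAt.comp (g := Complex.imCLM) (f := fun y => delForm L y v.2) p.2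
        Complex.imCLM.differentiableAt (((contDiffAt_delForm hL).differentiableAt (by simp)).clm_apply (differentiableAt_const _))
    have h2 : HasFDerivAt (fun p : ℂ × E => (delForm L p.2 v.2).im)
        ((fderiv ℝ (fun y => (delForm L y v.2).im) p.2).comp (ContinuousLinearMap.snd ℝ ℂ E)) p :=
      hL1.hasFDerivAt.comp p hasFDerivAt_snd
    have h3 : HasFDerivAt (fun p : ℂ × E => connCoeff L p v) _ p := h1.add h2
    rw [h3.fderiv, add_apply, ContinuousLinearMap.comp_apply, ContinuousLinearMap.comp_apply]
    change _ + fderiv ℝ (fun y => (delForm L y v.2).im) p.2 a.2 = _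
    rw [fderiv_im_delForm hL]
    simp
    ring_nf
  rw [key, key, mul_right_comm]
  ring

/-- The form `Re (a w θ)` on `ℂ × E`. -/
def kobCoeff (a : ℂ) (θ : E → E →L[ℝ] ℂ) (p : ℂ × E) : ℂ × E →L[ℝ] ℝ :=
  Complex.reCLM.comp ((ContinuousLinearMap.mul ℝ ℂ (a * p.1)).comp
    ((θ p.2).comp (ContinuousLinearMap.snd ℝ ℂ E)))

theorem contDiffAt_kobCoeff (a : ℂ) {θ : E → E →L[ℝ] ℂ} {p : ℂ × E} (hθ : ContDiffAt ℝ ∞ θ p.2) :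
    ContDiffAt ℝ ∞ (kobCoeff a θ) p := by
  have h1 : ContDiffAt ℝ ∞ (fun p : ℂ × E => a * p.1) p := contDiffAt_const.mul contDiffAt_fst
  have h2 : ContDiffAt ℝ ∞ (fun p : ℂ × E => θ p.2) p := hθ.comp p contDiffAt_snd
  exact contDiffAt_const.clm_comp (((contDiffAt_const (c := ContinuousLinearMap.mul ℝ ℂ)).clm_apply
    h1).clm_comp (h2.clm_comp contDiffAt_const))

theorem fderiv_kobCoeff (a : ℂ) {θ : E → E →L[ℝ] ℂ} {p : ℂ × E} (hθ : ContDiffAt ℝ ∞ θ p.2)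
    (x v : ℂ × E) : fderiv ℝ (kobCoeff a θ) p x v =
      (a * (x.1 * θ p.2 v.2 + p.1 * fderiv ℝ θ p.2 x.2 v.2)).re := by
  have hd : DifferentiableAt ℝ (kobCoeff a θ) p :=
    (contDiffAt_kobCoeff a hθ).differentiableAt (by simp)
  have hθd : HasFDerivAt θ (fderiv ℝ θ p.2) p.2 := (hθ.differentiableAt (by simp)).hasFDerivAt
  have h1 : HasFDerivAt (fun p : ℂ × E => θ p.2 v.2)
      ((ContinuousLinearMap.apply ℝ ℂ v.2).comp
        ((fderiv ℝ θ p.2).comp (ContinuousLinearMap.snd ℝ ℂ E))) p :=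
    (ContinuousLinearMap.apply ℝ ℂ v.2).hasFDerivAt.comp p (hθd.comp p hasFDerivAt_snd)
  have h2 : HasFDerivAt (fun p : ℂ × E => (a * (p.1 * θ p.2 v.2)).re) _ p :=
    Complex.reCLM.hasFDerivAt.comp p (((hasFDerivAt_fst (𝕜 := ℝ)).mul h1).const_mul a)
  have h3 : (fun p => kobCoeff a θ p v) = fun p : ℂ × E => (a * (p.1 * θ p.2 v.2)).re := by
    funext p
    rw [← mul_assoc]
    rfl
  rw [fderiv_clm_const_apply hd, h3, h2.fderiv]
  simp
  ring

end Coefficients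

namespace ComplexContactStructure.HermitianStructure

variable {n : ℕ} {E : Type*} [NormedAddCommGroup E] [NormedSpace ℂ E]
  {Z : Type*} [TopologicalSpace Z] [ChartedSpace E Z] [IsManifold 𝓘(ℂ, E) ω Z]
  {ι : Type*} {c : ComplexContactStructure n E Z ι} (h : c.HermitianStructure)

theorem contMDiffAt_coordBase {i : ι} {z₀ : Z} {q : h.Q} (hi : h.proj q ∈ c.U i)
    (hz : h.proj q ∈ (chartAt E z₀).source) :
    ContMDiffAt (𝓘(ℝ, E).prod (𝓡 1)) 𝓘(ℝ, ℂ × E) ∞ (fun q => (h.coord i q, h.base z₀ q)) q :=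
  (h.contMDiffAt_coord hi).prodMk_space (h.contMDiffAt_base hz)

theorem mvfderiv_coordBase {i : ι} {z₀ : Z} {q : h.Q} (hi : h.proj q ∈ c.U i)
    (hz : h.proj q ∈ (chartAt E z₀).source) (X : TangentSpace (𝓘(ℝ, E).prod (𝓡 1)) q) :
    mvfderiv (𝓘(ℝ, E).prod (𝓡 1)) (fun q => (h.coord i q, h.base z₀ q)) q X =
      (h.dcoord i q X, h.dbase z₀ q X) :=
  mvfderiv_prodMk_space (h.mdifferentiableAt_coord hi) (h.mdifferentiableAt_base hz) X

theorem η₁_eq {i : ι} {z₀ : Z} {q : h.Q} (hi : h.proj q ∈ c.U i)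
    (hz : h.proj q ∈ (chartAt E z₀).source) (X : TangentSpace (𝓘(ℝ, E).prod (𝓡 1)) q) :
    h.η₁ q X = connCoeff (h.logWeight i z₀) (h.coord i q, h.base z₀ q)
      (mvfderiv (𝓘(ℝ, E).prod (𝓡 1)) (fun q => (h.coord i q, h.base z₀ q)) q X) := by
  rw [h.mvfderiv_coordBase hi hz]
  have h1 := congrArg Complex.im (h.I_mul_η₁ hi hz X)
  rw [Complex.I_mul_im, Complex.ofReal_re] at h1
  exact h1

theorem eventually_η₁_eq {i : ι} {z₀ : Z} {q : h.Q} (hi : h.proj q ∈ c.U i)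
    (hz : h.proj q ∈ (chartAt E z₀).source) :
    ∀ᶠ q in 𝓝 q, ∀ X : TangentSpace (𝓘(ℝ, E).prod (𝓡 1)) q,
      h.η₁ q X = connCoeff (h.logWeight i z₀) (h.coord i q, h.base z₀ q)
      (mvfderiv (𝓘(ℝ, E).prod (𝓡 1)) (fun q => (h.coord i q, h.base z₀ q)) q X) := by
  filter_upwards [h.eventually_proj_mem hi, h.eventually_proj_mem_chart hz] with p h1 h2 X
  exact h.η₁_eq h1 h2 X

/-- The curvature `dη₁ = √-1 ∂∂̄ log h_i` of the Ishihara–Konishi connection. -/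
theorem extD_η₁ {i : ι} {z₀ : Z} {q : h.Q} (hi : h.proj q ∈ c.U i)
    (hz : h.proj q ∈ (chartAt E z₀).source) (X Y : TangentSpace (𝓘(ℝ, E).prod (𝓡 1)) q) :
    extD (𝓘(ℝ, E).prod (𝓡 1)) h.η₁ q X Y =
      -(1 / 2) * (fderiv ℝ (fderiv ℝ (h.logWeight i z₀)) (h.base z₀ q) (h.dbase z₀ q X)
          (Complex.I • h.dbase z₀ q Y) -
        fderiv ℝ (fderiv ℝ (h.logWeight i z₀)) (h.base z₀ q) (h.dbase z₀ q Y)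
          (Complex.I • h.dbase z₀ q X)) := by
  have h0 : (h.coord i q, h.base z₀ q).1 ≠ 0 := h.coord_ne_zero i q hi
  have hL : ContDiffAt ℝ ∞ (h.logWeight i z₀) (h.coord i q, h.base z₀ q).2 :=
    h.contDiffAt_logWeight hi hz
  rw [extD_pullback (h.contMDiffAt_coordBase hi hz) (contDiffAt_connCoeff h0 hL)
    (h.eventually_η₁_eq hi hz), fderiv_connCoeff h0 hL, h.mvfderiv_coordBase hi hz,
    h.mvfderiv_coordBase hi hz]

/-- The real form `Re (a ϑ)`, where `ϑ` is Kobayashi's form. -/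
def kob (a : ℂ) (q : h.Q) : TangentSpace (𝓘(ℝ, E).prod (𝓡 1)) q →L[ℝ] ℝ :=
  Complex.reCLM.comp ((ContinuousLinearMap.mul ℝ ℂ
    (a * h.coord (c.L.indexAt (h.proj q)) q)).comp
      ((c.θLoc (c.L.indexAt (h.proj q)) (h.proj q) (h.base (h.proj q) q)).comp
        (h.dbase (h.proj q) q)))

theorem kobayashiForm_eq {i : ι} {z₀ : Z} {q : h.Q} (hz : h.proj q ∈ (chartAt E z₀).source)
    (X : TangentSpace (𝓘(ℝ, E).prod (𝓡 1)) q) :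
    h.kobayashiForm i q X = h.coord i q * c.θLoc i z₀ (h.base z₀ q) (h.dbase z₀ q X) := by
  rw [h.dbase_eq hz]
  exact congrArg (_ * ·) (c.θLoc_dchart hz _).symm

theorem kobayashiForm_change {i j : ι} {q : h.Q} (hi : h.proj q ∈ c.U i)
    (hj : h.proj q ∈ c.U j) (X : TangentSpace (𝓘(ℝ, E).prod (𝓡 1)) q) :
    h.kobayashiForm i q X = h.kobayashiForm j q X := by
  have hz := mem_chart_source E (h.proj q)
  have hc : h.coord j q = c.f i j (h.proj q) * h.coord i q := coord_change (h.incl q) hi hj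
  have hθ := θLoc_change hi hj hz (h.dbase (h.proj q) q X)
  rw [h.kobayashiForm_eq hz, h.kobayashiForm_eq hz, hc]
  refine (congrArg (h.coord i q * ·) hθ).trans ?_
  change _ * (_ * c.θLoc j (h.proj q) (h.base (h.proj q) q) (h.dbase (h.proj q) q X)) = _
  ring

theorem kob_eq_kobayashiForm (a : ℂ) {i : ι} {q : h.Q} (hi : h.proj q ∈ c.U i)
    (X : TangentSpace (𝓘(ℝ, E).prod (𝓡 1)) q) : h.kob a q X = (a * h.kobayashiForm i q X).re := by
  rw [h.kobayashiForm_change hi (c.L.mem_baseSet_at (h.proj q)),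
    h.kobayashiForm_eq (mem_chart_source E (h.proj q)), ← mul_assoc]
  rfl

theorem kob_apply (a : ℂ) {i : ι} {z₀ : Z} {q : h.Q} (hi : h.proj q ∈ c.U i)
    (hz : h.proj q ∈ (chartAt E z₀).source) (X : TangentSpace (𝓘(ℝ, E).prod (𝓡 1)) q) :
    h.kob a q X = (a * (h.coord i q * c.θLoc i z₀ (h.base z₀ q) (h.dbase z₀ q X))).re := by
  rw [h.kob_eq_kobayashiForm a hi, h.kobayashiForm_eq hz]

theorem eventually_kob_eq (a : ℂ) {i : ι} {z₀ : Z} {q : h.Q} (hi : h.proj q ∈ c.U i)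
    (hz : h.proj q ∈ (chartAt E z₀).source) :
    ∀ᶠ q in 𝓝 q, ∀ X : TangentSpace (𝓘(ℝ, E).prod (𝓡 1)) q,
      h.kob a q X = kobCoeff a (c.θLoc i z₀) (h.coord i q, h.base z₀ q)
      (mvfderiv (𝓘(ℝ, E).prod (𝓡 1)) (fun q => (h.coord i q, h.base z₀ q)) q X) := by
  filter_upwards [h.eventually_proj_mem hi, h.eventually_proj_mem_chart hz] with p h1 h2 X
  rw [h.kob_apply a h1 h2, h.mvfderiv_coordBase h1 h2, ← mul_assoc]
  rfl

/-- The structure equation `dϑ = √-1 η₁ ∧ ϑ + z_i ψ_i`. -/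
theorem extD_kob (a : ℂ) {i : ι} {z₀ : Z} {q : h.Q} (hi : h.proj q ∈ c.U i)
    (hz : h.proj q ∈ (chartAt E z₀).source) (X Y : TangentSpace (𝓘(ℝ, E).prod (𝓡 1)) q) :
    extD (𝓘(ℝ, E).prod (𝓡 1)) (h.kob a) q X Y = (a * h.coord i q *
      (Complex.I * h.η₁ q X * c.θLoc i z₀ (h.base z₀ q) (h.dbase z₀ q Y) -
        Complex.I * h.η₁ q Y * c.θLoc i z₀ (h.base z₀ q) (h.dbase z₀ q X) +
        h.ψLoc i z₀ (h.base z₀ q) (h.dbase z₀ q X) (h.dbase z₀ q Y))).re := by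
  have hθ : ContDiffAt ℝ ∞ (c.θLoc i z₀) (h.coord i q, h.base z₀ q).2 := c.contDiffAt_θLoc hi hz
  rw [extD_pullback (h.contMDiffAt_coordBase hi hz) (contDiffAt_kobCoeff a hθ)
    (h.eventually_kob_eq a hi hz), fderiv_kobCoeff a hθ, fderiv_kobCoeff a hθ,
    h.mvfderiv_coordBase hi hz, h.mvfderiv_coordBase hi hz, ← Complex.sub_re]
  simp only [h.dcoord_eq hi hz, ψLoc, ComplexContactStructure.dθLoc, sub_apply, outer_apply,
    ContinuousLinearMap.flip_apply]
  congr 1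
  ring

theorem smoothFormAt_η₁ (q : h.Q) : SmoothFormAt (𝓘(ℝ, E).prod (𝓡 1)) h.η₁ q := by
  have hi : h.proj q ∈ c.U (c.L.indexAt (h.proj q)) := c.L.mem_baseSet_at _
  have hz := mem_chart_source E (h.proj q)
  have hb := h.contMDiffAt_coordBase hi hz
  have hA : ContDiffAt ℝ ∞ (connCoeff (h.logWeight (c.L.indexAt (h.proj q)) (h.proj q)))
      (h.coord (c.L.indexAt (h.proj q)) q, h.base (h.proj q) q) :=
    contDiffAt_connCoeff (h.coord_ne_zero _ q hi) (h.contDiffAt_logWeight hi hz)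
  exact ((smoothFormAt_mvfderiv hb).clm_comp (ContDiffAt.comp_contMDiffAt
    (f := fun p => (h.coord (c.L.indexAt (h.proj q)) p, h.base (h.proj q) p)) hA hb)).congr
    (h.eventually_η₁_eq hi hz)

theorem smoothFormAt_kob (a : ℂ) (q : h.Q) :
    SmoothFormAt (𝓘(ℝ, E).prod (𝓡 1)) (h.kob a) q := by
  have hi : h.proj q ∈ c.U (c.L.indexAt (h.proj q)) := c.L.mem_baseSet_at _
  have hz := mem_chart_source E (h.proj q)
  have hb := h.contMDiffAt_coordBase hi hz
  have hA : ContDiffAt ℝ ∞ (kobCoeff a (c.θLoc (c.L.indexAt (h.proj q)) (h.proj q)))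
      (h.coord (c.L.indexAt (h.proj q)) q, h.base (h.proj q) q) :=
    contDiffAt_kobCoeff a (c.contDiffAt_θLoc hi hz)
  exact ((smoothFormAt_mvfderiv hb).clm_comp (ContDiffAt.comp_contMDiffAt
    (f := fun p => (h.coord (c.L.indexAt (h.proj q)) p, h.base (h.proj q) p)) hA hb)).congr
    (h.eventually_kob_eq a hi hz)

/-- The coframe of `Q(L)` consisting of the coordinates of the base point in the chart at `z₀`
and of `η₁`. -/
def coframe (z₀ : Z) (q : h.Q) : TangentSpace (𝓘(ℝ, E).prod (𝓡 1)) q →L[ℝ] E × ℝ :=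
  (h.dbase z₀ q).prod (h.η₁ q)

theorem smoothFormAt_coframe {z₀ : Z} {q : h.Q} (hz : h.proj q ∈ (chartAt E z₀).source) :
    SmoothFormAt (𝓘(ℝ, E).prod (𝓡 1)) (h.coframe z₀) q :=
  (smoothFormAt_mvfderiv (h.contMDiffAt_base hz)).prodMk (h.smoothFormAt_η₁ q)

theorem eq_zero_of_dbase_of_η₁ {z₀ : Z} {q : h.Q} (hz : h.proj q ∈ (chartAt E z₀).source)
    {X : TangentSpace (𝓘(ℝ, E).prod (𝓡 1)) q} (hX : h.dbase z₀ q X = 0) (hX' : h.η₁ q X = 0) :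
    X = 0 := by
  refine h.eq_zero_of_dbase_of_dcoord (c.L.mem_baseSet_at _) hz hX ?_
  rw [h.dcoord_eq (c.L.mem_baseSet_at _) hz, hX, hX', map_zero]
  simp

theorem coframe_isInvertible [FiniteDimensional ℂ E] {z₀ : Z} {q : h.Q}
    (hz : h.proj q ∈ (chartAt E z₀).source) : (h.coframe z₀ q).IsInvertible := by
  let C : (E × EuclideanSpace ℝ (Fin 1)) →L[ℝ] E × ℝ := h.coframe z₀ q
  have hinj : Injective (C : (E × EuclideanSpace ℝ (Fin 1)) →ₗ[ℝ] E × ℝ) := by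
    refine (injective_iff_map_eq_zero _).2 fun X hX => ?_
    exact h.eq_zero_of_dbase_of_η₁ hz (congrArg Prod.fst hX) (congrArg Prod.snd hX)
  have hdim : Module.finrank ℝ (E × EuclideanSpace ℝ (Fin 1)) = Module.finrank ℝ (E × ℝ) := by
    simp
  exact ⟨(LinearEquiv.ofInjectiveOfFinrankEq
    (C : (E × EuclideanSpace ℝ (Fin 1)) →ₗ[ℝ] E × ℝ) hinj hdim).toContinuousLinearEquiv, by ext <;> rfl⟩

end ComplexContactStructure.HermitianStructure

/-! ### The three structures on a tangent space of the circle bundle -/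

section Model

variable {E : Type*} [NormedAddCommGroup E] [NormedSpace ℂ E]

/-- The endomorphism `(x, t) ↦ (i x, 0)` of `E × ℝ`. -/
def modelJ (E : Type*) [NormedAddCommGroup E] [NormedSpace ℂ E] : E × ℝ →L[ℝ] E × ℝ :=
  (ContinuousLinearMap.inl ℝ E ℝ).comp
    ((ContinuousLinearMap.lsmul ℝ ℂ Complex.I).comp (ContinuousLinearMap.fst ℝ E ℝ))

/-- The endomorphism `(x, t) ↦ (K (u x) - t i w⁻¹ v, Im (w θ(x)))` of `E × ℝ`, where `w = r u`. For
a unit complex number `u` it belongs to the contact form `Re (w θ)`, whose Reeb vector is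
`(w⁻¹ v, 0)`. -/
def modelΦ (θ : E →L[ℝ] ℂ) (K : E →L[ℝ] E) (v : E) (r : ℝ) (u : ℂ) : E × ℝ →L[ℝ] E × ℝ :=
  (ContinuousLinearMap.inl ℝ E ℝ).comp
      (K.comp ((ContinuousLinearMap.lsmul ℝ ℂ u).comp (ContinuousLinearMap.fst ℝ E ℝ)) -
        ((ContinuousLinearMap.lsmul ℝ ℝ).flip ((Complex.I * (r * u)⁻¹) • v)).comp
          (ContinuousLinearMap.snd ℝ E ℝ)) +
    (ContinuousLinearMap.inr ℝ E ℝ).comp (Complex.imCLM.comp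
      ((ContinuousLinearMap.mul ℝ ℂ (r * u)).comp (θ.comp (ContinuousLinearMap.fst ℝ E ℝ))))

/-- The inner product `g + dt²` on `E × ℝ`. -/
def modelG (g : E →L[ℝ] E →L[ℝ] ℝ) : E × ℝ →L[ℝ] E × ℝ →L[ℝ] ℝ :=
  ((ContinuousLinearMap.compL ℝ (E × ℝ) E ℝ).flip (ContinuousLinearMap.fst ℝ E ℝ)).comp
      (g.comp (ContinuousLinearMap.fst ℝ E ℝ)) +
    ((ContinuousLinearMap.compL ℝ (E × ℝ) ℝ ℝ).flip (ContinuousLinearMap.snd ℝ E ℝ)).comp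
      ((ContinuousLinearMap.mul ℝ ℝ).comp (ContinuousLinearMap.snd ℝ E ℝ))

@[simp] theorem modelJ_apply (p : E × ℝ) : modelJ E p = (Complex.I • p.1, 0) := rfl

@[simp] theorem modelΦ_apply (θ : E →L[ℝ] ℂ) (K : E →L[ℝ] E) (v : E) (r : ℝ) (u : ℂ) (p : E × ℝ) :
    modelΦ θ K v r u p = (K (u • p.1) - p.2 • ((Complex.I * (r * u)⁻¹) • v),
      (r * u * θ p.1).im) := by
  apply Prod.ext
  · exact add_zero _
  · exact zero_add _

@[simp] theorem modelG_apply (g : E →L[ℝ] E →L[ℝ] ℝ) (p p' : E × ℝ) :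
    modelG g p p' = g p.1 p'.1 + p.2 * p'.2 := rfl

namespace IsAdapted

variable {θ : E →L[ℝ] ℂ} {ψ : E →L[ℝ] E →L[ℝ] ℂ} {r : ℝ} {g : E →L[ℝ] E →L[ℝ] ℝ}
    {K : E →L[ℝ] E} {v : E} (A : IsAdapted θ ψ r g K v)

include A

theorem K_smul (a : ℂ) (x : E) : K (a • x) = starRingEnd ℂ a • K x := by
  have h : a • x = a.re • x + a.im • (Complex.I • x) := by
    conv_lhs => rw [← Complex.re_add_im a, add_smul, mul_smul]
    rfl
  have h' : starRingEnd ℂ a • K x = a.re • K x + -(a.im • (Complex.I • K x)) := by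
    conv_lhs => rw [← Complex.re_add_im a, map_add, map_mul, Complex.conj_I, Complex.conj_ofReal,
      Complex.conj_ofReal, add_smul, mul_smul, neg_smul, smul_neg]
    rfl
  rw [h, h', map_add, map_smul, map_smul, A.K_I, smul_neg]

theorem inner_smul_smul (a : ℂ) (x y : E) : g (a • x) (a • y) = ‖a‖ ^ 2 * g x y := by
  have h : ∀ x : E, a • x = a.re • x + a.im • (Complex.I • x) := fun x => by
    conv_lhs => rw [← Complex.re_add_im a, add_smul, mul_smul]
    rfl
  have h1 : g (Complex.I • x) y + g x (Complex.I • y) = 0 := by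
    have h2 := A.inner_I x (Complex.I • y)
    rw [smul_smul, Complex.I_mul_I, neg_one_smul, map_neg] at h2
    linarith
  rw [h, h, ← Complex.normSq_eq_norm_sq, Complex.normSq_apply]
  simp only [map_add, map_smul, add_apply, smul_apply, smul_eq_mul, A.inner_I]
  linear_combination a.re * a.im * h1

variable {u : ℂ} (hu : ‖u‖ = 1) (hr : 0 < r)

include hu hr

theorem inner_reeb_left (x : E) : g ((r * u)⁻¹ • v) x = (r * u * θ x).re := by
  have hu' : u * starRingEnd ℂ u = 1 := by rw [Complex.mul_conj, Complex.normSq_eq_norm_sq, hu]; simp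
  have hu0 : u ≠ 0 := by rintro rfl; simp at hu
  have h1 : starRingEnd ℂ ((r * u)⁻¹) = (r : ℂ)⁻¹ * u := by
    rw [map_inv₀, map_mul, Complex.conj_ofReal, mul_inv, inv_eq_of_mul_eq_one_left hu']
  have h2 : r ^ 2 * ((r : ℂ)⁻¹ * u * θ x).re = (r * u * θ x).re := by
    rw [← Complex.re_ofReal_mul]
    congr 1
    have : (r : ℂ) ≠ 0 := by exact_mod_cast hr.ne'
    push_cast
    field_simp
  rw [A.inner_reeb, h1, h2]

theorem inner_I_reeb_left (x : E) : g ((Complex.I * (r * u)⁻¹) • v) x = (r * u * θ x).im := by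
  have hu' : ‖-Complex.I * u‖ = 1 := by simp [hu]
  have h1 := A.inner_reeb_left hu' hr x
  have h2 : (r * (-Complex.I * u))⁻¹ = Complex.I * (r * u)⁻¹ := by
    rw [show r * (-Complex.I * u) = -Complex.I * (r * u) by ring, mul_inv, inv_neg, Complex.inv_I,
      neg_neg]
  rw [h2] at h1
  rw [h1, show r * (-Complex.I * u) * θ x = -(Complex.I * (r * u * θ x)) by ring, Complex.neg_re,
    Complex.I_mul_re, neg_neg]

variable (hθ : ∀ (a : ℂ) (x : E), θ (a • x) = a * θ x)

include hθ

theorem modelΦ_modelΦ (p : E × ℝ) :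
    modelΦ θ K v r u (modelΦ θ K v r u p) = -p + (r * u * θ p.1).re • ((r * u)⁻¹ • v, (0 : ℝ)) := by
  have hu' : starRingEnd ℂ u * u = 1 := by
    rw [mul_comm, Complex.mul_conj, Complex.normSq_eq_norm_sq, hu]; simp
  have hu0 : u ≠ 0 := by rintro rfl; simp at hu
  have hr0 : (r : ℂ) ≠ 0 := by exact_mod_cast hr.ne'
  have hw : (r * u : ℂ) ≠ 0 := mul_ne_zero hr0 hu0
  obtain ⟨x, t⟩ := p
  simp only [modelΦ_apply]
  apply Prod.ext
  · have h1 : K (u • (K (u • x) - t • ((Complex.I * (r * u)⁻¹) • v))) = -x + θ x • v := by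
      rw [smul_sub, map_sub, smul_comm u t, map_smul K t, smul_smul u, A.K_reeb, smul_zero, sub_zero,
        A.K_smul, A.K_K, hθ, smul_add, smul_neg, smul_smul, smul_smul, hu', one_smul, ← mul_assoc,
        hu', one_mul]
    have h2 : θ x • v - (r * u * θ x).im • ((Complex.I * (r * u)⁻¹) • v) =
        (r * u * θ x).re • ((r * u)⁻¹ • v) := by
      rw [← Complex.coe_smul, ← Complex.coe_smul, smul_smul, smul_smul, ← sub_smul]
      congr 1
      have h3 : θ x = (((r * u * θ x).re : ℂ) + (r * u * θ x).im * Complex.I) * (r * u)⁻¹ := by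
        rw [Complex.re_add_im]
        field_simp
      conv_lhs => enter [1]; rw [h3]
      ring
    change K (u • (K (u • x) - t • ((Complex.I * (r * u)⁻¹) • v))) -
      (r * u * θ x).im • ((Complex.I * (r * u)⁻¹) • v) = -x + (r * u * θ x).re • ((r * u)⁻¹ • v)
    rw [h1, ← h2]
    abel
  · change (r * u * θ (K (u • x) - t • ((Complex.I * (r * u)⁻¹) • v))).im = -t + _ * 0
    rw [map_sub, A.θ_K, map_smul, hθ, A.θ_reeb, mul_zero, add_zero, Complex.real_smul]
    have h1 : r * u * (0 - t * (Complex.I * (r * u)⁻¹ * 1)) = -(t * Complex.I) := by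
      field_simp
      ring
    rw [h1]
    simp

theorem modelG_modelΦ (hψ : ∀ x y, ψ x y = -ψ y x) (p p' : E × ℝ) :
    modelG g (modelΦ θ K v r u p) (modelΦ θ K v r u p') =
      modelG g p p' - (r * u * θ p.1).re * (r * u * θ p'.1).re := by
  have hu0 : u ≠ 0 := by rintro rfl; simp at hu
  have hr0 : (r : ℂ) ≠ 0 := by exact_mod_cast hr.ne'
  have hw : (r * u : ℂ) ≠ 0 := mul_ne_zero hr0 hu0
  obtain ⟨x, t⟩ := p
  obtain ⟨y, s⟩ := p'
  have hKv : ∀ x, g (K x) ((Complex.I * (r * u)⁻¹) • v) = 0 := fun x => by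
    rw [A.inner.symm, A.inner_I_reeb_left hu hr, A.θ_K, mul_zero, Complex.zero_im]
  have hvK : ∀ x, g ((Complex.I * (r * u)⁻¹) • v) (K x) = 0 := fun x => by
    rw [A.inner_I_reeb_left hu hr, A.θ_K, mul_zero, Complex.zero_im]
  have hvv : g ((Complex.I * (r * u)⁻¹) • v) ((Complex.I * (r * u)⁻¹) • v) = 1 := by
    rw [A.inner_I_reeb_left hu hr, hθ, A.θ_reeb]
    rw [show r * u * (Complex.I * (r * u)⁻¹ * 1) = Complex.I by field_simp, Complex.I_im]
  have hKK : g (K (u • x)) (K (u • y)) = g x y -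
      ((r * u * θ x).re * (r * u * θ y).re + (r * u * θ x).im * (r * u * θ y).im) := by
    have h1 : g (K (u • x)) (K (u • y)) = -g (K (K (u • y))) (u • x) := by
      rw [A.inner_K, A.inner_K, hψ, Complex.neg_re]
      ring
    have h2 : r ^ 2 * (starRingEnd ℂ (θ (u • y)) * θ (u • x)).re =
        (r * u * θ x).re * (r * u * θ y).re + (r * u * θ x).im * (r * u * θ y).im := by
      rw [hθ, hθ, mul_assoc (r : ℂ) u, mul_assoc (r : ℂ) u]
      simp only [Complex.re_ofReal_mul, Complex.im_ofReal_mul, Complex.mul_re (starRingEnd ℂ _),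
        Complex.conj_re, Complex.conj_im]
      ring
    rw [h1, A.K_K, map_add, map_neg, add_apply, neg_apply, A.inner_smul_smul, A.inner_reeb, h2, hu,
      A.inner.symm y x]
    ring
  simp only [modelΦ_apply, modelG_apply, map_sub, sub_apply, map_smul, smul_apply, smul_eq_mul,
    hKv, hvK, hvv, hKK]
  ring

omit hθ in
/-- The two-form `g(Φ ·, ·)` is the real part of `√-1 η₁ ∧ ϑ + w ψ`, with `η₁ = dt`, `ϑ = w θ` and
`w = r u`. -/
theorem modelG_modelΦ_left (hψ : ∀ (a : ℂ) x y, ψ (a • x) y = a * ψ x y) (p p' : E × ℝ) :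
    modelG g (modelΦ θ K v r u p) p' =
      (r * u * (Complex.I * p.2 * θ p'.1 - Complex.I * p'.2 * θ p.1 + ψ p.1 p'.1)).re := by
  obtain ⟨x, t⟩ := p
  obtain ⟨y, s⟩ := p'
  simp only [modelΦ_apply, modelG_apply, map_sub, sub_apply, map_smul, smul_apply, smul_eq_mul]
  rw [A.inner_I_reeb_left hu hr, A.inner_K, hψ]
  have h1 : r * u * (Complex.I * t * θ y - Complex.I * s * θ x + ψ x y) =
      t * (Complex.I * (r * u * θ y)) - s * (Complex.I * (r * u * θ x)) + r * (u * ψ x y) := by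
    ring
  rw [h1, Complex.add_re, Complex.sub_re, Complex.re_ofReal_mul, Complex.re_ofReal_mul,
    Complex.re_ofReal_mul, Complex.I_mul_re, Complex.I_mul_re]
  ring

end IsAdapted

end Model


section Model

variable {E : Type*} [NormedAddCommGroup E] [NormedSpace ℂ E]

/-- The linear form `(x, t) ↦ Re (w θ(x))` on `E × ℝ`, where `w = r u`. -/
def modelη (θ : E →L[ℝ] ℂ) (r : ℝ) (u : ℂ) : E × ℝ →L[ℝ] ℝ :=
  Complex.reCLM.comp
    ((ContinuousLinearMap.mul ℝ ℂ (r * u)).comp (θ.comp (ContinuousLinearMap.fst ℝ E ℝ)))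

/-- The vector `(w⁻¹ v, 0)` of `E × ℝ`, where `w = r u`. -/
def modelξ (v : E) (r : ℝ) (u : ℂ) : E × ℝ := ((r * u : ℂ)⁻¹ • v, 0)

theorem modelη_apply (θ : E →L[ℝ] ℂ) (r : ℝ) (u : ℂ) (p : E × ℝ) :
    modelη θ r u p = (r * u * θ p.1).re := rfl

/-- The relations of an almost contact `3`-structure for one ordered triple of indices, on a vector
space. -/
def ModelCyclic {W : Type*} [AddCommGroup W] [Module ℝ W] (Φα Φβ Φγ : W → W) (ξα ξβ ξγ : W)
    (ηα ηβ ηγ : W → ℝ) : Prop :=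
  (∀ p, Φα (Φβ p) - ηβ p • ξα = Φγ p ∧ -Φβ (Φα p) + ηα p • ξβ = Φγ p ∧
    ηα (Φβ p) = ηγ p ∧ -ηβ (Φα p) = ηγ p) ∧ Φα ξβ = ξγ ∧ -Φβ ξα = ξγ

theorem ofReal_mul_neg_I_mul (r : ℝ) (u : ℂ) : (r * (-Complex.I * u) : ℂ) = -Complex.I * (r * u) := by
  ring

theorem inv_ofReal_mul_neg_I_mul (r : ℝ) (u : ℂ) :
    (r * (-Complex.I * u) : ℂ)⁻¹ = Complex.I * (r * u)⁻¹ := by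
  rw [ofReal_mul_neg_I_mul, mul_inv, inv_neg, Complex.inv_I, neg_neg]

theorem modelη_rot (θ : E →L[ℝ] ℂ) (r : ℝ) (u : ℂ) (p : E × ℝ) :
    modelη θ r (-Complex.I * u) p = (r * u * θ p.1).im := by
  rw [modelη_apply, ofReal_mul_neg_I_mul, mul_assoc, neg_mul, Complex.neg_re, Complex.I_mul_re,
    neg_neg]

theorem modelξ_rot (v : E) (r : ℝ) (u : ℂ) :
    modelξ v r (-Complex.I * u) = ((Complex.I * (r * u)⁻¹) • v, 0) := by
  rw [modelξ, inv_ofReal_mul_neg_I_mul]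

namespace IsAdapted

variable {θ : E →L[ℝ] ℂ} {ψ : E →L[ℝ] E →L[ℝ] ℂ} {r : ℝ} {g : E →L[ℝ] E →L[ℝ] ℝ}
    {K : E →L[ℝ] E} {v : E} (A : IsAdapted θ ψ r g K v)

include A

theorem modelΦ_rot (u : ℂ) (p : E × ℝ) : modelΦ θ K v r (-Complex.I * u) p =
    (Complex.I • K (u • p.1) + p.2 • ((r * u : ℂ)⁻¹ • v), -(r * u * θ p.1).re) := by
  rw [modelΦ_apply, inv_ofReal_mul_neg_I_mul, ofReal_mul_neg_I_mul, mul_smul, A.K_smul (-Complex.I),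
    map_neg, Complex.conj_I, neg_neg, ← mul_assoc, Complex.I_mul_I, neg_one_mul, neg_smul, smul_neg,
    sub_neg_eq_add, mul_assoc, neg_mul, Complex.neg_im, Complex.I_mul_im]

variable {u : ℂ} (hu : ‖u‖ = 1) (hr : 0 < r) (hθ : ∀ (a : ℂ) (x : E), θ (a • x) = a * θ x)

include hu hr hθ

theorem cyclic_one : ModelCyclic (modelJ E) (modelΦ θ K v r u)
    (modelΦ θ K v r (-Complex.I * u)) (0, 1) (modelξ v r u) (modelξ v r (-Complex.I * u))
    Prod.snd (modelη θ r u) (modelη θ r (-Complex.I * u)) := by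
  have hu0 : u ≠ 0 := by rintro rfl; simp at hu
  have hr0 : (r : ℂ) ≠ 0 := by exact_mod_cast hr.ne'
  refine ⟨fun p => ⟨?_, ?_, ?_, ?_⟩, ?_, ?_⟩
  · rw [A.modelΦ_rot, modelJ_apply, modelΦ_apply, modelη_apply]
    ext
    · simp [smul_sub, smul_smul, smul_comm Complex.I p.2, ← mul_assoc]
    · simp
  · rw [A.modelΦ_rot, modelJ_apply, modelΦ_apply, modelξ]
    ext
    · simp [smul_comm u, A.K_I]
    · simp [hθ, mul_left_comm _ Complex.I]
  · rw [modelη_rot, modelΦ_apply]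
  · rw [modelη_rot, modelη_apply, modelJ_apply, hθ, mul_left_comm, Complex.I_mul_re, neg_neg]
  · rw [modelξ_rot, modelξ, modelJ_apply, smul_smul]
  · rw [modelξ_rot, modelΦ_apply]
    ext <;> simp

theorem cyclic_two : ModelCyclic (modelΦ θ K v r u) (modelΦ θ K v r (-Complex.I * u)) (modelJ E)
    (modelξ v r u) (modelξ v r (-Complex.I * u)) (0, 1)
    (modelη θ r u) (modelη θ r (-Complex.I * u)) Prod.snd := by
  have hu0 : u ≠ 0 := by rintro rfl; simp at hu
  have hr0 : (r : ℂ) ≠ 0 := by exact_mod_cast hr.ne'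
  have hu' : starRingEnd ℂ u * u = 1 := by
    rw [mul_comm, Complex.mul_conj, Complex.normSq_eq_norm_sq, hu]; simp
  have hKK : ∀ x, starRingEnd ℂ u • K (K (u • x)) = -x + θ x • v := fun x => by
    rw [A.K_K, hθ, smul_add, smul_neg, smul_smul, smul_smul, hu', one_smul, ← mul_assoc, hu',
      one_mul]
  have hKv : ∀ (a : ℝ) (b : ℂ), K (u • (a • b • v)) = 0 := fun a b => by
    rw [smul_comm u a, map_smul K a, smul_smul, A.K_reeb, smul_zero]
  have hIθ : ∀ x, Complex.I • (θ x • v) =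
      (r * u * θ x).re • ((Complex.I * (r * u : ℂ)⁻¹) • v) -
        (r * u * θ x).im • ((r * u : ℂ)⁻¹ • v) := fun x => by
    rw [← Complex.coe_smul, ← Complex.coe_smul, smul_smul, smul_smul, smul_smul, ← sub_smul]
    congr 1
    have h3 : θ x = (((r * u * θ x).re : ℂ) + (r * u * θ x).im * Complex.I) * (r * u)⁻¹ := by
      rw [Complex.re_add_im]
      field_simp
    conv_lhs => rw [h3]
    linear_combination ((r * u * θ x).im : ℂ) * (r * u : ℂ)⁻¹ * Complex.I_mul_I
  have h1 : ∀ (x : E) (t : ℝ), K (u • (Complex.I • K (u • x) + t • ((r * u : ℂ)⁻¹ • v))) =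
      Complex.I • x - Complex.I • (θ x • v) := fun x t => by
    rw [smul_add, map_add, hKv, add_zero, smul_comm u, A.K_I, A.K_smul, hKK, smul_add, smul_neg]
    abel
  have h2 : ∀ (x : E) (t : ℝ), K (u • (K (u • x) - t • ((Complex.I * (r * u : ℂ)⁻¹) • v))) =
      -x + θ x • v := fun x t => by
    rw [smul_sub, map_sub, hKv, sub_zero, A.K_smul, hKK]
  have h3 : ∀ (x : E) (t : ℝ), r * u * θ (Complex.I • K (u • x) + t • ((r * u : ℂ)⁻¹ • v)) = t :=
    fun x t => by
      rw [map_add, hθ, A.θ_K, mul_zero, zero_add, map_smul, hθ, A.θ_reeb, mul_one,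
        Complex.real_smul]
      field_simp
  have h4 : ∀ (x : E) (t : ℝ),
      r * u * θ (K (u • x) - t • ((Complex.I * (r * u : ℂ)⁻¹) • v)) = -(t * Complex.I) :=
    fun x t => by
      rw [map_sub, A.θ_K, zero_sub, map_smul, hθ, A.θ_reeb, mul_one, Complex.real_smul]
      field_simp
  refine ⟨fun p => ⟨?_, ?_, ?_, ?_⟩, ?_, ?_⟩
  · rw [A.modelΦ_rot, modelJ_apply, modelΦ_apply, modelη_rot, modelξ]
    apply Prod.ext
    · change K (u • (_ + _)) - (-(_ : ℝ)) • _ - _ • _ = _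
      rw [h1, hIθ, neg_smul]
      abel
    · change (r * u * θ _).im - _ • (0 : ℝ) = 0
      rw [h3, Complex.ofReal_im, smul_zero, sub_zero]
  · rw [modelΦ_apply _ _ _ _ u, A.modelΦ_rot, modelJ_apply, modelη_apply, modelξ_rot]
    apply Prod.ext
    · change -(Complex.I • K (u • (_ - _)) + _) + _ • ((Complex.I * (r * u : ℂ)⁻¹) • v) = _
      rw [h2, smul_add, smul_neg, hIθ]
      abel
    · change - -(r * u * θ _).re + _ • (0 : ℝ) = 0
      rw [h4]
      simp
  · rw [modelη_apply, A.modelΦ_rot, h3, Complex.ofReal_re]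
  · rw [modelη_rot, modelΦ_apply, h4]
    simp
  · rw [modelξ_rot, modelΦ_apply]
    apply Prod.ext
    · change K (u • _) - (0 : ℝ) • _ = 0
      rw [smul_smul, A.K_reeb, zero_smul, sub_zero]
    · change (r * u * θ _).im = 1
      rw [hθ, A.θ_reeb, mul_one, mul_left_comm, mul_inv_cancel₀ (mul_ne_zero hr0 hu0), mul_one,
        Complex.I_im]
  · rw [modelξ, A.modelΦ_rot]
    apply Prod.ext
    · change -(Complex.I • K (u • _) + (0 : ℝ) • _) = 0
      rw [smul_smul, A.K_reeb, zero_smul, smul_zero, add_zero, neg_zero]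
    · change - -(r * u * θ _).re = 1
      rw [hθ, A.θ_reeb, mul_one, mul_inv_cancel₀ (mul_ne_zero hr0 hu0), neg_neg, Complex.one_re]

theorem cyclic_three : ModelCyclic (modelΦ θ K v r (-Complex.I * u)) (modelJ E)
    (modelΦ θ K v r u) (modelξ v r (-Complex.I * u)) (0, 1) (modelξ v r u)
    (modelη θ r (-Complex.I * u)) Prod.snd (modelη θ r u) := by
  have hu0 : u ≠ 0 := by rintro rfl; simp at hu
  have hr0 : (r : ℂ) ≠ 0 := by exact_mod_cast hr.ne'
  refine ⟨fun p => ⟨?_, ?_, ?_, ?_⟩, ?_, ?_⟩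
  · rw [A.modelΦ_rot, modelJ_apply, modelΦ_apply, modelξ_rot]
    ext
    · change Complex.I • K (u • (Complex.I • p.1)) + (0 : ℝ) • _ - _ = _
      rw [smul_comm u, A.K_I, smul_neg, smul_smul, Complex.I_mul_I, neg_one_smul, neg_neg,
        zero_smul, add_zero]
      rfl
    · simp [hθ, mul_left_comm _ Complex.I]
  · rw [A.modelΦ_rot, modelJ_apply, modelΦ_apply, modelη_rot]
    ext
    · simp [smul_add, smul_smul, smul_comm Complex.I p.2]
      abel
    · simp
  · rw [modelη_rot, modelη_apply, modelJ_apply, hθ, mul_left_comm, Complex.I_mul_im]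
  · rw [modelη_apply, A.modelΦ_rot, neg_neg]
  · rw [modelξ, A.modelΦ_rot]
    ext <;> simp
  · rw [modelξ_rot, modelJ_apply, modelξ, smul_smul, ← mul_assoc, Complex.I_mul_I]
    ext <;> simp

theorem modelη_modelξ : modelη θ r u (modelξ v r u) = 1 := by
  have hu0 : u ≠ 0 := by rintro rfl; simp at hu
  have hr0 : (r : ℂ) ≠ 0 := by exact_mod_cast hr.ne'
  rw [modelη_apply, modelξ, hθ, A.θ_reeb, mul_one, mul_inv_cancel₀ (mul_ne_zero hr0 hu0),
    Complex.one_re]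

theorem modelΦ_modelξ : modelΦ θ K v r u (modelξ v r u) = 0 := by
  have hu0 : u ≠ 0 := by rintro rfl; simp at hu
  have hr0 : (r : ℂ) ≠ 0 := by exact_mod_cast hr.ne'
  rw [modelΦ_apply, modelξ, hθ, A.θ_reeb, mul_one, mul_inv_cancel₀ (mul_ne_zero hr0 hu0),
    Complex.one_im, smul_smul, A.K_reeb, zero_smul, sub_zero]
  rfl

theorem modelη_modelΦ (p : E × ℝ) : modelη θ r u (modelΦ θ K v r u p) = 0 := by
  have hu0 : u ≠ 0 := by rintro rfl; simp at hu
  have hr0 : (r : ℂ) ≠ 0 := by exact_mod_cast hr.ne'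
  rw [modelη_apply, modelΦ_apply, map_sub, A.θ_K, zero_sub, map_smul, hθ, A.θ_reeb, mul_one,
    Complex.real_smul, show r * u * -(p.2 * (Complex.I * (r * u)⁻¹)) = -(p.2 * Complex.I) by
      field_simp]
  simp

omit hu hr hθ in
theorem modelG_isInner : IsInner (modelG g) where
  symm p p' := by rw [modelG_apply, modelG_apply, A.inner.symm, mul_comm]
  pos p hp := by
    rw [modelG_apply]
    rcases eq_or_ne p.1 0 with h1 | h1
    · have h2 : p.2 ≠ 0 := fun h2 => hp (Prod.ext h1 h2)
      have := mul_self_pos.2 h2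
      rw [h1]
      simpa using this
    · have := A.inner.pos _ h1
      nlinarith [mul_self_nonneg p.2]

/-- The contact condition for `η` and `g(Φ ·, ·)`: the latter is nondegenerate on the kernel of
`η`. -/
theorem wedgePow_model_ne_zero [FiniteDimensional ℂ E]
    (hψ : ∀ (a : ℂ) x y, ψ (a • x) y = a * ψ x y) (hψ' : ∀ x y, ψ x y = -ψ y x) (m : ℕ)
    (hm : Module.finrank ℝ (E × ℝ) = 2 * m + 1) :
    wedgePow (fun p => modelη θ r u p) (fun p p' => modelG g (modelΦ θ K v r u p) p') m ≠ 0 := by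
  let β : (E × ℝ) →ₗ[ℝ] (E × ℝ) →ₗ[ℝ] ℝ := LinearMap.mk₂ ℝ
    (fun p p' => modelG g (modelΦ θ K v r u p) p')
    (by intros; simp only [map_add, add_apply]) (by intros; simp only [map_smul, smul_apply])
    (by intros; simp only [map_add]) (by intros; simp only [map_smul])
  refine wedgePow_ne_zero_of_nondegenerate (modelη θ r u : E × ℝ →ₗ[ℝ] ℝ) β (modelξ v r u)
    (fun p p' => ?_) (A.modelη_modelξ hu hr hθ) (fun p => ?_) (fun p hp hp' => ?_) m hm
  · change modelG g _ _ = -modelG g _ _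
    rw [A.modelG_modelΦ_left hu hr hψ, A.modelG_modelΦ_left hu hr hψ, hψ' p.1, ← Complex.neg_re]
    congr 1
    ring
  · change modelG g (modelΦ θ K v r u (modelξ v r u)) p = 0
    rw [A.modelΦ_modelξ hu hr hθ, map_zero, zero_apply]
  · have h1 : modelΦ θ K v r u p = 0 :=
      A.modelG_isInner.eq_zero (hp' _ (A.modelη_modelΦ hu hr hθ p))
    have h2 := A.modelΦ_modelΦ hu hr hθ p
    rw [h1, map_zero, ← modelη_apply θ r u p, show modelη θ r u p = 0 from hp, zero_smul, add_zero] at h2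
    exact neg_eq_zero.1 h2.symm

end IsAdapted

/-- The endomorphism of `E × ℝ` that multiplies the kernel of `θ` by `a` and the Reeb vector
by `a²`. -/
def scaleMap (θ : E →L[ℝ] ℂ) (v : E) (a : ℂ) : E × ℝ →L[ℝ] E × ℝ :=
  (ContinuousLinearMap.inl ℝ E ℝ).comp
      (((ContinuousLinearMap.lsmul ℝ ℂ a).comp (ContinuousLinearMap.id ℝ E - vertPart θ v) +
        (ContinuousLinearMap.lsmul ℝ ℂ (a ^ 2)).comp (vertPart θ v)).comp
          (ContinuousLinearMap.fst ℝ E ℝ)) +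
    (ContinuousLinearMap.inr ℝ E ℝ).comp (ContinuousLinearMap.snd ℝ E ℝ)

theorem scaleMap_apply (θ : E →L[ℝ] ℂ) (v : E) (a : ℂ) (p : E × ℝ) :
    scaleMap θ v a p = (a • (p.1 - θ p.1 • v) + a ^ 2 • (θ p.1 • v), p.2) := by
  apply Prod.ext
  · exact add_zero _
  · exact zero_add _

namespace IsAdapted

variable {θ : E →L[ℝ] ℂ} {ψ : E →L[ℝ] E →L[ℝ] ℂ} {r : ℝ} {g : E →L[ℝ] E →L[ℝ] ℝ}
    {K : E →L[ℝ] E} {v : E} (A : IsAdapted θ ψ r g K v)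

include A

theorem θ_scaleMap (hθ : ∀ (a : ℂ) (x : E), θ (a • x) = a * θ x) (a : ℂ) (p : E × ℝ) :
    θ (scaleMap θ v a p).1 = a ^ 2 * θ p.1 := by
  rw [scaleMap_apply, map_add, hθ, map_sub, hθ (θ p.1), A.θ_reeb, mul_one, sub_self, mul_zero,
    zero_add, hθ, hθ, A.θ_reeb, mul_one]

theorem scaleMap_comp (hθ : ∀ (a : ℂ) (x : E), θ (a • x) = a * θ x) (a b : ℂ) :
    (scaleMap θ v a).comp (scaleMap θ v b) = scaleMap θ v (a * b) := by
  refine ContinuousLinearMap.ext fun p => ?_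
  rw [ContinuousLinearMap.comp_apply, scaleMap_apply θ v a, A.θ_scaleMap hθ, scaleMap_apply θ v b,
    scaleMap_apply θ v (a * b)]
  refine Prod.ext ?_ rfl
  simp only [mul_smul, mul_pow]
  rw [add_sub_cancel_right]

omit A in
theorem scaleMap_one : scaleMap θ v 1 = ContinuousLinearMap.id ℝ (E × ℝ) := by
  refine ContinuousLinearMap.ext fun p => ?_
  rw [scaleMap_apply]
  simp

/-- The volume forms of `Re ϑ` and `Im ϑ` agree: they are exchanged by a linear map which, being the
square of a map of finite order, has determinant one. -/
theorem wedgePow_rot [FiniteDimensional ℂ E] (hθ : ∀ (a : ℂ) (x : E), θ (a • x) = a * θ x)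
    (hψ : ∀ (a : ℂ) x y, ψ (a • x) y = a * ψ x y) (hψ' : ∀ x y, ψ x y = -ψ y x) {u : ℂ}
    (hu : ‖u‖ = 1) (hr : 0 < r) (m : ℕ) (hm : Module.finrank ℝ (E × ℝ) = 2 * m + 1) :
    wedgePow (fun p => modelη θ r (-Complex.I * u) p)
        (fun p p' => modelG g (modelΦ θ K v r (-Complex.I * u) p) p') m =
      wedgePow (fun p => modelη θ r u p) (fun p p' => modelG g (modelΦ θ K v r u p) p') m := by
  -- With `a⁴ = -i`, the map `S (a²)` multiplies `θ` by `-i` and `ψ` by `-i` as well. It is the square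
  -- of `S a`, and `S a ^ 16 = 1`.
  obtain ⟨a, ha⟩ := IsAlgClosed.exists_pow_nat_eq (-Complex.I) (n := 4) (by norm_num)
  have hu' : ‖-Complex.I * u‖ = 1 := by simp [hu]
  let β : (E × ℝ) →ₗ[ℝ] (E × ℝ) →ₗ[ℝ] ℝ := LinearMap.mk₂ ℝ
    (fun p p' => modelG g (modelΦ θ K v r u p) p')
    (by intros; simp only [map_add, add_apply]) (by intros; simp only [map_smul, smul_apply])
    (by intros; simp only [map_add]) (by intros; simp only [map_smul])
  let S : ℂ → (E × ℝ →ₗ[ℝ] E × ℝ) := fun a => scaleMap θ v a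
  have hS : ∀ a b, S a * S b = S (a * b) := fun a b =>
    LinearMap.ext fun p => DFunLike.congr_fun (A.scaleMap_comp hθ a b) p
  have hS1 : S 1 = 1 :=
    LinearMap.ext fun p => DFunLike.congr_fun (scaleMap_one (θ := θ) (v := v)) p
  have hSpow : ∀ k : ℕ, S a ^ k = S (a ^ k) := fun k => by
    induction k with
    | zero => rw [pow_zero, pow_zero, hS1]
    | succ k ih => rw [pow_succ, pow_succ, ih, hS]
  have hdet : LinearMap.det (S (a ^ 2)) = 1 := by
    have h1 : LinearMap.det (S a) ^ 16 = 1 := by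
      rw [← map_pow, hSpow, show a ^ 16 = (a ^ 4) ^ 4 by ring, ha, neg_pow, Complex.I_pow_four]
      norm_num
      rw [hS1, map_one]
    rw [← hSpow, map_pow]
    rcases (pow_eq_one_iff_of_ne_zero (by norm_num)).1 h1 with h2 | ⟨h2, -⟩ <;> rw [h2] <;> norm_num
  funext w
  have h1 := wedgePow_comp_det (modelη θ r u : E × ℝ →ₗ[ℝ] ℝ) β m hm (S (a ^ 2)) w
  rw [hdet, one_mul] at h1
  refine Eq.trans ?_ h1
  have hη : (fun p => modelη θ r (-Complex.I * u) p) =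
      fun p => (modelη θ r u : E × ℝ →ₗ[ℝ] ℝ) (S (a ^ 2) p) := by
    funext p
    change _ = (r * u * θ (scaleMap θ v (a ^ 2) p).1).re
    rw [A.θ_scaleMap hθ, ← pow_mul, ha, modelη_apply]
    congr 1
    ring
  have hψs : ∀ p p' : E × ℝ, ψ (scaleMap θ v (a ^ 2) p).1 (scaleMap θ v (a ^ 2) p').1 =
      a ^ 4 * ψ p.1 p'.1 := fun p p' => by
    have hv : ∀ x, ψ x v = 0 := fun x => by rw [hψ', A.ψ_reeb, neg_zero]
    have hs : ∀ (b : ℂ) x y, ψ x (b • y) = b * ψ x y := fun b x y => by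
      rw [hψ', hψ, hψ' y]
      ring
    rw [scaleMap_apply, scaleMap_apply]
    simp only [map_add, map_sub, add_apply, sub_apply, hs, hψ, A.ψ_reeb, hv]
    ring
  have hβ : (fun p p' => modelG g (modelΦ θ K v r (-Complex.I * u) p) p') =
      fun p p' => β (S (a ^ 2) p) (S (a ^ 2) p') := by
    funext p p'
    change _ = modelG g (modelΦ θ K v r u (scaleMap θ v (a ^ 2) p)) (scaleMap θ v (a ^ 2) p')
    rw [A.modelG_modelΦ_left hu' hr hψ, A.modelG_modelΦ_left hu hr hψ, hψs, A.θ_scaleMap hθ,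
      A.θ_scaleMap hθ, ← pow_mul, ha]
    have h2 : ∀ p : E × ℝ, (scaleMap θ v (a ^ 2) p).2 = p.2 := fun p => by rw [scaleMap_apply]
    rw [h2, h2]
    congr 1
    ring
  rw [hη, hβ]

end IsAdapted

end Model


/-! ### Metrics -/

section Metrics

variable {EM : Type*} [NormedAddCommGroup EM] [NormedSpace ℝ EM] [FiniteDimensional ℝ EM]

theorem IsInner.isVonNBounded {g : EM →L[ℝ] EM →L[ℝ] ℝ} (hg : IsInner g) :
    Bornology.IsVonNBounded ℝ {v : EM | g v v < 1} := by
  obtain ⟨a, ha, hag⟩ := exists_coercive hg.pos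
  refine (NormedSpace.isVonNBounded_iff' ℝ).2 ⟨max 1 a⁻¹, fun v hv => ?_⟩
  have h1 : a * ‖v‖ ^ 2 < 1 := (hag v).trans_lt hv
  by_contra! h2
  obtain ⟨h3, h4⟩ := max_lt_iff.1 h2
  have h5 : 1 < a * ‖v‖ := by
    have := mul_lt_mul_of_pos_left h4 ha
    rwa [mul_inv_cancel₀ ha.ne'] at this
  nlinarith [norm_nonneg v]

variable {HM : Type*} [TopologicalSpace HM] {I : ModelWithCorners ℝ EM HM}
  {M : Type*} [TopologicalSpace M] [ChartedSpace HM M] [IsManifold I ∞ M]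

/-- The Riemannian metric given by a smooth family of inner products. -/
def metricOfInner (g : ∀ x : M, TangentSpace I x →L[ℝ] TangentSpace I x →L[ℝ] ℝ)
    (hg : ∀ x, IsInner (E := EM) (g x))
    (hs : ContMDiff I (I.prod 𝓘(ℝ, EM →L[ℝ] EM →L[ℝ] ℝ)) ∞
      (fun x => TotalSpace.mk' (EM →L[ℝ] EM →L[ℝ] ℝ) x (g x))) : Metric I M where
  inner := g
  symm x := (hg x).symm
  pos x := (hg x).pos
  isVonNBounded x := (hg x).isVonNBounded
  contMDiff := hs

end Metrics

section Hermitian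

variable (E : Type*) [NormedAddCommGroup E] [NormedSpace ℂ E] [FiniteDimensional ℂ E]

theorem exists_hermitian_inner : ∃ g : E →L[ℝ] E →L[ℝ] ℝ, IsInner g ∧
    ∀ x y, g (Complex.I • x) (Complex.I • y) = g x y := by
  let e := (Module.finBasis ℂ E).equivFun.toContinuousLinearEquiv
  let ek : Fin (Module.finrank ℂ E) → E →L[ℝ] ℂ := fun k =>
    (((ContinuousLinearMap.proj k : (Fin (Module.finrank ℂ E) → ℂ) →L[ℂ] ℂ).comp
      (e : E →L[ℂ] _)).restrictScalars ℝ)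
  let g : E →L[ℝ] E →L[ℝ] ℝ :=
    ∑ k, reBilin (outer ((Complex.conjCLE : ℂ →L[ℝ] ℂ).comp (ek k)) (ek k))
  have hg : ∀ x y, g x y = ∑ k, (starRingEnd ℂ (e x k) * e y k).re := fun x y => by
    simp only [g, sum_apply]
    rfl
  refine ⟨g, ⟨fun x y => ?_, fun x hx => ?_⟩, fun x y => ?_⟩
  · rw [hg, hg]
    refine Finset.sum_congr rfl fun k _ => ?_
    rw [← Complex.conj_re, map_mul, Complex.conj_conj, mul_comm]
  · rw [hg]
    have h1 : ∀ k, (starRingEnd ℂ (e x k) * e x k).re = ‖e x k‖ ^ 2 := fun k => by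
      rw [mul_comm, Complex.mul_conj, Complex.ofReal_re, Complex.normSq_eq_norm_sq]
    simp only [h1]
    have h2 : e x ≠ 0 := fun h => hx (e.map_eq_zero_iff.1 h)
    obtain ⟨k, hk⟩ := Function.ne_iff.1 h2
    exact Finset.sum_pos' (fun k _ => sq_nonneg _)
      ⟨k, Finset.mem_univ k, pow_pos (norm_pos_iff.2 hk) 2⟩
  · rw [hg, hg]
    refine Finset.sum_congr rfl fun k _ => ?_
    rw [map_smul, map_smul, Pi.smul_apply, Pi.smul_apply, smul_eq_mul, smul_eq_mul, map_mul,
      Complex.conj_I]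
    congr 1
    linear_combination (-(starRingEnd ℂ (e x k)) * e y k) * Complex.I_mul_I

omit [FiniteDimensional ℂ E] in
theorem convex_hermitian_inner : Convex ℝ {g : E →L[ℝ] E →L[ℝ] ℝ | IsInner g ∧
    ∀ x y, g (Complex.I • x) (Complex.I • y) = g x y} := by
  rintro g ⟨hg, hgI⟩ g' ⟨hg', hgI'⟩ a b ha hb hab
  refine ⟨⟨fun x y => ?_, fun x hx => ?_⟩, fun X Y => ?_⟩
  · change a * g x y + b * g' x y = a * g y x + b * g' y x
    rw [hg.symm, hg'.symm]
  · change 0 < a * g x x + b * g' x x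
    have h1 := hg.pos x hx
    have h2 := hg'.pos x hx
    rcases ha.eq_or_lt with rfl | ha
    · have : b = 1 := by linarith
      rw [this]
      linarith
    · have := mul_pos ha h1
      have := mul_nonneg hb h2.le
      linarith
  · change a * g _ _ + b * g' _ _ = a * g X Y + b * g' X Y
    rw [hgI, hgI']

variable {E}
variable {Z : Type*} [TopologicalSpace Z] [ChartedSpace E Z] [IsManifold 𝓘(ℂ, E) ω Z]

/-- An inner product on the model space, moved to the tangent spaces by the chart at `z₀`. -/
def chartInner (g₀ : E →L[ℝ] E →L[ℝ] ℝ) (z₀ z : Z) :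
    TangentSpace 𝓘(ℝ, E) z →L[ℝ] TangentSpace 𝓘(ℝ, E) z →L[ℝ] ℝ :=
  pullBilin (E := E) g₀ (dchart 𝓘(ℝ, E) z₀ z)

omit [FiniteDimensional ℂ E] in
theorem contMDiffAt_chartInner (g₀ : E →L[ℝ] E →L[ℝ] ℝ) {z₀ z : Z}
    (hz : z ∈ (chartAt E z₀).source) :
    ContMDiffAt 𝓘(ℝ, E) (𝓘(ℝ, E).prod 𝓘(ℝ, E →L[ℝ] E →L[ℝ] ℝ)) ∞
      (fun z => TotalSpace.mk' (E →L[ℝ] E →L[ℝ] ℝ) z (chartInner g₀ z₀ z)) z := by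
  obtain ⟨C, hC, h⟩ := smoothFormAt_mvfderiv (I := 𝓘(ℝ, E)) (contMDiffAt_extChartAt' hz)
  refine contMDiffAt_bilinear (n := ⊤) (contMDiffAt_pullBilin
    (contMDiffAt_const (c := g₀)) hC) ?_
  filter_upwards [h] with y hy X Y
  exact congrArg₂ (fun s t => g₀ s t) (hy X) (hy Y)

omit [FiniteDimensional ℂ E] in
theorem chartInner_hermitian {g₀ : E →L[ℝ] E →L[ℝ] ℝ} (hg₀ : IsInner g₀)
    (hg₀I : ∀ x y, g₀ (Complex.I • x) (Complex.I • y) = g₀ x y) {z₀ z : Z}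
    (hz : z ∈ (chartAt E z₀).source) :
    IsInner (E := E) (chartInner g₀ z₀ z) ∧ ∀ X Y : TangentSpace 𝓘(ℝ, E) z,
      chartInner g₀ z₀ z (complexStructure z X) (complexStructure z Y) =
        chartInner g₀ z₀ z X Y := by
  refine ⟨⟨?_, ?_⟩, ?_⟩
  · exact fun x y => hg₀.symm _ _
  · intro x hx
    refine hg₀.pos _ fun h0 => hx ?_
    have h1 := dchartSymm_dchart (I := 𝓘(ℝ, E)) hz x
    exact h1.symm.trans ((congrArg _ h0).trans (map_zero _))
  · intro X Y
    have h1 := dchart_smul hz Complex.I X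
    have h2 := dchart_smul hz Complex.I Y
    exact (congrArg₂ (fun s t => g₀ s t) h1 h2).trans (hg₀I _ _)

variable [T2Space Z] [SecondCountableTopology Z]

variable (E Z) in
set_option synthInstance.maxHeartbeats 400000 in
set_option maxHeartbeats 1000000 in
/-- A complex manifold carries Hermitian metrics. -/
theorem exists_hermitian_metric : ∃ g : Metric 𝓘(ℝ, E) Z,
    ∀ (z : Z) (X Y : TangentSpace 𝓘(ℝ, E) z),
      g.inner z (complexStructure z X) (complexStructure z Y) = g.inner z X Y := by
  have : LocallyCompactSpace Z := Manifold.locallyCompact_of_finiteDimensional 𝓘(ℝ, E)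
  obtain ⟨g₀, hg₀, hg₀I⟩ := exists_hermitian_inner E
  let t : ∀ z : Z, Set (TangentSpace 𝓘(ℝ, E) z →L[ℝ] TangentSpace 𝓘(ℝ, E) z →L[ℝ] ℝ) := fun z =>
    {g | IsInner (E := E) g ∧
      ∀ X Y : TangentSpace 𝓘(ℝ, E) z, g (complexStructure z X) (complexStructure z Y) = g X Y}
  have ht : ∀ z, Convex ℝ (t z) := by
    intro z g hg g' hg' a b ha hb hab
    exact convex_hermitian_inner E hg hg' ha hb hab
  obtain ⟨s, hs⟩ := exists_contMDiffSection_forall_mem_convex_of_local (n := ⊤) 𝓘(ℝ, E)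
    (F_fiber := E →L[ℝ] E →L[ℝ] ℝ)
    (fun z : Z => TangentSpace 𝓘(ℝ, E) z →L[ℝ] TangentSpace 𝓘(ℝ, E) z →L[ℝ] ℝ) t ht
    fun z₀ => ⟨(chartAt E z₀).source, (chartAt E z₀).open_source.mem_nhds (mem_chart_source E z₀),
      chartInner g₀ z₀, fun z hz => (contMDiffAt_chartInner g₀ hz).contMDiffWithinAt,
      fun z hz => chartInner_hermitian hg₀ hg₀I hz⟩
  exact ⟨metricOfInner s (fun z => (hs z).1) s.contMDiff, fun z => (hs z).2⟩

end Hermitian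


/-! ### Adapted tensors on the base -/

section Local

variable {E : Type*} [NormedAddCommGroup E] [NormedSpace ℂ E]
  {Z : Type*} [TopologicalSpace Z] [ChartedSpace E Z] [IsManifold 𝓘(ℂ, E) ω Z]
  (g : Metric 𝓘(ℝ, E) Z)

/-- A Riemannian metric on `Z` in the chart at `z₀`. -/
def gLoc (z₀ z : Z) : E →L[ℝ] E →L[ℝ] ℝ :=
  pullBilin (E := E) (g.inner z) (dchartSymm 𝓘(ℝ, E) z₀ z)

theorem gLoc_dchart {z₀ z : Z} (hz : z ∈ (chartAt E z₀).source) (X Y : TangentSpace 𝓘(ℝ, E) z) :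
    gLoc g z₀ z (dchart 𝓘(ℝ, E) z₀ z X) (dchart 𝓘(ℝ, E) z₀ z Y) = g.inner z X Y :=
  congrArg₂ (fun s t => g.inner z s t) (dchartSymm_dchart hz X) (dchartSymm_dchart hz Y)

/-- The differential of the chart at `z₀`, as an isomorphism. -/
def dchartEquiv {z₀ z : Z} (hz : z ∈ (chartAt E z₀).source) : E ≃L[ℝ] E :=
  .equivOfInverse (dchart 𝓘(ℝ, E) z₀ z : E →L[ℝ] E) (dchartSymm 𝓘(ℝ, E) z₀ z : E →L[ℝ] E)
    (dchartSymm_dchart hz) (dchart_dchartSymm hz)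

theorem gLoc_isInner {z₀ z : Z} (hz : z ∈ (chartAt E z₀).source) : IsInner (gLoc g z₀ z) := by
  refine ⟨fun x y => g.symm z _ _, fun x hx => g.pos z _ fun h0 => hx ?_⟩
  exact (dchart_dchartSymm (I := 𝓘(ℝ, E)) hz x).symm.trans ((congrArg _ h0).trans (map_zero _))

theorem gLoc_I (hgI : ∀ (z : Z) (X Y : TangentSpace 𝓘(ℝ, E) z),
      g.inner z (complexStructure z X) (complexStructure z Y) = g.inner z X Y)
    {z₀ z : Z} (hz : z ∈ (chartAt E z₀).source) (x y : E) :
    gLoc g z₀ z (Complex.I • x) (Complex.I • y) = gLoc g z₀ z x y := by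
  obtain ⟨X, rfl⟩ := (dchartEquiv hz).surjective x
  obtain ⟨Y, rfl⟩ := (dchartEquiv hz).surjective y
  have h1 := dchart_smul hz Complex.I X
  have h2 := dchart_smul hz Complex.I Y
  refine (congrArg₂ (fun s t => gLoc g z₀ z s t) h1.symm h2.symm).trans ?_
  exact (gLoc_dchart g hz _ _).trans ((hgI z X Y).trans (gLoc_dchart g hz X Y).symm)

theorem contMDiffAt_gLoc (z₀ : Z) :
    ContMDiffAt 𝓘(ℝ, E) 𝓘(ℝ, E →L[ℝ] E →L[ℝ] ℝ) ∞ (gLoc g z₀) z₀ := by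
  obtain ⟨g', hg', h⟩ := exists_bilinear (n := ⊤) (g.contMDiff.contMDiffAt (x := z₀))
  refine hg'.congr_of_eventuallyEq ?_
  filter_upwards [h, eventually_mem_chart_source (HM := E) z₀] with z h1 h2
  refine ContinuousLinearMap.ext fun x => ContinuousLinearMap.ext fun y => ?_
  refine (h1 _ _).trans ?_
  exact congrArg₂ (fun s t => g' z s t) (dchart_dchartSymm h2 x) (dchart_dchartSymm h2 y)

namespace ComplexContactStructure.HermitianStructure

variable {n : ℕ} {ι : Type*} {c : ComplexContactStructure n E Z ι} (h : c.HermitianStructure)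

/-- The complex Reeb vector of `(θ_i, ψ_i)` in the chart at `z₀`. -/
def reebLoc (i : ι) (z₀ z : Z) : E :=
  reeb (c.θLoc i z₀ (extChartAt 𝓘(ℝ, E) z₀ z)) (h.ψLoc i z₀ (extChartAt 𝓘(ℝ, E) z₀ z))

/-- The metric adapted to `(θ_i, ψ_i)` in the chart at `z₀`. -/
def metricLoc (i : ι) (z₀ z : Z) : E →L[ℝ] E →L[ℝ] ℝ :=
  hkMetric (gLoc g z₀ z) (c.θLoc i z₀ (extChartAt 𝓘(ℝ, E) z₀ z))
    (h.ψLoc i z₀ (extChartAt 𝓘(ℝ, E) z₀ z)) (h.radius i z)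

/-- The conjugate linear operator adapted to `(θ_i, ψ_i)` in the chart at `z₀`. -/
def opLoc (i : ι) (z₀ z : Z) : E →L[ℝ] E :=
  hkOp (gLoc g z₀ z) (c.θLoc i z₀ (extChartAt 𝓘(ℝ, E) z₀ z))
    (h.ψLoc i z₀ (extChartAt 𝓘(ℝ, E) z₀ z)) (h.radius i z)

/-- The metric adapted to the local contact forms, as a family of bilinear forms. -/
def adaptedMetric (z : Z) : TangentSpace 𝓘(ℝ, E) z →L[ℝ] TangentSpace 𝓘(ℝ, E) z →L[ℝ] ℝ :=
  (h.metricLoc g (c.L.indexAt z) z z : E →L[ℝ] E →L[ℝ] ℝ)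

variable [FiniteDimensional ℂ E] (hE : Module.finrank ℂ E = 2 * n + 1) {g}
  (hgI : ∀ (z : Z) (X Y : TangentSpace 𝓘(ℝ, E) z),
      g.inner z (complexStructure z X) (complexStructure z Y) = g.inner z X Y)

include hE hgI

theorem isDatumLoc {i : ι} {z₀ z : Z} (hi : z ∈ c.U i) (hz : z ∈ (chartAt E z₀).source) :
    IsDatum (gLoc g z₀ z) (c.θLoc i z₀ (extChartAt 𝓘(ℝ, E) z₀ z))
      (h.ψLoc i z₀ (extChartAt 𝓘(ℝ, E) z₀ z)) (h.radius i z) :=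
  h.isDatum hE hi hz (gLoc_isInner g hz) (gLoc_I g hgI hz)

theorem isAdaptedLoc {i : ι} {z₀ z : Z} (hi : z ∈ c.U i) (hz : z ∈ (chartAt E z₀).source) :
    IsAdapted (c.θLoc i z₀ (extChartAt 𝓘(ℝ, E) z₀ z)) (h.ψLoc i z₀ (extChartAt 𝓘(ℝ, E) z₀ z))
      (h.radius i z) (h.metricLoc g i z₀ z) (h.opLoc g i z₀ z) (h.reebLoc i z₀ z) :=
  (h.isDatumLoc hE hgI hi hz).isAdapted

/-- The adapted tensors in two trivialisations and two charts. The metric does not change, whereas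
the operator `K` changes by the phase of the transition function `f_ij`, and the Reeb vector by
`f_ij` itself. -/
theorem loc_change {i j : ι} {z₀ z : Z} (hi : z ∈ c.U i) (hj : z ∈ c.U j)
    (hz : z ∈ (chartAt E z₀).source) :
    dchart 𝓘(ℝ, E) z₀ z (h.reebLoc j z z) = c.f i j z • h.reebLoc i z₀ z ∧
    (∀ x y : E, h.metricLoc g i z₀ z (dchart 𝓘(ℝ, E) z₀ z x) (dchart 𝓘(ℝ, E) z₀ z y) =
      h.metricLoc g j z z x y) ∧
    ∀ x : E, h.opLoc g i z₀ z (dchart 𝓘(ℝ, E) z₀ z x) =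
      dchart 𝓘(ℝ, E) z₀ z (h.opLoc g j z z ((c.f i j z / ‖c.f i j z‖) • x)) := by
  have hzz := mem_chart_source E z
  refine (h.isDatumLoc hE hgI hj hzz).transport (h.isDatumLoc hE hgI hi hz) (dchartEquiv hz)
    (dchart_smul hz Complex.I) (c.f_ne_zero i j z ⟨hi, hj⟩) (fun x y => ?_) (fun x => ?_)
    (fun x y => ?_) (h.radius_mul hi hj)
  · refine (gLoc_dchart g hz x y).trans ((gLoc_dchart g hzz x y).symm.trans ?_)
    exact congrArg₂ (fun s t => gLoc g z z s t) (dchart_self z x) (dchart_self z y)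
  · refine (θLoc_change hi hj hz _).trans (congrArg (c.f i j z * ·) ?_)
    refine (c.θLoc_dchart hz x).trans ((c.θLoc_dchart hzz x).symm.trans ?_)
    exact congrArg (c.θLoc j z _) (dchart_self z x)
  · exact (h.ψLoc_change hi hj hz _ _).trans
      (congrArg (c.f i j z * ·) (h.ψLoc_dchart hj hz x y))

theorem contMDiffAt_loc {i : ι} {z₀ : Z} (hi : z₀ ∈ c.U i) :
    ContMDiffAt 𝓘(ℝ, E) 𝓘(ℝ, E) ∞ (h.reebLoc i z₀) z₀ ∧
    ContMDiffAt 𝓘(ℝ, E) 𝓘(ℝ, E →L[ℝ] E →L[ℝ] ℝ) ∞ (h.metricLoc g i z₀) z₀ ∧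
    ContMDiffAt 𝓘(ℝ, E) 𝓘(ℝ, E →L[ℝ] E) ∞ (h.opLoc g i z₀) z₀ := by
  have hzz := mem_chart_source E z₀
  have hφ : ContMDiffAt 𝓘(ℝ, E) 𝓘(ℝ, E) ∞ (extChartAt 𝓘(ℝ, E) z₀) z₀ := contMDiffAt_extChartAt
  have hθ := ContDiffAt.comp_contMDiffAt (f := extChartAt 𝓘(ℝ, E) z₀)
    (c.contDiffAt_θLoc hi hzz) hφ
  have hψ := ContDiffAt.comp_contMDiffAt (f := extChartAt 𝓘(ℝ, E) z₀)
    (h.contDiffAt_ψLoc hi hzz) hφ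
  have hD : ∀ᶠ z in 𝓝 z₀, IsDatum (gLoc g z₀ z) (c.θLoc i z₀ (extChartAt 𝓘(ℝ, E) z₀ z))
      (h.ψLoc i z₀ (extChartAt 𝓘(ℝ, E) z₀ z)) (h.radius i z) := by
    filter_upwards [(c.isOpen_U i).mem_nhds hi, eventually_mem_chart_source (HM := E) z₀]
      with z h1 h2
    exact h.isDatumLoc hE hgI h1 h2
  exact ⟨contMDiffAt_reeb hθ hψ hD.self_of_nhds,
    contMDiffAt_hk (contMDiffAt_gLoc g z₀) hθ hψ (h.contMDiffAt_radius hi) hD⟩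

/-- The metrics adapted to the local contact forms agree on overlaps. -/
theorem exists_adapted_metric : ∃ gZ : Metric 𝓘(ℝ, E) Z,
    (∀ (z : Z) (X Y : TangentSpace 𝓘(ℝ, E) z),
      gZ.inner z (complexStructure z X) (complexStructure z Y) = gZ.inner z X Y) ∧
    ∀ (z : Z) (X Y : E), gZ.inner z X Y = h.metricLoc g (c.L.indexAt z) z z X Y := by
  have hA := fun z : Z => h.isAdaptedLoc hE hgI (c.L.mem_baseSet_at z) (mem_chart_source E z)
  have hs : ContMDiff 𝓘(ℝ, E) (𝓘(ℝ, E).prod 𝓘(ℝ, E →L[ℝ] E →L[ℝ] ℝ)) ∞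
      (fun z => TotalSpace.mk' (E →L[ℝ] E →L[ℝ] ℝ) z (h.adaptedMetric g z)) := by
    intro z₀
    refine contMDiffAt_bilinear (n := ⊤)
      (h.contMDiffAt_loc hE hgI (c.L.mem_baseSet_at z₀)).2.1 ?_
    filter_upwards [(c.isOpen_U _).mem_nhds (c.L.mem_baseSet_at z₀),
      eventually_mem_chart_source (HM := E) z₀] with z h1 h2 X Y
    exact ((h.loc_change hE hgI h1 (c.L.mem_baseSet_at z) h2).2.1 X Y).symm
  exact ⟨metricOfInner (h.adaptedMetric g) (fun z => (hA z).inner) hs,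
    fun z X Y => (hA z).inner_I X Y, fun z X Y => rfl⟩

end ComplexContactStructure.HermitianStructure

end Local


/-! ### Tensors on the circle bundle -/

section SmoothModel

variable {E : Type*} [NormedAddCommGroup E] [NormedSpace ℂ E]
  {EM : Type*} [NormedAddCommGroup EM] [NormedSpace ℝ EM]
  {HM : Type*} [TopologicalSpace HM] {I : ModelWithCorners ℝ EM HM}
  {M : Type*} [TopologicalSpace M] [ChartedSpace HM M] {x₀ : M}
  {θ : M → E →L[ℝ] ℂ} {g : M → E →L[ℝ] E →L[ℝ] ℝ} {K : M → E →L[ℝ] E} {v : M → E} {r : M → ℝ}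
  {u : M → ℂ}

theorem contMDiffAt_ofReal_mul (hr : ContMDiffAt I 𝓘(ℝ, ℝ) ∞ r x₀)
    (hu : ContMDiffAt I 𝓘(ℝ, ℂ) ∞ u x₀) :
    ContMDiffAt I 𝓘(ℝ, ℂ) ∞ (fun x => (r x : ℂ) * u x) x₀ :=
  (hr.smul hu).congr_of_eventuallyEq (.of_forall fun _ => (Complex.real_smul).symm)

theorem contMDiffAt_complex_smul (hu : ContMDiffAt I 𝓘(ℝ, ℂ) ∞ u x₀)
    (hv : ContMDiffAt I 𝓘(ℝ, E) ∞ v x₀) : ContMDiffAt I 𝓘(ℝ, E) ∞ (fun x => u x • v x) x₀ :=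
  ((contMDiffAt_const (c := ContinuousLinearMap.lsmul ℝ ℂ)).clm_apply hu).clm_apply hv

theorem contMDiffAt_modelξ (hv : ContMDiffAt I 𝓘(ℝ, E) ∞ v x₀)
    (hr : ContMDiffAt I 𝓘(ℝ, ℝ) ∞ r x₀) (hu : ContMDiffAt I 𝓘(ℝ, ℂ) ∞ u x₀) (hr0 : r x₀ ≠ 0)
    (hu0 : u x₀ ≠ 0) :
    ContMDiffAt I 𝓘(ℝ, E × ℝ) ∞ (fun x => modelξ (v x) (r x) (u x)) x₀ := by
  have h1 : ContMDiffAt I 𝓘(ℝ, ℂ) ∞ (fun x => ((r x : ℂ) * u x)⁻¹) x₀ :=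
    ContDiffAt.comp_contMDiffAt (g := fun w : ℂ => w⁻¹) (f := fun x => (r x : ℂ) * u x)
      (contDiffAt_inv ℝ (mul_ne_zero (by exact_mod_cast hr0) hu0)) (contMDiffAt_ofReal_mul hr hu)
  exact (contMDiffAt_complex_smul h1 hv).prodMk_space contMDiffAt_const

theorem contMDiffAt_modelΦ (hθ : ContMDiffAt I 𝓘(ℝ, E →L[ℝ] ℂ) ∞ θ x₀)
    (hK : ContMDiffAt I 𝓘(ℝ, E →L[ℝ] E) ∞ K x₀) (hv : ContMDiffAt I 𝓘(ℝ, E) ∞ v x₀)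
    (hr : ContMDiffAt I 𝓘(ℝ, ℝ) ∞ r x₀) (hu : ContMDiffAt I 𝓘(ℝ, ℂ) ∞ u x₀) (hr0 : r x₀ ≠ 0)
    (hu0 : u x₀ ≠ 0) :
    ContMDiffAt I 𝓘(ℝ, E × ℝ →L[ℝ] E × ℝ) ∞
      (fun x => modelΦ (θ x) (K x) (v x) (r x) (u x)) x₀ := by
  have h0 := contMDiffAt_ofReal_mul hr hu
  have h1 : ContMDiffAt I 𝓘(ℝ, ℂ) ∞ (fun x => ((r x : ℂ) * u x)⁻¹) x₀ :=
    ContDiffAt.comp_contMDiffAt (g := fun w : ℂ => w⁻¹) (f := fun x => (r x : ℂ) * u x)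
      (contDiffAt_inv ℝ (mul_ne_zero (by exact_mod_cast hr0) hu0)) h0
  have h2 : ContMDiffAt I 𝓘(ℝ, E →L[ℝ] E) ∞ (fun x => ContinuousLinearMap.lsmul ℝ ℂ (u x)) x₀ :=
    (contMDiffAt_const (c := ContinuousLinearMap.lsmul ℝ ℂ)).clm_apply hu
  have h3 : ContMDiffAt I 𝓘(ℝ, E) ∞ (fun x => (Complex.I * ((r x : ℂ) * u x)⁻¹) • v x) x₀ :=
    contMDiffAt_complex_smul
      ((contMDiffAt_const (c := ContinuousLinearMap.mul ℝ ℂ Complex.I)).clm_apply h1) hv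
  have h4 : ContMDiffAt I 𝓘(ℝ, ℝ →L[ℝ] E) ∞ (fun x => (ContinuousLinearMap.lsmul ℝ ℝ).flip
      ((Complex.I * ((r x : ℂ) * u x)⁻¹) • v x)) x₀ :=
    (contMDiffAt_const (c := (ContinuousLinearMap.lsmul ℝ ℝ : ℝ →L[ℝ] E →L[ℝ] E).flip)).clm_apply h3
  exact (contMDiffAt_const.clm_comp ((hK.clm_comp (h2.clm_comp contMDiffAt_const)).sub
    (h4.clm_comp contMDiffAt_const))).add (contMDiffAt_const.clm_comp (contMDiffAt_const.clm_comp
      (((contMDiffAt_const (c := ContinuousLinearMap.mul ℝ ℂ)).clm_apply h0).clm_comp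
        (hθ.clm_comp contMDiffAt_const))))

theorem contMDiffAt_modelG (hg : ContMDiffAt I 𝓘(ℝ, E →L[ℝ] E →L[ℝ] ℝ) ∞ g x₀) :
    ContMDiffAt I 𝓘(ℝ, E × ℝ →L[ℝ] E × ℝ →L[ℝ] ℝ) ∞ (fun x => modelG (g x)) x₀ :=
  (contMDiffAt_const.clm_comp (hg.clm_comp contMDiffAt_const)).add contMDiffAt_const

end SmoothModel

namespace ComplexContactStructure.HermitianStructure

variable {n : ℕ} {E : Type*} [NormedAddCommGroup E] [NormedSpace ℂ E]
  {Z : Type*} [TopologicalSpace Z] [ChartedSpace E Z] [IsManifold 𝓘(ℂ, E) ω Z]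
  {ι : Type*} {c : ComplexContactStructure n E Z ι} (h : c.HermitianStructure)

/-- The coframe at `q` for the chart at `π_Q(q)`. -/
def coframeAt (q : h.Q) : TangentSpace (𝓘(ℝ, E).prod (𝓡 1)) q →L[ℝ] E × ℝ :=
  h.coframe (h.proj q) q

/-- The inverse of the coframe. -/
def frameAt (q : h.Q) : E × ℝ →L[ℝ] TangentSpace (𝓘(ℝ, E).prod (𝓡 1)) q :=
  (h.coframeAt q).inverse

theorem coframe_eq {z₀ : Z} {q : h.Q} (hz : h.proj q ∈ (chartAt E z₀).source)
    (X : TangentSpace (𝓘(ℝ, E).prod (𝓡 1)) q) :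
    h.coframe z₀ q X =
      ((dchart 𝓘(ℝ, E) z₀ (h.proj q) (h.coframeAt q X).1 : E), (h.coframeAt q X).2) :=
  Prod.ext ((h.dbase_eq hz X).trans
    (congrArg (dchart 𝓘(ℝ, E) z₀ (h.proj q)) (h.dbase_self q X).symm)) rfl

theorem norm_phase (a : ℂ) (ha : ‖a‖ = 1) (i : ι) (q : h.Q) : ‖a * h.phase i q‖ = 1 := by
  rw [norm_mul, ha, Circle.norm_coe, one_mul]

variable (g : Metric 𝓘(ℝ, E) Z)

/-- The endomorphism of the contact form `Re(a ϑ)`, in the coframe for the chart at `z₀`. -/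
def coordΦ (a : ℂ) (i : ι) (z₀ : Z) (q : h.Q) : E × ℝ →L[ℝ] E × ℝ :=
  modelΦ (c.θLoc i z₀ (extChartAt 𝓘(ℝ, E) z₀ (h.proj q))) (h.opLoc g i z₀ (h.proj q))
    (h.reebLoc i z₀ (h.proj q)) (h.radius i (h.proj q)) (a * h.phase i q)

/-- The Reeb field of the contact form `Re(a ϑ)`, in the coframe for the chart at `z₀`. -/
def coordξ (a : ℂ) (i : ι) (z₀ : Z) (q : h.Q) : E × ℝ :=
  modelξ (h.reebLoc i z₀ (h.proj q)) (h.radius i (h.proj q)) (a * h.phase i q)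

/-- The contact form `Re(a ϑ)`, in the coframe for the chart at `z₀`. -/
def coordη (a : ℂ) (i : ι) (z₀ : Z) (q : h.Q) : E × ℝ →L[ℝ] ℝ :=
  modelη (c.θLoc i z₀ (extChartAt 𝓘(ℝ, E) z₀ (h.proj q))) (h.radius i (h.proj q))
    (a * h.phase i q)

theorem kob_eq_coordη (a : ℂ) {i : ι} {z₀ : Z} {q : h.Q} (hi : h.proj q ∈ c.U i)
    (hz : h.proj q ∈ (chartAt E z₀).source) (X : TangentSpace (𝓘(ℝ, E).prod (𝓡 1)) q) :
    h.kob a q X = h.coordη a i z₀ q (h.coframe z₀ q X) := by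
  rw [h.kob_apply a hi hz, coordη, modelη_apply, h.coord_eq_radius hi]
  congr 1
  change _ = _ * c.θLoc i z₀ (h.base z₀ q) (h.dbase z₀ q X)
  ring

theorem radius_mul_phase {i j : ι} {q : h.Q} (hi : h.proj q ∈ c.U i) (hj : h.proj q ∈ c.U j) :
    (h.radius j (h.proj q) : ℂ) * h.phase j q =
      c.f i j (h.proj q) * (h.radius i (h.proj q) * h.phase i q) := by
  rw [← h.coord_eq_radius hi, ← h.coord_eq_radius hj]
  exact coord_change (h.incl q) hi hj

theorem phase_change {i j : ι} {q : h.Q} (hi : h.proj q ∈ c.U i) (hj : h.proj q ∈ c.U j) :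
    (h.phase j q : ℂ) = c.f i j (h.proj q) / ‖c.f i j (h.proj q)‖ * h.phase i q := by
  have h1 := h.radius_mul_phase hi hj
  have h2 : (‖c.f i j (h.proj q)‖ : ℂ) ≠ 0 := by
    exact_mod_cast norm_ne_zero_iff.2 (c.f_ne_zero i j _ ⟨hi, hj⟩)
  have h3 : (h.radius i (h.proj q) : ℂ) ≠ 0 := by exact_mod_cast (h.radius_pos hi).ne'
  rw [← h.radius_mul hi hj] at h1
  push_cast at h1
  field_simp
  apply mul_left_cancel₀ h3
  linear_combination h1

variable [FiniteDimensional ℂ E]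

theorem coframeAt_isInvertible (q : h.Q) : (h.coframeAt q).IsInvertible :=
  h.coframe_isInvertible (mem_chart_source E _)

theorem coframeAt_frameAt (q : h.Q) (p : E × ℝ) : h.coframeAt q (h.frameAt q p) = p :=
  (h.coframeAt_isInvertible q).self_apply_inverse p

theorem coframeAt_injective (q : h.Q) : Injective (h.coframeAt q) :=
  (h.coframeAt_isInvertible q).injective

variable (hE : Module.finrank ℂ E = 2 * n + 1) {g}
  (hgI : ∀ (z : Z) (X Y : TangentSpace 𝓘(ℝ, E) z),
      g.inner z (complexStructure z X) (complexStructure z Y) = g.inner z X Y)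

include hE hgI

theorem coordξ_change (a : ℂ) {i j : ι} {z₀ : Z} {q : h.Q} (hi : h.proj q ∈ c.U i)
    (hj : h.proj q ∈ c.U j) (hz : h.proj q ∈ (chartAt E z₀).source) :
    h.coordξ a i z₀ q = ((dchart 𝓘(ℝ, E) z₀ (h.proj q) (h.coordξ a j (h.proj q) q).1 : E),
      (h.coordξ a j (h.proj q) q).2) := by
  have hf := c.f_ne_zero i j _ ⟨hi, hj⟩
  have h1 := (h.loc_change hE hgI hi hj hz).1
  refine Prod.ext ?_ rfl
  change _ • h.reebLoc i z₀ (h.proj q) = dchart 𝓘(ℝ, E) z₀ (h.proj q) (_ • _ : E)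
  rw [dchart_smul hz]
  refine Eq.trans ?_ (congrArg (_ • ·) h1.symm)
  rw [smul_smul]
  congr 1
  rw [mul_left_comm (h.radius j (h.proj q) : ℂ), h.radius_mul_phase hi hj]
  field_simp

/-- The endomorphism does not depend on the trivialisation: the phase that multiplies `K` under a
change of trivialisation cancels against the change of the phase of the fibre coordinate. -/
theorem coordΦ_change (a : ℂ) {i j : ι} {z₀ : Z} {q : h.Q} (hi : h.proj q ∈ c.U i)
    (hj : h.proj q ∈ c.U j) (hz : h.proj q ∈ (chartAt E z₀).source) (p : E × ℝ) :
    h.coordΦ g a i z₀ q ((dchart 𝓘(ℝ, E) z₀ (h.proj q) p.1 : E), p.2) =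
      ((dchart 𝓘(ℝ, E) z₀ (h.proj q) (h.coordΦ g a j (h.proj q) q p).1 : E),
        (h.coordΦ g a j (h.proj q) q p).2) := by
  have hf := c.f_ne_zero i j _ ⟨hi, hj⟩
  obtain ⟨h1, -, h3⟩ := h.loc_change hE hgI hi hj hz
  have hzz := mem_chart_source E (h.proj q)
  rw [coordΦ, coordΦ, modelΦ_apply, modelΦ_apply]
  refine Prod.ext ?_ ?_
  · dsimp only
    have e1 := h3 ((a * h.phase i q) • p.1)
    rw [smul_smul, mul_left_comm, ← h.phase_change hi hj] at e1
    have e2 : (dchart 𝓘(ℝ, E) z₀ (h.proj q) ((a * h.phase i q) • p.1 : E) : E) =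
      (a * h.phase i q) • (dchart 𝓘(ℝ, E) z₀ (h.proj q) p.1 : E) := dchart_smul hz _ _
    rw [e2] at e1
    refine Eq.trans ?_ (map_sub (dchart 𝓘(ℝ, E) z₀ (h.proj q)) _ _).symm
    refine congrArg₂ (fun s t : E => s - t) e1 ?_
    refine Eq.trans ?_ (map_smul (dchart 𝓘(ℝ, E) z₀ (h.proj q)) p.2 _).symm
    refine congrArg (fun t : E => p.2 • t) ?_
    refine Eq.trans ?_ (dchart_smul hz _ _).symm
    refine Eq.trans ?_ (congrArg (_ • ·) h1.symm)
    rw [smul_smul]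
    congr 1
    rw [mul_left_comm (h.radius j (h.proj q) : ℂ), h.radius_mul_phase hi hj]
    field_simp
  · dsimp only
    have e1 := (θLoc_change hi hj hz (dchart 𝓘(ℝ, E) z₀ (h.proj q) p.1)).trans
      (congrArg (c.f i j (h.proj q) * ·) (((c.θLoc_dchart hz p.1).trans
        (c.θLoc_dchart hzz p.1).symm).trans
        (congrArg (c.θLoc j (h.proj q) _) (dchart_self (h.proj q) p.1))))
    refine congrArg Complex.im ?_
    refine (congrArg (_ * ·) e1).trans ?_
    rw [mul_left_comm (h.radius j (h.proj q) : ℂ), h.radius_mul_phase hi hj]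
    ring

end ComplexContactStructure.HermitianStructure
namespace ComplexContactStructure.HermitianStructure

/-! ### The three almost contact structures -/

variable {n : ℕ} {E : Type*} [NormedAddCommGroup E] [NormedSpace ℂ E]
  {Z : Type*} [TopologicalSpace Z] [ChartedSpace E Z] [IsManifold 𝓘(ℂ, E) ω Z]
  {ι : Type*} {c : ComplexContactStructure n E Z ι} (h : c.HermitianStructure)

/-- An endomorphism of `E × ℝ`, moved to the tangent space by the coframe. -/
def liftEnd (q : h.Q) (S : E × ℝ →L[ℝ] E × ℝ) :
    TangentSpace (𝓘(ℝ, E).prod (𝓡 1)) q →L[ℝ] TangentSpace (𝓘(ℝ, E).prod (𝓡 1)) q :=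
  (h.frameAt q).comp (S.comp (h.coframeAt q))

variable (g : Metric 𝓘(ℝ, E) Z)

/-- The operator `Φ` of the contact form `Re(a ϑ)`. -/
def kobΦ (a : ℂ) (q : h.Q) :
    TangentSpace (𝓘(ℝ, E).prod (𝓡 1)) q →L[ℝ] TangentSpace (𝓘(ℝ, E).prod (𝓡 1)) q :=
  h.liftEnd q (h.coordΦ g a (c.L.indexAt (h.proj q)) (h.proj q) q)

/-- The Reeb field of the contact form `Re(a ϑ)`. -/
def kobξ (a : ℂ) (q : h.Q) : TangentSpace (𝓘(ℝ, E).prod (𝓡 1)) q :=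
  h.frameAt q (h.coordξ a (c.L.indexAt (h.proj q)) (h.proj q) q)

/-- The bilinear form `π_Q^* g_Z + η₁ ⊗ η₁`. -/
def bilinQ (q : h.Q) : TangentSpace (𝓘(ℝ, E).prod (𝓡 1)) q →L[ℝ]
    TangentSpace (𝓘(ℝ, E).prod (𝓡 1)) q →L[ℝ] ℝ :=
  let C : (E × EuclideanSpace ℝ (Fin 1)) →L[ℝ] E × ℝ := h.coframeAt q
  ((modelG (h.metricLoc g (c.L.indexAt (h.proj q)) (h.proj q) (h.proj q))).bilinearComp C C :
    (E × EuclideanSpace ℝ (Fin 1)) →L[ℝ] (E × EuclideanSpace ℝ (Fin 1)) →L[ℝ] ℝ)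

theorem bilinQ_apply (q : h.Q) (X Y : TangentSpace (𝓘(ℝ, E).prod (𝓡 1)) q) :
    h.bilinQ g q X Y = modelG (h.metricLoc g (c.L.indexAt (h.proj q)) (h.proj q) (h.proj q))
      (h.coframeAt q X) (h.coframeAt q Y) := rfl

/-- The almost contact structure `S` at `q`, written in the coframe. -/
def Represents (S : h.AlmostContact) (q : h.Q) (Φ : E × ℝ → E × ℝ) (ξ : E × ℝ) (η : E × ℝ → ℝ) :
    Prop :=
  (∀ X, h.coframeAt q (S.Φ q X) = Φ (h.coframeAt q X)) ∧ h.coframeAt q (S.ξ q) = ξ ∧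
    ∀ X, S.η q X = η (h.coframeAt q X)

variable [FiniteDimensional ℂ E]

theorem coframeAt_liftEnd (q : h.Q) (S : E × ℝ →L[ℝ] E × ℝ)
    (X : TangentSpace (𝓘(ℝ, E).prod (𝓡 1)) q) :
    h.coframeAt q (h.liftEnd q S X) = S (h.coframeAt q X) :=
  h.coframeAt_frameAt q _

/-- The relations of an almost contact `3`-structure may be checked in the coframe. -/
theorem cyclicRelations_of {Sα Sβ Sγ : h.AlmostContact} {Φα Φβ Φγ : h.Q → E × ℝ → E × ℝ}
    {ξα ξβ ξγ : h.Q → E × ℝ} {ηα ηβ ηγ : h.Q → E × ℝ → ℝ}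
    (hα : ∀ q, h.Represents Sα q (Φα q) (ξα q) (ηα q))
    (hβ : ∀ q, h.Represents Sβ q (Φβ q) (ξβ q) (ηβ q))
    (hγ : ∀ q, h.Represents Sγ q (Φγ q) (ξγ q) (ηγ q))
    (H : ∀ q, ModelCyclic (Φα q) (Φβ q) (Φγ q) (ξα q) (ξβ q) (ξγ q) (ηα q) (ηβ q) (ηγ q)) :
    AlmostContactStructure.CyclicRelations Sα Sβ Sγ := by
  intro q
  obtain ⟨H1, H2, H3⟩ := H q
  obtain ⟨α1, α2, α3⟩ := hα q
  obtain ⟨β1, β2, β3⟩ := hβ q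
  obtain ⟨γ1, γ2, γ3⟩ := hγ q
  have hinj := h.coframeAt_injective q
  refine ⟨fun X => ?_, hinj ?_, hinj ?_⟩
  · obtain ⟨h1, h2, h3, h4⟩ := H1 (h.coframeAt q X)
    refine ⟨hinj ?_, hinj ?_, ?_, ?_⟩
    · rw [map_sub, map_smul, α1, β1, β3, α2, γ1, h1]
    · rw [map_add, map_neg, map_smul, β1, α1, α3, β2, γ1, h2]
    · rw [α3, β1, γ3, h3]
    · rw [β3, α1, γ3, h4]
  · rw [α1, β2, γ2, H2]
  · rw [map_neg, β1, α2, γ2, H3]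

/-- Hatakeyama's almost contact structure. -/
def hatakeyama : h.AlmostContact where
  Φ q := h.liftEnd q (modelJ E)
  ξ q := h.frameAt q (0, 1)
  η := h.η₁
  smooth_Φ q := by
    have hz := mem_chart_source E (h.proj q)
    refine (h.smoothFormAt_coframe hz).contMDiffAt_endomorphism (h.coframe_isInvertible hz)
      (contMDiffAt_const (c := modelJ E)) ?_
    filter_upwards [h.eventually_proj_mem_chart hz] with p hp X
    rw [h.coframe_eq hp, h.coframeAt_liftEnd, h.coframe_eq hp]
    exact Prod.ext (dchart_smul hp _ _) rfl
  smooth_ξ q := by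
    have hz := mem_chart_source E (h.proj q)
    refine (h.smoothFormAt_coframe hz).contMDiffAt_vectorField (h.coframe_isInvertible hz)
      (contMDiffAt_const (c := ((0, 1) : E × ℝ))) ?_
    filter_upwards [h.eventually_proj_mem_chart hz] with p hp
    rw [h.coframe_eq hp, h.coframeAt_frameAt]
    exact Prod.ext (map_zero (dchart 𝓘(ℝ, E) (h.proj q) (h.proj p))) rfl
  smooth_η q := smoothFormAt_iff.1 (h.smoothFormAt_η₁ q)
  Φ_Φ q X := by
    apply h.coframeAt_injective q
    rw [h.coframeAt_liftEnd, h.coframeAt_liftEnd, map_add, map_neg, map_smul, h.coframeAt_frameAt]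
    refine Prod.ext ?_ ?_
    · simp [smul_smul]
    · change (0 : ℝ) = -h.η₁ q X + h.η₁ q X * 1
      ring
  η_ξ q := congrArg Prod.snd (h.coframeAt_frameAt q (0, 1))

theorem represents_hatakeyama (q : h.Q) :
    h.Represents h.hatakeyama q (modelJ E) (0, 1) Prod.snd :=
  ⟨h.coframeAt_liftEnd q _, h.coframeAt_frameAt q _, fun _ => rfl⟩

variable (hE : Module.finrank ℂ E = 2 * n + 1) {g}
  (hgI : ∀ (z : Z) (X Y : TangentSpace 𝓘(ℝ, E) z),
      g.inner z (complexStructure z X) (complexStructure z Y) = g.inner z X Y)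

include hE hgI

theorem isAdaptedAt (q : h.Q) :
    IsAdapted (c.θLoc (c.L.indexAt (h.proj q)) (h.proj q) (extChartAt 𝓘(ℝ, E) (h.proj q) (h.proj q)))
      (h.ψLoc (c.L.indexAt (h.proj q)) (h.proj q) (extChartAt 𝓘(ℝ, E) (h.proj q) (h.proj q)))
      (h.radius (c.L.indexAt (h.proj q)) (h.proj q))
      (h.metricLoc g (c.L.indexAt (h.proj q)) (h.proj q) (h.proj q))
      (h.opLoc g (c.L.indexAt (h.proj q)) (h.proj q) (h.proj q))
      (h.reebLoc (c.L.indexAt (h.proj q)) (h.proj q) (h.proj q)) :=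
  h.isAdaptedLoc hE hgI (c.L.mem_baseSet_at _) (mem_chart_source E _)

theorem contMDiffAt_coord_tensors (a : ℂ) (ha : ‖a‖ = 1) {i : ι} {q : h.Q}
    (hi : h.proj q ∈ c.U i) :
    ContMDiffAt (𝓘(ℝ, E).prod (𝓡 1)) 𝓘(ℝ, E × ℝ →L[ℝ] E × ℝ) ∞ (h.coordΦ g a i (h.proj q)) q ∧
    ContMDiffAt (𝓘(ℝ, E).prod (𝓡 1)) 𝓘(ℝ, E × ℝ) ∞ (h.coordξ a i (h.proj q)) q ∧
    ContMDiffAt (𝓘(ℝ, E).prod (𝓡 1)) 𝓘(ℝ, E × ℝ →L[ℝ] E × ℝ →L[ℝ] ℝ) ∞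
      (fun p => modelG (h.metricLoc g i (h.proj q) (h.proj p))) q := by
  have hz := mem_chart_source E (h.proj q)
  obtain ⟨hv, hg, hK⟩ := h.contMDiffAt_loc hE hgI hi
  have hp := h.contMDiff_proj q
  have hθ : ContMDiffAt (𝓘(ℝ, E).prod (𝓡 1)) 𝓘(ℝ, E →L[ℝ] ℂ) ∞
      (fun p => c.θLoc i (h.proj q) (extChartAt 𝓘(ℝ, E) (h.proj q) (h.proj p))) q :=
    ContDiffAt.comp_contMDiffAt (g := c.θLoc i (h.proj q)) (f := h.base (h.proj q))
      (c.contDiffAt_θLoc hi hz) (h.contMDiffAt_base hz)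
  have hu : ContMDiffAt (𝓘(ℝ, E).prod (𝓡 1)) 𝓘(ℝ, ℂ) ∞ (fun p => a * (h.phase i p : ℂ)) q :=
    (contMDiffAt_const (c := ContinuousLinearMap.mul ℝ ℂ a)).clm_apply (h.contMDiffAt_coe_phase hi)
  have hr := (h.contMDiffAt_radius hi).comp q hp
  have hr0 : h.radius i (h.proj q) ≠ 0 := (h.radius_pos hi).ne'
  have hu0 : a * (h.phase i q : ℂ) ≠ 0 := by
    rw [← norm_ne_zero_iff, h.norm_phase a ha]
    exact one_ne_zero
  exact ⟨contMDiffAt_modelΦ hθ (hK.comp q hp) (hv.comp q hp) hr hu hr0 hu0,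
    contMDiffAt_modelξ (hv.comp q hp) hr hu hr0 hu0, contMDiffAt_modelG (hg.comp q hp)⟩

theorem coframe_kobΦ (a : ℂ) {i : ι} {z₀ : Z} {q : h.Q} (hi : h.proj q ∈ c.U i)
    (hz : h.proj q ∈ (chartAt E z₀).source) (X : TangentSpace (𝓘(ℝ, E).prod (𝓡 1)) q) :
    h.coframe z₀ q (h.kobΦ g a q X) = h.coordΦ g a i z₀ q (h.coframe z₀ q X) := by
  rw [h.coframe_eq hz, h.coframe_eq hz, kobΦ, h.coframeAt_liftEnd]
  exact (h.coordΦ_change hE hgI a hi (c.L.mem_baseSet_at _) hz _).symm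

theorem coframe_kobξ (a : ℂ) {i : ι} {z₀ : Z} {q : h.Q} (hi : h.proj q ∈ c.U i)
    (hz : h.proj q ∈ (chartAt E z₀).source) :
    h.coframe z₀ q (h.kobξ a q) = h.coordξ a i z₀ q := by
  rw [h.coframe_eq hz, kobξ, h.coframeAt_frameAt]
  exact (h.coordξ_change hE hgI a hi (c.L.mem_baseSet_at _) hz).symm

theorem bilinQ_eq {i : ι} {z₀ : Z} {q : h.Q} (hi : h.proj q ∈ c.U i)
    (hz : h.proj q ∈ (chartAt E z₀).source) (X Y : TangentSpace (𝓘(ℝ, E).prod (𝓡 1)) q) :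
    h.bilinQ g q X Y = modelG (h.metricLoc g i z₀ (h.proj q)) (h.coframe z₀ q X)
      (h.coframe z₀ q Y) := by
  rw [h.coframe_eq hz, h.coframe_eq hz, bilinQ_apply, modelG_apply, modelG_apply]
  exact congrArg (· + _) ((h.loc_change hE hgI hi (c.L.mem_baseSet_at _) hz).2.1 _ _).symm

/-- The metric `g_Q`. -/
def metricQ : Metric (𝓘(ℝ, E).prod (𝓡 1)) h.Q :=
  metricOfInner (h.bilinQ g)
    (fun q => by
      refine ⟨fun X Y => (h.isAdaptedAt hE hgI q).modelG_isInner.symm _ _, fun X hX => ?_⟩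
      refine (h.isAdaptedAt hE hgI q).modelG_isInner.pos _ fun h0 => hX ?_
      exact h.coframeAt_injective q (h0.trans (map_zero _).symm))
    fun q => by
      have hz := mem_chart_source E (h.proj q)
      have hi : h.proj q ∈ c.U (c.L.indexAt (h.proj q)) := c.L.mem_baseSet_at _
      refine (h.smoothFormAt_coframe hz).contMDiffAt_bilinear
        (h.contMDiffAt_coord_tensors hE hgI 1 norm_one hi).2.2 ?_
      filter_upwards [h.eventually_proj_mem hi, h.eventually_proj_mem_chart hz] with p h1 h2 X Y
      exact h.bilinQ_eq hE hgI h1 h2 X Y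

theorem metricQ_inner (q : h.Q) (X Y : TangentSpace (𝓘(ℝ, E).prod (𝓡 1)) q) :
    (h.metricQ hE hgI).inner q X Y =
      modelG (h.metricLoc g (c.L.indexAt (h.proj q)) (h.proj q) (h.proj q))
      (h.coframeAt q X) (h.coframeAt q Y) := rfl

/-- The almost contact structure of the contact form `Re(a ϑ)`, for a unit complex number `a`. -/
def kobStructure (a : ℂ) (ha : ‖a‖ = 1) : h.AlmostContact where
  Φ := h.kobΦ g a
  ξ := h.kobξ a
  η := h.kob a
  smooth_Φ q := by
    have hz := mem_chart_source E (h.proj q)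
    have hi : h.proj q ∈ c.U (c.L.indexAt (h.proj q)) := c.L.mem_baseSet_at _
    refine (h.smoothFormAt_coframe hz).contMDiffAt_endomorphism (h.coframe_isInvertible hz)
      (h.contMDiffAt_coord_tensors hE hgI a ha hi).1 ?_
    filter_upwards [h.eventually_proj_mem hi, h.eventually_proj_mem_chart hz] with p h1 h2 X
    exact h.coframe_kobΦ hE hgI a h1 h2 X
  smooth_ξ q := by
    have hz := mem_chart_source E (h.proj q)
    have hi : h.proj q ∈ c.U (c.L.indexAt (h.proj q)) := c.L.mem_baseSet_at _
    refine (h.smoothFormAt_coframe hz).contMDiffAt_vectorField (h.coframe_isInvertible hz)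
      (h.contMDiffAt_coord_tensors hE hgI a ha hi).2.1 ?_
    filter_upwards [h.eventually_proj_mem hi, h.eventually_proj_mem_chart hz] with p h1 h2
    exact h.coframe_kobξ hE hgI a h1 h2
  smooth_η q := smoothFormAt_iff.1 (h.smoothFormAt_kob a q)
  Φ_Φ q X := by
    have hi : h.proj q ∈ c.U (c.L.indexAt (h.proj q)) := c.L.mem_baseSet_at _
    apply h.coframeAt_injective q
    rw [map_add, map_neg, map_smul, kobΦ, kobξ, h.coframeAt_liftEnd, h.coframeAt_liftEnd,
      h.coframeAt_frameAt, h.kob_eq_coordη a hi (mem_chart_source E _)]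
    exact (h.isAdaptedAt hE hgI q).modelΦ_modelΦ (h.norm_phase a ha _ q) (h.radius_pos hi)
      (c.θLoc_smul _ _ _) _
  η_ξ q := by
    have hi : h.proj q ∈ c.U (c.L.indexAt (h.proj q)) := c.L.mem_baseSet_at _
    rw [h.kob_eq_coordη a hi (mem_chart_source E _)]
    refine (congrArg _ (h.coframeAt_frameAt q _)).trans ?_
    exact (h.isAdaptedAt hE hgI q).modelη_modelξ (h.norm_phase a ha _ q) (h.radius_pos hi)
      (c.θLoc_smul _ _ _)

theorem represents_kobStructure (a : ℂ) (ha : ‖a‖ = 1) (q : h.Q) :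
    h.Represents (h.kobStructure hE hgI a ha) q
      (h.coordΦ g a (c.L.indexAt (h.proj q)) (h.proj q) q)
      (h.coordξ a (c.L.indexAt (h.proj q)) (h.proj q) q)
      (h.coordη a (c.L.indexAt (h.proj q)) (h.proj q) q) :=
  ⟨h.coframeAt_liftEnd q _, h.coframeAt_frameAt q _,
    h.kob_eq_coordη a (c.L.mem_baseSet_at _) (mem_chart_source E _)⟩

end ComplexContactStructure.HermitianStructure
namespace ComplexContactStructure.HermitianStructure

/-! ### Properties of the three structures -/

variable {n : ℕ} {E : Type*} [NormedAddCommGroup E] [NormedSpace ℂ E]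
  {Z : Type*} [TopologicalSpace Z] [ChartedSpace E Z] [IsManifold 𝓘(ℂ, E) ω Z]
  {ι : Type*} {c : ComplexContactStructure n E Z ι} (h : c.HermitianStructure)
  [FiniteDimensional ℂ E]

theorem dbase_hatakeyamaΦ {z₀ : Z} {q : h.Q} (hz : h.proj q ∈ (chartAt E z₀).source)
    (X : TangentSpace (𝓘(ℝ, E).prod (𝓡 1)) q) :
    h.dbase z₀ q (h.hatakeyama.Φ q X) = Complex.I • h.dbase z₀ q X := by
  have h1 := congrArg Prod.fst (h.coframe_eq hz (h.hatakeyama.Φ q X))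
  have h2 := congrArg Prod.fst (h.coframe_eq hz X)
  rw [(h.represents_hatakeyama q).1] at h1
  exact h1.trans ((dchart_smul hz _ _).trans (congrArg (Complex.I • ·) h2.symm))

theorem dbase_hatakeyamaξ {z₀ : Z} {q : h.Q} (hz : h.proj q ∈ (chartAt E z₀).source) :
    h.dbase z₀ q (h.hatakeyama.ξ q) = 0 := by
  have h1 := congrArg Prod.fst (h.coframe_eq hz (h.hatakeyama.ξ q))
  rw [(h.represents_hatakeyama q).2.1] at h1
  exact h1.trans (map_zero (dchart 𝓘(ℝ, E) z₀ (h.proj q)))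

theorem dproj_hatakeyamaξ (q : h.Q) : h.dproj q (h.hatakeyama.ξ q) = 0 :=
  (h.dbase_self q _).symm.trans (h.dbase_hatakeyamaξ (mem_chart_source E _))

/-- Normality: `Φ₁` lifts the complex structure of `Z`, and the curvature `dη₁ = √-1 ∂∂̄ log h_i` is
of type `(1, 1)`. -/
theorem isNormal_hatakeyama : h.hatakeyama.IsNormal := by
  let J : E →L[ℝ] E := ContinuousLinearMap.lsmul ℝ ℂ Complex.I
  refine AlmostContactStructure.isNormal_of h.hatakeyama J (fun v => ?_) (fun q X => ?_)
    (fun q X Y => ?_) fun q => ⟨h.base (h.proj q), h.contMDiffAt_base (mem_chart_source E _), ?_,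
      h.dbase_hatakeyamaξ (mem_chart_source E _),
      fun X hX hX' => h.eq_zero_of_dbase_of_η₁ (mem_chart_source E _) hX hX'⟩
  · change Complex.I • Complex.I • v = -v
    rw [smul_smul, Complex.I_mul_I, neg_one_smul]
  · exact congrArg Prod.snd ((h.represents_hatakeyama q).1 X)
  · have hi : h.proj q ∈ c.U (c.L.indexAt (h.proj q)) := c.L.mem_baseSet_at _
    have hz := mem_chart_source E (h.proj q)
    have hL : ContDiffAt ℝ ∞ (h.logWeight (c.L.indexAt (h.proj q)) (h.proj q))
      (h.base (h.proj q) q) := h.contDiffAt_logWeight hi hz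
    have hs := hL.isSymmSndFDerivAt (by simpa using ENat.LEInfty.out)
    change extD _ h.η₁ q _ _ = extD _ h.η₁ q X Y
    rw [h.extD_η₁ hi hz, h.extD_η₁ hi hz, h.dbase_hatakeyamaΦ hz, h.dbase_hatakeyamaΦ hz,
      smul_smul, smul_smul, Complex.I_mul_I, neg_one_smul, neg_one_smul, map_neg, map_neg,
      hs (Complex.I • h.dbase (h.proj q) q X), hs (Complex.I • h.dbase (h.proj q) q Y)]
    ring
  · filter_upwards [h.eventually_proj_mem_chart (mem_chart_source E (h.proj q))] with p hp X
    exact h.dbase_hatakeyamaΦ hp X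

omit [FiniteDimensional ℂ E] in
theorem isReKobayashi : IsReKobayashi (h.kob 1) := by
  intro i q hi X
  rw [h.kob_eq_kobayashiForm 1 hi, one_mul]

omit [FiniteDimensional ℂ E] in
theorem isImKobayashi : IsImKobayashi (h.kob (-Complex.I)) := by
  intro i q hi X
  rw [h.kob_eq_kobayashiForm _ hi]
  simp

variable {g : Metric 𝓘(ℝ, E) Z} (hE : Module.finrank ℂ E = 2 * n + 1)
  (hgI : ∀ (z : Z) (X Y : TangentSpace 𝓘(ℝ, E) z),
      g.inner z (complexStructure z X) (complexStructure z Y) = g.inner z X Y)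

theorem isKilling_hatakeyama : IsKilling h.hatakeyama.ξ (h.metricQ hE hgI) := by
  refine isKilling_of (V := E) h.hatakeyama (h.metricQ hE hgI) (fun q X => ?_) fun q => ?_
  · have hi : h.proj q ∈ c.U (c.L.indexAt (h.proj q)) := c.L.mem_baseSet_at _
    have hz := mem_chart_source E (h.proj q)
    change extD _ h.η₁ q _ _ = 0
    rw [h.extD_η₁ hi hz, h.dbase_hatakeyamaξ hz, smul_zero, map_zero, map_zero, zero_apply,
      sub_zero, mul_zero]
  · have hi : h.proj q ∈ c.U (c.L.indexAt (h.proj q)) := c.L.mem_baseSet_at _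
    have hz := mem_chart_source E (h.proj q)
    have hm := (h.contMDiffAt_loc hE hgI hi).2.1
    have hp := h.contMDiff_proj q
    refine ⟨h.base (h.proj q), fun p => h.metricLoc g (c.L.indexAt (h.proj q)) (h.proj q)
      (h.proj p), h.contMDiffAt_base hz, hm.comp q hp, ?_, ?_, ?_⟩
    · filter_upwards [h.eventually_proj_mem_chart hz] with p hp
      exact h.dbase_hatakeyamaξ hp
    · have h1 := mfderiv_comp_apply (I := 𝓘(ℝ, E).prod (𝓡 1)) (I' := 𝓘(ℝ, E))
        (I'' := 𝓘(ℝ, E →L[ℝ] E →L[ℝ] ℝ)) q (hm.mdifferentiableAt (by simp))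
        (hp.mdifferentiableAt (by simp)) (h.hatakeyama.ξ q)
      refine h1.trans ?_
      refine (congrArg _ (h.dproj_hatakeyamaξ q)).trans ?_
      exact ContinuousLinearMap.map_zero _
    · filter_upwards [h.eventually_proj_mem hi, h.eventually_proj_mem_chart hz] with p h1 h2 X Y
      exact h.bilinQ_eq hE hgI h1 h2 X Y

theorem isSubmersionMetric : IsSubmersionMetric (h.metricQ hE hgI) h.η₁ := by
  obtain ⟨gZ, h1, h2⟩ := h.exists_adapted_metric hE hgI
  refine ⟨gZ, h1, fun q X Y => ?_⟩
  rw [h.metricQ_inner, modelG_apply]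
  refine congrArg (· + _) ?_
  refine Eq.trans ?_ (h2 _ _ _).symm
  exact congrArg₂ (fun s t => h.metricLoc g (c.L.indexAt (h.proj q)) (h.proj q) (h.proj q) s t)
    (h.dbase_self q X) (h.dbase_self q Y)

include hE hgI in
/-- The equation `dη = g_Q(Φ ·, ·)` for `η = Re(a ϑ)`, in the coframe: the structure equation of `ϑ`
is the formula for `modelG (modelΦ ·) ·`. -/
theorem extD_kob_eq (a : ℂ) (ha : ‖a‖ = 1) (q : h.Q)
    (X Y : TangentSpace (𝓘(ℝ, E).prod (𝓡 1)) q) :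
    extD (𝓘(ℝ, E).prod (𝓡 1)) (h.kob a) q X Y =
      modelG (h.metricLoc g (c.L.indexAt (h.proj q)) (h.proj q) (h.proj q))
        (h.coordΦ g a (c.L.indexAt (h.proj q)) (h.proj q) q (h.coframeAt q X))
        (h.coframeAt q Y) := by
  have hi : h.proj q ∈ c.U (c.L.indexAt (h.proj q)) := c.L.mem_baseSet_at _
  have hz := mem_chart_source E (h.proj q)
  have D := h.isDatumLoc hE hgI hi hz
  refine (h.extD_kob a hi hz X Y).trans (Eq.trans ?_ ((h.isAdaptedAt hE hgI q).modelG_modelΦ_left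
    (h.norm_phase a ha _ q) (h.radius_pos hi) D.ψ_smul_left _ _).symm)
  rw [h.coord_eq_radius hi, mul_left_comm a]
  rfl

theorem isCompatible_hatakeyama : h.hatakeyama.IsCompatible (h.metricQ hE hgI) := by
  intro q X Y
  rw [h.metricQ_inner, h.metricQ_inner, h.metricQ_inner, (h.represents_hatakeyama q).1,
    (h.represents_hatakeyama q).1, (h.represents_hatakeyama q).2.1,
    (h.represents_hatakeyama q).2.2, (h.represents_hatakeyama q).2.2, modelG_apply, modelG_apply,
    modelG_apply, modelJ_apply, modelJ_apply, (h.isAdaptedAt hE hgI q).inner_I, map_zero]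
  constructor
  · simp
  · ring

theorem isCompatible_kobStructure (a : ℂ) (ha : ‖a‖ = 1) :
    (h.kobStructure hE hgI a ha).IsCompatible (h.metricQ hE hgI) := by
  intro q X Y
  have hi : h.proj q ∈ c.U (c.L.indexAt (h.proj q)) := c.L.mem_baseSet_at _
  have D := h.isDatumLoc hE hgI hi (mem_chart_source E (h.proj q))
  have A := h.isAdaptedAt hE hgI q
  have hu := h.norm_phase a ha (c.L.indexAt (h.proj q)) q
  obtain ⟨h1, h2, h3⟩ := h.represents_kobStructure hE hgI a ha q
  rw [h.metricQ_inner, h.metricQ_inner, h.metricQ_inner, h1, h1, h2, h3, h3]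
  constructor
  · refine (add_eq_left.2 (zero_mul _)).trans ?_
    exact A.inner_reeb_left hu (h.radius_pos hi) _
  · exact A.modelG_modelΦ hu (h.radius_pos hi) (c.θLoc_smul _ _ _) D.alt _ _

theorem isThreeStructure : AlmostContactStructure.IsThreeStructure h.hatakeyama
    (h.kobStructure hE hgI 1 norm_one) (h.kobStructure hE hgI (-Complex.I) (by simp)) := by
  have H1 := h.represents_hatakeyama
  have H2 := h.represents_kobStructure hE hgI 1 norm_one
  have H3 := h.represents_kobStructure hE hgI (-Complex.I) (by simp)
  simp only [coordΦ, coordξ, coordη, one_mul] at H2 H3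
  have hi : ∀ q : h.Q, h.proj q ∈ c.U (c.L.indexAt (h.proj q)) := fun q => c.L.mem_baseSet_at _
  have A := h.isAdaptedAt hE hgI
  have hu : ∀ q : h.Q, ‖(h.phase (c.L.indexAt (h.proj q)) q : ℂ)‖ = 1 := fun q => Circle.norm_coe _
  exact ⟨h.cyclicRelations_of H1 H2 H3 fun q =>
      (A q).cyclic_one (hu q) (h.radius_pos (hi q)) (c.θLoc_smul _ _ _),
    h.cyclicRelations_of H2 H3 H1 fun q =>
      (A q).cyclic_two (hu q) (h.radius_pos (hi q)) (c.θLoc_smul _ _ _),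
    h.cyclicRelations_of H3 H1 H2 fun q =>
      (A q).cyclic_three (hu q) (h.radius_pos (hi q)) (c.θLoc_smul _ _ _)⟩

include hE hgI in
theorem contactVolume_kob (a : ℂ) (ha : ‖a‖ = 1) (q : h.Q) (m : ℕ)
    (v : Fin (2 * m + 1) → TangentSpace (𝓘(ℝ, E).prod (𝓡 1)) q) :
    contactVolume (𝓘(ℝ, E).prod (𝓡 1)) (h.kob a) m q v =
      wedgePow (fun p => h.coordη a (c.L.indexAt (h.proj q)) (h.proj q) q p)
        (fun p p' => modelG (h.metricLoc g (c.L.indexAt (h.proj q)) (h.proj q) (h.proj q))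
          (h.coordΦ g a (c.L.indexAt (h.proj q)) (h.proj q) q p) p') m
        (fun k => h.coframeAt q (v k)) := by
  have h1 : extD (𝓘(ℝ, E).prod (𝓡 1)) (h.kob a) q = fun X Y =>
      modelG (h.metricLoc g (c.L.indexAt (h.proj q)) (h.proj q) (h.proj q))
        (h.coordΦ g a (c.L.indexAt (h.proj q)) (h.proj q) q (h.coframeAt q X))
        (h.coframeAt q Y) := funext₂ (h.extD_kob_eq hE hgI a ha q)
  have h2 : (h.kob a q : TangentSpace (𝓘(ℝ, E).prod (𝓡 1)) q → ℝ) =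
      fun X => h.coordη a (c.L.indexAt (h.proj q)) (h.proj q) q (h.coframeAt q X) :=
    funext (h.kob_eq_coordη a (c.L.mem_baseSet_at _) (mem_chart_source E _))
  rw [contactVolume, h1, h2]
  rfl

omit [IsManifold 𝓘(ℂ, E) ω Z] in
include hE in
theorem finrank_model : Module.finrank ℝ (E × ℝ) = 2 * (2 * n + 1) + 1 := by
  rw [Module.finrank_prod, finrank_real_of_complex, hE, Module.finrank_self]

include hE hgI in
theorem isContactForm_kob (a : ℂ) (ha : ‖a‖ = 1) : IsContactForm (h.kob a) (2 * n + 1) := by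
  intro q
  have hi : h.proj q ∈ c.U (c.L.indexAt (h.proj q)) := c.L.mem_baseSet_at _
  have D := h.isDatumLoc hE hgI hi (mem_chart_source E (h.proj q))
  obtain ⟨v, hv⟩ := Function.ne_iff.1 ((h.isAdaptedAt hE hgI q).wedgePow_model_ne_zero
    (h.norm_phase a ha (c.L.indexAt (h.proj q)) q) (h.radius_pos hi) (c.θLoc_smul _ _ _)
    D.ψ_smul_left D.alt (2 * n + 1) (finrank_model hE))
  refine Function.ne_iff.2 ⟨fun k => h.frameAt q (v k), ?_⟩
  rw [h.contactVolume_kob hE hgI a ha]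
  simp only [h.coframeAt_frameAt]
  exact hv

include hE hgI in
theorem contactVolume_eq (q : h.Q) :
    contactVolume (𝓘(ℝ, E).prod (𝓡 1)) (h.kob 1) (2 * n + 1) q =
      contactVolume (𝓘(ℝ, E).prod (𝓡 1)) (h.kob (-Complex.I)) (2 * n + 1) q := by
  have hi : h.proj q ∈ c.U (c.L.indexAt (h.proj q)) := c.L.mem_baseSet_at _
  have D := h.isDatumLoc hE hgI hi (mem_chart_source E (h.proj q))
  funext v
  rw [h.contactVolume_kob hE hgI 1 norm_one, h.contactVolume_kob hE hgI (-Complex.I) (by simp)]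
  have h1 := (h.isAdaptedAt hE hgI q).wedgePow_rot (c.θLoc_smul _ _ _) D.ψ_smul_left D.alt
    (Circle.norm_coe (h.phase (c.L.indexAt (h.proj q)) q)) (h.radius_pos hi) (2 * n + 1)
    (finrank_model hE)
  simp only [coordΦ, coordη, one_mul]
  exact (congrFun h1 _).symm

theorem isContactMetric_kobStructure (a : ℂ) (ha : ‖a‖ = 1) :
    (h.kobStructure hE hgI a ha).IsContactMetric (h.metricQ hE hgI) (2 * n + 1) := by
  refine ⟨h.isContactForm_kob hE hgI a ha, fun q X Y => ⟨?_, ?_, ?_⟩⟩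
  · have hi : h.proj q ∈ c.U (c.L.indexAt (h.proj q)) := c.L.mem_baseSet_at _
    refine (h.extD_kob_eq hE hgI a ha q _ _).trans ?_
    rw [(h.represents_kobStructure hE hgI a ha q).2.1]
    refine (congrArg (fun p => modelG _ p _) ((h.isAdaptedAt hE hgI q).modelΦ_modelξ
      (h.norm_phase a ha _ q) (h.radius_pos hi) (c.θLoc_smul _ _ _))).trans ?_
    rw [map_zero, zero_apply]
  · rw [(h.metricQ hE hgI).symm]
    exact (h.isCompatible_kobStructure hE hgI a ha q X Y).1.symm
  · refine (h.extD_kob_eq hE hgI a ha q _ _).trans ?_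
    rw [h.metricQ_inner, (h.represents_kobStructure hE hgI a ha q).1]

end ComplexContactStructure.HermitianStructure
namespace ComplexContactStructure.HermitianStructure

/-! ### The leaf space and the embedding in the line bundle -/

variable {n : ℕ} {E : Type*} [NormedAddCommGroup E] [NormedSpace ℂ E]
  {Z : Type*} [TopologicalSpace Z] [ChartedSpace E Z] [IsManifold 𝓘(ℂ, E) ω Z]
  {ι : Type*} {c : ComplexContactStructure n E Z ι} (h : c.HermitianStructure)

theorem contMDiff_orbit (q : h.Q) :
    ContMDiff 𝓘(ℝ, ℝ) (𝓘(ℝ, E).prod (𝓡 1)) ∞ (fun t : ℝ => Circle.exp t • q) :=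
  h.isPrincipalCircleBundle.1.comp (contMDiff_circleExp.prodMk contMDiff_const)

theorem surjective_proj : Surjective h.proj := fun z =>
  ⟨h.point (c.L.indexAt z) z (c.L.mem_baseSet_at z) 1, rfl⟩

theorem eq_of_phase {i : ι} {p q : h.Q} (hp : h.proj p ∈ c.U i) (hpq : h.proj p = h.proj q)
    (hφ : h.phase i p = h.phase i q) : p = q :=
  (h.triv i).injOn (x₁ := p) (x₂ := q) hp (hpq ▸ hp : h.proj q ∈ c.U i) (Prod.ext hpq hφ)

theorem exists_exp_smul {p q : h.Q} (hpq : h.proj p = h.proj q) :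
    ∃ t : ℝ, Circle.exp t • p = q := by
  have hi : h.proj p ∈ c.U (c.L.indexAt (h.proj p)) := c.L.mem_baseSet_at _
  refine ⟨Complex.arg (h.phase (c.L.indexAt (h.proj p)) q / h.phase (c.L.indexAt (h.proj p)) p :
    Circle), h.eq_of_phase (i := c.L.indexAt (h.proj p)) hi hpq ?_⟩
  rw [h.phase_smul _ hi, Circle.exp_arg, div_mul_cancel]

/-- A curve in `Q(L)` whose velocity is vertical stays in one fibre. -/
theorem proj_eq_of_vertical {ξ : ∀ q : h.Q, TangentSpace (𝓘(ℝ, E).prod (𝓡 1)) q}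
    (hξ : ∀ q, h.dproj q (ξ q) = 0) {γ : ℝ → h.Q} {a b : ℝ}
    (hγ : IsMIntegralCurveOn γ ξ (Ioo a b)) {s t : ℝ} (hs : s ∈ Ioo a b) (ht : t ∈ Ioo a b) :
    h.proj (γ s) = h.proj (γ t) := by
  have hγ' : ∀ u ∈ Ioo a b, HasMFDerivAt 𝓘(ℝ, ℝ) (𝓘(ℝ, E).prod (𝓡 1)) γ u
      ((1 : ℝ →L[ℝ] ℝ).smulRight (ξ (γ u))) := fun u hu =>
    (hγ u hu).hasMFDerivAt (isOpen_Ioo.mem_nhds hu)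
  refine isPreconnected_Ioo.induction₂ (fun u v => h.proj (γ u) = h.proj (γ v)) (fun u hu => ?_)
    (fun _ _ _ _ _ _ => Eq.trans) (fun _ _ _ _ => Eq.symm) hs ht
  set z₀ := h.proj (γ u) with hz₀
  have hz : h.proj (γ u) ∈ (chartAt E z₀).source := mem_chart_source E z₀
  have hev : ∀ᶠ v in 𝓝 u, v ∈ Ioo a b ∧ h.proj (γ v) ∈ (chartAt E z₀).source :=
    Filter.Eventually.and (isOpen_Ioo.mem_nhds hu) ((hγ' u hu).continuousAt.eventually
      (h.eventually_proj_mem_chart hz))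
  obtain ⟨ε, hε, hball⟩ := Metric.eventually_nhds_iff_ball.1 hev
  have hder : ∀ v ∈ Metric.ball u ε, HasDerivAt (fun v => h.base z₀ (γ v)) 0 v := by
    intro v hv
    obtain ⟨h1, h2⟩ := hball v hv
    have h3 := ((h.contMDiffAt_base h2).mdifferentiableAt (by simp)).hasMFDerivAt.comp v (hγ' v h1)
    obtain ⟨A, hA, hA1⟩ : ∃ A : ℝ →L[ℝ] E, HasFDerivAt (fun v => h.base z₀ (γ v)) A v ∧ A 1 = 0 := by
      refine ⟨_, h3.hasFDerivAt, ?_⟩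
      change h.dbase z₀ (γ v) ((1 : ℝ) • ξ (γ v)) = 0
      rw [one_smul, h.dbase_eq h2, hξ]
      exact map_zero (dchart 𝓘(ℝ, E) z₀ (h.proj (γ v)))
    exact hA.hasDerivAt.congr_deriv hA1
  refine mem_nhdsWithin_of_mem_nhds ?_
  filter_upwards [Metric.ball_mem_nhds u hε] with v hv
  have h5 := Metric.isOpen_ball.is_const_of_deriv_eq_zero (convex_ball u ε).isPreconnected
    (fun w hw => (hder w hw).differentiableAt.differentiableWithinAt)
    (fun w hw => (hder w hw).deriv) (Metric.mem_ball_self hε) hv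
  have h6 := h.base_symm (hball v hv).2
  have h7 := h.base_symm hz
  exact h7.symm.trans ((congrArg (extChartAt 𝓘(ℝ, E) z₀).symm h5).trans h6)

/-- The coordinates of the base point and the fibre coordinate of `L` restrict to functions on
`Q(L)` whose differentials have no common kernel, so the inclusion is an immersion. -/
theorem isSubmanifoldOfL : h.IsSubmanifoldOfL := by
  have hincl : ContMDiff (𝓘(ℝ, E).prod (𝓡 1)) (𝓘(ℝ, E).prod 𝓘(ℝ, ℂ)) ∞ h.incl := fun q =>
    (Bundle.contMDiffAt_totalSpace (F := ℂ) (E := c.L.Fiber)).2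
      ⟨h.contMDiff_proj q, h.contMDiffAt_coord (c.L.mem_baseSet_at _)⟩
  refine ⟨hincl, fun q => ?_⟩
  obtain ⟨h1, h2⟩ := (Bundle.contMDiffAt_totalSpace (𝕜 := ℝ) (F := ℂ) (E := c.L.Fiber)
    (IB := 𝓘(ℝ, E)) (n := ∞)).1 (contMDiffAt_id (x := h.incl q))
  refine (injective_iff_map_eq_zero _).2 fun X hX => ?_
  have hi : h.proj q ∈ c.U (c.L.indexAt (h.proj q)) := c.L.mem_baseSet_at _
  refine h.eq_zero_of_dbase_of_dcoord hi (mem_chart_source E (h.proj q)) ?_ ?_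
  · rw [h.dbase_self]
    have h3 := mfderiv_comp_apply (I := 𝓘(ℝ, E).prod (𝓡 1)) (I' := 𝓘(ℝ, E).prod 𝓘(ℝ, ℂ))
      (I'' := 𝓘(ℝ, E)) q (h1.mdifferentiableAt (by simp))
      ((hincl q).mdifferentiableAt (by simp)) X
    refine h3.trans ((congrArg _ hX).trans ?_)
    exact ContinuousLinearMap.map_zero _
  · have h3 := mfderiv_comp_apply (I := 𝓘(ℝ, E).prod (𝓡 1)) (I' := 𝓘(ℝ, E).prod 𝓘(ℝ, ℂ))
      (I'' := 𝓘(ℝ, ℂ)) q (h2.mdifferentiableAt (by simp))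
      ((hincl q).mdifferentiableAt (by simp)) X
    refine h3.trans ((congrArg _ hX).trans ?_)
    exact ContinuousLinearMap.map_zero _

variable [FiniteDimensional ℂ E]

/-- The vector field `ξ₁` is tangent to the orbits of `U(1)`. -/
theorem isMIntegralCurve_orbit (q : h.Q) : IsMIntegralCurve (I := 𝓘(ℝ, E).prod (𝓡 1))
    (fun t : ℝ => Circle.exp t • q) h.hatakeyama.ξ := by
  intro t
  set γ : ℝ → h.Q := fun t => Circle.exp t • q with hγ
  have hd : MDifferentiableAt 𝓘(ℝ, ℝ) (𝓘(ℝ, E).prod (𝓡 1)) γ t :=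
    (h.contMDiff_orbit q t).mdifferentiableAt (by simp)
  set i := c.L.indexAt (h.proj (γ t)) with hidef
  have hi : h.proj (γ t) ∈ c.U i := c.L.mem_baseSet_at _
  have hz := mem_chart_source E (h.proj (γ t))
  have hbase : h.dbase (h.proj (γ t)) (γ t) (mfderiv 𝓘(ℝ, ℝ) (𝓘(ℝ, E).prod (𝓡 1)) γ t (1 : ℝ)) =
      0 := by
    have h1 := mfderiv_comp_apply t ((h.contMDiffAt_base hz).mdifferentiableAt (by simp)) hd (1 : ℝ)
    have h2 : h.base (h.proj (γ t)) ∘ γ = fun _ => h.base (h.proj (γ t)) q := rfl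
    rw [h2, mfderiv_const] at h1
    exact h1.symm
  have hcoord : h.dcoord i (γ t) (mfderiv 𝓘(ℝ, ℝ) (𝓘(ℝ, E).prod (𝓡 1)) γ t (1 : ℝ)) =
      h.coord i (γ t) * Complex.I := by
    have h1 := mfderiv_comp_apply t ((h.contMDiffAt_coord hi).mdifferentiableAt (by simp)) hd
      (1 : ℝ)
    have h2 : h.coord i ∘ γ = fun s : ℝ => Complex.exp (s * Complex.I) * h.coord i q :=
      funext fun s => (h.coord_smul i _ q).trans (by rw [Circle.coe_exp])
    have h3 : HasDerivAt (fun s : ℝ => Complex.exp (s * Complex.I) * h.coord i q)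
        (Complex.exp (t * Complex.I) * (1 * Complex.I) * h.coord i q) t :=
      (((hasDerivAt_id t).ofReal_comp.mul_const Complex.I).cexp).mul_const _
    rw [h2, mfderiv_eq_fderiv] at h1
    refine h1.symm.trans ((fderiv_apply_one_eq_deriv).trans (h3.deriv.trans ?_))
    have h4 : h.coord i (γ t) = Complex.exp (t * Complex.I) * h.coord i q := congrFun h2 t
    rw [h4]
    ring
  have hη : h.η₁ (γ t) (mfderiv 𝓘(ℝ, ℝ) (𝓘(ℝ, E).prod (𝓡 1)) γ t (1 : ℝ)) = 1 := by
    have h1 := h.dcoord_eq hi hz (mfderiv 𝓘(ℝ, ℝ) (𝓘(ℝ, E).prod (𝓡 1)) γ t (1 : ℝ))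
    rw [hcoord, hbase, map_zero, sub_zero] at h1
    have h2 := mul_left_cancel₀ (h.coord_ne_zero i _ hi) h1
    have h3 := mul_left_cancel₀ Complex.I_ne_zero ((mul_one Complex.I).trans h2)
    exact_mod_cast h3.symm
  have hfin : mfderiv 𝓘(ℝ, ℝ) (𝓘(ℝ, E).prod (𝓡 1)) γ t =
      (1 : ℝ →L[ℝ] ℝ).smulRight (h.hatakeyama.ξ (γ t)) := by
    refine ContinuousLinearMap.ext_ring ?_
    refine h.coframeAt_injective (γ t) ?_
    refine (Prod.ext hbase hη).trans (((h.represents_hatakeyama (γ t)).2.1.symm).trans ?_)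
    refine congrArg _ ?_
    exact (one_smul ℝ (h.hatakeyama.ξ (γ t))).symm
  rw [← hfin]
  exact hd.hasMFDerivAt

theorem isHatakeyama : IsHatakeyama h.hatakeyama := by
  refine ⟨h.isIKConnection, h.isMIntegralCurve_orbit, fun q X => ⟨?_, ?_⟩⟩
  · exact congrArg Prod.snd ((h.represents_hatakeyama q).1 X)
  · refine (h.dbase_self q _).symm.trans ((h.dbase_hatakeyamaΦ (mem_chart_source E _) X).trans ?_)
    exact congrArg (Complex.I • ·) (h.dbase_self q X)

/-- The fibres of `π_Q` are the orbits of `U(1)`, which are the leaves of `ξ₁`. -/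
theorem isLeafSpace : IsLeafSpace 𝓘(ℝ, E) h.proj h.hatakeyama.ξ := by
  refine ⟨h.contMDiff_proj, h.surjective_proj, fun q w => ?_, fun p q => ⟨fun hpq => ?_, ?_⟩⟩
  · refine ⟨h.frameAt q ((w : E), 0), (h.dbase_self q _).symm.trans ?_⟩
    exact congrArg Prod.fst (h.coframeAt_frameAt q ((w : E), (0 : ℝ)))
  · obtain ⟨t, ht⟩ := h.exists_exp_smul hpq
    refine ⟨fun s => Circle.exp s • p, -(|t| + 1), |t| + 1, 0, t,
      fun s _ => (h.isMIntegralCurve_orbit p s).hasMFDerivWithinAt, ?_, ?_, ?_, ht⟩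
    · constructor <;> linarith [abs_nonneg t]
    · constructor <;> linarith [neg_abs_le t, le_abs_self t]
    · simp
  · rintro ⟨γ, a, b, s, t, hγ, hs, ht, rfl, rfl⟩
    exact h.proj_eq_of_vertical h.dproj_hatakeyamaξ hγ hs ht

end ComplexContactStructure.HermitianStructure
namespace ComplexContactStructure

/-! ### Existence of Hermitian structures -/

variable {n : ℕ} {E : Type*} [NormedAddCommGroup E] [NormedSpace ℂ E]
  {Z : Type*} [TopologicalSpace Z] [ChartedSpace E Z] [IsManifold 𝓘(ℂ, E) ω Z]
  {ι : Type*} (c : ComplexContactStructure n E Z ι)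

/-- The function `∑ ρ_k |f_ik|²`, where `ρ_k` is a partition of unity. -/
def sumWeight (ρ : SmoothPartitionOfUnity ι 𝓘(ℝ, E) Z univ) (i : ι) (z : Z) : ℝ :=
  ∑ᶠ k, ρ k z • ‖c.f i k z‖ ^ 2

variable {c} {ρ : SmoothPartitionOfUnity ι 𝓘(ℝ, E) Z univ} (hρ : ρ.IsSubordinate c.U)

include hρ

theorem mem_U_of_ne_zero {k : ι} {z : Z} (hk : ρ k z ≠ 0) : z ∈ c.U k :=
  hρ k (subset_tsupport _ hk)

theorem sumWeight_pos {i : ι} {z : Z} (hi : z ∈ c.U i) : 0 < c.sumWeight ρ i z := by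
  obtain ⟨k, hk⟩ := ρ.exists_pos_of_mem (mem_univ z)
  refine finsum_pos (fun j => smul_nonneg (ρ.nonneg j z) (sq_nonneg _)) ⟨k, ?_⟩ ?_
  · exact mul_pos hk (pow_pos (norm_pos_iff.2
      (c.f_ne_zero i k z ⟨hi, mem_U_of_ne_zero hρ hk.ne'⟩)) 2)
  · refine (ρ.locallyFinite.point_finite z).subset fun j hj => ?_
    exact fun h0 => hj (by simp only [h0, zero_smul])

theorem sumWeight_change {i j : ι} {z : Z} (hi : z ∈ c.U i) (hj : z ∈ c.U j) :
    c.sumWeight ρ i z = ‖c.f i j z‖ ^ 2 * c.sumWeight ρ j z := by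
  rw [sumWeight, sumWeight, mul_finsum]
  refine finsum_congr fun k => ?_
  rcases eq_or_ne (ρ k z) 0 with h0 | h0
  · simp [h0]
  · rw [← c.f_comp hi hj (mem_U_of_ne_zero hρ h0), norm_mul, smul_eq_mul, smul_eq_mul]
    ring

theorem contMDiffAt_sumWeight {i : ι} {z : Z} (hi : z ∈ c.U i) :
    ContMDiffAt 𝓘(ℝ, E) 𝓘(ℝ, ℝ) ∞ (c.sumWeight ρ i) z := by
  refine ρ.contMDiffAt_finsum fun k hk => ?_
  have h1 : ContMDiffAt 𝓘(ℝ, E) 𝓘(ℝ, ℂ) ∞ (c.f i k) z :=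
    (contMDiffOn_real (c.holomorphic_f i k)).contMDiffAt
      (((c.isOpen_U i).inter (c.isOpen_U k)).mem_nhds ⟨hi, hρ k hk⟩)
  exact ContDiffAt.comp_contMDiffAt (g := fun w : ℂ => ‖w‖ ^ 2) (f := c.f i k)
    (contDiff_norm_sq ℝ).contDiffAt h1

omit hρ

variable (c) [FiniteDimensional ℂ E] [T2Space Z] [SecondCountableTopology Z]

/-- The line bundle `L` admits Hermitian structures. -/
theorem nonempty_hermitianStructure : Nonempty c.HermitianStructure := by
  have : LocallyCompactSpace Z := Manifold.locallyCompact_of_finiteDimensional 𝓘(ℝ, E)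
  obtain ⟨ρ, hρ⟩ := SmoothPartitionOfUnity.exists_isSubordinate 𝓘(ℝ, E) isClosed_univ c.U
    c.isOpen_U fun z _ => mem_iUnion.2 (c.cover z)
  let B : ∀ z : Z, ℂ →ₗ⋆[ℂ] ℂ →ₗ[ℂ] ℂ := fun z =>
    LinearMap.mk₂'ₛₗ (starRingEnd ℂ) (RingHom.id ℂ)
      (fun u v => starRingEnd ℂ u * v * (c.sumWeight ρ (c.L.indexAt z) z : ℂ))
      (by intros; simp only [map_add]; ring) (by intros; simp only [smul_eq_mul, map_mul]; ring)
      (by intros; ring) (by intros; simp only [smul_eq_mul, RingHom.id_apply]; ring)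
  have hB : ∀ (z : Z) (u v : ℂ),
    B z u v = starRingEnd ℂ u * v * (c.sumWeight ρ (c.L.indexAt z) z : ℂ) := fun _ _ _ => rfl
  have hre : ∀ (z : Z) (u : ℂ), (B z u u).re = ‖u‖ ^ 2 * c.sumWeight ρ (c.L.indexAt z) z := by
    intro z u
    rw [hB, mul_comm (starRingEnd ℂ u), Complex.mul_conj, Complex.normSq_eq_norm_sq,
      ← Complex.ofReal_mul, Complex.ofReal_re]
  refine ⟨⟨B, fun z (u v : ℂ) => ?_, fun z (u : ℂ) hu => ?_, fun i z hi => ?_⟩⟩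
  · change starRingEnd ℂ (starRingEnd ℂ u * v * (c.sumWeight ρ (c.L.indexAt z) z : ℂ)) =
      starRingEnd ℂ v * u * (c.sumWeight ρ (c.L.indexAt z) z : ℂ)
    rw [map_mul, map_mul, Complex.conj_conj, Complex.conj_ofReal, mul_comm u]
  · refine (hre z u).symm ▸ mul_pos (pow_pos (norm_pos_iff.2 hu) 2) (sumWeight_pos hρ (c.L.mem_baseSet_at z))
  · refine ((contMDiffAt_sumWeight hρ hi).congr_of_eventuallyEq ?_).contMDiffWithinAt
    filter_upwards [(c.isOpen_U i).mem_nhds hi] with y hy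
    refine (hre y (c.frame i y)).trans ?_
    rw [sumWeight_change hρ hy (c.L.mem_baseSet_at y)]
    exact congrArg (fun w : ℂ => ‖w‖ ^ 2 * _) (HermitianStructure.frame_eq i y)

end ComplexContactStructure
end ContactTriple

end

open ContactTriple ContactTriple.ComplexContactStructure.HermitianStructure in
theorem theorem1 (n : ℕ) (hn : 1 ≤ n)
    {E : Type*} [NormedAddCommGroup E] [NormedSpace ℂ E] [FiniteDimensional ℂ E]
    (hE : Module.finrank ℂ E = 2 * n + 1)
    {Z : Type*} [TopologicalSpace Z] [T2Space Z] [SecondCountableTopology Z] [ChartedSpace E Z]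
    [IsManifold 𝓘(ℂ, E) ω Z]
    {ι : Type*} (c : ComplexContactStructure n E Z ι) :
    Nonempty c.HermitianStructure ∧
    ∀ h : c.HermitianStructure,
      IsPrincipalCircleBundle (𝓘(ℝ, E).prod (𝓡 1)) 𝓘(ℝ, E) h.proj ∧ h.IsSubmanifoldOfL ∧
      ∃ (gQ : Metric (𝓘(ℝ, E).prod (𝓡 1)) h.Q) (S₁ S₂ S₃ : h.AlmostContact),
        AlmostContactStructure.IsMetricThreeStructure gQ S₁ S₂ S₃ ∧
        IsHatakeyama S₁ ∧ S₁.IsNormal ∧ IsLeafSpace 𝓘(ℝ, E) h.proj S₁.ξ ∧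
        IsKilling S₁.ξ gQ ∧ IsSubmersionMetric gQ S₁.η ∧
        IsReKobayashi S₂.η ∧ IsImKobayashi S₃.η ∧
        IsContactForm S₂.η (2 * n + 1) ∧ IsContactForm S₃.η (2 * n + 1) ∧
        (∀ q : h.Q, contactVolume (𝓘(ℝ, E).prod (𝓡 1)) S₂.η (2 * n + 1) q =
          contactVolume (𝓘(ℝ, E).prod (𝓡 1)) S₃.η (2 * n + 1) q) ∧
        S₂.IsContactMetric gQ (2 * n + 1) ∧ S₃.IsContactMetric gQ (2 * n + 1) := by
  refine ⟨c.nonempty_hermitianStructure, fun h => ?_⟩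
  obtain ⟨g, hgI⟩ := exists_hermitian_metric E Z
  exact ⟨h.isPrincipalCircleBundle, h.isSubmanifoldOfL, h.metricQ hE hgI, h.hatakeyama,
    h.kobStructure hE hgI 1 norm_one, h.kobStructure hE hgI (-Complex.I) (by simp),
    ⟨h.isThreeStructure hE hgI, h.isCompatible_hatakeyama hE hgI,
      h.isCompatible_kobStructure hE hgI _ _, h.isCompatible_kobStructure hE hgI _ _⟩,
    h.isHatakeyama, h.isNormal_hatakeyama, h.isLeafSpace, h.isKilling_hatakeyama hE hgI,
    h.isSubmersionMetric hE hgI, h.isReKobayashi, h.isImKobayashi,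
    h.isContactForm_kob hE hgI _ norm_one, h.isContactForm_kob hE hgI _ (by simp),
    h.contactVolume_eq hE hgI, h.isContactMetric_kobStructure hE hgI _ _,
    h.isContactMetric_kobStructure hE hgI _ _⟩
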